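/- **Setting.** Let $\alpha,\theta,r\in(0,1)$ with $\theta<1-\alpha$, $\beta\in(0,1-\alpha)$ and $\varpi>0$. For $p\ge 1$ put $n=\lfloor p^{\theta}\rfloor$, and observe $$X_i=\tilde\ell_i\,\mu+Z_i\in\mathbb R^p,\qquad 1\le i\le n,$$ where all $Z_i\sim N(0,I_p)$ and $\tilde\ell_i$ are independent and $\tilde\ell_i=1$ with probability $\varpi/(1+\varpi)$, $\tilde\ell_i=-\varpi$ with probability $1/(1+\varpi)$. Let $\rho_0,\rho_1,\rho_2,\dots$ be positive constants, bounded away from $0$ and $\infty$. Let $\mathcal U(\alpha,\beta,r)$ be the set of $\mu\in\mathbb R^p$ for which there are $m=\lfloor p^{1-\alpha-\beta}\rfloor$ ordered disjoint blocks $I_{0,1},\dots,I_{0,m}\subset\{1,\dots,p\}$ of consecutive integers with $|I_{0,g}|=\lfloor\rho_g p^{\alpha}\rfloor$, $\min I_{0,g+1}-\max I_{0,g}>\rho_0\,p^{\alpha}\log p$ for $1\le g<m$, such that $\mu_j=\tau_g$ for $j\in I_{0,g}$ with $|\tau_g|=p^{-r}$, and $\mu_j=0$ outside the blocks. With $S(\mu)=\{j:\mu_j\ne0\}$,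 the risk of a (possibly randomized) estimator $\hat S=\hat S(X)\subset\{1,\dots,p\}$ is $$\mathrm{Hamm}_{\mathrm{sig}}(\hat S;\mu,\varpi)=|S(\mu)|^{-1}\,\mathbb E\,|\hat S\,\Delta\,S(\mu)| .$$ Put $c_1=(1-\theta-\alpha)/2$ and define the functions, continuous in $\beta\in(0,1-\alpha)$, $$\eta^{\mathrm{sig}}_{\theta,\alpha}(\beta)=\begin{cases}(\theta+\alpha)/2,&\beta<2c_1,\\(1+\theta+\alpha-\beta)/4,&\beta\ge2c_1,\end{cases}\qquad \tilde\eta^{\mathrm{sig}}_{\theta,\alpha}(\beta)=\begin{cases}(\theta+\alpha)/2,&\beta<c_1,\\(1+\theta+\alpha-2\beta)/4,&c_1\le\beta<(1-\alpha)/2,\\ \theta/4+\alpha/2,&\beta\ge(1-\alpha)/2.\end{cases}$$ A polynomial-time procedure (a family of estimators or tests indexed by $p$) is one computed, for all $p$, by a single randomized program that receives the sample size, the dimension, the data (clipped and rounded to polynomially many binary digits) and polynomially many fair coins, and halts after a number of steps polynomial in $p$. **Low-degree polynomial conjecture** (for this testing problem, with the given $\alpha,\beta,r,\varpi,(\rho_g)$).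 For any sample sizes $N=N_p$ bounded by a fixed power of $p$ for all large $p$, let $\mathbb P_0$ be the law of $N$ independent $N(0,I_p)$ observations and $\mathbb P_1$ the law of $N$ observations from the model above with $\mu$ drawn uniformly from the finite set $\mathcal U(\alpha,\beta,r)$. Let $\Lambda_{(D)}$ be the orthogonal projection in $L^2(\mathbb P_0)$ of $\Lambda=d\mathbb P_1/d\mathbb P_0$ onto the polynomials of degree at most $D=(\log p)^{1.01}$ in the data. If $\mathbb E_0\{\Lambda_{(D)}^2\}=1+o(1)$ as $p\to\infty$, then no polynomial-time test distinguishes them: $\mathbb P_1(\phi\text{ rejects})-\mathbb P_0(\phi\text{ rejects})\to0$ for every polynomial-time test $\phi$. **Theorem.** (1) If $r>\eta^{\mathrm{sig}}_{\theta,\alpha}(\beta)$, there is a constant $C>0$ such that every signal recovery procedure $\hat S$ satisfies $$\liminf_{p\to\infty}\ \sup_{\mu\in\mathcal U(\alpha,\beta,r)}\mathrm{Hamm}_{\mathrm{sig}}(\hat S;\mu,\varpi)\ \ge\ C .$$ (2) If the low-degree polynomial conjecture holds and $r>\tilde\eta^{\mathrm{sig}}_{\theta,\alpha}(\beta)$,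 there is a constant $C>0$ such that every polynomial-time signal recovery procedure $\hat S$ satisfies the same inequality. -/

import Mathlib

open MeasureTheory ProbabilityTheory Filter Topology
open scoped ENNReal NNReal symmDiff

noncomputable section

namespace BlockSignal

/-! ### The two-group Gaussian model -/

/-- A data matrix with `n` observations (rows) of dimension `p`. -/
abbrev Sample (n p : ℕ) : Type := Fin n → Fin p → ℝ

/-- Law of one generalized label: `1` with probability `ϖ / (1 + ϖ)` and `-ϖ` with probability
`1 / (1 + ϖ)`. -/
def labelLaw (ϖ : ℝ) : Measure ℝ :=
  (ϖ / (1 + ϖ)).toNNReal • Measure.dirac 1 + (1 / (1 + ϖ)).toNNReal • Measure.dirac (-ϖ)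

/-- Law of the noise matrix: independent rows with law `N(0, I_p)`.  This is also the law of the
data when there is no signal. -/
def noiseLaw (n p : ℕ) : Measure (Sample n p) :=
  Measure.pi fun _ => Measure.pi fun _ => gaussianReal 0 1

/-- Law of the data `X_i = ℓ_i • μ + Z_i`, `1 ≤ i ≤ n`, with independent labels and noise. -/
def sampleLaw (n : ℕ) {p : ℕ} (ϖ : ℝ) (μ : Fin p → ℝ) : Measure (Sample n p) :=
  ((Measure.pi fun _ : Fin n => labelLaw ϖ).prod (noiseLaw n p)).map
    fun y i j => y.1 i * μ j + y.2 i j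

/-! ### The class of block signals -/

/-- The number of signal blocks. -/
def numBlocks (α β : ℝ) (p : ℕ) : ℕ := ⌊(p : ℝ) ^ (1 - α - β)⌋₊

/-- The length of the `g`-th block (blocks are numbered from `1`; `ρ 0` is the gap constant). -/
def blockLen (ρ : ℕ → ℝ) (α : ℝ) (p g : ℕ) : ℕ := ⌊ρ g * (p : ℝ) ^ α⌋₊

/-- The class `𝒰(α, β, r)` of block signals in dimension `p`. Coordinates are numbered from `0`; the
block with number `g + 1` is `{start g, …, start g + blockLen (g + 1) - 1}`.  The distance between
consecutive blocks is measured from the last point of one to the first point of the next. -/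
def blockClass (ρ : ℕ → ℝ) (α β r : ℝ) (p : ℕ) : Set (Fin p → ℝ) :=
  {μ | ∃ (start : Fin (numBlocks α β p) → ℕ) (τ : Fin (numBlocks α β p) → ℝ),
    (∀ g, start g + blockLen ρ α p (g + 1) ≤ p) ∧
    (∀ g, |τ g| = (p : ℝ) ^ (-r)) ∧
    (∀ g h : Fin (numBlocks α β p), (h : ℕ) = g + 1 →
      ρ 0 * Real.log p * (p : ℝ) ^ α <
        (start h : ℝ) - ((start g : ℝ) + (blockLen ρ α p (g + 1) : ℝ) - 1)) ∧
    (∀ g, ∀ j : Fin p, start g ≤ j → (j : ℕ) < start g + blockLen ρ α p (g + 1) → μ j = τ g) ∧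
    (∀ j : Fin p, (∀ g, ¬ (start g ≤ j ∧ (j : ℕ) < start g + blockLen ρ α p (g + 1))) → μ j = 0)}

/-! ### Signal recovery and its risk -/

/-- A (possibly randomized) procedure with values in `O p`, for sample size `n p` in dimension `p`,
given as one kernel for each `p`. -/
abbrev Procedure (n : ℕ → ℕ) (O : ℕ → Type) [∀ p, MeasurableSpace (O p)] : Type :=
  ∀ p, Kernel (Sample (n p) p) (O p)

/-- The normalized expected Hamming distance between the estimated set and the support of `μ`. -/
def hammSig {n p : ℕ} (κ : Kernel (Sample n p) (Set (Fin p))) (ϖ : ℝ) (μ : Fin p → ℝ) : ℝ≥0∞ :=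
  (∫⁻ x, ∫⁻ A, ((A ∆ Function.support μ).ncard : ℝ≥0∞) ∂(κ x) ∂(sampleLaw n ϖ μ)) /
    ((Function.support μ).ncard : ℝ≥0∞)

/-- The worst-case risk over the class of block signals. -/
def worstHammSig {n p : ℕ} (κ : Kernel (Sample n p) (Set (Fin p))) (ϖ : ℝ) (ρ : ℕ → ℝ)
    (α β r : ℝ) : ℝ≥0∞ :=
  ⨆ μ ∈ blockClass ρ α β r p, hammSig κ ϖ μ

/-! ### The boundaries -/

def c₁ (θ α : ℝ) : ℝ := (1 - θ - α) / 2

/-- The statistical boundary for signal recovery. It is continuous in `β`. -/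
def etaSig (θ α β : ℝ) : ℝ :=
  if β < 2 * c₁ θ α then (θ + α) / 2 else (1 + θ + α - β) / 4

/-- The computational boundary for signal recovery. It is continuous in `β`. -/
def etaSigComp (θ α β : ℝ) : ℝ :=
  if β < c₁ θ α then (θ + α) / 2
  else if β < (1 - α) / 2 then (1 + θ + α - 2 * β) / 4
  else θ / 4 + α / 2

/-! ### Polynomial time

A random access machine on integers with additions, subtractions and comparisons only, at unit cost
(polynomially equivalent to Turing machines, since the number of bits of a cell grows by at most a
constant in each step of a fixed program).  It is presented as a structured language. -/

/-- The memory: arrays, named by natural numbers, of integers indexed by integers. -/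
abbrev Mem : Type := ℕ → ℤ → ℤ

inductive Expr : Type
  | const (z : ℤ)
  | get (a : ℕ) (i : Expr)
  | add (e f : Expr)
  | sub (e f : Expr)

def Expr.eval (s : Mem) : Expr → ℤ
  | .const z => z
  | .get a i => s a (i.eval s)
  | .add e f => e.eval s + f.eval s
  | .sub e f => e.eval s - f.eval s

inductive Prog : Type
  | skip
  | store (a : ℕ) (i v : Expr)
  | seq (c d : Prog)
  | ifPos (e : Expr) (c d : Prog)
  | whilePos (e : Expr) (c : Prog)

/-- Writing `v` into cell `i` of array `a`. -/
def Mem.write (s : Mem) (a : ℕ) (i v : ℤ) : Mem :=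
  Function.update s a (Function.update (s a) i v)

/-- `Exec c s t s'`: started in memory `s`, the program `c` halts after `t` steps in memory `s'`. -/
inductive Exec : Prog → Mem → ℕ → Mem → Prop
  | skip (s : Mem) : Exec .skip s 1 s
  | store (s : Mem) (a : ℕ) (i v : Expr) :
      Exec (.store a i v) s 1 (s.write a (i.eval s) (v.eval s))
  | seq {c d : Prog} {s s' s'' : Mem} {t t' : ℕ} :
      Exec c s t s' → Exec d s' t' s'' → Exec (.seq c d) s (t + t') s''
  | ifTrue {e : Expr} {c d : Prog} {s s' : Mem} {t : ℕ} :
      0 < e.eval s → Exec c s t s' → Exec (.ifPos e c d) s (t + 1) s'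
  | ifFalse {e : Expr} {c d : Prog} {s s' : Mem} {t : ℕ} :
      ¬ 0 < e.eval s → Exec d s t s' → Exec (.ifPos e c d) s (t + 1) s'
  | whileTrue {e : Expr} {c : Prog} {s s' s'' : Mem} {t t' : ℕ} :
      0 < e.eval s → Exec c s t s' → Exec (.whilePos e c) s' t' s'' →
      Exec (.whilePos e c) s (t + t' + 1) s''
  | whileFalse {e : Expr} {c : Prog} {s : Mem} :
      ¬ 0 < e.eval s → Exec (.whilePos e c) s 1 s

/-- A real number clipped to `[-2 ^ K, 2 ^ K]` and rounded down to `K` binary digits, in units of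
`2 ^ (-K)`. -/
def quantize (K : ℕ) (x : ℝ) : ℤ := ⌊(2 : ℝ) ^ K * max (-(2 : ℝ) ^ K) (min ((2 : ℝ) ^ K) x)⌋

/-- The initial memory: array `0` holds the sample size, the dimension, the precision and the number
of coins; array `1` holds the quantized data matrix, row by row; array `2` holds fair coins. -/
def initMem {n p : ℕ} (K R : ℕ) (x : Sample n p) (w : Fin R → Bool) : Mem
  | 0, z => if z = 0 then n else if z = 1 then p else if z = 2 then K else if z = 3 then R else 0
  | 1, z =>
      if h : 0 ≤ z ∧ z.toNat < n * p then
        quantize K (x (finProdFinEquiv.symm ⟨z.toNat, h.2⟩).1 (finProdFinEquiv.symm ⟨z.toNat, h.2⟩).2)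
      else 0
  | 2, z => if h : 0 ≤ z ∧ z.toNat < R then (if w ⟨z.toNat, h.2⟩ then 1 else 0) else 0
  | _, _ => 0

/-- The procedure is computed by one program, on data of polynomial precision and with polynomially
many fair coins, in a number of steps that is polynomial in `p` (the sample size `n p` will always
be polynomially bounded in `p`).  The output is read off the final memory by `decode`. -/
def IsPolyTime (n : ℕ → ℕ) {O : ℕ → Type} [∀ p, MeasurableSpace (O p)]
    (decode : ∀ p, Mem → O p) (κ : Procedure n O) : Prop :=
  ∃ (P : Prog) (a b c : ℕ), ∀ p : ℕ, ∃ f : Sample (n p) p → (Fin (p ^ b + b) → Bool) → O p,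
    (∀ x w, ∃ t s, Exec P (initMem (p ^ a + a) (p ^ b + b) x w) t s ∧ t ≤ p ^ c + c ∧
      decode p s = f x w) ∧
    ∀ x, κ p x = ((PMF.uniformOfFintype (Fin (p ^ b + b) → Bool)).map (f x)).toMeasure

/-- The set encoded in array `3`. -/
def decodeSet (p : ℕ) (s : Mem) : Set (Fin p) := {j | 0 < s 3 ((j : ℕ) : ℤ)}

/-- The decision encoded in array `3`; `true` means rejection of the null hypothesis. -/
def decodeTest (_p : ℕ) (s : Mem) : Bool := decide (0 < s 3 0)

/-! ### The low-degree polynomial conjecture -/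

/-- The alternative law of the data: the signal is drawn uniformly from the (finite) class of block
signals. -/
def altLaw (n p : ℕ) (ϖ : ℝ) (ρ : ℕ → ℝ) (α β r : ℝ) : Measure (Sample n p) :=
  ((blockClass ρ α β r p).ncard : ℝ≥0∞)⁻¹ •
    Measure.sum fun μ : blockClass ρ α β r p => sampleLaw n ϖ (μ : Fin p → ℝ)

/-- The value of a polynomial in the `n * p` entries of the data matrix. -/
def polyVal {n p : ℕ} (q : MvPolynomial (Fin n × Fin p) ℝ) (x : Sample n p) : ℝ :=
  MvPolynomial.eval (fun ij => x ij.1 ij.2) q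

/-- The polynomial `q` is the orthogonal projection in `L²(P₀)` of the likelihood ratio `dP₁/dP₀`
onto the space of polynomials of degree at most `D`. -/
def IsLowDegreeProj {n p : ℕ} (P₀ P₁ : Measure (Sample n p)) (D : ℝ)
    (q : MvPolynomial (Fin n × Fin p) ℝ) : Prop :=
  (q.totalDegree : ℝ) ≤ D ∧
    ∀ h : MvPolynomial (Fin n × Fin p) ℝ, (h.totalDegree : ℝ) ≤ D →
      ∫ x, ((P₁.rnDeriv P₀ x).toReal - polyVal q x) * polyVal h x ∂P₀ = 0

/-- The probability under `P` that the test `φ` rejects. -/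
def rejectProb {n p : ℕ} (P : Measure (Sample n p)) (φ : Kernel (Sample n p) Bool) : ℝ :=
  (∫⁻ x, φ x {true} ∂P).toReal

/-- Two sequences of laws are indistinguishable by polynomial-time tests. -/
def PolyTimeIndistinguishable (n : ℕ → ℕ) (P₀ P₁ : ∀ p, Measure (Sample (n p) p)) : Prop :=
  ∀ φ : Procedure n fun _ => Bool, IsPolyTime n decodeTest φ →
    Tendsto (fun p => rejectProb (P₁ p) (φ p) - rejectProb (P₀ p) (φ p)) atTop (𝓝 0)

/-- The low-degree polynomial conjecture for testing pure noise against the two-group Gaussian model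
with a random block signal, for every sample size that is polynomially bounded in the dimension:
if `E₀ Λ_(D)² = 1 + o(1)` with `D = (log p) ^ 1.01`, then the two laws are indistinguishable by
polynomial-time tests. -/
def LowDegreeConjecture (ϖ : ℝ) (ρ : ℕ → ℝ) (α β r : ℝ) : Prop :=
  ∀ n : ℕ → ℕ, (∃ k : ℕ, ∀ᶠ p in atTop, n p ≤ p ^ k) →
    ∀ q : ∀ p, MvPolynomial (Fin (n p) × Fin p) ℝ,
      (∀ᶠ p in atTop, IsLowDegreeProj (noiseLaw (n p) p) (altLaw (n p) p ϖ ρ α β r)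
        (Real.log p ^ (1.01 : ℝ)) (q p)) →
      Tendsto (fun p => ∫ x, polyVal (q p) x ^ 2 ∂(noiseLaw (n p) p)) atTop (𝓝 1) →
      PolyTimeIndistinguishable n (fun p => noiseLaw (n p) p)
        (fun p => altLaw (n p) p ϖ ρ α β r)

/-- The sample size `n = p ^ θ`. -/
def sampleSize (θ : ℝ) (p : ℕ) : ℕ := ⌊(p : ℝ) ^ θ⌋₊

end BlockSignal

end

noncomputable section

namespace BlockSignal

/-! ### Product measures and Gaussian shifts -/

/-! Statistical part. Give each of the `m` blocks a cell of its own, in which it may sit at one of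
two adjacent positions (`cubeSignal`). An estimator has to decide, for every cell, which position is
taken. Two vertices of this hypercube that differ in one cell have nearly equal laws: if the
chi-square integral of one row is at most `exp κ` with `n κ ≤ 1/8`, then no procedure can locate
that block (`two_point_bound`, `two_point_sampleLaw`), and averaging over the cube as in Assouad's
lemma yields risk at least one half (`half_le_of_hammSig_le`). There are two bounds for `κ`, and
they produce the two terms of the minimum in `etaSig_eq_min`. Pretending that the labels are known
gives `κ` of order `p^(α-2r)`, hence the threshold `(θ+α)/2`. If the whole signal has small norm,
the labels are unknown in an essential way: they have mean zero, so the first-order term cancels and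
`κ` is of order `‖μ‖² p^(α-2r)`, that is `p^(1-β+α-4r)`, hence the threshold `(1+θ+α-β)/4`
(`integral_rowDens_sq_div_le'`).

Computational part. Above the statistical boundary the first part applies. Otherwise recovery is
turned into a test. A polynomial-time procedure with small risk is run on the first `n` rows, and
its output `A` is checked on further, independent rows: the statistic adds the products of signs of
entries in the same row, over pairs of columns of `A` at odd distance below `2W`. Under pure noise,
changing the signs of all even columns preserves the law and negates the statistic, so it is
positive with probability at most one half, whatever `A` is (`noiseLaw_pairStat_pos_le`). Under the
alternative, two nearby signal columns lie in one block and their means have the same sign whatever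
the label is, so the statistic has positive mean, and Chebyshev's inequality shows that it is
positive with high probability if `A` is close to the support
(`IsPlacement.shiftLaw_pairStat_nonpos_le`). The rejection probabilities then differ by at least
`1/8` (`eighth_le_rejectProb_sub`).

The test must be a program in the same language that sees only the sample size `N`, the dimension
and the data. Therefore `N` encodes what has to be known: division of `N` by `L = p.size + 1` gives
`n` as the quotient and `log₂ W` as the remainder (`testSize`). This costs a logarithmic factor in
the sample size, which also provides the extra rows needed when `r` lies exactly on the statistical
boundary. Only signs are used because rounding to any precision preserves them.

On the other hand, the low-degree second moment at this `N` tends to one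
(`exists_isLowDegreeProj_tendsto`), so the conjecture excludes such a test. By Hermite expansion,
that moment is the truncated exponential series in the moments of the inner product of two
independent mean matrices, which factors into an overlap of labels and an overlap of signals
(`sum_priorWeight_mul_pow`). Labels and random block signs give sub-Gaussian moments; the number of
blocks that collide has lighter exponential moments than a Poisson variable
(`arrWeight_le_card_mul_exp`). Up to powers of the logarithm the terms are controlled by
`p^(θ+2α-4r) (1 + p^(1-α-2β))`, and the smallness of both summands is what `r > etaSigComp` means
below the statistical boundary. -/

lemma lintegral_pi_prod {ι : Type*} [Fintype ι] {Ω : ι → Type*} [∀ i, MeasurableSpace (Ω i)]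
    (μ : ∀ i, Measure (Ω i)) [∀ i, IsProbabilityMeasure (μ i)] {f : ∀ i, Ω i → ℝ≥0∞}
    (hf : ∀ i, Measurable (f i)) :
    ∫⁻ x, ∏ i, f i (x i) ∂Measure.pi μ = ∏ i, ∫⁻ y, f i y ∂μ i := by
  have h := lintegral_prod_eq_prod_lintegral_of_indepFun (μ := Measure.pi μ) Finset.univ
    (fun i x => f i (x i)) (iIndepFun_pi fun i => (hf i).aemeasurable)
    (fun i => (hf i).comp (measurable_pi_apply i))
  rw [h]
  refine Finset.prod_congr rfl fun i _ => ?_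
  exact (measurePreserving_eval μ i).lintegral_comp (hf i)

lemma pi_withDensity_prod {ι : Type*} [Fintype ι] {Ω : ι → Type*} [∀ i, MeasurableSpace (Ω i)]
    (μ : ∀ i, Measure (Ω i)) [∀ i, IsProbabilityMeasure (μ i)] {f : ∀ i, Ω i → ℝ≥0∞}
    (hf : ∀ i, Measurable (f i)) [∀ i, SigmaFinite ((μ i).withDensity (f i))] :
    Measure.pi (fun i => (μ i).withDensity (f i))
      = (Measure.pi μ).withDensity fun x => ∏ i, f i (x i) := by
  refine Measure.pi_eq fun s hs => ?_
  rw [withDensity_apply _ (MeasurableSet.univ_pi hs), ← lintegral_indicator (MeasurableSet.univ_pi hs)]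
  have h : (Set.univ.pi s).indicator (fun x => ∏ i, f i (x i))
      = fun x => ∏ i, (s i).indicator (f i) (x i) := by
    funext x
    by_cases hx : x ∈ Set.univ.pi s
    · rw [Set.indicator_of_mem hx]
      exact Finset.prod_congr rfl fun i _ => (Set.indicator_of_mem (hx i trivial) _).symm
    · rw [Set.indicator_of_notMem hx]
      simp only [Set.mem_pi, Set.mem_univ, forall_true_left, not_forall] at hx
      obtain ⟨i, hi⟩ := hx
      exact (Finset.prod_eq_zero (Finset.mem_univ i) (Set.indicator_of_notMem hi _)).symm
  rw [h, lintegral_pi_prod _ fun i => (hf i).indicator (hs i)]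
  refine Finset.prod_congr rfl fun i _ => ?_
  rw [withDensity_apply _ (hs i), lintegral_indicator (hs i)]

lemma gaussianReal_eq_withDensity_std (t : ℝ) :
    gaussianReal t 1
      = (gaussianReal 0 1).withDensity fun x => ENNReal.ofReal (Real.exp (t * x - t ^ 2 / 2)) := by
  rw [gaussianReal_of_var_ne_zero _ one_ne_zero, gaussianReal_of_var_ne_zero _ one_ne_zero,
    ← withDensity_mul _ (measurable_gaussianPDF 0 1) (by fun_prop)]
  congr 1
  funext x
  simp only [gaussianPDF, Pi.mul_apply]
  rw [← ENNReal.ofReal_mul (gaussianPDFReal_nonneg _ _ _)]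
  congr 1
  simp only [gaussianPDFReal, mul_assoc]
  rw [← Real.exp_add]
  congr 2
  push_cast
  ring

/-- The law of the data with independent entries of mean `M i j` and variance one. -/
def shiftLaw {n p : ℕ} (M : Fin n → Fin p → ℝ) : Measure (Sample n p) :=
  Measure.pi fun i => Measure.pi fun j => gaussianReal (M i j) 1

instance {n p : ℕ} (M : Fin n → Fin p → ℝ) : IsProbabilityMeasure (shiftLaw M) := by
  unfold shiftLaw; infer_instance

instance {n p : ℕ} : IsProbabilityMeasure (noiseLaw n p) := by
  unfold noiseLaw; infer_instance

lemma noiseLaw_eq_shiftLaw (n p : ℕ) : noiseLaw n p = shiftLaw 0 := rfl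

lemma noiseLaw_map_add {n p : ℕ} (M : Fin n → Fin p → ℝ) :
    (noiseLaw n p).map (fun z i j => M i j + z i j) = shiftLaw M := by
  unfold noiseLaw shiftLaw
  rw [Measure.pi_map_pi (f := fun i (z : Fin p → ℝ) j => M i j + z j) fun i =>
    (measurable_pi_lambda _ fun j => (measurable_pi_apply j).const_add _).aemeasurable]
  congr 1
  funext i
  rw [Measure.pi_map_pi (f := fun j (z : ℝ) => M i j + z) fun j =>
    (measurable_id.const_add _).aemeasurable]
  congr 1
  funext j
  rw [gaussianReal_map_const_add]
  simp

/-- The likelihood ratio of `shiftLaw M` with respect to the noise. -/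
def shiftDensity {n p : ℕ} (M x : Fin n → Fin p → ℝ) : ℝ :=
  ∏ i, ∏ j, Real.exp (M i j * x i j - M i j ^ 2 / 2)

lemma shiftDensity_pos {n p : ℕ} (M x : Fin n → Fin p → ℝ) : 0 < shiftDensity M x :=
  Finset.prod_pos fun _ _ => Finset.prod_pos fun _ _ => Real.exp_pos _

lemma measurable_shiftDensity {n p : ℕ} (M : Fin n → Fin p → ℝ) :
    Measurable (shiftDensity M : Sample n p → ℝ) := by
  unfold shiftDensity; fun_prop

lemma shiftLaw_eq_withDensity {n p : ℕ} (M : Fin n → Fin p → ℝ) :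
    shiftLaw M = (noiseLaw n p).withDensity fun x => ENNReal.ofReal (shiftDensity M x) := by
  have h1 : ∀ i, (Measure.pi fun j => gaussianReal (M i j) 1)
      = (Measure.pi fun _ : Fin p => gaussianReal 0 1).withDensity
        fun y => ∏ j, ENNReal.ofReal (Real.exp (M i j * y j - M i j ^ 2 / 2)) := by
    intro i
    have : ∀ j, SigmaFinite ((gaussianReal 0 1).withDensity
        fun x => ENNReal.ofReal (Real.exp (M i j * x - M i j ^ 2 / 2))) := fun j => by
      rw [← gaussianReal_eq_withDensity_std]; infer_instance
    rw [← pi_withDensity_prod (fun _ : Fin p => gaussianReal 0 1)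
      (f := fun j x => ENNReal.ofReal (Real.exp (M i j * x - M i j ^ 2 / 2))) fun j => by fun_prop]
    simp_rw [← gaussianReal_eq_withDensity_std]
  have : ∀ i, SigmaFinite ((Measure.pi fun _ : Fin p => gaussianReal 0 1).withDensity
        fun y => ∏ j, ENNReal.ofReal (Real.exp (M i j * y j - M i j ^ 2 / 2))) := fun i => by
    rw [← h1]; infer_instance
  unfold shiftLaw noiseLaw
  simp_rw [h1]
  rw [pi_withDensity_prod (fun _ : Fin n => Measure.pi fun _ : Fin p => gaussianReal 0 1)
    (f := fun i y => ∏ j, ENNReal.ofReal (Real.exp (M i j * y j - M i j ^ 2 / 2)))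
    fun i => by fun_prop]
  congr 1
  funext x
  unfold shiftDensity
  rw [ENNReal.ofReal_prod_of_nonneg fun i _ => Finset.prod_nonneg fun _ _ => (Real.exp_pos _).le]
  refine Finset.prod_congr rfl fun i _ => ?_
  rw [ENNReal.ofReal_prod_of_nonneg fun i _ => (Real.exp_pos _).le]

lemma integral_noiseLaw_prod {n p : ℕ} (f : Fin n → Fin p → ℝ → ℝ) :
    ∫ x, ∏ i, ∏ j, f i j (x i j) ∂noiseLaw n p = ∏ i, ∏ j, ∫ y, f i j y ∂gaussianReal 0 1 := by
  unfold noiseLaw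
  rw [integral_fintype_prod_eq_prod (fun i (y : Fin p → ℝ) => ∏ j, f i j (y j))]
  exact Finset.prod_congr rfl fun i _ => integral_fintype_prod_eq_prod (fun j y => f i j y)

lemma integral_shiftLaw_prod {n p : ℕ} (M : Fin n → Fin p → ℝ) (f : Fin n → Fin p → ℝ → ℝ) :
    ∫ x, ∏ i, ∏ j, f i j (x i j) ∂shiftLaw M
      = ∏ i, ∏ j, ∫ y, f i j y ∂gaussianReal (M i j) 1 := by
  unfold shiftLaw
  rw [integral_fintype_prod_eq_prod (fun i (y : Fin p → ℝ) => ∏ j, f i j (y j))]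
  exact Finset.prod_congr rfl fun i _ => integral_fintype_prod_eq_prod (fun j y => f i j y)

/-! ### The label law as a finite mixture -/

/-- The two label values. -/
def lab (ϖ : ℝ) (b : Bool) : ℝ := if b then 1 else -ϖ

/-- The probabilities of the two label values. -/
def labW (ϖ : ℝ) (b : Bool) : ℝ := if b then ϖ / (1 + ϖ) else 1 / (1 + ϖ)

section Labels

variable {ϖ : ℝ}

lemma labW_nonneg (hϖ : 0 < ϖ) (b : Bool) : 0 ≤ labW ϖ b := by
  unfold labW; split_ifs <;> positivity

lemma sum_labW (hϖ : 0 < ϖ) : ∑ b, labW ϖ b = 1 := by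
  simp only [labW, Fintype.sum_bool, if_true, Bool.false_eq_true, if_false]
  field_simp
  ring

lemma sum_labW_mul_lab (hϖ : 0 < ϖ) : ∑ b, labW ϖ b * lab ϖ b = 0 := by
  simp only [labW, lab, Fintype.sum_bool, if_true, Bool.false_eq_true, if_false]
  field_simp
  ring

lemma sum_labW_mul_lab_sq (hϖ : 0 < ϖ) : ∑ b, labW ϖ b * lab ϖ b ^ 2 = ϖ := by
  simp only [labW, lab, Fintype.sum_bool, if_true, Bool.false_eq_true, if_false]
  field_simp

lemma abs_lab_le (hϖ : 0 < ϖ) (b : Bool) : |lab ϖ b| ≤ 1 + ϖ := by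
  unfold lab; split_ifs
  · rw [abs_one]; linarith
  · rw [abs_neg, abs_of_pos hϖ]; linarith

lemma le_abs_lab (hϖ : 0 < ϖ) (b : Bool) : min 1 ϖ ≤ |lab ϖ b| := by
  unfold lab; split_ifs
  · rw [abs_one]; exact min_le_left _ _
  · rw [abs_neg, abs_of_pos hϖ]; exact min_le_right _ _

/-- The probability of a vector of labels. -/
def labProd (ϖ : ℝ) {n : ℕ} (b : Fin n → Bool) : ℝ := ∏ i, labW ϖ (b i)

lemma labProd_nonneg (hϖ : 0 < ϖ) {n : ℕ} (b : Fin n → Bool) : 0 ≤ labProd ϖ b :=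
  Finset.prod_nonneg fun _ _ => labW_nonneg hϖ _

lemma sum_prod_bool {n : ℕ} {R : Type*} [CommSemiring R] (f : Fin n → Bool → R) :
    ∑ b : Fin n → Bool, ∏ i, f i (b i) = ∏ i, ∑ c, f i c := by
  rw [Finset.prod_univ_sum, Fintype.piFinset_univ]

lemma sum_labProd (hϖ : 0 < ϖ) (n : ℕ) : ∑ b : Fin n → Bool, labProd ϖ b = 1 := by
  unfold labProd
  rw [sum_prod_bool fun _ c => labW ϖ c]
  rw [sum_labW hϖ, Finset.prod_const_one]

lemma labelLaw_eq : labelLaw ϖ = ∑ b, ENNReal.ofReal (labW ϖ b) • Measure.dirac (lab ϖ b) := by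
  rw [Fintype.sum_bool]; rfl

lemma isProbabilityMeasure_labelLaw (hϖ : 0 < ϖ) : IsProbabilityMeasure (labelLaw ϖ) := by
  constructor
  rw [labelLaw_eq]
  simp only [Measure.coe_finsetSum, Finset.sum_apply, Measure.smul_apply, measure_univ, smul_eq_mul,
    mul_one]
  rw [← ENNReal.ofReal_sum_of_nonneg fun b _ => labW_nonneg hϖ b, sum_labW hϖ, ENNReal.ofReal_one]

lemma pi_labelLaw_eq (hϖ : 0 < ϖ) (n : ℕ) :
    (Measure.pi fun _ : Fin n => labelLaw ϖ)
      = ∑ b : Fin n → Bool, ENNReal.ofReal (labProd ϖ b) • Measure.dirac fun i => lab ϖ (b i) := by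
  have := isProbabilityMeasure_labelLaw hϖ
  refine Measure.pi_eq fun s hs => ?_
  simp only [Measure.coe_finsetSum, Finset.sum_apply, Measure.smul_apply, smul_eq_mul, labelLaw_eq]
  rw [← sum_prod_bool fun i c => ENNReal.ofReal (labW ϖ c) * (Measure.dirac (lab ϖ c)) (s i)]
  refine Finset.sum_congr rfl fun b _ => ?_
  rw [Finset.prod_mul_distrib, labProd, ENNReal.ofReal_prod_of_nonneg fun i _ => labW_nonneg hϖ _]
  congr 1
  rw [Measure.dirac_apply' _ (MeasurableSet.univ_pi hs)]
  simp_rw [Measure.dirac_apply' _ (hs _)]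
  by_cases h : (fun i => lab ϖ (b i)) ∈ Set.univ.pi s
  · rw [Set.indicator_of_mem h]
    refine (Finset.prod_eq_one fun i _ => ?_).symm
    rw [Set.indicator_of_mem (h i trivial)]; rfl
  · rw [Set.indicator_of_notMem h]
    simp only [Set.mem_pi, Set.mem_univ, forall_true_left, not_forall] at h
    obtain ⟨i, hi⟩ := h
    exact (Finset.prod_eq_zero (Finset.mem_univ i) (Set.indicator_of_notMem hi _)).symm

/-- The matrix of means for given labels. -/
def meanMat (ϖ : ℝ) {n p : ℕ} (b : Fin n → Bool) (μ : Fin p → ℝ) : Fin n → Fin p → ℝ :=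
  fun i j => lab ϖ (b i) * μ j

/-- Conditioning on the labels leaves a Gaussian shift. This finite mixture is the form in which
both the Hermite calculus and the analysis of the test, which holds for every fixed label vector,
can be applied. -/
lemma sampleLaw_eq_sum (hϖ : 0 < ϖ) (n : ℕ) {p : ℕ} (μ : Fin p → ℝ) :
    sampleLaw n ϖ μ
      = ∑ b : Fin n → Bool, ENNReal.ofReal (labProd ϖ b) • shiftLaw (meanMat ϖ b μ) := by
  refine Measure.ext_of_lintegral _ fun f hf => ?_
  have hm : Measurable fun y : (Fin n → ℝ) × Sample n p => fun i j => y.1 i * μ j + y.2 i j := by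
    fun_prop
  have := isProbabilityMeasure_labelLaw hϖ
  unfold sampleLaw
  rw [lintegral_map hf hm, lintegral_prod (fun y : (Fin n → ℝ) × Sample n p => f fun i j => y.1 i * μ j + y.2 i j)
      (hf.comp hm).aemeasurable, pi_labelLaw_eq hϖ]
  simp only [lintegral_finsetSum_measure, lintegral_smul_measure, lintegral_dirac]
  refine Finset.sum_congr rfl fun b _ => ?_
  rw [← noiseLaw_map_add, lintegral_map hf (by fun_prop)]
  rfl

lemma isProbabilityMeasure_sampleLaw (hϖ : 0 < ϖ) (n : ℕ) {p : ℕ} (μ : Fin p → ℝ) :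
    IsProbabilityMeasure (sampleLaw n ϖ μ) := by
  constructor
  rw [sampleLaw_eq_sum hϖ]
  simp only [Measure.coe_finsetSum, Finset.sum_apply, Measure.smul_apply, measure_univ, smul_eq_mul,
    mul_one]
  rw [← ENNReal.ofReal_sum_of_nonneg fun b _ => labProd_nonneg hϖ b, sum_labProd hϖ,
    ENNReal.ofReal_one]

end Labels

/-! ### Chi-square bounds for the two-group model -/

/-- Le Cam's two-point argument, with losses in place of tests: whenever every outcome costs at
least `D` in total under the two hypotheses, a chi-square divergence of `t²` can save at most the
fraction `t` of this cost. -/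
lemma two_point_bound {Ω : Type*} [MeasurableSpace Ω] (ν : Measure Ω) {F F' : Ω → ℝ}
    (hF : Measurable F) (hF' : Measurable F') (hpos : ∀ x, 0 < F x) (hpos' : ∀ x, 0 < F' x)
    (hi : Integrable F ν) (hi' : Integrable F' ν) (h1 : ∫ x, F x ∂ν = 1) (h1' : ∫ x, F' x ∂ν = 1)
    (hq : Integrable (fun x => F' x ^ 2 / F x) ν) {t : ℝ} (ht : 0 < t)
    (hchi : ∫ x, F' x ^ 2 / F x ∂ν ≤ 1 + t ^ 2) {D : ℝ} (hD : 0 < D) {d d' : Ω → ℝ≥0∞}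
    (hd : Measurable d) (hd' : Measurable d') (hdd : ∀ x, ENNReal.ofReal D ≤ d x + d' x) :
    ENNReal.ofReal (D * (1 - t)) ≤
      ∫⁻ x, d x ∂(ν.withDensity fun x => ENNReal.ofReal (F x)) +
      ∫⁻ x, d' x ∂(ν.withDensity fun x => ENNReal.ofReal (F' x)) := by
  -- The second loss is truncated at `D`, so that all integrals are finite; `D - g` still lies below
  -- the first loss.
  set g : Ω → ℝ := fun x => (min (d' x) (ENNReal.ofReal D)).toReal with hg
  have hgm : Measurable g := (hd'.min measurable_const).ennreal_toReal
  have hg0 : ∀ x, 0 ≤ g x := fun x => ENNReal.toReal_nonneg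
  have hgfin : ∀ x, min (d' x) (ENNReal.ofReal D) ≠ ∞ :=
    fun x => ne_top_of_le_ne_top ENNReal.ofReal_ne_top (min_le_right _ _)
  have hgD : ∀ x, g x ≤ D := fun x => by
    have := ENNReal.toReal_mono ENNReal.ofReal_ne_top (min_le_right (d' x) (ENNReal.ofReal D))
    rwa [ENNReal.toReal_ofReal hD.le] at this
  have hgd' : ∀ x, ENNReal.ofReal (g x) ≤ d' x := fun x => by
    rw [hg, ENNReal.ofReal_toReal (hgfin x)]; exact min_le_left _ _
  have hgd : ∀ x, ENNReal.ofReal (D - g x) ≤ d x := fun x => by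
    rw [ENNReal.ofReal_sub _ (hg0 x), tsub_le_iff_right]
    rcases le_total (d' x) (ENNReal.ofReal D) with h | h
    · rw [hg, ENNReal.ofReal_toReal (hgfin x), min_eq_left h]; exact hdd x
    · rw [hg, ENNReal.ofReal_toReal (hgfin x), min_eq_right h]; exact le_add_self
  have hib : ∀ {G : Ω → ℝ}, Integrable G ν → ∀ {u : Ω → ℝ}, Measurable u → (∀ x, 0 ≤ u x) →
      (∀ x, u x ≤ D) → Integrable (fun x => G x * u x) ν := by
    intro G hG u hu h0 hu1
    refine hG.mul_bdd (c := D) hu.aestronglyMeasurable (ae_of_all _ fun x => ?_)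
    rw [Real.norm_eq_abs, abs_of_nonneg (h0 x)]; exact hu1 x
  have e1 : ENNReal.ofReal (∫ x, F x * (D - g x) ∂ν)
      ≤ ∫⁻ x, d x ∂(ν.withDensity fun x => ENNReal.ofReal (F x)) := by
    rw [lintegral_withDensity_eq_lintegral_mul _ hF.ennreal_ofReal hd,
      ofReal_integral_eq_lintegral_ofReal (hib hi (hgm.const_sub D)
        (fun x => sub_nonneg.2 (hgD x)) fun x => by linarith [hg0 x])
        (ae_of_all _ fun x => mul_nonneg (hpos x).le (sub_nonneg.2 (hgD x)))]
    refine lintegral_mono fun x => ?_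
    rw [ENNReal.ofReal_mul (hpos x).le]
    exact mul_le_mul_right (hgd x) _
  have e2 : ENNReal.ofReal (∫ x, F' x * g x ∂ν)
      ≤ ∫⁻ x, d' x ∂(ν.withDensity fun x => ENNReal.ofReal (F' x)) := by
    rw [lintegral_withDensity_eq_lintegral_mul _ hF'.ennreal_ofReal hd',
      ofReal_integral_eq_lintegral_ofReal (hib hi' hgm hg0 hgD)
        (ae_of_all _ fun x => mul_nonneg (hpos' x).le (hg0 x))]
    refine lintegral_mono fun x => ?_
    rw [ENNReal.ofReal_mul (hpos' x).le]
    exact mul_le_mul_right (hgd' x) _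
  refine le_trans ?_ (add_le_add e1 e2)
  rw [← ENNReal.ofReal_add (integral_nonneg fun x => mul_nonneg (hpos x).le (sub_nonneg.2 (hgD x)))
    (integral_nonneg fun x => mul_nonneg (hpos' x).le (hg0 x))]
  refine ENNReal.ofReal_le_ofReal ?_
  have i1 : Integrable (fun x => F x * (D - g x)) ν := hib hi (hgm.const_sub D)
    (fun x => sub_nonneg.2 (hgD x)) fun x => by linarith [hg0 x]
  have i2 : Integrable (fun x => F' x * g x) ν := hib hi' hgm hg0 hgD
  rw [← integral_add i1 i2]
  -- The arithmetic-geometric mean inequality with weight `t` bounds `F - F'` by `t F / 2 + (F -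
  -- F')² / (2 t F)`. Both summands integrate to at most `t / 2`.
  have key : ∀ x, D * F x - D * (t / 2 * F x + (F' x ^ 2 / F x - 2 * F' x + F x) / (2 * t))
      ≤ F x * (D - g x) + F' x * g x := by
    intro x
    have hx := hpos x
    have h3 : F' x ^ 2 / F x - 2 * F' x + F x = (F x - F' x) ^ 2 / F x := by
      field_simp; ring
    have h4 : F x - F' x ≤ t / 2 * F x + (F x - F' x) ^ 2 / F x / (2 * t) := by
      have : t / 2 * F x + (F x - F' x) ^ 2 / F x / (2 * t) - (F x - F' x)
          = (t * F x - (F x - F' x)) ^ 2 / (2 * t * F x) := by field_simp; ring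
      have : 0 ≤ (t * F x - (F x - F' x)) ^ 2 / (2 * t * F x) := by positivity
      linarith
    have h5 : 0 ≤ t / 2 * F x + (F x - F' x) ^ 2 / F x / (2 * t) := by positivity
    rw [h3]
    set R := t / 2 * F x + (F x - F' x) ^ 2 / F x / (2 * t)
    have h6 : g x * (F x - F' x) ≤ D * R :=
      (mul_le_mul_of_nonneg_left h4 (hg0 x)).trans (mul_le_mul_of_nonneg_right (hgD x) h5)
    nlinarith
  have iq₀ : Integrable (fun x => F' x ^ 2 / F x - 2 * F' x) ν := hq.sub (hi'.const_mul 2)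
  have iq : Integrable (fun x => F' x ^ 2 / F x - 2 * F' x + F x) ν :=
    iq₀.add hi
  have iR : Integrable (fun x => t / 2 * F x + (F' x ^ 2 / F x - 2 * F' x + F x) / (2 * t)) ν :=
    (hi.const_mul _).add (iq.div_const _)
  refine le_trans ?_ (integral_mono ((hi.const_mul D).sub (iR.const_mul D)) (i1.add i2) key)
  rw [integral_sub' (hi.const_mul D) (iR.const_mul D), integral_const_mul, integral_const_mul,
    integral_add (hi.const_mul _) (iq.div_const _),
    integral_const_mul, integral_div, integral_add iq₀ hi,
    integral_sub hq (hi'.const_mul 2), integral_const_mul, h1, h1']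
  have h7 : (∫ x, F' x ^ 2 / F x ∂ν - 2 * 1 + 1) / (2 * t) ≤ t / 2 := by
    rw [div_le_iff₀ (by positivity)]; nlinarith
  nlinarith

/-- The standard normal law in dimension `p`. -/
abbrev stdNormal (p : ℕ) : Measure (Fin p → ℝ) := Measure.pi fun _ => gaussianReal 0 1

lemma integrable_exp_linear {p : ℕ} (u c : Fin p → ℝ) :
    Integrable (fun y : Fin p → ℝ => Real.exp (∑ j, (u j * y j + c j))) (stdNormal p) := by
  simp_rw [Real.exp_sum]
  refine Integrable.fintype_prod (f := fun j (y : ℝ) => Real.exp (u j * y + c j)) fun j => ?_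
  simp_rw [Real.exp_add]
  exact (integrable_exp_mul_gaussianReal (u j)).mul_const _

lemma integral_exp_linear {p : ℕ} (u c : Fin p → ℝ) :
    ∫ y : Fin p → ℝ, Real.exp (∑ j, (u j * y j + c j)) ∂stdNormal p
      = Real.exp (∑ j, (u j ^ 2 / 2 + c j)) := by
  simp_rw [Real.exp_sum]
  rw [integral_fintype_prod_eq_prod (fun j (y : ℝ) => Real.exp (u j * y + c j))]
  refine Finset.prod_congr rfl fun j _ => ?_
  simp_rw [Real.exp_add]
  rw [integral_mul_const]
  have := congrFun (mgf_id_gaussianReal (μ := 0) (v := 1)) (u j)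
  simp only [mgf, id_eq] at this
  rw [this]
  simp

/-- The likelihood ratio of one observation with label value `l`. -/
def labelDens {p : ℕ} (l : ℝ) (μ y : Fin p → ℝ) : ℝ :=
  Real.exp (∑ j, (l * μ j * y j + -(l * μ j) ^ 2 / 2))

/-- The likelihood ratio of one observation. -/
def rowDens (ϖ : ℝ) {p : ℕ} (μ y : Fin p → ℝ) : ℝ :=
  ∑ b, labW ϖ b * labelDens (lab ϖ b) μ y

/-- The likelihood ratio of the sample. -/
def sampleDens (ϖ : ℝ) {n p : ℕ} (μ : Fin p → ℝ) (x : Sample n p) : ℝ :=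
  ∏ i, rowDens ϖ μ (x i)

section

variable {ϖ : ℝ} {n p : ℕ}

lemma integral_labelDens (l : ℝ) (μ : Fin p → ℝ) : ∫ y, labelDens l μ y ∂stdNormal p = 1 := by
  unfold labelDens
  rw [integral_exp_linear fun j => l * μ j, Finset.sum_eq_zero, Real.exp_zero]
  intro j _; ring

lemma integrable_labelDens (l : ℝ) (μ : Fin p → ℝ) : Integrable (labelDens l μ) (stdNormal p) :=
  integrable_exp_linear (fun j => l * μ j) _

lemma labelDens_mul (l l' : ℝ) (μ μ' y : Fin p → ℝ) : labelDens l μ y * labelDens l' μ' y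
    = Real.exp (∑ j, ((l * μ j + l' * μ' j) * y j + (-(l * μ j) ^ 2 / 2 + -(l' * μ' j) ^ 2 / 2))) := by
  unfold labelDens
  rw [← Real.exp_add, ← Finset.sum_add_distrib]
  congr 1
  exact Finset.sum_congr rfl fun j _ => by ring

lemma integrable_labelDens_mul (l l' : ℝ) (μ μ' : Fin p → ℝ) :
    Integrable (fun y => labelDens l μ y * labelDens l' μ' y) (stdNormal p) := by
  simp_rw [labelDens_mul]
  exact integrable_exp_linear _ _

lemma integral_labelDens_mul (l l' : ℝ) (μ μ' : Fin p → ℝ) :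
    ∫ y, labelDens l μ y * labelDens l' μ' y ∂stdNormal p
      = Real.exp (l * l' * ∑ j, μ j * μ' j) := by
  simp_rw [labelDens_mul]
  rw [integral_exp_linear, Finset.mul_sum]
  congr 1
  exact Finset.sum_congr rfl fun j _ => by ring

lemma labelDens_sq_div (l : ℝ) (μ μ' y : Fin p → ℝ) : labelDens l μ' y ^ 2 / labelDens l μ y
    = Real.exp (∑ j, ((2 * (l * μ' j) - l * μ j) * y j
        + (-(l * μ' j) ^ 2 + (l * μ j) ^ 2 / 2))) := by
  unfold labelDens
  rw [← Real.exp_nat_mul, ← Real.exp_sub, Finset.mul_sum, ← Finset.sum_sub_distrib]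
  congr 1
  exact Finset.sum_congr rfl fun j _ => by push_cast; ring

lemma integral_labelDens_sq_div (l : ℝ) (μ μ' : Fin p → ℝ) :
    ∫ y, labelDens l μ' y ^ 2 / labelDens l μ y ∂stdNormal p
      = Real.exp (l ^ 2 * ∑ j, (μ' j - μ j) ^ 2) := by
  simp_rw [labelDens_sq_div]
  rw [integral_exp_linear, Finset.mul_sum]
  congr 1
  exact Finset.sum_congr rfl fun j _ => by ring

lemma integrable_labelDens_sq_div (l : ℝ) (μ μ' : Fin p → ℝ) :
    Integrable (fun y => labelDens l μ' y ^ 2 / labelDens l μ y) (stdNormal p) := by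
  simp_rw [labelDens_sq_div]
  exact integrable_exp_linear _ _

lemma labW_pos (hϖ : 0 < ϖ) (b : Bool) : 0 < labW ϖ b := by
  unfold labW; split_ifs <;> positivity

lemma rowDens_pos (hϖ : 0 < ϖ) (μ y : Fin p → ℝ) : 0 < rowDens ϖ μ y :=
  Finset.sum_pos (fun b _ => mul_pos (labW_pos hϖ b) (Real.exp_pos _)) Finset.univ_nonempty

lemma measurable_labelDens (l : ℝ) (μ : Fin p → ℝ) : Measurable (labelDens l μ) := by
  unfold labelDens; fun_prop

lemma measurable_rowDens (μ : Fin p → ℝ) : Measurable (rowDens ϖ μ) :=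
  Finset.measurable_sum _ fun b _ => (measurable_labelDens _ μ).const_mul _

lemma integrable_rowDens (μ : Fin p → ℝ) : Integrable (rowDens ϖ μ) (stdNormal p) :=
  integrable_finsetSum _ fun b _ => (integrable_labelDens _ μ).const_mul _

lemma integral_rowDens (hϖ : 0 < ϖ) (μ : Fin p → ℝ) : ∫ y, rowDens ϖ μ y ∂stdNormal p = 1 := by
  unfold rowDens
  rw [integral_finsetSum _ fun b _ => (integrable_labelDens _ μ).const_mul _]
  simp_rw [integral_const_mul, integral_labelDens, mul_one]
  exact sum_labW hϖ

lemma rowDens_mul (μ μ' y : Fin p → ℝ) : rowDens ϖ μ y * rowDens ϖ μ' y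
    = ∑ b, ∑ c, labW ϖ b * labW ϖ c * (labelDens (lab ϖ b) μ y * labelDens (lab ϖ c) μ' y) := by
  unfold rowDens
  rw [Finset.sum_mul_sum]
  exact Finset.sum_congr rfl fun b _ => Finset.sum_congr rfl fun c _ => by ring

lemma integrable_rowDens_mul (μ μ' : Fin p → ℝ) :
    Integrable (fun y => rowDens ϖ μ y * rowDens ϖ μ' y) (stdNormal p) := by
  simp_rw [rowDens_mul]
  exact integrable_finsetSum _ fun b _ => integrable_finsetSum _ fun c _ =>
    (integrable_labelDens_mul _ _ μ μ').const_mul _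

lemma integral_rowDens_mul (μ μ' : Fin p → ℝ) :
    ∫ y, rowDens ϖ μ y * rowDens ϖ μ' y ∂stdNormal p
      = ∑ b, ∑ c, labW ϖ b * labW ϖ c * Real.exp (lab ϖ b * lab ϖ c * ∑ j, μ j * μ' j) := by
  simp_rw [rowDens_mul]
  rw [integral_finsetSum _ fun b _ => integrable_finsetSum _ fun c _ =>
    (integrable_labelDens_mul _ _ μ μ').const_mul _]
  refine Finset.sum_congr rfl fun b _ => ?_
  rw [integral_finsetSum _ fun c _ => (integrable_labelDens_mul _ _ μ μ').const_mul _]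
  refine Finset.sum_congr rfl fun c _ => ?_
  rw [integral_const_mul, integral_labelDens_mul]

/-- Cauchy–Schwarz for the mixture over labels: the chi-square divergence is jointly convex, so it
only grows when the labels are revealed. -/
lemma rowDens_sq_div_le (hϖ : 0 < ϖ) (μ μ' y : Fin p → ℝ) :
    rowDens ϖ μ' y ^ 2 / rowDens ϖ μ y
      ≤ ∑ b, labW ϖ b * (labelDens (lab ϖ b) μ' y ^ 2 / labelDens (lab ϖ b) μ y) := by
  refine (Finset.sum_sq_le_sum_mul_sum_of_sq_le_mul Finset.univ
    (r := fun b => labW ϖ b * labelDens (lab ϖ b) μ' y)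
    (f := fun b => labW ϖ b * (labelDens (lab ϖ b) μ' y ^ 2 / labelDens (lab ϖ b) μ y))
    (g := fun b => labW ϖ b * labelDens (lab ϖ b) μ y) ?_ ?_ ?_ |>.trans_eq' ?_ |> fun h =>
      (div_le_iff₀ (rowDens_pos hϖ μ y)).2 h)
  · exact fun b _ => mul_nonneg (labW_nonneg hϖ b) (div_nonneg (sq_nonneg _) (Real.exp_pos _).le)
  · exact fun b _ => mul_nonneg (labW_nonneg hϖ b) (Real.exp_pos _).le
  · intro b _
    have : labelDens (lab ϖ b) μ y ≠ 0 := (Real.exp_pos _).ne'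
    exact le_of_eq (by field_simp)
  · rfl

lemma integrable_rowDens_sq_div (hϖ : 0 < ϖ) (μ μ' : Fin p → ℝ) :
    Integrable (fun y => rowDens ϖ μ' y ^ 2 / rowDens ϖ μ y) (stdNormal p) := by
  refine (integrable_finsetSum Finset.univ fun b _ =>
    (integrable_labelDens_sq_div (lab ϖ b) μ μ').const_mul (labW ϖ b)).mono'
    (((measurable_rowDens μ').pow_const 2).div (measurable_rowDens μ)).aestronglyMeasurable
    (ae_of_all _ fun y => ?_)
  rw [Real.norm_eq_abs, abs_of_nonneg (div_nonneg (sq_nonneg _) (rowDens_pos hϖ μ y).le)]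
  exact rowDens_sq_div_le hϖ μ μ' y

/-- The chi-square bound that ignores the uncertainty about the labels. -/
lemma integral_rowDens_sq_div_le (hϖ : 0 < ϖ) (μ μ' : Fin p → ℝ) :
    ∫ y, rowDens ϖ μ' y ^ 2 / rowDens ϖ μ y ∂stdNormal p
      ≤ Real.exp ((1 + ϖ) ^ 2 * ∑ j, (μ' j - μ j) ^ 2) := by
  refine (integral_mono (integrable_rowDens_sq_div hϖ μ μ') (integrable_finsetSum Finset.univ
    fun b _ => (integrable_labelDens_sq_div (lab ϖ b) μ μ').const_mul (labW ϖ b))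
    (rowDens_sq_div_le hϖ μ μ')).trans ?_
  rw [integral_finsetSum _ fun b _ => (integrable_labelDens_sq_div (lab ϖ b) μ μ').const_mul _]
  simp_rw [integral_const_mul, integral_labelDens_sq_div]
  have h : ∀ b, lab ϖ b ^ 2 ≤ (1 + ϖ) ^ 2 := fun b => by
    rw [← sq_abs]; exact pow_le_pow_left₀ (abs_nonneg _) (abs_lab_le hϖ b) 2
  refine (Finset.sum_le_sum fun b _ => mul_le_mul_of_nonneg_left (Real.exp_le_exp.2
    (mul_le_mul_of_nonneg_right (h b) (Finset.sum_nonneg fun j _ => sq_nonneg _)))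
    (labW_nonneg hϖ b)).trans_eq ?_
  · rw [← Finset.sum_mul, sum_labW hϖ, one_mul]

/-- Jensen's inequality for the exponential: the term linear in the observation averages out because
the labels have mean zero, and their second moment is `ϖ`. The result is a lower bound uniform in
the observation. -/
lemma exp_le_rowDens (hϖ : 0 < ϖ) (μ y : Fin p → ℝ) :
    Real.exp (-(ϖ * ∑ j, μ j ^ 2) / 2) ≤ rowDens ϖ μ y := by
  have h := convexOn_exp.map_sum_le (t := Finset.univ) (w := labW ϖ)
    (p := fun b => ∑ j, (lab ϖ b * μ j * y j + -(lab ϖ b * μ j) ^ 2 / 2))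
    (fun b _ => labW_nonneg hϖ b) (sum_labW hϖ) (fun _ _ => Set.mem_univ _)
  refine le_trans (Real.exp_le_exp.2 (le_of_eq ?_)) h
  simp only [smul_eq_mul]
  have h1 : ∀ b, ∑ j, (lab ϖ b * μ j * y j + -(lab ϖ b * μ j) ^ 2 / 2)
      = lab ϖ b * ∑ j, μ j * y j - lab ϖ b ^ 2 * (∑ j, μ j ^ 2) / 2 := by
    intro b
    rw [Finset.mul_sum, Finset.mul_sum, Finset.sum_div, ← Finset.sum_sub_distrib]
    exact Finset.sum_congr rfl fun j _ => by ring
  simp_rw [h1, mul_sub, Finset.sum_sub_distrib]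
  have h2 : ∑ b, labW ϖ b * (lab ϖ b * ∑ j, μ j * y j) = 0 := by
    simp_rw [← mul_assoc]
    rw [← Finset.sum_mul, sum_labW_mul_lab hϖ, zero_mul]
  have h3 : ∑ b, labW ϖ b * (lab ϖ b ^ 2 * (∑ j, μ j ^ 2) / 2) = ϖ * (∑ j, μ j ^ 2) / 2 := by
    simp_rw [mul_div_assoc, ← mul_assoc]
    rw [← Finset.sum_mul, sum_labW_mul_lab_sq hϖ]
  rw [h2, h3]; ring

/-- The first-order term is kept exactly, with its sign, because it will cancel when `ξ` is the
product of two independent labels; only the second-order remainder is estimated. -/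
lemma exp_sub_exp_le {c ξ s t : ℝ} (hξ : |ξ| ≤ c) (ht : 0 ≤ t) (hts : t ≤ s) (hcs : c * s ≤ 1) :
    Real.exp (ξ * s) - Real.exp (ξ * t) ≤ ξ * (s - t) + 2 * c ^ 2 * s * (s - t) := by
  have hs : 0 ≤ s := ht.trans hts
  have hc : 0 ≤ c := (abs_nonneg _).trans hξ
  have h1 : Real.exp (ξ * s) - Real.exp (ξ * t) ≤ ξ * (s - t) * Real.exp (ξ * s) := by
    have h2 : Real.exp (ξ * t) = Real.exp (ξ * s) * Real.exp (ξ * t - ξ * s) := by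
      rw [← Real.exp_add]; congr 1; ring
    have h3 := Real.add_one_le_exp (ξ * t - ξ * s)
    nlinarith [Real.exp_pos (ξ * s)]
  have h4 : |ξ * s| ≤ c * s := by
    rw [abs_mul, abs_of_nonneg hs]; exact mul_le_mul_of_nonneg_right hξ hs
  have h5 := Real.abs_exp_sub_one_le (h4.trans hcs)
  have h6 : ξ * (s - t) * (Real.exp (ξ * s) - 1) ≤ 2 * c ^ 2 * s * (s - t) := by
    calc ξ * (s - t) * (Real.exp (ξ * s) - 1) ≤ |ξ * (s - t) * (Real.exp (ξ * s) - 1)| := le_abs_self _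
      _ = |ξ| * (s - t) * |Real.exp (ξ * s) - 1| := by
        rw [abs_mul, abs_mul, abs_of_nonneg (sub_nonneg.2 hts)]
      _ ≤ c * (s - t) * (2 * (c * s)) := by
        have := sub_nonneg.2 hts
        gcongr
        exact h5.trans (by gcongr)
      _ = _ := by ring
  nlinarith

/-- The chi-square bound for weak signals, where the labels cannot be estimated. -/
lemma integral_rowDens_sq_div_le' (hϖ : 0 < ϖ) (μ μ' : Fin p → ℝ) {s t : ℝ}
    (hs : ∑ j, μ j ^ 2 = s) (hs' : ∑ j, μ' j ^ 2 = s) (ht : ∑ j, μ j * μ' j = t) (ht0 : 0 ≤ t)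
    (hts : t ≤ s) (hcs : (1 + ϖ) ^ 2 * s ≤ 1) :
    ∫ y, rowDens ϖ μ' y ^ 2 / rowDens ϖ μ y ∂stdNormal p
      ≤ Real.exp (12 * (1 + ϖ) ^ 4 * s * (s - t)) := by
  have hs0 : 0 ≤ s := ht0.trans hts
  set E := Real.exp (ϖ * s / 2) with hE
  have hE3 : E ≤ 3 := by
    have : ϖ * s / 2 ≤ 1 := by nlinarith [mul_nonneg hϖ.le hs0, mul_nonneg (mul_nonneg hϖ.le hϖ.le) hs0]
    exact (Real.exp_le_exp.2 this).trans Real.exp_one_lt_three.le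
  -- The uniform lower bound for the density replaces the denominator in `(f' - f)² / f` by the
  -- constant `E`. What remains is quadratic in the densities and has an explicit integral.
  have hpt : ∀ y, rowDens ϖ μ' y ^ 2 / rowDens ϖ μ y ≤ (2 * rowDens ϖ μ' y - rowDens ϖ μ y)
      + E * ((rowDens ϖ μ' y * rowDens ϖ μ' y - 2 * (rowDens ϖ μ y * rowDens ϖ μ' y))
        + rowDens ϖ μ y * rowDens ϖ μ y) := by
    intro y
    have h1 := exp_le_rowDens hϖ μ y
    rw [hs] at h1
    set f := rowDens ϖ μ y
    set f' := rowDens ϖ μ' y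
    have hf : 0 < f := rowDens_pos hϖ μ y
    have h2 : f' ^ 2 / f = (2 * f' - f) + (f' - f) ^ 2 / f := by field_simp; ring
    have h3 : (f' - f) ^ 2 / f ≤ E * (f' - f) ^ 2 := by
      rw [div_le_iff₀ hf]
      have h4 : 1 ≤ E * f := by
        calc (1 : ℝ) = E * Real.exp (-(ϖ * s) / 2) := by
              rw [hE, ← Real.exp_add, ← Real.exp_zero]; congr 1; ring
          _ ≤ E * f := by gcongr
      nlinarith [sq_nonneg (f' - f)]
    rw [h2]
    nlinarith
  have i1 : Integrable (fun y => 2 * rowDens ϖ μ' y - rowDens ϖ μ y) (stdNormal p) :=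
    ((integrable_rowDens μ').const_mul 2).sub (integrable_rowDens μ)
  have i2 : Integrable (fun y => rowDens ϖ μ' y * rowDens ϖ μ' y
      - 2 * (rowDens ϖ μ y * rowDens ϖ μ' y)) (stdNormal p) :=
    (integrable_rowDens_mul μ' μ').sub ((integrable_rowDens_mul μ μ').const_mul 2)
  have i3 := i2.add (integrable_rowDens_mul (ϖ := ϖ) μ μ)
  refine (integral_mono (integrable_rowDens_sq_div hϖ μ μ') (i1.add (i3.const_mul E)) hpt).trans ?_
  rw [integral_add' i1 (i3.const_mul E), integral_sub ((integrable_rowDens μ').const_mul 2)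
    (integrable_rowDens μ), integral_const_mul, integral_const_mul, integral_rowDens hϖ,
    integral_rowDens hϖ, integral_add' i2 (integrable_rowDens_mul μ μ),
    integral_sub (integrable_rowDens_mul μ' μ') ((integrable_rowDens_mul μ μ').const_mul 2),
    integral_const_mul, integral_rowDens_mul, integral_rowDens_mul, integral_rowDens_mul]
  simp_rw [← pow_two (μ _), ← pow_two (μ' _), hs, hs', ht]
  -- `Φ u` is the mean of `exp (l l' u)` over two independent labels, and `(f' - f)²` integrates to
  -- `2 (Φ s - Φ t)`.
  set Φ : ℝ → ℝ := fun u => ∑ b, ∑ c, labW ϖ b * labW ϖ c * Real.exp (lab ϖ b * lab ϖ c * u)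
  have hΦ : Φ s - Φ t ≤ 2 * (1 + ϖ) ^ 4 * s * (s - t) := by
    have h1 : Φ s - Φ t ≤ ∑ b, ∑ c, labW ϖ b * labW ϖ c *
        (lab ϖ b * lab ϖ c * (s - t) + 2 * ((1 + ϖ) ^ 2) ^ 2 * s * (s - t)) := by
      simp only [Φ]
      rw [← Finset.sum_sub_distrib]
      refine Finset.sum_le_sum fun b _ => ?_
      rw [← Finset.sum_sub_distrib]
      refine Finset.sum_le_sum fun c _ => ?_
      rw [← mul_sub]
      refine mul_le_mul_of_nonneg_left (exp_sub_exp_le ?_ ht0 hts hcs)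
        (mul_nonneg (labW_nonneg hϖ b) (labW_nonneg hϖ c))
      rw [abs_mul, pow_two]
      exact mul_le_mul (abs_lab_le hϖ b) (abs_lab_le hϖ c) (abs_nonneg _) (by positivity)
    refine h1.trans (le_of_eq ?_)
    have h2 : ∀ b c, labW ϖ b * labW ϖ c *
        (lab ϖ b * lab ϖ c * (s - t) + 2 * ((1 + ϖ) ^ 2) ^ 2 * s * (s - t))
        = (labW ϖ b * lab ϖ b * (s - t)) * (labW ϖ c * lab ϖ c)
          + (labW ϖ b * (2 * ((1 + ϖ) ^ 2) ^ 2 * s * (s - t))) * labW ϖ c := fun b c => by ring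
    simp_rw [h2, Finset.sum_add_distrib, ← Finset.mul_sum, sum_labW hϖ, sum_labW_mul_lab hϖ]
    simp only [mul_zero, Finset.sum_const_zero, zero_add, mul_one, ← Finset.sum_mul, sum_labW hϖ]
    ring
  -- The constant is `12 = 3 · 2 · 2`: the bound for `E`, the two differences of `Φ`, and the
  -- constant in the bound for one difference.
  have hfin : 2 * 1 - 1 + E * (Φ s - 2 * Φ t + Φ s) ≤ 1 + 12 * (1 + ϖ) ^ 4 * s * (s - t) := by
    have hst : 0 ≤ 2 * (1 + ϖ) ^ 4 * s * (s - t) := by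
      have := sub_nonneg.2 hts; positivity
    have hE0 : 0 < E := Real.exp_pos _
    have : E * (Φ s - Φ t) ≤ 3 * (2 * (1 + ϖ) ^ 4 * s * (s - t)) :=
      (mul_le_mul_of_nonneg_left hΦ hE0.le).trans (mul_le_mul_of_nonneg_right hE3 hst)
    nlinarith
  exact hfin.trans (by linarith [Real.add_one_le_exp (12 * (1 + ϖ) ^ 4 * s * (s - t))])

/-- The labels are independent across rows, so the sum over label vectors of products is a product
of sums and chi-square integrals tensorize over rows. -/
lemma sampleLaw_eq_withDensity (hϖ : 0 < ϖ) (μ : Fin p → ℝ) :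
    sampleLaw n ϖ μ = (noiseLaw n p).withDensity fun x => ENNReal.ofReal (sampleDens ϖ μ x) := by
  rw [sampleLaw_eq_sum hϖ]
  refine Measure.ext fun s hs => ?_
  simp only [Measure.coe_finsetSum, Finset.sum_apply, Measure.smul_apply, smul_eq_mul]
  simp_rw [shiftLaw_eq_withDensity, withDensity_apply _ hs]
  simp_rw [← lintegral_const_mul _ (measurable_shiftDensity _).ennreal_ofReal]
  rw [← lintegral_finsetSum _ fun b _ =>
    ((measurable_shiftDensity _).ennreal_ofReal.const_mul _)]
  congr 1
  funext x
  simp_rw [← ENNReal.ofReal_mul (labProd_nonneg hϖ _)]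
  rw [← ENNReal.ofReal_sum_of_nonneg fun b _ =>
    mul_nonneg (labProd_nonneg hϖ b) (shiftDensity_pos _ _).le]
  congr 1
  unfold sampleDens rowDens
  rw [← sum_prod_bool fun i c => labW ϖ c * labelDens (lab ϖ c) μ (x i)]
  refine Finset.sum_congr rfl fun b _ => ?_
  rw [Finset.prod_mul_distrib]
  congr 1
  refine Finset.prod_congr rfl fun i _ => ?_
  rw [labelDens, Real.exp_sum]
  refine Finset.prod_congr rfl fun j _ => ?_
  simp only [meanMat]
  congr 1
  ring

/-- Two signals cannot be told apart when the chi-square distance per observation is small. -/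
lemma two_point_sampleLaw (hϖ : 0 < ϖ) (μ μ' : Fin p → ℝ) {κ : ℝ}
    (hκ : ∫ y, rowDens ϖ μ' y ^ 2 / rowDens ϖ μ y ∂stdNormal p ≤ Real.exp κ)
    (hnκ : n * κ ≤ 1 / 8) {D : ℝ} (hD : 0 < D) {d d' : Sample n p → ℝ≥0∞}
    (hd : Measurable d) (hd' : Measurable d') (hdd : ∀ x, ENNReal.ofReal D ≤ d x + d' x) :
    ENNReal.ofReal (D / 2) ≤ ∫⁻ x, d x ∂sampleLaw n ϖ μ + ∫⁻ x, d' x ∂sampleLaw n ϖ μ' := by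
  rw [sampleLaw_eq_withDensity hϖ, sampleLaw_eq_withDensity hϖ]
  have hm : ∀ μ : Fin p → ℝ, Measurable (sampleDens ϖ μ : Sample n p → ℝ) := fun μ =>
    Finset.measurable_prod _ fun i _ => (measurable_rowDens μ).comp (measurable_pi_apply i)
  have hp : ∀ (μ : Fin p → ℝ) (x : Sample n p), 0 < sampleDens ϖ μ x := fun μ x =>
    Finset.prod_pos fun i _ => rowDens_pos hϖ μ _
  have hi : ∀ μ : Fin p → ℝ, Integrable (sampleDens ϖ μ : Sample n p → ℝ) (noiseLaw n p) := fun μ =>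
    Integrable.fintype_prod (f := fun _ => rowDens ϖ μ) fun i => integrable_rowDens μ
  have h1 : ∀ μ : Fin p → ℝ, ∫ x : Sample n p, sampleDens ϖ μ x ∂noiseLaw n p = 1 := fun μ => by
    unfold sampleDens noiseLaw
    rw [integral_fintype_prod_eq_prod (fun _ : Fin n => rowDens ϖ μ)]
    exact Finset.prod_eq_one fun i _ => integral_rowDens hϖ μ
  have hq : ∀ x : Sample n p, sampleDens ϖ μ' x ^ 2 / sampleDens ϖ μ x
      = ∏ i, (rowDens ϖ μ' (x i) ^ 2 / rowDens ϖ μ (x i)) := fun x => by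
    unfold sampleDens
    rw [Finset.prod_div_distrib, Finset.prod_pow]
  have hq1 : Integrable (fun x : Sample n p => sampleDens ϖ μ' x ^ 2 / sampleDens ϖ μ x)
      (noiseLaw n p) := by
    simp_rw [hq]
    exact Integrable.fintype_prod (f := fun _ y => rowDens ϖ μ' y ^ 2 / rowDens ϖ μ y)
      fun i => integrable_rowDens_sq_div hϖ μ μ'
  -- The choice `t = 1/2` requires a chi-square integral of at most `1 + 1/4`, which `exp (1/8)`
  -- satisfies.
  have h := two_point_bound (noiseLaw n p) (hm μ) (hm μ') (hp μ) (hp μ') (hi μ) (hi μ') (h1 μ)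
    (h1 μ') hq1 (t := 1 / 2) (by norm_num) ?_ hD hd hd' hdd
  · convert h using 2; ring
  simp_rw [hq]
  unfold noiseLaw
  rw [integral_fintype_prod_eq_prod (fun (_ : Fin n) y => rowDens ϖ μ' y ^ 2 / rowDens ϖ μ y),
    Finset.prod_const, Finset.card_univ, Fintype.card_fin]
  calc _ ≤ Real.exp κ ^ n := pow_le_pow_left₀ (integral_nonneg fun y =>
        div_nonneg (sq_nonneg _) (rowDens_pos hϖ μ y).le) hκ n
    _ = Real.exp (n * κ) := (Real.exp_nat_mul _ _).symm
    _ ≤ Real.exp (1 / 8) := Real.exp_le_exp.2 hnκ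
    _ ≤ 1 + (1 / 2) ^ 2 := by
      have := Real.abs_exp_sub_one_le (x := 1 / 8) (by rw [abs_of_pos] <;> norm_num)
      rw [abs_of_pos (by norm_num : (0 : ℝ) < 1 / 8)] at this
      linarith [le_abs_self (Real.exp (1 / 8) - 1)]

end

/-! ### Block signals -/

/-- The coordinates `s, …, s + l - 1`. -/
def blk (p s l : ℕ) : Finset (Fin p) := Finset.univ.filter fun j => s ≤ (j : ℕ) ∧ (j : ℕ) < s + l

lemma mem_blk {p s l : ℕ} {j : Fin p} : j ∈ blk p s l ↔ s ≤ (j : ℕ) ∧ (j : ℕ) < s + l := by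
  simp [blk]

lemma card_blk {p s l : ℕ} (h : s + l ≤ p) : (blk p s l).card = l := by
  have : (blk p s l).map Fin.valEmbedding = Finset.Ico s (s + l) := by
    ext j
    simp only [Finset.mem_map, mem_blk, Fin.valEmbedding_apply, Finset.mem_Ico]
    constructor
    · rintro ⟨i, hi, rfl⟩; exact hi
    · intro hj; exact ⟨⟨j, by omega⟩, hj, rfl⟩
  rw [← Finset.card_map Fin.valEmbedding, this, Nat.card_Ico]; omega

lemma disjoint_blk {p s l s' l' : ℕ} (h : s + l ≤ s') : Disjoint (blk p s l) (blk p s' l') := by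
  rw [Finset.disjoint_left]
  intro j h1 h2
  rw [mem_blk] at h1 h2
  omega

/-- The blocks with lengths `len`, at least `G` apart, fit into `{0, …, p - 1}`. -/
def IsPlacement (p G : ℕ) {m : ℕ} (len s : Fin m → ℕ) : Prop :=
  (∀ g, s g + len g ≤ p) ∧ ∀ g h : Fin m, (h : ℕ) = g + 1 → s g + len g + G ≤ s h

/-- The signal with value `τ g` on the `g`-th block. -/
def blockSignal (p : ℕ) {m : ℕ} (len s : Fin m → ℕ) (τ : Fin m → ℝ) (j : Fin p) : ℝ :=
  ∑ g, if j ∈ blk p (s g) (len g) then τ g else 0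

section Blocks

variable {p G m : ℕ} {len s : Fin m → ℕ} {τ : Fin m → ℝ}

lemma IsPlacement.add_le (h : IsPlacement p G len s) {g k : Fin m} (hgk : g < k) :
    s g + len g + G ≤ s k := by
  obtain ⟨k, hk⟩ := k
  induction k with
  | zero => exact absurd hgk (by simp [Fin.lt_def])
  | succ k ih =>
    have hk' : k < m := by omega
    rcases Nat.lt_or_ge g k with h1 | h1
    · have h2 := ih hk' (by simpa [Fin.lt_def] using h1)
      have h3 := h.2 ⟨k, hk'⟩ ⟨k + 1, hk⟩ rfl
      omega
    · have : (g : ℕ) = k := by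
        have : (g : ℕ) < k + 1 := hgk
        omega
      exact h.2 g ⟨k + 1, hk⟩ (by simp [this])

lemma IsPlacement.disjoint (h : IsPlacement p G len s) {g k : Fin m} (hgk : g ≠ k) :
    Disjoint (blk p (s g) (len g)) (blk p (s k) (len k)) := by
  rcases lt_or_gt_of_ne hgk with h1 | h1
  · exact disjoint_blk (by have := h.add_le h1; omega)
  · exact (disjoint_blk (by have := h.add_le h1; omega)).symm

lemma IsPlacement.apply_of_mem (h : IsPlacement p G len s) {g : Fin m} {j : Fin p}
    (hj : j ∈ blk p (s g) (len g)) : blockSignal p len s τ j = τ g := by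
  unfold blockSignal
  rw [Finset.sum_eq_single g, if_pos hj]
  · intro k _ hk
    rw [if_neg]
    exact fun hjk => Finset.disjoint_left.1 (h.disjoint hk) hjk hj
  · simp

lemma blockSignal_of_notMem {j : Fin p} (hj : ∀ g, j ∉ blk p (s g) (len g)) :
    blockSignal p len s τ j = 0 :=
  Finset.sum_eq_zero fun g _ => if_neg (hj g)

lemma sum_blockSignal_mul (F : Fin p → ℝ) :
    ∑ j, blockSignal p len s τ j * F j = ∑ g, τ g * ∑ j ∈ blk p (s g) (len g), F j := by
  unfold blockSignal
  simp_rw [Finset.sum_mul]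
  rw [Finset.sum_comm]
  refine Finset.sum_congr rfl fun g _ => ?_
  rw [Finset.mul_sum, ← Finset.sum_filter_add_sum_filter_not Finset.univ
    (fun j => j ∈ blk p (s g) (len g))]
  simp only [Finset.filter_mem_eq_inter, Finset.univ_inter]
  rw [Finset.sum_eq_zero (s := Finset.univ.filter fun j => ¬ j ∈ blk p (s g) (len g)), add_zero]
  · exact Finset.sum_congr rfl fun j hj => by rw [if_pos hj]
  · intro j hj
    rw [if_neg (Finset.mem_filter.1 hj).2, zero_mul]

lemma IsPlacement.sum_sq (h : IsPlacement p G len s) :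
    ∑ j, blockSignal p len s τ j ^ 2 = ∑ g, τ g ^ 2 * len g := by
  simp_rw [pow_two (blockSignal p len s τ _)]
  rw [sum_blockSignal_mul]
  refine Finset.sum_congr rfl fun g _ => ?_
  rw [Finset.sum_congr rfl fun j hj => h.apply_of_mem hj, Finset.sum_const, card_blk (h.1 g),
    nsmul_eq_mul]
  ring

/-- The union of the blocks. -/
def blkUnion (p : ℕ) {m : ℕ} (len s : Fin m → ℕ) : Finset (Fin p) :=
  Finset.univ.biUnion fun g => blk p (s g) (len g)

lemma IsPlacement.card_blkUnion (h : IsPlacement p G len s) :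
    (blkUnion p len s).card = ∑ g, len g := by
  unfold blkUnion
  rw [Finset.card_biUnion fun g _ k _ hgk => h.disjoint hgk]
  exact Finset.sum_congr rfl fun g _ => card_blk (h.1 g)

lemma IsPlacement.support_blockSignal (h : IsPlacement p G len s) (hτ : ∀ g, τ g ≠ 0) :
    Function.support (blockSignal p len s τ) = blkUnion p len s := by
  ext j
  simp only [Function.mem_support, blkUnion, Finset.coe_biUnion, Finset.coe_univ, Set.mem_univ,
    Set.iUnion_true, Set.mem_iUnion, Finset.mem_coe]
  constructor
  · intro hj
    by_contra! hn
    exact hj (blockSignal_of_notMem hn)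
  · rintro ⟨g, hg⟩
    rw [h.apply_of_mem hg]; exact hτ g

end Blocks

/-- The required gap between consecutive blocks. -/
def gapLen (ρ : ℕ → ℝ) (α : ℝ) (p : ℕ) : ℕ := ⌊ρ 0 * Real.log p * (p : ℝ) ^ α⌋₊

/-- The last point of a block is its start plus its length minus one, so the strict real inequality
for the distance becomes a weak one between natural numbers with the floor of the gap. -/
lemma mem_blockClass_iff {ρ : ℕ → ℝ} {α β r : ℝ} {p : ℕ} (hp : 1 ≤ p) (hρ : 0 ≤ ρ 0)
    (μ : Fin p → ℝ) : μ ∈ blockClass ρ α β r p ↔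
      ∃ (s : Fin (numBlocks α β p) → ℕ) (τ : Fin (numBlocks α β p) → ℝ),
        IsPlacement p (gapLen ρ α p) (fun g => blockLen ρ α p (g + 1)) s ∧
        (∀ g, |τ g| = (p : ℝ) ^ (-r)) ∧
        μ = blockSignal p (fun g => blockLen ρ α p (g + 1)) s τ := by
  have hγ : 0 ≤ ρ 0 * Real.log p * (p : ℝ) ^ α :=
    mul_nonneg (mul_nonneg hρ (Real.log_natCast_nonneg p)) (Real.rpow_nonneg (Nat.cast_nonneg p) α)
  have hgap : ∀ a b c : ℕ, ρ 0 * Real.log p * (p : ℝ) ^ α < (a : ℝ) - ((b : ℝ) + (c : ℝ) - 1) ↔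
      b + c + gapLen ρ α p ≤ a := by
    intro a b c
    unfold gapLen
    set γ := ρ 0 * Real.log p * (p : ℝ) ^ α
    rw [show (a : ℝ) - ((b : ℝ) + (c : ℝ) - 1) = a + 1 - (b + c) by ring, lt_sub_iff_add_lt]
    constructor
    · intro h
      have h1 := Nat.floor_le hγ
      have h2 : ((⌊γ⌋₊ + (b + c) : ℕ) : ℝ) < ((a + 1 : ℕ) : ℝ) := by push_cast; linarith
      have := Nat.cast_lt.1 h2
      omega
    · intro h
      have h1 := Nat.lt_floor_add_one γ
      have h2 : ((b + c + ⌊γ⌋₊ : ℕ) : ℝ) ≤ (a : ℝ) := Nat.cast_le.2 h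
      push_cast at h2
      linarith
  constructor
  · rintro ⟨s, τ, h1, h2, h3, h4, h5⟩
    have hs : IsPlacement p (gapLen ρ α p) (fun g : Fin (numBlocks α β p) =>
        blockLen ρ α p (g + 1)) s := ⟨h1, fun g h hgh => (hgap _ _ _).1 (h3 g h hgh)⟩
    refine ⟨s, τ, hs, h2, ?_⟩
    funext j
    by_cases hj : ∃ g, j ∈ blk p (s g) (blockLen ρ α p (g + 1))
    · obtain ⟨g, hg⟩ := hj
      rw [hs.apply_of_mem hg]
      rw [mem_blk] at hg
      exact h4 g j hg.1 hg.2
    · push Not at hj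
      rw [blockSignal_of_notMem hj]
      exact h5 j fun g hg => hj g (mem_blk.2 hg)
  · rintro ⟨s, τ, hs, h2, rfl⟩
    refine ⟨s, τ, hs.1, h2, fun g h hgh => (hgap _ _ _).2 (hs.2 g h hgh), fun g j ha hb => ?_,
      fun j hj => ?_⟩
    · exact hs.apply_of_mem (mem_blk.2 ⟨ha, hb⟩)
    · exact blockSignal_of_notMem fun g hg => hj g (mem_blk.1 hg)

/-! ### The lower bound over a hypercube of block signals -/

section Assouad

variable {p G m : ℕ}

/-- The starting points of the blocks for the vertex `b` of the hypercube. -/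
def cubeStart (cell : ℕ) (len : Fin m → ℕ) (b : Fin m → Bool) (g : Fin m) : ℕ :=
  g * cell + if b g then len g else 0

/-- The block signal for the vertex `b` of the hypercube. -/
def cubeSignal (p : ℕ) (A : ℝ) (cell : ℕ) (len : Fin m → ℕ) (b : Fin m → Bool) : Fin p → ℝ :=
  blockSignal p len (cubeStart cell len b) fun _ => A

variable {cell : ℕ} {len : Fin m → ℕ}

lemma isPlacement_cubeStart (hcell : ∀ g, 2 * len g + G ≤ cell) (hp : m * cell ≤ p)
    (b : Fin m → Bool) : IsPlacement p G len (cubeStart cell len b) := by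
  have h1 : ∀ g : Fin m, cubeStart cell len b g + len g + G ≤ (g + 1) * cell := fun g => by
    have := hcell g
    unfold cubeStart
    split_ifs <;> nlinarith
  refine ⟨fun g => ?_, fun g h hgh => ?_⟩
  · have h2 : ((g : ℕ) + 1) * cell ≤ m * cell := Nat.mul_le_mul_right _ (by omega)
    have := h1 g
    omega
  · refine (h1 g).trans ?_
    rw [← hgh]
    unfold cubeStart
    omega

/-- Both positions of a block stay inside its own cell, so a point in the window of the `g`-th cell
can only be covered by the `g`-th block. -/
lemma mem_blk_cubeStart (hcell : ∀ g, 2 * len g + G ≤ cell) {b : Fin m → Bool} {g h : Fin m}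
    {j : Fin p} (hj : j ∈ blk p (g * cell) (2 * len g))
    (hj' : j ∈ blk p (cubeStart cell len b h) (len h)) : h = g := by
  rw [mem_blk] at hj hj'
  have h1 := hcell g
  have h2 := hcell h
  have h3 : (h : ℕ) * cell ≤ j := by
    refine le_trans ?_ hj'.1; unfold cubeStart; omega
  have h4 : (j : ℕ) < (h + 1) * cell := by
    refine lt_of_lt_of_le hj'.2 ?_
    unfold cubeStart
    split_ifs <;> nlinarith
  have h5 : (j : ℕ) < (g + 1) * cell := by nlinarith [hj.2]
  have h6 : (h : ℕ) < g + 1 := Nat.lt_of_mul_lt_mul_right (h3.trans_lt h5)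
  have h7 : (g : ℕ) < h + 1 := Nat.lt_of_mul_lt_mul_right (hj.1.trans_lt h4)
  exact Fin.ext (by omega)

open Classical in
/-- The number of errors near the `g`-th block when it is in position `c`. -/
def localLoss (cell : ℕ) (len : Fin m → ℕ) (g : Fin m) (c : Bool) (A : Set (Fin p)) : ℕ :=
  ((blk p (g * cell) (2 * len g)).filter fun j =>
    j ∈ A ↔ j ∉ blk p (g * cell + if c then len g else 0) (len g)).card

/-- The two positions partition the window, so each point of the window is an error for exactly one
of them, whatever the estimate is. This is the separation needed in the two-point bound. -/
lemma localLoss_add (hcell : ∀ g, 2 * len g + G ≤ cell) (hp : m * cell ≤ p) (g : Fin m)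
    (A : Set (Fin p)) :
    localLoss cell len g false A + localLoss cell len g true A = 2 * len g := by
  classical
  have hc : (blk p (g * cell) (2 * len g)).card = 2 * len g := by
    refine card_blk ?_
    have h2 : ((g : ℕ) + 1) * cell ≤ m * cell := Nat.mul_le_mul_right _ (by omega)
    have := hcell g
    nlinarith
  unfold localLoss
  conv_rhs => rw [← hc]
  rw [← Finset.card_filter_add_card_filter_not (s := blk p (g * cell) (2 * len g))
    (fun j => j ∈ A ↔ j ∉ blk p (g * cell + if false then len g else 0) (len g))]
  congr 2
  refine Finset.filter_congr fun j hj => ?_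
  rw [mem_blk] at hj
  have : j ∈ blk p (g * cell + if true then len g else 0) (len g) ↔
      j ∉ blk p (g * cell + if false then len g else 0) (len g) := by
    simp only [mem_blk, if_true, Bool.false_eq_true, if_false]
    omega
  rw [this]
  tauto

/-- The windows are disjoint and inside each of them the support is the block itself; errors outside
the windows are ignored. -/
lemma sum_localLoss_le (hcell : ∀ g, 2 * len g + G ≤ cell) (hp : m * cell ≤ p) {A₀ : ℝ}
    (hA : A₀ ≠ 0) (b : Fin m → Bool) (A : Set (Fin p)) :
    ∑ g, localLoss cell len g (b g) A
      ≤ (A ∆ Function.support (cubeSignal p A₀ cell len b)).ncard := by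
  classical
  have hs : Function.support (cubeSignal p A₀ cell len b) = blkUnion p len (cubeStart cell len b) :=
    (isPlacement_cubeStart hcell hp b).support_blockSignal fun _ => hA
  have h1 : ∀ g, localLoss cell len g (b g) A = ((blk p (g * cell) (2 * len g)).filter fun j =>
      j ∈ A ∆ Function.support (cubeSignal p A₀ cell len b)).card := by
    intro g
    unfold localLoss
    congr 1
    refine Finset.filter_congr fun j hj => ?_
    rw [hs, Set.mem_symmDiff]
    have : j ∈ (blkUnion p len (cubeStart cell len b) : Set (Fin p)) ↔
        j ∈ blk p (g * cell + if b g then len g else 0) (len g) := by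
      simp only [blkUnion, Finset.coe_biUnion, Set.mem_iUnion, Finset.coe_univ, Set.mem_univ,
        Finset.mem_coe, exists_prop, true_and]
      constructor
      · rintro ⟨h, hh⟩
        obtain rfl := mem_blk_cubeStart hcell hj hh
        exact hh
      · exact fun h => ⟨g, h⟩
    rw [this]
    tauto
  simp_rw [h1]
  rw [← Finset.card_biUnion]
  · rw [← Set.ncard_coe_finset]
    refine Set.ncard_le_ncard (fun j hj => ?_) (Set.toFinite _)
    simp only [Finset.coe_biUnion, Set.mem_iUnion, Finset.mem_coe, Finset.mem_filter] at hj
    obtain ⟨g, -, -, h⟩ := hj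
    exact h
  · intro g _ h _ hgh
    refine Finset.disjoint_filter_filter ?_
    rcases lt_or_gt_of_ne hgh with h1 | h1
    · refine disjoint_blk ?_
      have h2 : ((g : ℕ) + 1) * cell ≤ h * cell := Nat.mul_le_mul_right _ h1
      have := hcell g
      nlinarith
    · refine (disjoint_blk ?_).symm
      have h2 : ((h : ℕ) + 1) * cell ≤ g * cell := Nat.mul_le_mul_right _ h1
      have := hcell h
      nlinarith

/-- Flipping the `g`-th coordinate is an involution of the cube, so its vertices can be grouped into
pairs of neighbours. -/
lemma two_mul_sum_eq_sum_update {R : Type*} [CommSemiring R] (g : Fin m)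
    (f : (Fin m → Bool) → R) :
    2 * ∑ b, f b
      = ∑ b, (f (Function.update b g false) + f (Function.update b g true)) := by
  have e1 : ∑ b, f b = ∑ b, f (Function.update b g (!(b g))) := by
    refine (Equiv.sum_comp (Function.Involutive.toPerm
      (fun b : Fin m → Bool => Function.update b g (!(b g))) fun b => ?_) f).symm
    simp
  rw [two_mul]
  conv_lhs => rw [e1]
  conv_lhs => enter [1]; rw [← e1]
  rw [← Finset.sum_add_distrib]
  refine Finset.sum_congr rfl fun b _ => ?_
  cases h : b g
  · conv_lhs => rw [← Function.update_eq_self g b, h]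
    simp
  · conv_lhs => rw [← Function.update_eq_self g b, h]
    simp [add_comm]

/-- If no single block can be located, then a fraction of one half of the signal is missed. -/
lemma half_le_of_hammSig_le {ϖ : ℝ} (hϖ : 0 < ϖ) {n : ℕ} (hm : 1 ≤ m) (hlen : ∀ g, 1 ≤ len g)
    (hcell : ∀ g, 2 * len g + G ≤ cell) (hp : m * cell ≤ p) {A₀ : ℝ} (hA : A₀ ≠ 0) {κ : ℝ}
    (hnκ : n * κ ≤ 1 / 8)
    (hκ : ∀ (b : Fin m → Bool) (g : Fin m),
      ∫ y, rowDens ϖ (cubeSignal p A₀ cell len (Function.update b g true)) y ^ 2 /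
        rowDens ϖ (cubeSignal p A₀ cell len (Function.update b g false)) y ∂stdNormal p
        ≤ Real.exp κ)
    (S : Kernel (Sample n p) (Set (Fin p))) [IsMarkovKernel S] {w : ℝ≥0∞}
    (hw : ∀ b, hammSig S ϖ (cubeSignal p A₀ cell len b) ≤ w) : 1 / 2 ≤ w := by
  set R : (Fin m → Bool) → ℝ≥0∞ := fun b =>
    ∫⁻ x, ∫⁻ A, ((A ∆ Function.support (cubeSignal p A₀ cell len b)).ncard : ℝ≥0∞) ∂(S x)
      ∂(sampleLaw n ϖ (cubeSignal p A₀ cell len b)) with hR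
  set f : Fin m → (Fin m → Bool) → ℝ≥0∞ := fun g b =>
    ∫⁻ x, ∫⁻ A, (localLoss cell len g (b g) A : ℝ≥0∞) ∂(S x)
      ∂(sampleLaw n ϖ (cubeSignal p A₀ cell len b)) with hf
  have hmeas : ∀ g c, Measurable fun x => ∫⁻ A, (localLoss cell len g c A : ℝ≥0∞) ∂(S x) :=
    fun g c => Measurable.lintegral_kernel (Measurable.of_discrete)
  have hfR : ∀ b, ∑ g, f g b ≤ R b := fun b => by
    simp only [hf, hR]
    rw [← lintegral_finsetSum _ fun g _ => hmeas g (b g)]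
    refine lintegral_mono fun x => ?_
    rw [← lintegral_finsetSum _ fun g _ => Measurable.of_discrete]
    refine lintegral_mono fun A => ?_
    have := sum_localLoss_le hcell hp hA b A
    rw [← Nat.cast_sum]
    exact Nat.cast_le.2 this
  have hfg : ∀ g b, (len g : ℝ≥0∞)
      ≤ f g (Function.update b g false) + f g (Function.update b g true) := by
    intro g b
    -- The two local losses add up to `2 * len g`; half of this survives the two-point bound.
    have h := two_point_sampleLaw hϖ (cubeSignal p A₀ cell len (Function.update b g false))
      (cubeSignal p A₀ cell len (Function.update b g true)) (hκ b g) hnκ (D := 2 * len g)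
      (by have : (1 : ℝ) ≤ len g := by exact_mod_cast hlen g
          linarith)
      (hmeas g false) (hmeas g true) (fun x => ?_)
    · simp only [hf, Function.update_self]
      refine le_trans (le_of_eq ?_) h
      rw [mul_div_cancel_left₀ _ (two_ne_zero), ENNReal.ofReal_natCast]
    · rw [← lintegral_add_left Measurable.of_discrete]
      simp_rw [← Nat.cast_add, localLoss_add hcell hp]
      rw [lintegral_const, measure_univ, mul_one, ← ENNReal.ofReal_natCast]
      push_cast
      exact le_rfl
  set T : ℝ≥0∞ := ((∑ g, len g : ℕ) : ℝ≥0∞) with hT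
  have hT0 : T ≠ 0 := by
    rw [hT, Nat.cast_ne_zero]
    refine (Finset.sum_pos (fun g _ => hlen g) ?_).ne'
    exact ⟨⟨0, hm⟩, Finset.mem_univ _⟩
  have hRw : ∀ b, R b ≤ w * T := fun b => by
    have h := hw b
    unfold hammSig at h
    have hpl := isPlacement_cubeStart hcell hp b
    have hc : (Function.support (cubeSignal p A₀ cell len b)).ncard = ∑ g, len g := by
      rw [cubeSignal, hpl.support_blockSignal fun _ => hA, Set.ncard_coe_finset,
        hpl.card_blkUnion]
    rw [hc] at h
    exact (ENNReal.div_le_iff_le_mul (Or.inl hT0) (Or.inl (ENNReal.natCast_ne_top _))).1 h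
  -- For each block the loss is averaged over pairs of neighbours in its own direction; then the
  -- sums over blocks and vertices are exchanged.
  have h1 : ∑ _b : Fin m → Bool, T ≤ 2 * ∑ b, R b := by
    calc ∑ _b : Fin m → Bool, T = ∑ g, ∑ _b : Fin m → Bool, (len g : ℝ≥0∞) := by
          rw [Finset.sum_comm]; simp [hT]
      _ ≤ ∑ g, ∑ b, (f g (Function.update b g false) + f g (Function.update b g true)) :=
          Finset.sum_le_sum fun g _ => Finset.sum_le_sum fun b _ => hfg g b
      _ = ∑ g, 2 * ∑ b, f g b := 
          Finset.sum_congr rfl fun g _ => (two_mul_sum_eq_sum_update g (f g)).symm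
      _ = 2 * ∑ b, ∑ g, f g b := by rw [← Finset.mul_sum, Finset.sum_comm]
      _ ≤ 2 * ∑ b, R b := by gcongr with b; exact hfR b
  have h2 : ∑ _b : Fin m → Bool, T ≤ (2 * w) * ∑ _b : Fin m → Bool, T := by
    refine h1.trans ?_
    rw [mul_assoc, Finset.mul_sum (a := w)]
    gcongr with b
    exact hRw b
  have h3 : ∑ _b : Fin m → Bool, T ≠ 0 := by simp [hT0]
  have h4 : ∑ _b : Fin m → Bool, T ≠ ∞ := by
    simp [ENNReal.mul_eq_top, hT]
  have h5 : 1 ≤ 2 * w := by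
    by_contra! hlt
    have := ENNReal.mul_lt_mul_left h3 h4 hlt
    rw [one_mul] at this
    exact absurd h2 (not_le.2 this)
  rw [ENNReal.div_le_iff_le_mul (by simp) (by simp), mul_comm]
  exact h5

/-- The geometry of two neighbouring vertices of the hypercube. -/
lemma inner_cubeSignal (hcell : ∀ g, 2 * len g + G ≤ cell) (hp : m * cell ≤ p) {A₀ : ℝ}
    (b : Fin m → Bool) (g : Fin m) :
    ∑ j, cubeSignal p A₀ cell len (Function.update b g false) j *
        cubeSignal p A₀ cell len (Function.update b g true) j
      = A₀ ^ 2 * ∑ h, (len h : ℝ) - A₀ ^ 2 * len g := by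
  have hpl := isPlacement_cubeStart hcell hp
  have h1 : ∀ h, A₀ * ∑ j ∈ blk p (cubeStart cell len (Function.update b g false) h) (len h),
      cubeSignal p A₀ cell len (Function.update b g true) j
      = if h = g then 0 else A₀ ^ 2 * len h := by
    intro h
    split_ifs with hh
    · subst hh
      rw [Finset.sum_eq_zero, mul_zero]
      intro j hj
      refine blockSignal_of_notMem fun k hk => ?_
      have hjU : j ∈ blk p (h * cell) (2 * len h) := by
        rw [mem_blk] at hj ⊢
        simp only [cubeStart, Function.update_self, Bool.false_eq_true, if_false] at hj
        omega
      obtain rfl := mem_blk_cubeStart hcell hjU hk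
      rw [mem_blk] at hj hk
      simp only [cubeStart, Function.update_self, Bool.false_eq_true, if_false, if_true] at hj hk
      omega
    · have h2 : cubeStart cell len (Function.update b g false) h
          = cubeStart cell len (Function.update b g true) h := by
        simp [cubeStart, Function.update_of_ne hh]
      rw [h2, cubeSignal, Finset.sum_congr rfl fun j hj => (hpl _).apply_of_mem hj, Finset.sum_const,
        card_blk ((hpl _).1 h), nsmul_eq_mul]
      ring
  conv_lhs => enter [2, j]; rw [cubeSignal]
  rw [sum_blockSignal_mul]
  simp_rw [h1]
  rw [Finset.sum_ite, Finset.sum_const_zero, zero_add, Finset.mul_sum,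
    ← Finset.sum_filter_add_sum_filter_not Finset.univ (fun h => h = g)
      (fun h => A₀ ^ 2 * (len h : ℝ))]
  simp [Finset.filter_eq']

lemma sum_sq_cubeSignal (hcell : ∀ g, 2 * len g + G ≤ cell) (hp : m * cell ≤ p) {A₀ : ℝ}
    (b : Fin m → Bool) : ∑ j, cubeSignal p A₀ cell len b j ^ 2 = A₀ ^ 2 * ∑ h, (len h : ℝ) := by
  rw [cubeSignal, (isPlacement_cubeStart hcell hp b).sum_sq, Finset.mul_sum]

/-- Neighbours have the same norm and differ only in one block, so `‖μ' - μ‖² = 2 A₀² len g` and `s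
- t = A₀² len g`. The two alternatives correspond to the two chi-square bounds, with and without
knowledge of the labels. -/
lemma rowDens_cubeSignal_le {ϖ : ℝ} (hϖ : 0 < ϖ) (hcell : ∀ g, 2 * len g + G ≤ cell)
    (hp : m * cell ≤ p) {A₀ κ : ℝ} (b : Fin m → Bool) (g : Fin m)
    (hκ : 2 * (1 + ϖ) ^ 2 * (A₀ ^ 2 * len g) ≤ κ ∨
      ((1 + ϖ) ^ 2 * (A₀ ^ 2 * ∑ h, (len h : ℝ)) ≤ 1 ∧
        12 * (1 + ϖ) ^ 4 * (A₀ ^ 2 * ∑ h, (len h : ℝ)) * (A₀ ^ 2 * len g) ≤ κ)) :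
    ∫ y, rowDens ϖ (cubeSignal p A₀ cell len (Function.update b g true)) y ^ 2 /
        rowDens ϖ (cubeSignal p A₀ cell len (Function.update b g false)) y ∂stdNormal p
        ≤ Real.exp κ := by
  have e1 := sum_sq_cubeSignal hcell hp (A₀ := A₀) (Function.update b g true)
  have e2 := sum_sq_cubeSignal hcell hp (A₀ := A₀) (Function.update b g false)
  have e3 := inner_cubeSignal hcell hp (A₀ := A₀) b g
  set μ := cubeSignal p A₀ cell len (Function.update b g false)
  set μ' := cubeSignal p A₀ cell len (Function.update b g true)
  rcases hκ with h | ⟨h1, h2⟩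
  · refine (integral_rowDens_sq_div_le hϖ μ μ').trans (Real.exp_le_exp.2 (le_trans (le_of_eq ?_) h))
    have : ∑ j, (μ' j - μ j) ^ 2 = ∑ j, μ' j ^ 2 + ∑ j, μ j ^ 2 - 2 * ∑ j, μ j * μ' j := by
      rw [Finset.mul_sum, ← Finset.sum_add_distrib, ← Finset.sum_sub_distrib]
      exact Finset.sum_congr rfl fun j _ => by ring
    rw [this, e1, e2, e3]
    ring
  · have hle : (len g : ℝ) ≤ ∑ h, (len h : ℝ) :=
      Finset.single_le_sum (f := fun h => (len h : ℝ)) (fun h _ => Nat.cast_nonneg _)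
        (Finset.mem_univ g)
    refine (integral_rowDens_sq_div_le' hϖ μ μ' e2 e1 e3 ?_ ?_ h1).trans
      (Real.exp_le_exp.2 (le_trans (le_of_eq (by ring)) h2))
    · nlinarith [sq_nonneg A₀]
    · have : 0 ≤ A₀ ^ 2 * (len g : ℝ) := by positivity
      linarith

end Assouad

/-! ### Orders of magnitude -/

open Asymptotics in
lemma eventually_log_pow_le (C : ℝ) (k : ℕ) {x : ℝ} (hx : 0 < x) :
    ∀ᶠ p : ℕ in atTop, C * (1 + Real.log p) ^ k ≤ (p : ℝ) ^ x := by
  have hconst : ∀ {x : ℝ}, 0 < x → ∀ c : ℝ, (fun _ : ℝ => c) =o[(atTop : Filter ℝ)] fun y : ℝ => y ^ x :=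
    fun hx c => Asymptotics.isLittleO_const_left.2 (Or.inr (tendsto_norm_atTop_atTop.comp
      (tendsto_rpow_atTop hx)))
  have h1 : (fun y : ℝ => (1 + Real.log y) ^ k) =o[(atTop : Filter ℝ)] fun y : ℝ => y ^ x := by
    rcases Nat.eq_zero_or_pos k with rfl | hk
    · simpa using hconst hx 1
    have hkpos : (0 : ℝ) < k := Nat.cast_pos.2 hk
    have h2 : (fun y : ℝ => 1 + Real.log y) =o[(atTop : Filter ℝ)] fun y : ℝ => y ^ (x / k) :=
      (hconst (div_pos hx hkpos) 1).add (isLittleO_log_rpow_atTop (div_pos hx hkpos))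
    refine (h2.pow hk).congr' (EventuallyEq.refl _ _) ?_
    filter_upwards [eventually_ge_atTop 0] with y hy
    rw [← Real.rpow_natCast, ← Real.rpow_mul hy, div_mul_cancel₀ _ hkpos.ne']
  have h3 := ((h1.const_mul_left C).comp_tendsto tendsto_natCast_atTop_atTop).bound one_pos
  filter_upwards [h3] with p hp
  simp only [Function.comp, Real.norm_eq_abs, one_mul] at hp
  rw [abs_of_nonneg (Real.rpow_nonneg (Nat.cast_nonneg p) x)] at hp
  exact (le_abs_self _).trans hp

lemma eventually_mul_rpow_neg_le (C : ℝ) {ε : ℝ} (hε : 0 < ε) {x : ℝ} (hx : x < 0) :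
    ∀ᶠ p : ℕ in atTop, C * (p : ℝ) ^ x ≤ ε := by
  filter_upwards [eventually_log_pow_le (C / ε) 0 (neg_pos.2 hx), eventually_ge_atTop 1] with p h hp
  have hp' : (0 : ℝ) < p := by exact_mod_cast hp
  rw [pow_zero, mul_one, Real.rpow_neg hp'.le, div_le_iff₀ hε, inv_mul_eq_div,
    le_div_iff₀ (Real.rpow_pos_of_pos hp' x)] at h
  exact h

lemma half_le_floor {x : ℝ} (hx : 1 ≤ x) : x / 2 ≤ (⌊x⌋₊ : ℝ) := by
  have h1 := Nat.lt_floor_add_one x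
  have h2 : (1 : ℝ) ≤ ⌊x⌋₊ := by exact_mod_cast Nat.le_floor (by simpa using hx)
  linarith

/-- The sizes of the blocks and of their number, for large `p`. -/
structure BlockSizes (ρ : ℕ → ℝ) (α β a b : ℝ) (p : ℕ) : Prop where
  one_le : 1 ≤ p
  one_le_len : ∀ g, 1 ≤ blockLen ρ α p g
  le_len : ∀ g, a / 2 * (p : ℝ) ^ α ≤ blockLen ρ α p g
  len_le : ∀ g, (blockLen ρ α p g : ℝ) ≤ b * (p : ℝ) ^ α
  one_le_num : 1 ≤ numBlocks α β p
  le_num : (p : ℝ) ^ (1 - α - β) / 2 ≤ numBlocks α β p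
  num_le : (numBlocks α β p : ℝ) ≤ (p : ℝ) ^ (1 - α - β)
  len_le_gap : ∀ g, blockLen ρ α p g ≤ gapLen ρ α p
  room : ∀ g, 8 * (blockLen ρ α p g + gapLen ρ α p) ≤ p / numBlocks α β p

lemma eventually_blockSizes {ρ : ℕ → ℝ} {α β a b : ℝ} (hα : 0 < α) (hβ : 0 < β) (hβ' : β < 1 - α)
    (ha : 0 < a) (hρ : ∀ g, a ≤ ρ g ∧ ρ g ≤ b) : ∀ᶠ p in atTop, BlockSizes ρ α β a b p := by
  have hb : 0 < b := ha.trans_le ((hρ 0).1.trans (hρ 0).2)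
  filter_upwards [eventually_ge_atTop 1, eventually_log_pow_le (1 / a) 0 hα,
    eventually_log_pow_le 1 0 (x := 1 - α - β) (by linarith), eventually_log_pow_le (8 * b) 1 hβ,
    (Real.tendsto_log_atTop.comp tendsto_natCast_atTop_atTop).eventually_ge_atTop (b / a)]
    with p hp1 h1 h2 h3 h4
  have hp : (0 : ℝ) < p := by exact_mod_cast hp1
  have hpα : 0 < (p : ℝ) ^ α := Real.rpow_pos_of_pos hp α
  rw [pow_zero, mul_one] at h1 h2
  rw [pow_one] at h3
  have h1' : 1 ≤ a * (p : ℝ) ^ α := by rwa [div_le_iff₀' ha] at h1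
  have hx : ∀ g, a * (p : ℝ) ^ α ≤ ρ g * (p : ℝ) ^ α := fun g =>
    mul_le_mul_of_nonneg_right (hρ g).1 hpα.le
  have hx' : ∀ g, ρ g * (p : ℝ) ^ α ≤ b * (p : ℝ) ^ α := fun g =>
    mul_le_mul_of_nonneg_right (hρ g).2 hpα.le
  have hlog : 0 ≤ Real.log p := Real.log_natCast_nonneg p
  have hlen : ∀ g, (blockLen ρ α p g : ℝ) ≤ b * (p : ℝ) ^ α := fun g =>
    (Nat.floor_le (by linarith [hx g])).trans (hx' g)
  have hnum : (numBlocks α β p : ℝ) ≤ (p : ℝ) ^ (1 - α - β) := Nat.floor_le (by positivity)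
  have hnum1 : 1 ≤ numBlocks α β p := Nat.le_floor (by simpa using h2)
  have hgap : (gapLen ρ α p : ℝ) ≤ b * Real.log p * (p : ℝ) ^ α := by
    refine (Nat.floor_le ?_).trans ?_
    · exact mul_nonneg (mul_nonneg (ha.le.trans (hρ 0).1) hlog) hpα.le
    · have := (hρ 0).2; gcongr
  refine ⟨hp1, fun g => Nat.le_floor (by simpa using h1'.trans (hx g)), fun g => ?_, hlen, hnum1,
    half_le_floor h2, hnum, fun g => ?_, fun g => ?_⟩
  · have := half_le_floor (h1'.trans (hx g))
    unfold blockLen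
    linarith [hx g]
  · refine Nat.floor_le_floor ((hx' g).trans ?_)
    refine mul_le_mul_of_nonneg_right ?_ hpα.le
    simp only [Function.comp] at h4
    rw [div_le_iff₀ ha] at h4
    nlinarith [(hρ 0).1]
  · rw [Nat.le_div_iff_mul_le hnum1]
    -- The blocks with their gaps occupy at most `p^(1-β) (1 + log p)` points up to a constant, and
    -- the factor `p^β` absorbs the logarithm.
    have h5 : ((8 * (blockLen ρ α p g + gapLen ρ α p) * numBlocks α β p : ℕ) : ℝ) ≤ (p : ℝ) := by
      push_cast
      calc 8 * ((blockLen ρ α p g : ℝ) + gapLen ρ α p) * numBlocks α β p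
          ≤ 8 * (b * (p : ℝ) ^ α + b * Real.log p * (p : ℝ) ^ α) * (p : ℝ) ^ (1 - α - β) := by
            gcongr
            exact hlen g
        _ = (8 * b * (1 + Real.log p)) * ((p : ℝ) ^ α * (p : ℝ) ^ (1 - α - β)) := by ring
        _ ≤ (p : ℝ) ^ β * ((p : ℝ) ^ α * (p : ℝ) ^ (1 - α - β)) := by gcongr
        _ = p := by
            rw [← Real.rpow_add hp, ← Real.rpow_add hp]
            ring_nf
            rw [Real.rpow_one]
    exact_mod_cast h5

/-- The two expressions cross at `β = 1 - θ - α`, so the boundary is where the better of the two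
chi-square bounds becomes effective. -/
lemma etaSig_eq_min (θ α β : ℝ) : etaSig θ α β = min ((θ + α) / 2) ((1 + θ + α - β) / 4) := by
  unfold etaSig c₁
  split_ifs with h
  · rw [min_eq_left]; linarith
  · rw [min_eq_right]; linarith

/-- Above the statistical boundary, the worst-case risk is eventually at least one half. -/
theorem eventually_half_le_worstHammSig {θ α β r ϖ a b : ℝ} (hα : 0 < α) (hβ : 0 < β)
    (hβ' : β < 1 - α) (hϖ : 0 < ϖ) {ρ : ℕ → ℝ} (ha : 0 < a) (hρ : ∀ g, a ≤ ρ g ∧ ρ g ≤ b)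
    (hr : etaSig θ α β < r) :
    ∀ᶠ p in atTop, ∀ S : Kernel (Sample (sampleSize θ p) p) (Set (Fin p)), IsMarkovKernel S →
      1 / 2 ≤ worstHammSig S ϖ ρ α β r := by
  have hb : 0 < b := ha.trans_le ((hρ 0).1.trans (hρ 0).2)
  set c := (1 + ϖ) ^ 2 with hc
  have hc0 : 0 < c := by positivity
  have key : ∀ᶠ p : ℕ in atTop, 1 ≤ p → ∃ κ : ℝ, (p : ℝ) ^ θ * κ ≤ 1 / 8 ∧ 0 ≤ κ ∧
      (2 * c * ((p : ℝ) ^ (-(2 * r)) * (b * (p : ℝ) ^ α)) ≤ κ ∨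
        (c * ((p : ℝ) ^ (-(2 * r)) * ((p : ℝ) ^ (1 - α - β) * (b * (p : ℝ) ^ α))) ≤ 1 ∧
          12 * c ^ 2 * ((p : ℝ) ^ (-(2 * r)) * ((p : ℝ) ^ (1 - α - β) * (b * (p : ℝ) ^ α))) *
            ((p : ℝ) ^ (-(2 * r)) * (b * (p : ℝ) ^ α)) ≤ κ)) := by
    rw [etaSig_eq_min] at hr
    by_cases h : (θ + α) / 2 < r
    · filter_upwards [eventually_mul_rpow_neg_le (2 * c * b) (ε := 1 / 8) (by norm_num)
        (x := θ + α - 2 * r) (by linarith)] with p h1 hp1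
      have hp : (0 : ℝ) < p := by exact_mod_cast hp1
      refine ⟨_, ?_, ?_, Or.inl le_rfl⟩
      · refine le_trans (le_of_eq ?_) h1
        rw [show θ + α - 2 * r = θ + (-(2 * r) + α) by ring, Real.rpow_add hp, Real.rpow_add hp]
        ring
      · positivity
    · have h' : (1 + θ + α - β) / 4 < r := by
        rcases min_lt_iff.1 hr with h1 | h1
        · exact absurd h1 h
        · exact h1
      -- In this case `2 r ≤ θ + α`, which together with `1 + θ + α - β < 4 r` gives `1 - β < 2 r`:
      -- the norm of the whole signal tends to zero, as the bound with unknown labels demands.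
      filter_upwards [eventually_mul_rpow_neg_le (12 * c ^ 2 * b ^ 2) (ε := 1 / 8) (by norm_num)
        (x := 1 + θ + α - β - 4 * r) (by linarith), eventually_mul_rpow_neg_le (c * b) one_pos
        (x := 1 - β - 2 * r) (by linarith)] with p h1 h2 hp1
      have hp : (0 : ℝ) < p := by exact_mod_cast hp1
      refine ⟨_, ?_, ?_, Or.inr ⟨?_, le_rfl⟩⟩
      · refine le_trans (le_of_eq ?_) h1
        rw [show 1 + θ + α - β - 4 * r = θ + (-(2 * r) + ((1 - α - β) + (α + (-(2 * r) + α)))) by ring,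
          Real.rpow_add hp, Real.rpow_add hp, Real.rpow_add hp, Real.rpow_add hp, Real.rpow_add hp]
        ring
      · positivity
      · refine le_trans (le_of_eq ?_) h2
        rw [show 1 - β - 2 * r = -(2 * r) + ((1 - α - β) + α) by ring,
          Real.rpow_add hp, Real.rpow_add hp]
        ring
  filter_upwards [eventually_blockSizes hα hβ hβ' ha hρ, key] with p hsz hkey S hS
  obtain ⟨κ, hκ1, hκ0, hκ⟩ := hkey hsz.one_le
  have hp : (0 : ℝ) < p := by exact_mod_cast hsz.one_le
  set len : Fin (numBlocks α β p) → ℕ := fun g => blockLen ρ α p (g + 1) with hlen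
  have hA : (p : ℝ) ^ (-r) ≠ 0 := (Real.rpow_pos_of_pos hp _).ne'
  have hA2 : ((p : ℝ) ^ (-r)) ^ 2 = (p : ℝ) ^ (-(2 * r)) := by
    rw [← Real.rpow_natCast, ← Real.rpow_mul hp.le]; congr 1; push_cast; ring
  have hcell : ∀ g, 2 * len g + gapLen ρ α p ≤ p / numBlocks α β p := fun g => by
    have := hsz.room (g + 1); simp only [hlen]; omega
  have hmp : numBlocks α β p * (p / numBlocks α β p) ≤ p := Nat.mul_div_le _ _
  refine half_le_of_hammSig_le (G := gapLen ρ α p) (cell := p / numBlocks α β p) (len := len)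
    (A₀ := (p : ℝ) ^ (-r)) (κ := κ) hϖ hsz.one_le_num
    (fun g => hsz.one_le_len _) hcell hmp hA ?_ ?_ S ?_
  · refine le_trans (mul_le_mul_of_nonneg_right ?_ hκ0) hκ1
    exact Nat.floor_le (Real.rpow_nonneg hp.le _)
  · intro e g
    refine rowDens_cubeSignal_le hϖ hcell hmp e g ?_
    rw [hA2]
    have hg : (len g : ℝ) ≤ b * (p : ℝ) ^ α := hsz.len_le _
    have hs : ∑ h, (len h : ℝ) ≤ (p : ℝ) ^ (1 - α - β) * (b * (p : ℝ) ^ α) := by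
      refine (Finset.sum_le_sum (f := fun h => (len h : ℝ)) (g := fun _ => b * (p : ℝ) ^ α) fun h _ =>
        hsz.len_le ((h : ℕ) + 1)).trans ?_
      rw [Finset.sum_const, Finset.card_univ, Fintype.card_fin, nsmul_eq_mul]
      exact mul_le_mul_of_nonneg_right hsz.num_le (by positivity)
    rcases hκ with h1 | ⟨h1, h2⟩
    · left
      refine le_trans ?_ h1
      gcongr
    · right
      refine ⟨le_trans ?_ h1, le_trans ?_ h2⟩
      · gcongr
      · rw [hc, ← pow_mul]
        gcongr
  · intro e
    unfold worstHammSig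
    refine le_iSup₂_of_le (cubeSignal p ((p : ℝ) ^ (-r)) (p / numBlocks α β p) len e) ?_ le_rfl
    rw [mem_blockClass_iff hsz.one_le (ha.le.trans (hρ 0).1)]
    refine ⟨_, _, isPlacement_cubeStart hcell hmp e, fun g => ?_, rfl⟩
    exact abs_of_pos (Real.rpow_pos_of_pos hp _)

/-! ### Hermite polynomials under the standard normal law -/

section Hermite

open Polynomial

/-- The Hermite polynomials with real coefficients. -/
def hermiteR (k : ℕ) : ℝ[X] := (hermite k).map (Int.castRingHom ℝ)

lemma hermiteR_succ (k : ℕ) : hermiteR (k + 1) = X * hermiteR k - derivative (hermiteR k) := by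
  simp [hermiteR, hermite_succ, Polynomial.map_sub, Polynomial.map_mul, derivative_map]

lemma natDegree_hermiteR (k : ℕ) : (hermiteR k).natDegree = k := by
  rw [hermiteR, natDegree_map_eq_of_injective Int.cast_injective, natDegree_hermite]

lemma coeff_hermiteR_self (k : ℕ) : (hermiteR k).coeff k = 1 := by
  rw [hermiteR, coeff_map, coeff_hermite_self, map_one]

lemma integrable_pow_gaussianReal (t : ℝ) (k : ℕ) :
    Integrable (fun x : ℝ => x ^ k) (gaussianReal t 1) := by
  have h := (memLp_id_gaussianReal (μ := t) (v := 1) (k : ℝ≥0)).integrable_norm_pow'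
  refine (integrable_norm_iff (by fun_prop)).1 ?_
  simpa [norm_pow] using h

lemma integrable_eval_gaussianReal (t : ℝ) (f : ℝ[X]) :
    Integrable (fun x => f.eval x) (gaussianReal t 1) := by
  simp_rw [eval_eq_sum_range]
  exact integrable_finsetSum _ fun k _ => (integrable_pow_gaussianReal t k).const_mul _

lemma integrable_eval_mul_pdf (f : ℝ[X]) :
    Integrable (fun x => f.eval x * gaussianPDFReal 0 1 x) := by
  have h := integrable_eval_gaussianReal 0 f
  rw [gaussianReal_of_var_ne_zero _ one_ne_zero,
    integrable_withDensity_iff_integrable_smul' (measurable_gaussianPDF 0 1)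
      (ae_of_all _ fun _ => gaussianPDF_lt_top)] at h
  refine h.congr (ae_of_all _ fun x => ?_)
  simp only [toReal_gaussianPDF, smul_eq_mul]
  ring

lemma hasDerivAt_gaussianPDFReal (x : ℝ) :
    HasDerivAt (gaussianPDFReal 0 1) (-x * gaussianPDFReal 0 1 x) x := by
  have h1 : HasDerivAt (fun x : ℝ => -(x - 0) ^ 2 / (2 * ((1 : ℝ≥0) : ℝ))) (-x) x := by
    have := ((((hasDerivAt_id x).sub_const 0).pow 2).neg).div_const (2 * ((1 : ℝ≥0) : ℝ))
    refine this.congr_deriv ?_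
    simp
    ring
  have h2 := (h1.exp).const_mul (√(2 * Real.pi * ((1 : ℝ≥0) : ℝ)))⁻¹
  refine h2.congr_deriv ?_
  simp only [gaussianPDFReal]
  ring

lemma integral_gaussianReal_eval (f : ℝ[X]) :
    ∫ x, f.eval x ∂gaussianReal 0 1 = ∫ x, f.eval x * gaussianPDFReal 0 1 x := by
  rw [integral_gaussianReal_eq_integral_smul one_ne_zero]
  exact integral_congr_ae (ae_of_all _ fun x => by simp [mul_comm])

/-- Gaussian integration by parts for polynomials. -/
lemma integral_X_mul_gaussianReal (f : ℝ[X]) :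
    ∫ x, (X * f).eval x ∂gaussianReal 0 1 = ∫ x, (derivative f).eval x ∂gaussianReal 0 1 := by
  rw [integral_gaussianReal_eval, integral_gaussianReal_eval, ← sub_eq_zero,
    ← integral_sub (integrable_eval_mul_pdf _) (integrable_eval_mul_pdf _), ← neg_eq_zero,
    ← integral_neg]
  refine integral_eq_zero_of_hasDerivAt_of_integrable
    (f := fun x => f.eval x * gaussianPDFReal 0 1 x) (fun x => ?_)
    ((integrable_eval_mul_pdf _).sub (integrable_eval_mul_pdf _)).neg (integrable_eval_mul_pdf f)
  refine ((f.hasDerivAt x).mul (hasDerivAt_gaussianPDFReal x)).congr_deriv ?_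
  simp only [eval_mul, eval_X]
  ring

/-- The adjoint of differentiation under the Gaussian law is `f ↦ X f - f'`, which is exactly the
recursion of the Hermite polynomials. Orthogonality and norms follow by differentiating a polynomial
of known degree. -/
lemma integral_hermiteR_mul (k : ℕ) (f : ℝ[X]) :
    ∫ x, (hermiteR k * f).eval x ∂gaussianReal 0 1
      = ∫ x, (derivative^[k] f).eval x ∂gaussianReal 0 1 := by
  induction k generalizing f with
  | zero => simp [hermiteR]
  | succ k ih =>
    have h1 : hermiteR (k + 1) * f = X * (hermiteR k * f) - derivative (hermiteR k) * f := by
      rw [hermiteR_succ]; ring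
    have h2 : derivative (hermiteR k * f) = derivative (hermiteR k) * f + hermiteR k * derivative f :=
      derivative_mul
    rw [h1, Function.iterate_succ_apply, ← ih]
    simp only [eval_sub]
    rw [integral_sub (integrable_eval_gaussianReal _ _) (integrable_eval_gaussianReal _ _),
      integral_X_mul_gaussianReal, h2]
    simp only [eval_add]
    rw [integral_add (integrable_eval_gaussianReal _ _) (integrable_eval_gaussianReal _ _)]
    ring

lemma integral_hermiteR_mul_of_natDegree_lt {k : ℕ} {f : ℝ[X]} (h : f.natDegree < k) :
    ∫ x, (hermiteR k * f).eval x ∂gaussianReal 0 1 = 0 := by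
  rw [integral_hermiteR_mul, iterate_derivative_eq_zero h]
  simp

lemma integral_hermiteR_sq (k : ℕ) :
    ∫ x, (hermiteR k * hermiteR k).eval x ∂gaussianReal 0 1 = (k.factorial : ℝ) := by
  rw [integral_hermiteR_mul]
  have h1 : derivative^[k] (hermiteR k) = C (k.factorial : ℝ) := by
    refine (eq_C_of_natDegree_le_zero ?_).trans ?_
    · refine (natDegree_iterate_derivative _ _).trans ?_
      rw [natDegree_hermiteR, Nat.sub_self]
    · rw [coeff_iterate_derivative, zero_add, coeff_hermiteR_self, Nat.descFactorial_self]
      simp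
  rw [h1]
  simp

lemma integral_hermiteR_mul_hermiteR (j k : ℕ) :
    ∫ x, (hermiteR j * hermiteR k).eval x ∂gaussianReal 0 1
      = if j = k then (k.factorial : ℝ) else 0 := by
  split_ifs with h
  · rw [h, integral_hermiteR_sq]
  · rcases lt_or_gt_of_ne h with h1 | h1
    · rw [mul_comm]
      exact integral_hermiteR_mul_of_natDegree_lt (by rwa [natDegree_hermiteR])
    · exact integral_hermiteR_mul_of_natDegree_lt (by rwa [natDegree_hermiteR])

/-- The coefficient of `He_k` in the Hermite expansion of `x ^ b`, times `k!`. -/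
def hermiteCoef (k b : ℕ) : ℝ := ∫ x, (hermiteR k * X ^ b).eval x ∂gaussianReal 0 1

lemma hermiteCoef_of_lt {k b : ℕ} (h : b < k) : hermiteCoef k b = 0 :=
  integral_hermiteR_mul_of_natDegree_lt (by simpa using h)

lemma hermiteCoef_eq (k b : ℕ) :
    hermiteCoef k b = (b.descFactorial k : ℝ) * ∫ x : ℝ, x ^ (b - k) ∂gaussianReal 0 1 := by
  rw [hermiteCoef, integral_hermiteR_mul, iterate_derivative_X_pow_eq_natCast_mul]
  simp only [eval_mul, eval_natCast, eval_pow, eval_X]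
  rw [integral_const_mul]

/-- Binomial expansion of a shifted power. Since `hermiteCoef k b` equals `b! / (b - k)!` times a
Gaussian moment, the coefficients are `t ^ k / k!`: the shift by `t` has this Hermite expansion,
which needs no infinite series when tested against polynomials. -/
lemma integral_pow_gaussianReal (t : ℝ) (b : ℕ) : ∫ x : ℝ, x ^ b ∂gaussianReal t 1
    = ∑ k ∈ Finset.range (b + 1), t ^ k / k.factorial * hermiteCoef k b := by
  have h1 : gaussianReal t 1 = (gaussianReal 0 1).map (fun x => t + x) := by
    rw [gaussianReal_map_const_add]; simp
  rw [h1, integral_map (by fun_prop) (by fun_prop)]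
  simp_rw [add_pow]
  rw [integral_finsetSum _ fun k _ =>
    ((integrable_pow_gaussianReal 0 (b - k)).const_mul (t ^ k)).mul_const _]
  refine Finset.sum_congr rfl fun k _ => ?_
  rw [integral_mul_const, integral_const_mul, hermiteCoef_eq, Nat.descFactorial_eq_factorial_mul_choose]
  have : (k.factorial : ℝ) ≠ 0 := by positivity
  push_cast
  field_simp

end Hermite

/-! ### The low-degree projection for a finite mixture of shifts -/

section LowDegree

variable {n p : ℕ}

/-- Exponents of total degree at most `d`. -/
def degSet (ι : Type*) [Fintype ι] [DecidableEq ι] (d : ℕ) : Finset (ι → ℕ) :=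
  (Fintype.piFinset fun _ => Finset.range (d + 1)).filter fun a => ∑ i, a i ≤ d

lemma mem_degSet {ι : Type*} [Fintype ι] [DecidableEq ι] {d : ℕ} {a : ι → ℕ} :
    a ∈ degSet ι d ↔ ∑ i, a i ≤ d := by
  simp only [degSet, Finset.mem_filter, Fintype.mem_piFinset, Finset.mem_range,
    and_iff_right_iff_imp]
  intro h i
  have := Finset.single_le_sum (f := a) (fun j _ => Nat.zero_le _) (Finset.mem_univ i)
  omega

/-- The multinomial theorem in each total degree. Truncation by total degree, and not degree by
coordinate, is what makes the second moment depend on the inner product alone. -/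
lemma sum_degSet {ι : Type*} [Fintype ι] [DecidableEq ι] (d : ℕ) (y : ι → ℝ) :
    ∑ a ∈ degSet ι d, ∏ i, (y i ^ a i / (a i).factorial)
      = ∑ k ∈ Finset.range (d + 1), (∑ i, y i) ^ k / k.factorial := by
  rw [← Finset.sum_fiberwise_of_maps_to (s := degSet ι d) (t := Finset.range (d + 1))
    (g := fun a => ∑ i, a i) fun a ha => by
      rw [mem_degSet] at ha; rw [Finset.mem_range]; omega]
  refine Finset.sum_congr rfl fun k hk => ?_
  rw [Finset.mem_range] at hk
  have h1 : (degSet ι d).filter (fun a => ∑ i, a i = k) = Finset.piAntidiag Finset.univ k := by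
    ext a
    simp only [Finset.mem_filter, mem_degSet, Finset.mem_piAntidiag, Finset.mem_univ, implies_true,
      and_true]
    constructor
    · exact fun h => h.2
    · exact fun h => ⟨h.le.trans (by omega), h⟩
  rw [h1, Finset.sum_pow_eq_sum_piAntidiag, Finset.sum_div]
  refine Finset.sum_congr rfl fun a ha => ?_
  rw [Finset.mem_piAntidiag] at ha
  have h2 := Nat.multinomial_spec Finset.univ a
  rw [ha.1] at h2
  have h3 : ((∏ i, (a i).factorial : ℕ) : ℝ) * (Nat.multinomial Finset.univ a : ℝ)
      = (k.factorial : ℝ) := by exact_mod_cast h2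
  have h4 : ((∏ i, (a i).factorial : ℕ) : ℝ) ≠ 0 := by
    exact_mod_cast Finset.prod_ne_zero_iff.2 fun i _ => (Nat.factorial_pos _).ne'
  rw [Finset.prod_div_distrib, ← Nat.cast_prod, ← h3]
  have h5 : (Nat.multinomial Finset.univ a : ℝ) ≠ 0 := by
    intro h0; rw [h0, mul_zero] at h3; exact (Nat.cast_ne_zero.2 (Nat.factorial_ne_zero k)) h3.symm
  field_simp

/-- A product of Hermite polynomials as a polynomial in the entries of the data. -/
def hermiteMv (a : Fin n × Fin p → ℕ) : MvPolynomial (Fin n × Fin p) ℝ :=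
  ∏ i, Polynomial.aeval (MvPolynomial.X i) (hermiteR (a i))

lemma polyVal_hermiteMv (a : Fin n × Fin p → ℕ) (x : Sample n p) :
    polyVal (hermiteMv a) x = ∏ i, ∏ j, (hermiteR (a (i, j))).eval (x i j) := by
  have h : ∀ i : Fin n × Fin p, MvPolynomial.eval (fun ij => x ij.1 ij.2)
      (Polynomial.aeval (MvPolynomial.X i) (hermiteR (a i)))
      = (hermiteR (a i)).eval (x i.1 i.2) := by
    intro i
    rw [Polynomial.aeval_def, Polynomial.hom_eval₂, MvPolynomial.eval_X, Polynomial.eval]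
    congr 1
    ext; simp
  rw [polyVal, hermiteMv, map_prod, Fintype.prod_prod_type]
  simp_rw [h]

lemma totalDegree_hermiteMv_le (a : Fin n × Fin p → ℕ) :
    (hermiteMv a).totalDegree ≤ ∑ i, a i := by
  refine (MvPolynomial.totalDegree_finsetProd _ _).trans (Finset.sum_le_sum fun i _ => ?_)
  rw [Polynomial.aeval_eq_sum_range]
  refine MvPolynomial.totalDegree_finsetSum_le fun k hk => ?_
  refine (MvPolynomial.totalDegree_smul_le _ _).trans ?_
  rw [MvPolynomial.totalDegree_X_pow]
  rw [Finset.mem_range, natDegree_hermiteR] at hk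
  omega

lemma polyVal_monomial (s : Fin n × Fin p →₀ ℕ) (c : ℝ) (x : Sample n p) :
    polyVal (MvPolynomial.monomial s c) x = c * ∏ i, ∏ j, x i j ^ s (i, j) := by
  rw [polyVal, MvPolynomial.eval_monomial, Finsupp.prod_fintype _ _ fun i => pow_zero _,
    Fintype.prod_prod_type]

lemma polyVal_eq_sum (h : MvPolynomial (Fin n × Fin p) ℝ) (x : Sample n p) :
    polyVal h x = ∑ s ∈ h.support, h.coeff s * ∏ i, ∏ j, x i j ^ s (i, j) := by
  conv_lhs => rw [h.as_sum]
  rw [polyVal, map_sum]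
  exact Finset.sum_congr rfl fun s _ => polyVal_monomial s _ x

lemma integrable_shiftLaw_prod (M : Fin n → Fin p → ℝ) {f : Fin n → Fin p → ℝ → ℝ}
    (hf : ∀ i j, Integrable (f i j) (gaussianReal (M i j) 1)) :
    Integrable (fun x : Sample n p => ∏ i, ∏ j, f i j (x i j)) (shiftLaw M) := by
  unfold shiftLaw
  exact Integrable.fintype_prod (f := fun i (y : Fin p → ℝ) => ∏ j, f i j (y j))
    fun i => Integrable.fintype_prod fun j => hf i j

lemma integrable_polyVal (M : Fin n → Fin p → ℝ) (h : MvPolynomial (Fin n × Fin p) ℝ) :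
    Integrable (polyVal h) (shiftLaw M) := by
  have : polyVal h = fun x : Sample n p =>
      ∑ s ∈ h.support, h.coeff s * ∏ i, ∏ j, x i j ^ s (i, j) := funext (polyVal_eq_sum h)
  rw [this]
  exact integrable_finsetSum _ fun s _ => (integrable_shiftLaw_prod M fun i j =>
    integrable_pow_gaussianReal _ (s (i, j))).const_mul _

lemma integral_hermiteMv_mul_monomial (a : Fin n × Fin p → ℕ) (s : Fin n × Fin p →₀ ℕ) :
    ∫ x, polyVal (hermiteMv a) x * ∏ i, ∏ j, x i j ^ s (i, j) ∂noiseLaw n p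
      = ∏ ij, hermiteCoef (a ij) (s ij) := by
  simp_rw [polyVal_hermiteMv, ← Finset.prod_mul_distrib]
  rw [integral_noiseLaw_prod fun i j y => (hermiteR (a (i, j))).eval y * y ^ s (i, j),
    Fintype.prod_prod_type]
  refine Finset.prod_congr rfl fun i _ => Finset.prod_congr rfl fun j _ => ?_
  rw [hermiteCoef]
  congr 1; funext y; simp

lemma integral_hermiteMv_mul_hermiteMv (a a' : Fin n × Fin p → ℕ) :
    ∫ x, polyVal (hermiteMv a) x * polyVal (hermiteMv a') x ∂noiseLaw n p
      = if a = a' then ∏ ij, ((a ij).factorial : ℝ) else 0 := by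
  simp_rw [polyVal_hermiteMv, ← Finset.prod_mul_distrib, ← Polynomial.eval_mul]
  rw [integral_noiseLaw_prod fun i j y => (hermiteR (a (i, j)) * hermiteR (a' (i, j))).eval y]
  simp_rw [integral_hermiteR_mul_hermiteR]
  rw [← Fintype.prod_prod_type (f := fun ij : Fin n × Fin p =>
    if a ij = a' ij then ((a' ij).factorial : ℝ) else 0)]
  split_ifs with h
  · subst h; simp
  · obtain ⟨i, hi⟩ := Function.ne_iff.1 h
    exact Finset.prod_eq_zero (Finset.mem_univ i) (if_neg hi)

lemma integral_monomial_shiftLaw (M : Fin n → Fin p → ℝ) (s : Fin n × Fin p →₀ ℕ) {d : ℕ}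
    (hs : ∑ ij, s ij ≤ d) : ∫ x, ∏ i, ∏ j, x i j ^ s (i, j) ∂shiftLaw M
      = ∑ a ∈ degSet (Fin n × Fin p) d, (∏ ij, (M ij.1 ij.2 ^ a ij / (a ij).factorial)) *
          ∏ ij, hermiteCoef (a ij) (s ij) := by
  rw [integral_shiftLaw_prod M fun i j y => y ^ s (i, j)]
  simp_rw [integral_pow_gaussianReal]
  rw [← Fintype.prod_prod_type (f := fun ij : Fin n × Fin p => ∑ k ∈ Finset.range (s ij + 1),
    M ij.1 ij.2 ^ k / k.factorial * hermiteCoef k (s ij)), Finset.prod_univ_sum]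
  simp_rw [← Finset.prod_mul_distrib]
  -- An exponent that exceeds `s` in some coordinate has a vanishing Hermite coefficient there, so
  -- the box may be enlarged to all exponents of bounded total degree.
  refine Finset.sum_subset (fun a ha => ?_) fun a _ ha => ?_
  · rw [mem_degSet]
    refine le_trans (Finset.sum_le_sum fun i _ => ?_) hs
    have := Fintype.mem_piFinset.1 ha i
    rw [Finset.mem_range] at this
    omega
  · rw [Fintype.mem_piFinset] at ha
    push Not at ha
    obtain ⟨i, hi⟩ := ha
    refine Finset.prod_eq_zero (Finset.mem_univ i) ?_
    rw [Finset.mem_range] at hi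
    rw [hermiteCoef_of_lt (by omega), mul_zero]

variable {Ω : Type*} [Fintype Ω]

/-- The moment of the mean matrix with exponents `a`. -/
def priorMoment (w : Ω → ℝ) (M : Ω → Fin n → Fin p → ℝ) (a : Fin n × Fin p → ℕ) : ℝ :=
  ∑ ω, w ω * ∏ ij, M ω ij.1 ij.2 ^ a ij

/-- The mixture of shifted noise laws. -/
def mixLaw (w : Ω → ℝ) (M : Ω → Fin n → Fin p → ℝ) : Measure (Sample n p) :=
  ∑ ω, ENNReal.ofReal (w ω) • shiftLaw (M ω)

/-- The low-degree projection of the likelihood ratio of a mixture. -/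
def lowDegPoly (w : Ω → ℝ) (M : Ω → Fin n → Fin p → ℝ) (d : ℕ) : MvPolynomial (Fin n × Fin p) ℝ :=
  ∑ a ∈ degSet (Fin n × Fin p) d, (priorMoment w M a / ∏ ij, ((a ij).factorial : ℝ)) • hermiteMv a

lemma polyVal_lowDegPoly (w : Ω → ℝ) (M : Ω → Fin n → Fin p → ℝ) (d : ℕ) (x : Sample n p) :
    polyVal (lowDegPoly w M d) x = ∑ a ∈ degSet (Fin n × Fin p) d,
      (priorMoment w M a / ∏ ij, ((a ij).factorial : ℝ)) * polyVal (hermiteMv a) x := by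
  simp [polyVal, lowDegPoly, map_sum, MvPolynomial.smul_eval]

lemma isFiniteMeasure_mixLaw (w : Ω → ℝ) (M : Ω → Fin n → Fin p → ℝ) :
    IsFiniteMeasure (mixLaw w M) := by
  constructor
  simp only [mixLaw, Measure.coe_finsetSum, Finset.sum_apply, Measure.smul_apply, measure_univ,
    smul_eq_mul, mul_one]
  exact ENNReal.sum_lt_top.2 fun _ _ => ENNReal.ofReal_lt_top

lemma mixLaw_absolutelyContinuous (w : Ω → ℝ) (M : Ω → Fin n → Fin p → ℝ) :
    mixLaw w M ≪ noiseLaw n p := by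
  intro s hs
  simp only [mixLaw, Measure.coe_finsetSum, Finset.sum_apply, Measure.smul_apply, smul_eq_mul]
  refine Finset.sum_eq_zero fun ω _ => ?_
  rw [shiftLaw_eq_withDensity, withDensity_absolutelyContinuous _ _ hs, mul_zero]

lemma integrable_polyVal_mixLaw (w : Ω → ℝ) (M : Ω → Fin n → Fin p → ℝ)
    (h : MvPolynomial (Fin n × Fin p) ℝ) : Integrable (polyVal h) (mixLaw w M) :=
  integrable_finsetSum_measure.2 fun _ _ =>
    (integrable_polyVal _ h).smul_measure ENNReal.ofReal_ne_top

lemma integral_mixLaw {w : Ω → ℝ} (hw : ∀ ω, 0 ≤ w ω) (M : Ω → Fin n → Fin p → ℝ)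
    {f : Sample n p → ℝ} (hf : ∀ ω, Integrable f (shiftLaw (M ω))) :
    ∫ x, f x ∂mixLaw w M = ∑ ω, w ω * ∫ x, f x ∂shiftLaw (M ω) := by
  rw [mixLaw, integral_finsetSum_measure fun ω _ => (hf ω).smul_measure ENNReal.ofReal_ne_top]
  refine Finset.sum_congr rfl fun ω _ => ?_
  rw [integral_smul_measure, ENNReal.toReal_ofReal (hw ω), smul_eq_mul]

lemma polyVal_mul (g h : MvPolynomial (Fin n × Fin p) ℝ) (x : Sample n p) :
    polyVal g x * polyVal h x = polyVal (g * h) x := by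
  simp [polyVal]

/-- This is the defining property of the projection, checked on monomials: both sides equal the sum
over `a` of the prior moment over `a!` times the Hermite coefficients of the monomial, and no index
above its degree contributes. -/
lemma integral_lowDegPoly_mul {w : Ω → ℝ} (hw : ∀ ω, 0 ≤ w ω) (M : Ω → Fin n → Fin p → ℝ) {d : ℕ}
    {h : MvPolynomial (Fin n × Fin p) ℝ} (hd : h.totalDegree ≤ d) :
    ∫ x, polyVal (lowDegPoly w M d) x * polyVal h x ∂noiseLaw n p
      = ∫ x, polyVal h x ∂mixLaw w M := by
  have hmon : ∀ (M : Fin n → Fin p → ℝ) (s : Fin n × Fin p →₀ ℕ),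
      Integrable (fun x : Sample n p => ∏ i, ∏ j, x i j ^ s (i, j)) (shiftLaw M) := fun M s =>
    integrable_shiftLaw_prod M fun i j => integrable_pow_gaussianReal _ (s (i, j))
  have hint : ∀ (a : Fin n × Fin p → ℕ) (s : Fin n × Fin p →₀ ℕ), Integrable
      (fun x : Sample n p => polyVal (hermiteMv a) x * ∏ i, ∏ j, x i j ^ s (i, j))
      (noiseLaw n p) := fun a s => by
    have := integrable_polyVal (0 : Fin n → Fin p → ℝ) (hermiteMv a * MvPolynomial.monomial s 1)
    refine this.congr (ae_of_all _ fun x => ?_)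
    simp only
    rw [← polyVal_mul, polyVal_monomial, one_mul]
  rw [integral_mixLaw hw M fun ω => integrable_polyVal _ h]
  simp_rw [polyVal_eq_sum h, polyVal_lowDegPoly, Finset.sum_mul_sum]
  have e1 : ∀ ω, ∫ x, ∑ s ∈ h.support, h.coeff s * ∏ i, ∏ j, x i j ^ s (i, j) ∂shiftLaw (M ω)
      = ∑ s ∈ h.support, h.coeff s * ∑ a ∈ degSet (Fin n × Fin p) d,
        (∏ ij, (M ω ij.1 ij.2 ^ a ij / (a ij).factorial)) *
          ∏ ij, hermiteCoef (a ij) (s ij) := by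
    intro ω
    rw [integral_finsetSum _ fun s _ => (hmon _ s).const_mul _]
    refine Finset.sum_congr rfl fun s hs => ?_
    rw [integral_const_mul, integral_monomial_shiftLaw]
    refine le_trans ?_ hd
    have := MvPolynomial.le_totalDegree hs
    rwa [Finsupp.sum_fintype _ _ fun _ => rfl] at this
  simp_rw [e1]
  have e2 : ∀ (a : Fin n × Fin p → ℕ) (s : Fin n × Fin p →₀ ℕ) (x : Sample n p),
      priorMoment w M a / (∏ ij, ((a ij).factorial : ℝ)) * polyVal (hermiteMv a) x *
        (h.coeff s * ∏ i, ∏ j, x i j ^ s (i, j))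
      = (priorMoment w M a / (∏ ij, ((a ij).factorial : ℝ)) * h.coeff s) *
        (polyVal (hermiteMv a) x * ∏ i, ∏ j, x i j ^ s (i, j)) := fun a s x => by ring
  simp_rw [e2]
  rw [integral_finsetSum _ fun a _ => integrable_finsetSum _ fun s _ => (hint a s).const_mul _]
  have e3 : ∀ a, ∫ x, ∑ s ∈ h.support, priorMoment w M a / (∏ ij, ((a ij).factorial : ℝ)) *
      h.coeff s * (polyVal (hermiteMv a) x * ∏ i, ∏ j, x i j ^ s (i, j)) ∂noiseLaw n p
      = ∑ s ∈ h.support, priorMoment w M a / (∏ ij, ((a ij).factorial : ℝ)) *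
        h.coeff s * ∏ ij, hermiteCoef (a ij) (s ij) := fun a => by
    rw [integral_finsetSum _ fun s _ => (hint a s).const_mul _]
    exact Finset.sum_congr rfl fun s _ => by
      rw [integral_const_mul, integral_hermiteMv_mul_monomial]
  simp_rw [e3, priorMoment, Finset.sum_div, Finset.sum_mul, Finset.mul_sum]
  rw [Finset.sum_comm]
  conv_rhs => rw [Finset.sum_comm]
  refine Finset.sum_congr rfl fun s _ => ?_
  rw [Finset.sum_comm]
  refine Finset.sum_congr rfl fun ω _ => Finset.sum_congr rfl fun a _ => ?_
  rw [Finset.prod_div_distrib]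
  ring

/-- The mixture is absolutely continuous with respect to the noise, so integrating a polynomial
against the likelihood ratio is integrating it under the mixture. -/
lemma isLowDegreeProj_lowDegPoly {w : Ω → ℝ} (hw : ∀ ω, 0 ≤ w ω) (M : Ω → Fin n → Fin p → ℝ)
    {D : ℝ} (hD : 0 ≤ D) :
    IsLowDegreeProj (noiseLaw n p) (mixLaw w M) D (lowDegPoly w M ⌊D⌋₊) := by
  have := isFiniteMeasure_mixLaw w M
  have hac := mixLaw_absolutelyContinuous w M
  constructor
  · refine le_trans (Nat.cast_le.2 ?_) (Nat.floor_le hD)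
    refine MvPolynomial.totalDegree_finsetSum_le fun a ha => ?_
    refine (MvPolynomial.totalDegree_smul_le _ _).trans ((totalDegree_hermiteMv_le a).trans ?_)
    exact mem_degSet.1 ha
  · intro h hh
    have hh' : h.totalDegree ≤ ⌊D⌋₊ := Nat.le_floor hh
    have i1 : Integrable (fun x => ((mixLaw w M).rnDeriv (noiseLaw n p) x).toReal * polyVal h x)
        (noiseLaw n p) :=
      (integrable_rnDeriv_smul_iff hac).2 (integrable_polyVal_mixLaw w M h)
    have i2 : Integrable (fun x => polyVal (lowDegPoly w M ⌊D⌋₊) x * polyVal h x)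
        (noiseLaw n p) := by
      simp_rw [polyVal_mul]
      exact integrable_polyVal 0 _
    simp_rw [sub_mul]
    rw [integral_sub i1 i2, integral_lowDegPoly_mul hw M hh', sub_eq_zero]
    exact integral_rnDeriv_smul hac

/-- Orthogonality leaves the squared prior moments over `a!`. Writing each square as a double
average over two independent copies of the prior and summing over `a` in one degree gives powers of
the inner product of the two means. -/
lemma integral_lowDegPoly_sq (w : Ω → ℝ) (M : Ω → Fin n → Fin p → ℝ) (d : ℕ) :
    ∫ x, polyVal (lowDegPoly w M d) x ^ 2 ∂noiseLaw n p
      = ∑ k ∈ Finset.range (d + 1), (∑ ω, ∑ ω', w ω * w ω' *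
          (∑ i, ∑ j, M ω i j * M ω' i j) ^ k) / k.factorial := by
  set c : (Fin n × Fin p → ℕ) → ℝ := fun a =>
    priorMoment w M a / ∏ ij, ((a ij).factorial : ℝ) with hc
  have hi : ∀ a a' : Fin n × Fin p → ℕ, Integrable
      (fun x : Sample n p => polyVal (hermiteMv a) x * polyVal (hermiteMv a') x) (noiseLaw n p) :=
    fun a a' => by simp_rw [polyVal_mul]; exact integrable_polyVal 0 _
  have e1 : ∀ x : Sample n p, polyVal (lowDegPoly w M d) x ^ 2 = ∑ a ∈ degSet (Fin n × Fin p) d,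
      ∑ a' ∈ degSet (Fin n × Fin p) d, c a * c a' *
        (polyVal (hermiteMv a) x * polyVal (hermiteMv a') x) := fun x => by
    rw [polyVal_lowDegPoly, pow_two, Finset.sum_mul_sum]
    exact Finset.sum_congr rfl fun a _ => Finset.sum_congr rfl fun a' _ => by ring
  simp_rw [e1]
  rw [integral_finsetSum _ fun a _ => integrable_finsetSum _ fun a' _ => (hi a a').const_mul _]
  have e2 : ∀ a ∈ degSet (Fin n × Fin p) d, ∫ x, ∑ a' ∈ degSet (Fin n × Fin p) d, c a * c a' *
        (polyVal (hermiteMv a) x * polyVal (hermiteMv a') x) ∂noiseLaw n p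
      = ∑ ω, ∑ ω', w ω * w ω' *
        ∏ ij : Fin n × Fin p, ((M ω ij.1 ij.2 * M ω' ij.1 ij.2) ^ a ij / (a ij).factorial) := by
    intro a ha
    rw [integral_finsetSum _ fun a' _ => (hi a a').const_mul _]
    simp_rw [integral_const_mul, integral_hermiteMv_mul_hermiteMv]
    rw [Finset.sum_eq_single a (fun a' _ h => by rw [if_neg h.symm, mul_zero])
      (fun h => absurd ha h), if_pos rfl]
    have h0 : (∏ ij, ((a ij).factorial : ℝ)) ≠ 0 :=
      Finset.prod_ne_zero_iff.2 fun i _ => Nat.cast_ne_zero.2 (Nat.factorial_ne_zero _)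
    have h1 : c a * c a * (∏ ij, ((a ij).factorial : ℝ))
        = priorMoment w M a * priorMoment w M a / ∏ ij, ((a ij).factorial : ℝ) := by
      rw [hc]; field_simp
    rw [h1, priorMoment, Finset.sum_mul_sum, Finset.sum_div]
    refine Finset.sum_congr rfl fun ω _ => ?_
    rw [Finset.sum_div]
    refine Finset.sum_congr rfl fun ω' _ => ?_
    rw [Finset.prod_div_distrib]
    simp_rw [mul_pow]
    rw [Finset.prod_mul_distrib]
    ring
  rw [Finset.sum_congr rfl e2, Finset.sum_comm]
  have e3 : ∀ ω, ∑ a ∈ degSet (Fin n × Fin p) d, ∑ ω', w ω * w ω' *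
        ∏ ij : Fin n × Fin p, ((M ω ij.1 ij.2 * M ω' ij.1 ij.2) ^ a ij / (a ij).factorial)
      = ∑ k ∈ Finset.range (d + 1), (∑ ω', w ω * w ω' *
          (∑ i, ∑ j, M ω i j * M ω' i j) ^ k) / k.factorial := by
    intro ω
    rw [Finset.sum_comm]
    simp_rw [← Finset.mul_sum, sum_degSet, Fintype.sum_prod_type, Finset.mul_sum, Finset.sum_div]
    rw [Finset.sum_comm]
    exact Finset.sum_congr rfl fun _ _ => Finset.sum_congr rfl fun _ _ => by ring
  simp_rw [e3, Finset.sum_div]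
  rw [Finset.sum_comm]

end LowDegree

/-! ### Counting placements of blocks -/

section Counting

/-- The arrangements of `m` disjoint intervals with lengths `l` in `[x, e)`, from left to right. -/
def arrangements {m : ℕ} (l : Fin m → ℕ) (x e : ℕ) : Finset (Fin m → ℕ) :=
  (Fintype.piFinset fun _ => Finset.range (e + 1)).filter fun s =>
    (∀ g, x ≤ s g) ∧ (∀ g, s g + l g ≤ e) ∧ ∀ g h, g < h → s g + l g ≤ s h

lemma mem_arrangements {m : ℕ} {l : Fin m → ℕ} {x e : ℕ} {s : Fin m → ℕ} :
    s ∈ arrangements l x e ↔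
      (∀ g, x ≤ s g) ∧ (∀ g, s g + l g ≤ e) ∧ ∀ g h, g < h → s g + l g ≤ s h := by
  simp only [arrangements, Finset.mem_filter, Fintype.mem_piFinset, Finset.mem_range,
    and_iff_right_iff_imp]
  intro h g
  have := h.2.1 g
  omega

lemma tail_mem_arrangements {m : ℕ} {l : Fin (m + 1) → ℕ} {x e : ℕ} {s : Fin (m + 1) → ℕ}
    (hs : s ∈ arrangements l x e) :
    Fin.tail s ∈ arrangements (Fin.tail l) (s 0 + l 0) e := by
  rw [mem_arrangements] at hs ⊢
  exact ⟨fun g => hs.2.2 0 g.succ (Fin.succ_pos g), fun g => hs.2.1 g.succ,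
    fun g h hgh => hs.2.2 g.succ h.succ (Fin.succ_lt_succ_iff.2 hgh)⟩

lemma cons_mem_arrangements {m : ℕ} {l : Fin (m + 1) → ℕ} {x e : ℕ} {s : Fin m → ℕ}
    (hx : x + l 0 ≤ e) (hs : s ∈ arrangements (Fin.tail l) (x + l 0) e) :
    (Fin.cons x s : Fin (m + 1) → ℕ) ∈ arrangements l x e := by
  rw [mem_arrangements] at hs ⊢
  refine ⟨fun g => ?_, fun g => ?_, fun g h hgh => ?_⟩
  · refine Fin.cases ?_ (fun g => ?_) g
    · simp
    · rw [Fin.cons_succ]; exact le_trans (by omega) (hs.1 g)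
  · refine Fin.cases ?_ (fun g => ?_) g
    · simpa using hx
    · simpa [Fin.tail] using hs.2.1 g
  · induction h using Fin.cases with
    | zero => exact absurd hgh (by simp)
    | succ h =>
      induction g using Fin.cases with
      | zero => simpa using hs.1 h
      | succ g => simpa [Fin.tail] using hs.2.2 g h (Fin.succ_lt_succ_iff.1 hgh)

lemma add_sum_le_of_mem_arrangements {m : ℕ} {l : Fin m → ℕ} {x e : ℕ} (hx : x ≤ e)
    {s : Fin m → ℕ} (hs : s ∈ arrangements l x e) : x + ∑ g, l g ≤ e := by
  induction m generalizing x with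
  | zero => simpa using hx
  | succ m ih =>
    have h1 := tail_mem_arrangements hs
    rw [mem_arrangements] at hs
    have h2 := ih (hs.2.1 0) h1
    have h3 := hs.1 0
    rw [Fin.sum_univ_succ]
    simp only [Fin.tail] at h2
    omega

/-- Prepending a starting point. -/
def consEmb {m : ℕ} (x : ℕ) : (Fin m → ℕ) ↪ (Fin (m + 1) → ℕ) where
  toFun s := Fin.cons x s
  inj' s s' h := by
    have := congrArg (Fin.tail (α := fun _ => ℕ)) h
    simpa using this

lemma consEmb_apply {m : ℕ} (x : ℕ) (s : Fin m → ℕ) : consEmb x s = Fin.cons x s := rfl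

/-- The first interval starts at `x` or later; in the second case all intervals start after `x`.
Every count and every weight below is computed with this dichotomy. -/
lemma arrangements_succ {m : ℕ} {l : Fin (m + 1) → ℕ} {x e : ℕ} (hx : x + l 0 ≤ e) :
    arrangements l x e = arrangements l (x + 1) e ∪
      (arrangements (Fin.tail l) (x + l 0) e).map
        (consEmb x) := by
  ext s
  rw [Finset.mem_union, Finset.mem_map]
  constructor
  · intro hs
    have hs' := mem_arrangements.1 hs
    rcases (hs'.1 0).eq_or_lt with h | h
    · right
      refine ⟨Fin.tail s, ?_, ?_⟩
      · rw [h]; exact tail_mem_arrangements hs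
      · rw [consEmb_apply, h]; exact Fin.cons_self_tail s
    · left
      rw [mem_arrangements]
      refine ⟨fun g => ?_, hs'.2⟩
      refine Fin.cases h (fun g => ?_) g
      have := hs'.2.2 0 g.succ (Fin.succ_pos g)
      omega
  · rintro (h | ⟨s', hs', rfl⟩)
    · rw [mem_arrangements] at h ⊢
      exact ⟨fun g => (Nat.le_succ x).trans (h.1 g), h.2⟩
    · exact cons_mem_arrangements hx hs'

lemma disjoint_arrangements {m : ℕ} {l : Fin (m + 1) → ℕ} {x e : ℕ} :
    Disjoint (arrangements l (x + 1) e) ((arrangements (Fin.tail l) (x + l 0) e).map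
        (consEmb x)) := by
  rw [Finset.disjoint_left]
  intro s hs hs'
  obtain ⟨s', -, rfl⟩ := Finset.mem_map.1 hs'
  rw [consEmb_apply] at hs
  have := (mem_arrangements.1 hs).1 0
  simp at this

variable (H : Finset ℕ) (t : ℝ)

/-- The sum over all arrangements of `(1 + t)` to the number of intervals that start in `H`. -/
def arrWeight {m : ℕ} (l : Fin m → ℕ) (x e : ℕ) : ℝ :=
  ∑ s ∈ arrangements l x e, ∏ g, if s g ∈ H then 1 + t else 1

lemma arrWeight_succ {m : ℕ} {l : Fin (m + 1) → ℕ} {x e : ℕ} (hx : x + l 0 ≤ e) :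
    arrWeight H t l x e = arrWeight H t l (x + 1) e
      + (if x ∈ H then 1 + t else 1) * arrWeight H t (Fin.tail l) (x + l 0) e := by
  unfold arrWeight
  rw [arrangements_succ hx, Finset.sum_union disjoint_arrangements, Finset.sum_map, Finset.mul_sum]
  congr 1
  refine Finset.sum_congr rfl fun s _ => ?_
  rw [Fin.prod_univ_succ, consEmb_apply]
  simp

lemma arrWeight_eq_zero {m : ℕ} {l : Fin m → ℕ} {x e : ℕ} (hx : x ≤ e) (h : e < x + ∑ g, l g) :
    arrWeight H t l x e = 0 := by
  unfold arrWeight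
  rw [Finset.eq_empty_of_forall_notMem fun s hs =>
    absurd (add_sum_le_of_mem_arrangements hx hs) (not_le.2 h), Finset.sum_empty]

/-- If each interval is shrunk to a point, what remains is an `m`-element subset of `P + m` places.
The double induction is Pascal's rule; `P` is the number of free places. -/
lemma card_arrangements {m : ℕ} (l : Fin m → ℕ) (hl : ∀ g, 1 ≤ l g) (x P : ℕ) :
    (arrangements l x (x + ∑ g, l g + P)).card = (P + m).choose m := by
  induction m generalizing x P with
  | zero =>
    have : arrangements l x (x + ∑ g, l g + P) = {default} := by
      ext s
      simp [mem_arrangements, Subsingleton.elim s default]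
    rw [this]; simp
  | succ m ih =>
    induction P generalizing x with
    | zero =>
      rw [arrangements_succ (by rw [Fin.sum_univ_succ]; omega),
        Finset.card_union_of_disjoint disjoint_arrangements, Finset.card_map]
      have h1 : arrangements l (x + 1) (x + ∑ g, l g + 0) = ∅ := by
        refine Finset.eq_empty_of_forall_notMem fun s hs => ?_
        have := add_sum_le_of_mem_arrangements
          (by have := hl 0; rw [Fin.sum_univ_succ]; omega) hs
        omega
      have h2 : x + ∑ g, l g + 0 = (x + l 0) + ∑ g, Fin.tail l g + 0 := by
        rw [Fin.sum_univ_succ]; simp only [Fin.tail]; omega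
      rw [h1, h2, ih (Fin.tail l) (fun g => hl g.succ)]
      simp
    | succ P ihP =>
      rw [arrangements_succ (by rw [Fin.sum_univ_succ]; omega),
        Finset.card_union_of_disjoint disjoint_arrangements, Finset.card_map]
      have h1 : x + ∑ g, l g + (P + 1) = (x + 1) + ∑ g, l g + P := by omega
      have h2 : x + ∑ g, l g + (P + 1) = (x + l 0) + ∑ g, Fin.tail l g + (P + 1) := by
        rw [Fin.sum_univ_succ]; simp only [Fin.tail]; omega
      conv_lhs => enter [1]; rw [h1, ihP]
      rw [h2, ih (Fin.tail l) (fun g => hl g.succ)]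
      have : P + 1 + (m + 1) = (P + m + 1) + 1 := by omega
      rw [this, Nat.choose_succ_succ, add_comm]
      congr 2; omega

/-- The weight of the subsets of size `m` of a set of size `P + m`, of whose elements `h` count. -/
def subsetWeight (h P m : ℕ) : ℝ :=
  ∑ ij ∈ Finset.HasAntidiagonal.antidiagonal m, (h.choose ij.1 : ℝ) * t ^ ij.1 * ((P + ij.2).choose ij.2 : ℝ)

variable {t}

lemma subsetWeight_mono (ht : 0 ≤ t) {h h' : ℕ} (hh : h ≤ h') (P m : ℕ) :
    subsetWeight t h P m ≤ subsetWeight t h' P m := by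
  refine Finset.sum_le_sum fun ij _ => ?_
  have : (h.choose ij.1 : ℝ) ≤ h'.choose ij.1 := Nat.cast_le.2 (Nat.choose_le_choose _ hh)
  gcongr

/-- This and the next identity are Pascal's rule in the number of marked places and in the number of
free places, the two moves made by the recursion for arrangements. -/
lemma subsetWeight_succ_left (h P m : ℕ) :
    subsetWeight t (h + 1) P (m + 1) = subsetWeight t h P (m + 1) + t * subsetWeight t h P m := by
  unfold subsetWeight
  rw [Finset.Nat.sum_antidiagonal_succ, Finset.Nat.sum_antidiagonal_succ, Finset.mul_sum, add_assoc,
    ← Finset.sum_add_distrib]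
  congr 1
  · simp
  · refine Finset.sum_congr rfl fun ij _ => ?_
    simp only [Nat.choose_succ_succ]
    push_cast
    ring

lemma subsetWeight_succ_mid (h P m : ℕ) :
    subsetWeight t h (P + 1) (m + 1) = subsetWeight t h P (m + 1) + subsetWeight t h (P + 1) m := by
  unfold subsetWeight
  rw [Finset.Nat.sum_antidiagonal_succ', Finset.Nat.sum_antidiagonal_succ']
  refine Eq.trans ?_ (add_assoc _ _ _).symm
  rw [← Finset.sum_add_distrib]
  refine congrArg₂ (· + ·) (by simp) (Finset.sum_congr rfl fun ij _ => ?_)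
  have h1 : P + 1 + (ij.2 + 1) = (P + 1 + ij.2) + 1 := by omega
  have h2 : P + (ij.2 + 1) = P + 1 + ij.2 := by omega
  simp only [h1, h2, Nat.choose_succ_succ]
  push_cast
  ring

lemma subsetWeight_zero_le (ht : 0 ≤ t) (h m : ℕ) :
    subsetWeight t h 0 m ≤ subsetWeight t h 0 (m + 1) := by
  unfold subsetWeight
  rw [Finset.Nat.sum_antidiagonal_succ']
  refine le_add_of_nonneg_of_le (by positivity) (le_of_eq ?_)
  exact Finset.sum_congr rfl fun ij _ => by simp

/-- The recursion step at a marked place: either it stays free, or it is the start of an interval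
and contributes the factor `1 + t`. -/
lemma subsetWeight_add_le (ht : 0 ≤ t) (h P m : ℕ) :
    subsetWeight t h P (m + 1) + (1 + t) * subsetWeight t h (P + 1) m
      ≤ subsetWeight t (h + 1) (P + 1) (m + 1) := by
  rw [subsetWeight_succ_left, subsetWeight_succ_mid]
  linarith

/-- Intervals of positive length cover marked places that then can no longer be starting points, so
the weight is at most that of points placed on a line where no marked place is lost. The recursions
of the two weights are compared step by step. -/
lemma arrWeight_le {H : Finset ℕ} (ht : 0 ≤ t) {m : ℕ} (l : Fin m → ℕ) (hl : ∀ g, 1 ≤ l g)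
    (x P : ℕ) : arrWeight H t l x (x + ∑ g, l g + P)
      ≤ subsetWeight t (H.filter fun y => x ≤ y).card P m := by
  induction m generalizing x P with
  | zero =>
    have : arrangements l x (x + ∑ g, l g + P) = {default} := by
      ext s
      simp [mem_arrangements, Subsingleton.elim s default]
    unfold arrWeight
    rw [this]; simp [subsetWeight]
  | succ m ih =>
    -- After an interval that starts at `x`, the next one starts at `x + l 0` or later, where there
    -- are no more marked places than from `x + 1` on.
    have hmono : ∀ x y, x + 1 ≤ y → (H.filter fun z => y ≤ z).card
        ≤ (H.filter fun z => x + 1 ≤ z).card := fun x y hy =>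
      Finset.card_le_card fun z hz => by
        rw [Finset.mem_filter] at hz ⊢; exact ⟨hz.1, hy.trans hz.2⟩
    have hcard : ∀ x, (H.filter fun y => x ≤ y).card
        = (H.filter fun y => x + 1 ≤ y).card + if x ∈ H then 1 else 0 := by
      intro x
      split_ifs with hx
      · have : H.filter (fun y => x ≤ y) = insert x (H.filter fun y => x + 1 ≤ y) := by
          ext y
          simp only [Finset.mem_filter, Finset.mem_insert]
          constructor
          · rintro ⟨h1, h2⟩
            rcases h2.eq_or_lt with h | h
            · exact Or.inl h.symm
            · exact Or.inr ⟨h1, h⟩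
          · rintro (rfl | ⟨h1, h2⟩)
            · exact ⟨hx, le_rfl⟩
            · exact ⟨h1, by omega⟩
        rw [this, Finset.card_insert_of_notMem (by simp)]
      · rw [add_zero]
        congr 1
        ext y
        simp only [Finset.mem_filter, and_congr_right_iff]
        intro hy
        constructor
        · intro h
          rcases h.eq_or_lt with h | h
          · exact absurd (h ▸ hy) hx
          · exact h
        · intro h; omega
    induction P generalizing x with
    | zero =>
      rw [arrWeight_succ H t (by rw [Fin.sum_univ_succ]; omega), arrWeight_eq_zero H t
        (by have := hl 0; rw [Fin.sum_univ_succ]; omega) (by omega), zero_add]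
      have h2 : x + ∑ g, l g + 0 = (x + l 0) + ∑ g, Fin.tail l g + 0 := by
        rw [Fin.sum_univ_succ]; simp only [Fin.tail]; omega
      rw [h2]
      have h3 := (ih (Fin.tail l) (fun g => hl g.succ) (x + l 0) 0).trans
        (subsetWeight_mono ht (hmono x _ (by have := hl 0; omega)) 0 m)
      rw [hcard x]
      set h := (H.filter fun y => x + 1 ≤ y).card
      have h4 := subsetWeight_zero_le ht h m
      split_ifs with hx
      · rw [subsetWeight_succ_left]
        nlinarith
      · rw [one_mul]; exact h3.trans h4
    | succ P ihP =>
      rw [arrWeight_succ H t (by rw [Fin.sum_univ_succ]; omega)]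
      have h1 : x + ∑ g, l g + (P + 1) = (x + 1) + ∑ g, l g + P := by omega
      have h2 : x + ∑ g, l g + (P + 1) = (x + l 0) + ∑ g, Fin.tail l g + (P + 1) := by
        rw [Fin.sum_univ_succ]; simp only [Fin.tail]; omega
      have h3 := (ih (Fin.tail l) (fun g => hl g.succ) (x + l 0) (P + 1)).trans
        (subsetWeight_mono ht (hmono x _ (by have := hl 0; omega)) (P + 1) m)
      have h5 := ihP (x + 1)
      rw [← h1] at h5
      rw [← h2] at h3
      rw [hcard x]
      set h := (H.filter fun y => x + 1 ≤ y).card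
      split_ifs with hx
      · refine le_trans ?_ (subsetWeight_add_le ht h P m)
        exact add_le_add h5 (mul_le_mul_of_nonneg_left h3 (by linarith))
      · rw [one_mul, add_zero, subsetWeight_succ_mid]
        exact add_le_add h5 h3

/-- Raising the index by one multiplies the binomial coefficient by `(P + i) / i` for some `i ≤ m`,
and this ratio is smallest at `i = m`. -/
lemma choose_le_mul_pow (P m j k : ℕ) (hjk : j + k ≤ m) : ((P + j).choose j : ℝ)
    ≤ ((P + (j + k)).choose (j + k) : ℝ) * ((m : ℝ) / (P + m)) ^ k := by
  induction k with
  | zero => simp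
  | succ k ih =>
    refine (ih (by omega)).trans ?_
    rw [pow_succ', ← mul_assoc]
    refine mul_le_mul_of_nonneg_right ?_ (by positivity)
    have hm : (0 : ℝ) < P + m := by
      have : 0 < P + m := by omega
      exact_mod_cast this
    have h1 := Nat.add_one_mul_choose_eq (P + (j + k)) (j + k)
    have h2 : (((P + (j + k) + 1 : ℕ) : ℝ)) * ((P + (j + k)).choose (j + k) : ℝ)
        = ((P + (j + k) + 1).choose (j + k + 1) : ℝ) * ((j + k + 1 : ℕ) : ℝ) := by
      exact_mod_cast h1
    rw [mul_div_assoc', le_div_iff₀ hm]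
    have h3 : P + (j + (k + 1)) = P + (j + k) + 1 := by omega
    have h4 : j + (k + 1) = j + k + 1 := by omega
    rw [h3, h4]
    set A : ℝ := ((P + (j + k)).choose (j + k) : ℝ)
    set B : ℝ := ((P + (j + k) + 1).choose (j + k + 1) : ℝ)
    have hA : 0 ≤ A := Nat.cast_nonneg _
    have hB : 0 ≤ B := Nat.cast_nonneg _
    have h5 : ((j + k + 1 : ℕ) : ℝ) ≤ m := Nat.cast_le.2 (by omega)
    have h6 : (0 : ℝ) < ((P + (j + k) + 1 : ℕ) : ℝ) := by exact_mod_cast Nat.succ_pos _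
    have h7 : ((P + (j + k) + 1 : ℕ) : ℝ) = P + ((j + k + 1 : ℕ) : ℝ) := by push_cast; ring
    have hP : (0 : ℝ) ≤ P := Nat.cast_nonneg _
    rw [h7] at h2 h6
    set q : ℝ := ((j + k + 1 : ℕ) : ℝ)
    have h8 : A * (P + m) * (P + q) ≤ B * m * (P + q) := by
      have : A * (P + m) * (P + q) = B * q * (P + m) := by rw [← h2]; ring
      rw [this]
      have h9 : q * (P + m) ≤ m * (P + q) := by nlinarith
      nlinarith
    exact le_of_mul_le_mul_right h8 h6

/-- Each of the `i` prescribed marked places costs a factor `m / (P + m)`, the density of the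
starting points. The binomial theorem sums these costs to `(1 + t m / (P + m)) ^ h`. -/
lemma subsetWeight_le (ht : 0 ≤ t) (h P m : ℕ) : subsetWeight t h P m
    ≤ ((P + m).choose m : ℝ) * Real.exp (t * ((m : ℝ) / (P + m)) * h) := by
  set u : ℝ := (m : ℝ) / (P + m) with hu
  have hu0 : 0 ≤ u := by positivity
  have h1 : subsetWeight t h P m
      ≤ ∑ ij ∈ Finset.HasAntidiagonal.antidiagonal m, (h.choose ij.1 : ℝ) * t ^ ij.1 *
        (((P + m).choose m : ℝ) * u ^ ij.1) := by
    refine Finset.sum_le_sum fun ij hij => ?_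
    rw [Finset.HasAntidiagonal.mem_antidiagonal] at hij
    have := choose_le_mul_pow P m ij.2 ij.1 (by omega)
    rw [show ij.2 + ij.1 = m by omega] at this
    gcongr
  have h2 : ∑ ij ∈ Finset.HasAntidiagonal.antidiagonal m, (h.choose ij.1 : ℝ) * t ^ ij.1 *
        (((P + m).choose m : ℝ) * u ^ ij.1)
      = ((P + m).choose m : ℝ) * ∑ k ∈ Finset.range (m + 1), (t * u) ^ k * (h.choose k : ℝ) := by
    rw [Finset.Nat.sum_antidiagonal_eq_sum_range_succ_mk, Finset.mul_sum]
    exact Finset.sum_congr rfl fun k _ => by rw [mul_pow]; ring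
  have h3 : ∑ k ∈ Finset.range (m + 1), (t * u) ^ k * (h.choose k : ℝ) ≤ (1 + t * u) ^ h := by
    rw [add_comm 1, add_pow]
    simp only [one_pow, mul_one]
    calc ∑ k ∈ Finset.range (m + 1), (t * u) ^ k * (h.choose k : ℝ)
        ≤ ∑ k ∈ Finset.range (m + 1 + (h + 1)), (t * u) ^ k * (h.choose k : ℝ) :=
          Finset.sum_le_sum_of_subset_of_nonneg (Finset.range_subset_range.2 (by omega))
            fun _ _ _ => by positivity
      _ = ∑ k ∈ Finset.range (h + 1), (t * u) ^ k * (h.choose k : ℝ) := by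
          refine (Finset.sum_subset (Finset.range_subset_range.2 (by omega)) fun k _ hk => ?_).symm
          rw [Finset.mem_range] at hk
          rw [Nat.choose_eq_zero_of_lt (by omega), Nat.cast_zero, mul_zero]
  have h4 : (1 + t * u) ^ h ≤ Real.exp (t * u * h) := by
    rw [mul_comm (t * u), Real.exp_nat_mul]
    exact pow_le_pow_left₀ (by positivity) (by linarith [Real.add_one_le_exp (t * u)]) h
  refine h1.trans (h2.trans_le ?_)
  exact mul_le_mul_of_nonneg_left (h3.trans h4) (Nat.cast_nonneg _)

/-- Under the uniform law on arrangements, the number of intervals that start in `H` has lighter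
exponential moments than a Poisson variable. -/
lemma arrWeight_le_card_mul_exp {H : Finset ℕ} (ht : 0 ≤ t) {m : ℕ} (l : Fin m → ℕ)
    (hl : ∀ g, 1 ≤ l g) (P : ℕ) : arrWeight H t l 0 (∑ g, l g + P)
      ≤ ((arrangements l 0 (∑ g, l g + P)).card : ℝ) *
        Real.exp (t * ((m : ℝ) / (P + m)) * H.card) := by
  have h1 := arrWeight_le (H := H) ht l hl 0 P
  have h2 := card_arrangements l hl 0 P
  rw [zero_add] at h1 h2
  rw [h2]
  refine h1.trans ((subsetWeight_mono ht (Finset.card_filter_le _ _) P m).trans ?_)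
  exact subsetWeight_le ht _ P m

end Counting

/-! ### Moments of the overlap of two signals -/

section Moments

variable {ϖ : ℝ}

lemma pow_div_factorial_le_cosh (x : ℝ) (j : ℕ) :
    x ^ (2 * j) / ((2 * j).factorial : ℝ) ≤ Real.cosh x :=
  le_hasSum (Real.hasSum_cosh x) j fun i _ =>
    div_nonneg ((even_two_mul i).pow_nonneg x) (Nat.cast_nonneg _)

/-- Even moments are controlled by the exponential moments. -/
lemma sum_mul_pow_le {ι : Type*} (s : Finset ι) {w : ι → ℝ} (hw : ∀ i, 0 ≤ w i) (X : ι → ℝ)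
    {A B : ℝ} (hA : 0 < A)
    (h : ∀ u, u = (√A)⁻¹ ∨ u = -(√A)⁻¹ → ∑ i ∈ s, w i * Real.exp (u * X i) ≤ B) (j : ℕ) :
    ∑ i ∈ s, w i * X i ^ (2 * j) ≤ ((2 * j).factorial : ℝ) * B * A ^ j := by
  have hA' : 0 < √A := Real.sqrt_pos.2 hA
  set u := (√A)⁻¹ with hu
  have h1 : ∀ i ∈ s, w i * X i ^ (2 * j) ≤ ((2 * j).factorial : ℝ) * A ^ j *
      ((w i * Real.exp (u * X i) + w i * Real.exp (-u * X i)) / 2) := by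
    intro i _
    have h2 := pow_div_factorial_le_cosh (u * X i) j
    rw [div_le_iff₀ (by positivity), mul_pow, Real.cosh_eq] at h2
    have h3 : A ^ j * u ^ (2 * j) = 1 := by
      rw [pow_mul, hu, inv_pow, Real.sq_sqrt hA.le, ← mul_pow, mul_inv_cancel₀ hA.ne', one_pow]
    calc w i * X i ^ (2 * j) = w i * A ^ j * (u ^ (2 * j) * X i ^ (2 * j)) := by
          rw [mul_assoc, ← mul_assoc (A ^ j), h3, one_mul]
      _ ≤ w i * A ^ j * ((Real.exp (u * X i) + Real.exp (-(u * X i))) / 2 *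
            ((2 * j).factorial : ℝ)) :=
          mul_le_mul_of_nonneg_left h2 (mul_nonneg (hw i) (by positivity))
      _ = _ := by rw [neg_mul]; ring
  refine (Finset.sum_le_sum h1).trans ?_
  rw [← Finset.mul_sum, ← Finset.sum_div, Finset.sum_add_distrib, mul_right_comm]
  have h4 := h u (Or.inl rfl)
  have h5 := h (-u) (Or.inr rfl)
  have h6 : 0 ≤ ((2 * j).factorial : ℝ) * A ^ j := by positivity
  rw [mul_right_comm, mul_right_comm _ B]
  exact mul_le_mul_of_nonneg_left (by linarith) h6

/-- For arguments of absolute value at most one the exponential is at most `1 + x + x²`, and the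
linear term vanishes since the labels are centred. -/
lemma sum_labW_mul_exp_le (hϖ : 0 < ϖ) {u : ℝ} (hu : |u| * (1 + ϖ) ≤ 1) :
    ∑ c, labW ϖ c * Real.exp (u * lab ϖ c) ≤ Real.exp ((u * (1 + ϖ)) ^ 2) := by
  have h1 : ∀ c, labW ϖ c * Real.exp (u * lab ϖ c)
      ≤ labW ϖ c + u * (labW ϖ c * lab ϖ c) + labW ϖ c * (u * (1 + ϖ)) ^ 2 := by
    intro c
    have h2 : |u * lab ϖ c| ≤ |u| * (1 + ϖ) := by
      rw [abs_mul]; exact mul_le_mul_of_nonneg_left (abs_lab_le hϖ c) (abs_nonneg u)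
    have h3 := (abs_le.1 (Real.abs_exp_sub_one_sub_id_le (h2.trans hu))).2
    have h4 : (u * lab ϖ c) ^ 2 ≤ (u * (1 + ϖ)) ^ 2 := by
      rw [← sq_abs, ← sq_abs (u * (1 + ϖ)), abs_mul u (1 + ϖ), abs_of_pos (by linarith : 0 < 1 + ϖ)]
      exact pow_le_pow_left₀ (abs_nonneg _) h2 2
    have h5 := mul_le_mul_of_nonneg_left
      (show Real.exp (u * lab ϖ c) ≤ 1 + u * lab ϖ c + (u * (1 + ϖ)) ^ 2 by linarith)
      (labW_nonneg hϖ c)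
    linarith
  refine (Finset.sum_le_sum fun c _ => h1 c).trans ?_
  rw [Finset.sum_add_distrib, Finset.sum_add_distrib, ← Finset.mul_sum, ← Finset.sum_mul,
    sum_labW hϖ, sum_labW_mul_lab hϖ, mul_zero, add_zero, one_mul, add_comm]
  exact Real.add_one_le_exp _

/-- The moments of the overlap of two independent label vectors. -/
lemma sum_labProd_mul_pow_le (hϖ : 0 < ϖ) {N : ℕ} (hN : 1 ≤ N) (j : ℕ) :
    ∑ b : Fin N → Bool, ∑ b' : Fin N → Bool, labProd ϖ b * labProd ϖ b' *
        (∑ i, lab ϖ (b i) * lab ϖ (b' i)) ^ (2 * j)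
      ≤ ((2 * j).factorial : ℝ) * Real.exp 1 * ((1 + ϖ) ^ 4 * N) ^ j := by
  have hN' : (1 : ℝ) ≤ N := by exact_mod_cast hN
  have hϖ1 : 1 ≤ 1 + ϖ := by linarith
  have hA : 0 < (1 + ϖ) ^ 4 * (N : ℝ) := by positivity
  have key : ∀ b : Fin N → Bool, ∑ b' : Fin N → Bool, labProd ϖ b' *
        (∑ i, lab ϖ (b i) * lab ϖ (b' i)) ^ (2 * j)
      ≤ ((2 * j).factorial : ℝ) * Real.exp 1 * ((1 + ϖ) ^ 4 * N) ^ j := by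
    intro b
    refine sum_mul_pow_le Finset.univ (fun b' => labProd_nonneg hϖ b') _ hA (fun u hu => ?_) j
    have hu2 : |u| = (√((1 + ϖ) ^ 4 * N))⁻¹ := by
      have : 0 ≤ (√((1 + ϖ) ^ 4 * (N : ℝ)))⁻¹ := by positivity
      rcases hu with rfl | rfl
      · exact abs_of_nonneg this
      · rw [abs_neg, abs_of_nonneg this]
    have hsq : √((1 + ϖ) ^ 4 * (N : ℝ)) = (1 + ϖ) ^ 2 * √N := by
      rw [Real.sqrt_mul (by positivity), show (1 + ϖ) ^ 4 = ((1 + ϖ) ^ 2) ^ 2 by ring,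
        Real.sqrt_sq (by positivity)]
    have hsN : 1 ≤ √(N : ℝ) := Real.one_le_sqrt.2 hN'
    -- With `|u| = 1 / ((1 + ϖ)² √N)` each of the `N` independent factors has exponential moment at
    -- most `exp (1 / N)`, so the product is at most `exp 1`.
    have h1 : ∀ i, ∑ c, labW ϖ c * Real.exp (u * lab ϖ (b i) * lab ϖ c) ≤ Real.exp (1 / N) := by
      intro i
      have h2 : |u * lab ϖ (b i)| * (1 + ϖ) ≤ (√N)⁻¹ := by
        rw [abs_mul, hu2, hsq, mul_inv]
        calc (((1 + ϖ) ^ 2)⁻¹ * (√N)⁻¹) * |lab ϖ (b i)| * (1 + ϖ)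
            ≤ (((1 + ϖ) ^ 2)⁻¹ * (√N)⁻¹) * (1 + ϖ) * (1 + ϖ) := by
              gcongr; exact abs_lab_le hϖ _
          _ = (√N)⁻¹ := by field_simp
      refine (sum_labW_mul_exp_le hϖ (h2.trans (inv_le_one_of_one_le₀ hsN))).trans ?_
      refine Real.exp_le_exp.2 ?_
      rw [← sq_abs, abs_mul, abs_of_nonneg (by linarith : 0 ≤ 1 + ϖ)]
      refine (pow_le_pow_left₀ (by positivity) h2 2).trans ?_
      rw [inv_pow, Real.sq_sqrt (by positivity), one_div]
    calc ∑ b' : Fin N → Bool, labProd ϖ b' * Real.exp (u * ∑ i, lab ϖ (b i) * lab ϖ (b' i))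
        = ∑ b' : Fin N → Bool, ∏ i, labW ϖ (b' i) * Real.exp (u * lab ϖ (b i) * lab ϖ (b' i)) := by
          refine Finset.sum_congr rfl fun b' _ => ?_
          rw [labProd, Finset.prod_mul_distrib, ← Real.exp_sum, Finset.mul_sum]
          simp only [mul_assoc]
      _ = ∏ i, ∑ c, labW ϖ c * Real.exp (u * lab ϖ (b i) * lab ϖ c) :=
          sum_prod_bool fun i c => labW ϖ c * Real.exp (u * lab ϖ (b i) * lab ϖ c)
      _ ≤ ∏ _i : Fin N, Real.exp (1 / N) := Finset.prod_le_prod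
          (fun i _ => Finset.sum_nonneg fun c _ =>
            mul_nonneg (labW_nonneg hϖ c) (Real.exp_pos _).le) fun i _ => h1 i
      _ = Real.exp 1 := by
          rw [Finset.prod_const, Finset.card_univ, Fintype.card_fin, ← Real.exp_nat_mul]
          congr 1; field_simp
  calc _ = ∑ b : Fin N → Bool, labProd ϖ b * ∑ b' : Fin N → Bool, labProd ϖ b' *
        (∑ i, lab ϖ (b i) * lab ϖ (b' i)) ^ (2 * j) := by
        simp only [Finset.mul_sum, mul_assoc]
    _ ≤ ∑ b : Fin N → Bool, labProd ϖ b *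
        (((2 * j).factorial : ℝ) * Real.exp 1 * ((1 + ϖ) ^ 4 * N) ^ j) :=
        Finset.sum_le_sum fun b _ => mul_le_mul_of_nonneg_left (key b) (labProd_nonneg hϖ b)
    _ = _ := by rw [← Finset.sum_mul, sum_labProd hϖ, one_mul]

/-- The sign encoded by a Boolean. -/
def boolSign (b : Bool) : ℝ := if b then 1 else -1

lemma abs_boolSign (b : Bool) : |boolSign b| = 1 := by cases b <;> simp [boolSign]

lemma boolSign_not (b : Bool) : boolSign (!b) = -boolSign b := by cases b <;> simp [boolSign]

lemma boolSign_injective : Function.Injective boolSign := by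
  intro b c h
  cases b <;> cases c <;> first | rfl | (norm_num [boolSign] at h)

/-- Reversing all signs is a bijection that negates each term. -/
lemma sum_boolSign_pow_odd {m : ℕ} (c : Fin m → ℝ) {k : ℕ} (hk : Odd k) :
    ∑ e : Fin m → Bool, (∑ g, boolSign (e g) * c g) ^ k = 0 := by
  have h : ∑ e : Fin m → Bool, (∑ g, boolSign (e g) * c g) ^ k
      = ∑ e : Fin m → Bool, -(∑ g, boolSign (e g) * c g) ^ k := by
    refine Fintype.sum_equiv (Equiv.piCongrRight fun _ => Equiv.boolNot) _ _ fun e => ?_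
    rw [← hk.neg_pow, ← Finset.sum_neg_distrib]
    simp [boolSign_not]
  rw [Finset.sum_neg_distrib] at h
  linarith

/-- Rademacher sums are sub-Gaussian because `cosh x ≤ exp (x² / 2)`; the variance bound `A` sets
the scale of the exponential moment. -/
lemma sum_boolSign_pow_le {m : ℕ} (c : Fin m → ℝ) {A : ℝ} (hA : 0 < A) (hc : ∑ g, c g ^ 2 ≤ A)
    (j : ℕ) : ∑ e : Fin m → Bool, (∑ g, boolSign (e g) * c g) ^ (2 * j)
      ≤ ((2 * j).factorial : ℝ) * (2 ^ m * Real.exp (1 / 2)) * A ^ j := by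
  have := sum_mul_pow_le (Finset.univ : Finset (Fin m → Bool)) (w := fun _ => 1)
    (fun _ => zero_le_one) (fun e => ∑ g, boolSign (e g) * c g) hA
    (B := 2 ^ m * Real.exp (1 / 2)) (fun u hu => ?_) j
  · simpa using this
  have hu2 : u ^ 2 = A⁻¹ := by
    rcases hu with rfl | rfl <;> simp [Real.sq_sqrt hA.le]
  calc ∑ e : Fin m → Bool, 1 * Real.exp (u * ∑ g, boolSign (e g) * c g)
      = ∑ e : Fin m → Bool, ∏ g, Real.exp (u * (boolSign (e g) * c g)) := by
        simp [← Real.exp_sum, Finset.mul_sum]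
    _ = ∏ g, ∑ b : Bool, Real.exp (u * (boolSign b * c g)) :=
        sum_prod_bool fun g b => Real.exp (u * (boolSign b * c g))
    _ ≤ ∏ g, 2 * Real.exp (u ^ 2 * c g ^ 2 / 2) := by
        refine Finset.prod_le_prod (fun g _ => Finset.sum_nonneg fun b _ => (Real.exp_pos _).le)
          fun g _ => ?_
        have := Real.cosh_le_exp_half_sq (u * c g)
        rw [Real.cosh_eq, mul_pow] at this
        simp only [Fintype.sum_bool, boolSign, if_true, Bool.false_eq_true, if_false, one_mul,
          neg_one_mul, mul_neg]
        linarith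
    _ = 2 ^ m * Real.exp (u ^ 2 * (∑ g, c g ^ 2) / 2) := by
        rw [Finset.prod_mul_distrib, ← Real.exp_sum]
        simp [← Finset.sum_div, ← Finset.mul_sum]
    _ ≤ _ := by
        refine mul_le_mul_of_nonneg_left (Real.exp_le_exp.2 ?_) (by positivity)
        rw [hu2, inv_mul_eq_div]
        have : (∑ g, c g ^ 2) / A ≤ 1 := (div_le_one hA).2 hc
        linarith

end Moments
/-! ### The uniform prior on block signals -/

section Prior

variable {p G m : ℕ} {len s s' : Fin m → ℕ}

/-- The required gap is attached to the right end of each block. The line is extended by `G` because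
the last block needs no gap after it. -/
lemma isPlacement_iff_mem_arrangements :
    IsPlacement p G len s ↔ s ∈ arrangements (fun g => len g + G) 0 (p + G) := by
  rw [mem_arrangements]
  constructor
  · intro h
    refine ⟨fun g => Nat.zero_le _, fun g => ?_, fun g k hgk => ?_⟩
    · have := h.1 g; omega
    · have := h.add_le hgk; omega
  · rintro ⟨-, h1, h2⟩
    refine ⟨fun g => ?_, fun g k hgk => ?_⟩
    · have := h1 g; omega
    · have := h2 g k (by rw [Fin.lt_def]; omega); omega

/-- The block signal with signs `e` and absolute value `δ`. -/
def signSignal (p : ℕ) (δ : ℝ) (len s : Fin m → ℕ) (e : Fin m → Bool) : Fin p → ℝ :=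
  blockSignal p len s fun g => boolSign (e g) * δ

lemma IsPlacement.signSignal_of_mem (h : IsPlacement p G len s) {δ : ℝ} {e : Fin m → Bool}
    {g : Fin m} {j : Fin p} (hj : j ∈ blk p (s g) (len g)) :
    signSignal p δ len s e j = boolSign (e g) * δ :=
  h.apply_of_mem hj

lemma IsPlacement.exists_mem_of_signSignal_ne_zero {δ : ℝ} {e : Fin m → Bool} {j : Fin p}
    (hj : signSignal p δ len s e j ≠ 0) : ∃ g, j ∈ blk p (s g) (len g) := by
  by_contra! hn
  exact hj (blockSignal_of_notMem hn)

lemma IsPlacement.abs_signSignal_le (h : IsPlacement p G len s) {δ : ℝ} (hδ : 0 ≤ δ)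
    (e : Fin m → Bool) (j : Fin p) : |signSignal p δ len s e j| ≤ δ := by
  by_cases hj : signSignal p δ len s e j = 0
  · rw [hj, abs_zero]; exact hδ
  · obtain ⟨g, hg⟩ := exists_mem_of_signSignal_ne_zero hj
    rw [h.signSignal_of_mem hg, abs_mul, abs_boolSign, one_mul, abs_of_nonneg hδ]

/-- If the block of the first signal started earlier, its first point would lie in no block of the
second: the preceding blocks coincide and end before it, and the later ones start after it. -/
lemma IsPlacement.le_of_signSignal_eq (h : IsPlacement p G len s)
    (hlen : ∀ g, 1 ≤ len g) {δ : ℝ} (hδ : δ ≠ 0) {e e' : Fin m → Bool}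
    (heq : signSignal p δ len s e = signSignal p δ len s' e') (h' : IsPlacement p G len s')
    {g : Fin m} (hg : ∀ k < g, s k = s' k) : s' g ≤ s g := by
  by_contra! hlt
  have hj : s g < p := by have := h.1 g; have := hlen g; omega
  have hmem : (⟨s g, hj⟩ : Fin p) ∈ blk p (s g) (len g) := by
    rw [mem_blk]; have := hlen g; exact ⟨le_rfl, by simp only []; omega⟩
  have hne : signSignal p δ len s' e' ⟨s g, hj⟩ ≠ 0 := by
    rw [← heq, h.signSignal_of_mem hmem]
    refine mul_ne_zero (fun h0 => ?_) hδ
    have := abs_boolSign (e g)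
    rw [h0, abs_zero] at this
    exact zero_ne_one this
  obtain ⟨k, hk⟩ := exists_mem_of_signSignal_ne_zero hne
  rw [mem_blk] at hk
  simp only [] at hk
  rcases lt_trichotomy k g with hkg | rfl | hkg
  · have h1 := h.add_le hkg
    have h2 := hg k hkg
    omega
  · omega
  · have h1 := h'.add_le hkg
    omega

/-- Starting points are recovered from left to right, then the signs from the values. Hence a
uniform law on placements and signs induces the uniform law on the class of signals, with no
multiplicities. -/
lemma signSignal_inj (h : IsPlacement p G len s) (h' : IsPlacement p G len s')
    (hlen : ∀ g, 1 ≤ len g) {δ : ℝ} (hδ : δ ≠ 0) {e e' : Fin m → Bool}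
    (heq : signSignal p δ len s e = signSignal p δ len s' e') : s = s' ∧ e = e' := by
  have hs : ∀ k : ℕ, ∀ g : Fin m, (g : ℕ) = k → s g = s' g := by
    intro k
    induction k using Nat.strong_induction_on with
    | _ k ih =>
      intro g hgk
      have hlt : ∀ i < g, s i = s' i := fun i hi => ih i (by rw [← hgk]; exact hi) i rfl
      exact le_antisymm (h'.le_of_signSignal_eq hlen hδ heq.symm h fun i hi => (hlt i hi).symm)
        (h.le_of_signSignal_eq hlen hδ heq h' hlt)
  obtain rfl : s = s' := funext fun g => hs g g rfl
  refine ⟨rfl, funext fun g => ?_⟩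
  have hj : s g < p := by have := h.1 g; have := hlen g; omega
  have hmem : (⟨s g, hj⟩ : Fin p) ∈ blk p (s g) (len g) := by
    rw [mem_blk]; have := hlen g; exact ⟨le_rfl, by simp only []; omega⟩
  have := congrFun heq ⟨s g, hj⟩
  rw [h.signSignal_of_mem hmem, h.signSignal_of_mem hmem] at this
  exact boolSign_injective (mul_right_cancel₀ hδ this)

lemma inner_signSignal (δ : ℝ) (e : Fin m → Bool) (F : Fin p → ℝ) :
    ∑ j, signSignal p δ len s e j * F j
      = ∑ g, boolSign (e g) * (δ * ∑ j ∈ blk p (s g) (len g), F j) := by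
  unfold signSignal
  rw [sum_blockSignal_mul]
  exact Finset.sum_congr rfl fun g _ => by ring

/-- The starting points from which a block of length at most `w` may hit given blocks. -/
def hitSet (w : ℕ) (len s : Fin m → ℕ) : Finset ℕ :=
  Finset.univ.biUnion fun k => Finset.Ico (s k + 1 - w) (s k + len k)

/-- Each fixed block is hit only from starting points in an interval of fewer than `2 w` integers.
-/
lemma card_hitSet_le {w : ℕ} (hlen : ∀ g, len g ≤ w) : (hitSet w len s).card ≤ m * (2 * w) := by
  refine Finset.card_biUnion_le.trans ?_
  refine (Finset.sum_le_sum fun k _ => (show _ ≤ 2 * w from ?_)).trans ?_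
  · rw [Nat.card_Ico]; have := hlen k; omega
  · simp

/-- The overlap with a fixed signal of the part of the signal on one block. -/
lemma sq_overlap_le (h' : IsPlacement p G len s') {w : ℕ} (hlen : ∀ g, len g ≤ w) {δ : ℝ}
    (hδ : 0 ≤ δ) (e' : Fin m → Bool) (g : Fin m) :
    (δ * ∑ j ∈ blk p (s g) (len g), signSignal p δ len s' e' j) ^ 2
      ≤ (δ ^ 2 * w) ^ 2 * if s g ∈ hitSet w len s' then 1 else 0 := by
  split_ifs with hg
  · rw [mul_one, ← sq_abs]
    refine pow_le_pow_left₀ (abs_nonneg _) ?_ 2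
    rw [abs_mul, abs_of_nonneg hδ, pow_two, mul_assoc]
    refine mul_le_mul_of_nonneg_left ?_ hδ
    refine (Finset.abs_sum_le_sum_abs _ _).trans ?_
    refine (Finset.sum_le_sum fun j _ => h'.abs_signSignal_le hδ e' j).trans ?_
    rw [Finset.sum_const, nsmul_eq_mul, mul_comm]
    refine mul_le_mul_of_nonneg_left (Nat.cast_le.2 ?_) hδ
    refine le_trans ?_ (hlen g)
    have : (blk p (s g) (len g)).map Fin.valEmbedding ⊆ Finset.Ico (s g) (s g + len g) := by
      intro j hj
      obtain ⟨i, hi, rfl⟩ := Finset.mem_map.1 hj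
      exact Finset.mem_Ico.2 (mem_blk.1 hi)
    have := Finset.card_le_card this
    rw [Finset.card_map, Nat.card_Ico] at this
    omega
  · rw [mul_zero, Finset.sum_eq_zero, mul_zero, zero_pow two_ne_zero]
    intro j hj
    by_contra hne
    obtain ⟨k, hk⟩ := IsPlacement.exists_mem_of_signSignal_ne_zero hne
    rw [mem_blk] at hj hk
    refine hg (Finset.mem_biUnion.2 ⟨k, Finset.mem_univ k, Finset.mem_Ico.2 ?_⟩)
    have := hlen g
    omega

/-- A power of the number of hits is dominated by an exponential, which in turn is bounded by `(1 +
1 / lam) ^ n`. The latter is a product over the blocks, the form that `arrWeight` averages. -/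
lemma natCast_pow_le_exp {v lam : ℝ} (hv : 0 ≤ v) (hlam : 1 ≤ lam) (n j : ℕ) (hvn : v = n) :
    (v + 1) ^ j ≤ (j.factorial : ℝ) * (2 * lam) ^ j * (2 * (1 + 1 / lam) ^ n) := by
  have hl : 0 < lam := by linarith
  have ht : 1 / lam ≤ 1 := (div_le_one hl).2 hlam
  have ht0 : 0 < 1 / lam := by positivity
  have h1 : Real.exp (1 / (2 * lam)) ≤ 1 + 1 / lam := by
    have h2 : 1 / (2 * lam) = (1 / lam) / 2 := by field_simp
    have h3 := (abs_le.1 (Real.abs_exp_sub_one_sub_id_le (x := (1 / lam) / 2)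
      (by rw [abs_of_pos (by positivity)]; linarith))).2
    rw [h2]
    nlinarith
  have h4 := Real.pow_div_factorial_le_exp ((v + 1) / (2 * lam)) (by positivity) j
  rw [div_pow, div_div, div_le_iff₀ (by positivity)] at h4
  refine h4.trans ?_
  have h5 : Real.exp ((v + 1) / (2 * lam)) ≤ 2 * (1 + 1 / lam) ^ n := by
    have : (v + 1) / (2 * lam) = (n + 1 : ℕ) * (1 / (2 * lam)) := by
      rw [hvn]; push_cast; ring
    rw [this, Real.exp_nat_mul]
    refine (pow_le_pow_left₀ (Real.exp_pos _).le h1 _).trans ?_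
    rw [pow_succ, mul_comm]
    have : 0 ≤ (1 + 1 / lam) ^ n := by positivity
    nlinarith
  calc Real.exp ((v + 1) / (2 * lam)) * ((2 * lam) ^ j * (j.factorial : ℝ))
      ≤ (2 * (1 + 1 / lam) ^ n) * ((2 * lam) ^ j * (j.factorial : ℝ)) := by gcongr
    _ = _ := by ring

/-- The moments of the overlap of a random block signal with a fixed one. -/
lemma sum_signSignal_pow_le (h' : IsPlacement p G len s') {w : ℕ} (hlen : ∀ g, len g ≤ w)
    (hlen1 : ∀ g, 1 ≤ len g) (hm : 1 ≤ m) {δ : ℝ} (hδ : 0 < δ) (e' : Fin m → Bool) {P : ℕ}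
    (hP : p + G = ∑ g, (len g + G) + P) {lam : ℝ} (hlam : 1 ≤ lam)
    (hlam' : (m : ℝ) / (P + m) * (m * (2 * w)) ≤ lam) (j : ℕ) :
    ∑ s ∈ arrangements (fun g => len g + G) 0 (p + G), ∑ e : Fin m → Bool,
        (∑ i, signSignal p δ len s e i * signSignal p δ len s' e' i) ^ (2 * j)
      ≤ ((arrangements (fun g => len g + G) 0 (p + G)).card : ℝ) * 2 ^ m *
        (((2 * j).factorial : ℝ) * j.factorial * (2 * Real.exp (3 / 2)) *
          (2 * (δ ^ 2 * w) ^ 2 * lam) ^ j) := by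
  have hw : 0 < w := lt_of_lt_of_le (hlen1 ⟨0, hm⟩) (hlen _)
  have hw' : (0 : ℝ) < w := by exact_mod_cast hw
  set κ := (δ ^ 2 * w) ^ 2 with hκ
  have hκ0 : 0 < κ := by positivity
  set H := hitSet w len s' with hH
  have hl0 : 0 < lam := by linarith
  have h1 : ∀ s : Fin m → ℕ, ∑ e : Fin m → Bool,
        (∑ i, signSignal p δ len s e i * signSignal p δ len s' e' i) ^ (2 * j)
      ≤ (2 ^ m * (((2 * j).factorial : ℝ) * j.factorial * (2 * Real.exp (1 / 2)) *
          (2 * κ * lam) ^ j)) * ∏ g, if s g ∈ H then 1 + 1 / lam else 1 := by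
    intro s
    set n := (Finset.univ.filter fun g => s g ∈ H).card with hn
    simp only [inner_signSignal]
    -- For a fixed placement only the `n` hitting blocks contribute, each with squared overlap at
    -- most `κ`. The additional one in `n + 1` keeps the variance bound positive when nothing is
    -- hit.
    refine (sum_boolSign_pow_le _ (A := κ * (n + 1)) (by positivity) ?_ j).trans ?_
    · refine (Finset.sum_le_sum fun g _ => sq_overlap_le h' hlen hδ.le e' g).trans ?_
      rw [← Finset.mul_sum, Finset.sum_boole]
      gcongr
      rw [← hn]; linarith
    · rw [Finset.prod_ite, Finset.prod_const_one, mul_one, Finset.prod_const, ← hn, mul_pow]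
      have := natCast_pow_le_exp (Nat.cast_nonneg n) hlam n j rfl
      calc ((2 * j).factorial : ℝ) * (2 ^ m * Real.exp (1 / 2)) * (κ ^ j * ((n : ℝ) + 1) ^ j)
          ≤ ((2 * j).factorial : ℝ) * (2 ^ m * Real.exp (1 / 2)) * (κ ^ j *
            ((j.factorial : ℝ) * (2 * lam) ^ j * (2 * (1 + 1 / lam) ^ n))) := by gcongr
        _ = _ := by rw [show 2 * κ * lam = κ * (2 * lam) by ring, mul_pow κ]; ring
  refine (Finset.sum_le_sum fun s _ => h1 s).trans ?_
  rw [← Finset.mul_sum]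
  -- Since `lam` dominates the bound for the expected number of hits, the parameter `1 / lam` makes
  -- the exponential moment at most `exp 1`.
  have h2 := arrWeight_le_card_mul_exp (H := H) (t := 1 / lam) (by positivity)
    (fun g => len g + G) (fun g => (hlen1 g).trans (Nat.le_add_right _ _)) P
  rw [← hP] at h2
  have h3 : Real.exp (1 / lam * ((m : ℝ) / (P + m)) * H.card) ≤ Real.exp 1 := by
    refine Real.exp_le_exp.2 ?_
    have h4 : (H.card : ℝ) ≤ m * (2 * w) := by exact_mod_cast card_hitSet_le hlen
    rw [mul_assoc, one_div_mul_eq_div, div_le_one hl0]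
    refine le_trans ?_ hlam'
    gcongr
  have h5 : (∑ s ∈ arrangements (fun g => len g + G) 0 (p + G),
      ∏ g, if s g ∈ H then 1 + 1 / lam else 1)
      ≤ ((arrangements (fun g => len g + G) 0 (p + G)).card : ℝ) * Real.exp 1 :=
    h2.trans (mul_le_mul_of_nonneg_left h3 (Nat.cast_nonneg _))
  refine (mul_le_mul_of_nonneg_left h5 (by positivity)).trans (le_of_eq ?_)
  rw [show (3 : ℝ) / 2 = 1 / 2 + 1 by norm_num, Real.exp_add]
  ring

end Prior
/-! ### The second moment of the low-degree likelihood ratio -/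

section LowDegree

variable {ϖ : ℝ} {p G m N : ℕ}

/-- The parameters of the prior: starting points, signs and labels. -/
abbrev PriorIndex (p G : ℕ) {m : ℕ} (len : Fin m → ℕ) (N : ℕ) : Type :=
  (arrangements (fun g => len g + G) 0 (p + G)) × (Fin m → Bool) × (Fin N → Bool)

/-- The prior weights. -/
def priorWeight (ϖ : ℝ) {len : Fin m → ℕ} (ω : PriorIndex p G len N) : ℝ :=
  (((arrangements (fun g => len g + G) 0 (p + G)).card : ℝ) * 2 ^ m)⁻¹ * labProd ϖ ω.2.2

/-- The means of the entries of the data matrix. -/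
def priorMean (ϖ δ : ℝ) {len : Fin m → ℕ} (ω : PriorIndex p G len N) : Fin N → Fin p → ℝ :=
  meanMat ϖ ω.2.2 (signSignal p δ len ω.1 ω.2.1)

lemma priorWeight_nonneg (hϖ : 0 < ϖ) {len : Fin m → ℕ} (ω : PriorIndex p G len N) :
    0 ≤ priorWeight ϖ ω :=
  mul_nonneg (by positivity) (labProd_nonneg hϖ _)

/-- Mean matrices have rank one, so their inner product separates into labels and signals, which are
independent under the prior. -/
lemma sum_meanMat_mul (b b' : Fin N → Bool) (μ μ' : Fin p → ℝ) :
    ∑ i, ∑ j, meanMat ϖ b μ i j * meanMat ϖ b' μ' i j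
      = (∑ i, lab ϖ (b i) * lab ϖ (b' i)) * ∑ j, μ j * μ' j := by
  rw [Finset.sum_mul_sum]
  refine Finset.sum_congr rfl fun i _ => Finset.sum_congr rfl fun j _ => ?_
  unfold meanMat
  ring

lemma sum_four_comm {ι κ : Type*} [Fintype ι] [Fintype κ] (c : ℝ) (F : ι → κ → ι → κ → ℝ) :
    ∑ i, ∑ k, ∑ i', ∑ k', c * F i k i' k' = c * ∑ i', ∑ k', ∑ i, ∑ k, F i k i' k' := by
  have h1 : ∀ F : ι → κ → ℝ, ∑ i, ∑ k, F i k = ∑ x : ι × κ, F x.1 x.2 := fun F =>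
    (Fintype.sum_prod_type fun x : ι × κ => F x.1 x.2).symm
  simp only [h1, ← Finset.mul_sum]
  rw [Finset.sum_comm]

/-- The moments of the overlap of two independent means factorize. -/
lemma sum_priorWeight_mul_pow (len : Fin m → ℕ) (δ : ℝ) (k : ℕ) :
    ∑ ω : PriorIndex p G len N, ∑ ω' : PriorIndex p G len N, priorWeight ϖ ω * priorWeight ϖ ω' *
        (∑ i, ∑ j, priorMean ϖ δ ω i j * priorMean ϖ δ ω' i j) ^ k
      = ((((arrangements (fun g => len g + G) 0 (p + G)).card : ℝ) * 2 ^ m)⁻¹) ^ 2 *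
        (∑ b : Fin N → Bool, ∑ b' : Fin N → Bool, labProd ϖ b * labProd ϖ b' *
          (∑ i, lab ϖ (b i) * lab ϖ (b' i)) ^ k) *
        ∑ s' ∈ arrangements (fun g => len g + G) 0 (p + G), ∑ e' : Fin m → Bool,
          ∑ s ∈ arrangements (fun g => len g + G) 0 (p + G), ∑ e : Fin m → Bool,
            (∑ i, signSignal p δ len s e i * signSignal p δ len s' e' i) ^ k := by
  simp only [priorMean, sum_meanMat_mul, priorWeight, mul_pow]
  have hcoe : ∀ F : (Fin m → ℕ) → ℝ, ∑ s ∈ arrangements (fun g => len g + G) 0 (p + G), F s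
      = ∑ s : arrangements (fun g => len g + G) 0 (p + G), F s := fun F =>
    (Finset.sum_coe_sort _ F).symm
  simp only [hcoe, Fintype.sum_prod_type]
  set C := ((((arrangements (fun g => len g + G) 0 (p + G)).card : ℝ) * 2 ^ m)⁻¹)
  rw [← sum_four_comm]
  refine Finset.sum_congr rfl fun s _ => Finset.sum_congr rfl fun e _ => ?_
  rw [Finset.sum_comm]
  refine Finset.sum_congr rfl fun s' _ => ?_
  rw [Finset.sum_comm]
  refine Finset.sum_congr rfl fun e' _ => ?_
  rw [Finset.mul_sum, Finset.sum_mul]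
  refine Finset.sum_congr rfl fun b _ => ?_
  rw [Finset.mul_sum, Finset.sum_mul]
  refine Finset.sum_congr rfl fun b' _ => ?_
  ring

lemma factorial_two_mul_mul_factorial_le {d j : ℕ} (hj : 2 * j ≤ d) :
    ((2 * j).factorial : ℝ) * j.factorial ≤ ((d : ℝ) ^ 3) ^ j := by
  have h1 : (2 * j).factorial ≤ d ^ (2 * j) :=
    (Nat.factorial_le_pow _).trans (Nat.pow_le_pow_left hj _)
  have h2 : j.factorial ≤ d ^ j :=
    (Nat.factorial_le_pow _).trans (Nat.pow_le_pow_left (by omega) _)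
  have : (2 * j).factorial * j.factorial ≤ (d ^ 3) ^ j := by
    refine (Nat.mul_le_mul h1 h2).trans (le_of_eq ?_)
    rw [pow_mul, ← mul_pow]; congr 1
  exact_mod_cast this

/-- The second moment of the low-degree likelihood ratio is close to one if the signal is weak. -/
theorem integral_lowDegPoly_prior_sq (hϖ : 0 < ϖ) (hN : 1 ≤ N) {len : Fin m → ℕ} {w : ℕ}
    (hlen : ∀ g, len g ≤ w) (hlen1 : ∀ g, 1 ≤ len g) (hm : 1 ≤ m) {δ : ℝ} (hδ : 0 < δ) {P : ℕ}
    (hP : p + G = ∑ g, (len g + G) + P) {lam : ℝ} (hlam : 1 ≤ lam)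
    (hlam' : (m : ℝ) / (P + m) * (m * (2 * w)) ≤ lam) (d : ℕ)
    (hd : (d : ℝ) ^ 3 * ((1 + ϖ) ^ 4 * N * (2 * (δ ^ 2 * w) ^ 2 * lam)) ≤ 1) :
    1 ≤ ∫ x, polyVal (lowDegPoly (priorWeight ϖ) (priorMean ϖ δ (len := len) (G := G)) d) x ^ 2
          ∂noiseLaw N p ∧
    ∫ x, polyVal (lowDegPoly (priorWeight ϖ) (priorMean ϖ δ (len := len) (G := G)) d) x ^ 2
        ∂noiseLaw N p
      ≤ 1 + d * (2 * Real.exp (5 / 2) *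
        ((d : ℝ) ^ 3 * ((1 + ϖ) ^ 4 * N * (2 * (δ ^ 2 * w) ^ 2 * lam)))) := by
  set A := arrangements (fun g => len g + G) 0 (p + G) with hA
  have hAcard : 0 < A.card := by
    have := card_arrangements (fun g => len g + G) (fun g => (hlen1 g).trans (Nat.le_add_right _ _))
      0 P
    rw [zero_add, ← hP, ← hA] at this
    rw [this]
    exact Nat.choose_pos (by omega)
  have hC : (0 : ℝ) < (A.card : ℝ) * 2 ^ m := by positivity
  set y := (d : ℝ) ^ 3 * ((1 + ϖ) ^ 4 * N * (2 * (δ ^ 2 * w) ^ 2 * lam)) with hy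
  have hy0 : 0 ≤ y := by positivity
  set L : ℕ → ℝ := fun k => ∑ b : Fin N → Bool, ∑ b' : Fin N → Bool,
    labProd ϖ b * labProd ϖ b' * (∑ i, lab ϖ (b i) * lab ϖ (b' i)) ^ k with hL
  set Q : ℕ → ℝ := fun k => ∑ s' ∈ A, ∑ e' : Fin m → Bool, ∑ s ∈ A, ∑ e : Fin m → Bool,
    (∑ i, signSignal p δ len s e i * signSignal p δ len s' e' i) ^ k with hQ
  set T : ℕ → ℝ := fun k => (((A.card : ℝ) * 2 ^ m)⁻¹ ^ 2 * L k * Q k) / k.factorial with hT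
  have hmain : ∫ x, polyVal (lowDegPoly (priorWeight ϖ)
      (priorMean ϖ δ (len := len) (G := G)) d) x ^ 2 ∂noiseLaw N p = ∑ k ∈ Finset.range (d + 1), T k := by
    rw [integral_lowDegPoly_sq]
    exact Finset.sum_congr rfl fun k _ => by rw [sum_priorWeight_mul_pow]
  have hT0 : T 0 = 1 := by
    simp only [hT, hL, hQ, pow_zero, mul_one, Nat.factorial_zero, Nat.cast_one, div_one]
    simp only [← Finset.mul_sum, sum_labProd hϖ, mul_one]
    simp only [Finset.sum_const, Finset.card_univ, Fintype.card_fun, Fintype.card_bool,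
      Fintype.card_fin, nsmul_eq_mul, mul_one]
    push_cast
    field_simp
  -- The random signs of the blocks are symmetric, which removes all odd degrees.
  have hodd : ∀ k, Odd k → T k = 0 := by
    intro k hk
    have : Q k = 0 := by
      refine Finset.sum_eq_zero fun s' _ => Finset.sum_eq_zero fun e' _ =>
        Finset.sum_eq_zero fun s _ => ?_
      simp only [inner_signSignal]
      exact sum_boolSign_pow_odd _ hk
    simp only [hT, this, mul_zero, zero_div]
  have heven0 : ∀ j, 0 ≤ T (2 * j) := by
    intro j
    refine div_nonneg (mul_nonneg (mul_nonneg (by positivity) ?_) ?_) (Nat.cast_nonneg _)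
    · exact Finset.sum_nonneg fun b _ => Finset.sum_nonneg fun b' _ =>
        mul_nonneg (mul_nonneg (labProd_nonneg hϖ b) (labProd_nonneg hϖ b'))
          ((even_two_mul j).pow_nonneg _)
    · exact Finset.sum_nonneg fun _ _ => Finset.sum_nonneg fun _ _ => Finset.sum_nonneg fun _ _ =>
        Finset.sum_nonneg fun _ _ => (even_two_mul j).pow_nonneg _
  have heven : ∀ j, 2 * j ≤ d → 1 ≤ j → T (2 * j) ≤ 2 * Real.exp (5 / 2) * y := by
    intro j hjd hj
    set D := (((2 * j).factorial : ℝ) * j.factorial * (2 * Real.exp (3 / 2)) *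
          (2 * (δ ^ 2 * w) ^ 2 * lam) ^ j) with hD
    have h1 : Q (2 * j) ≤ ((A.card : ℝ) * 2 ^ m) * (((A.card : ℝ) * 2 ^ m) * D) := by
      refine (Finset.sum_le_sum fun s' hs' => Finset.sum_le_sum fun e' _ =>
        sum_signSignal_pow_le (isPlacement_iff_mem_arrangements.2 hs') hlen hlen1 hm hδ e' hP hlam
          hlam' j).trans (le_of_eq ?_)
      simp only [Finset.sum_const, Finset.card_univ, Fintype.card_fun, Fintype.card_bool,
        Fintype.card_fin, nsmul_eq_mul]
      push_cast
      ring
    have h2 : L (2 * j) ≤ ((2 * j).factorial : ℝ) * Real.exp 1 * ((1 + ϖ) ^ 4 * N) ^ j :=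
      sum_labProd_mul_pow_le hϖ hN j
    have hQ0 : 0 ≤ Q (2 * j) := Finset.sum_nonneg fun _ _ => Finset.sum_nonneg fun _ _ =>
      Finset.sum_nonneg fun _ _ => Finset.sum_nonneg fun _ _ => (even_two_mul j).pow_nonneg _
    have hf : (0 : ℝ) < ((2 * j).factorial : ℝ) := Nat.cast_pos.2 (Nat.factorial_pos _)
    have h3 : T (2 * j) ≤ (((A.card : ℝ) * 2 ^ m)⁻¹ ^ 2 *
        (((2 * j).factorial : ℝ) * Real.exp 1 * ((1 + ϖ) ^ 4 * N) ^ j) *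
        (((A.card : ℝ) * 2 ^ m) * (((A.card : ℝ) * 2 ^ m) * D))) / ((2 * j).factorial : ℝ) := by
      simp only [hT]
      gcongr
    refine h3.trans ?_
    have h4 : (((A.card : ℝ) * 2 ^ m)⁻¹ ^ 2 *
        (((2 * j).factorial : ℝ) * Real.exp 1 * ((1 + ϖ) ^ 4 * N) ^ j) *
        (((A.card : ℝ) * 2 ^ m) * (((A.card : ℝ) * 2 ^ m) * D))) / ((2 * j).factorial : ℝ)
        = Real.exp 1 * ((1 + ϖ) ^ 4 * N) ^ j * D := by
      have : ∀ a f x z : ℝ, a ≠ 0 → f ≠ 0 →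
          (a⁻¹ ^ 2 * (f * x * z) * (a * (a * D))) / f = x * z * D := by
        intro a f x z ha hf
        field_simp
      exact this _ _ _ _ hC.ne' hf.ne'
    rw [h4, hD]
    -- Labels and signals contribute `(2j)!` each, and the exponential series cancels one of them.
    -- The remaining `(2j)! j!` costs at most `d³` for each unit of `j`, hence the factor `d³` in
    -- `y`.
    have h5 := factorial_two_mul_mul_factorial_le hjd
    have h6 : Real.exp 1 * ((1 + ϖ) ^ 4 * N) ^ j *
        (((2 * j).factorial : ℝ) * j.factorial * (2 * Real.exp (3 / 2)) *
          (2 * (δ ^ 2 * w) ^ 2 * lam) ^ j) ≤ 2 * Real.exp (5 / 2) * y ^ j := by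
      calc _ = (2 * (Real.exp 1 * Real.exp (3 / 2))) * ((((2 * j).factorial : ℝ) * j.factorial) *
            ((1 + ϖ) ^ 4 * N * (2 * (δ ^ 2 * w) ^ 2 * lam)) ^ j) := by
            rw [mul_pow ((1 + ϖ) ^ 4 * (N : ℝ))]; ring
        _ ≤ (2 * (Real.exp 1 * Real.exp (3 / 2))) * (((d : ℝ) ^ 3) ^ j *
            ((1 + ϖ) ^ 4 * N * (2 * (δ ^ 2 * w) ^ 2 * lam)) ^ j) := by gcongr
        _ = _ := by rw [← Real.exp_add, ← mul_pow, ← hy]; norm_num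
    refine h6.trans ?_
    have : y ^ j ≤ y := by
      calc y ^ j ≤ y ^ 1 := pow_le_pow_of_le_one hy0 hd hj
        _ = y := pow_one y
    gcongr
  have hle : ∀ k ∈ Finset.range d, 0 ≤ T (k + 1) ∧ T (k + 1) ≤ 2 * Real.exp (5 / 2) * y := by
    intro k hk
    rw [Finset.mem_range] at hk
    rcases Nat.even_or_odd' (k + 1) with ⟨j, hj | hj⟩
    · rw [hj]; exact ⟨heven0 j, heven j (by omega) (by omega)⟩
    · rw [hodd _ ⟨j, hj⟩]; exact ⟨le_rfl, by positivity⟩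
  rw [hmain, Finset.sum_range_succ', hT0]
  constructor
  · have := Finset.sum_nonneg fun k hk => (hle k hk).1
    linarith
  · have := Finset.sum_le_sum fun k hk => (hle k hk).2
    rw [Finset.sum_const, Finset.card_range, nsmul_eq_mul] at this
    linarith

/-- The law of the data under a uniformly drawn signal. -/
lemma sum_sampleLaw_range {ι : Type*} [Fintype ι] {f : ι → Fin p → ℝ}
    (hf : Function.Injective f) (n : ℕ) :
    (Measure.sum fun μ : Set.range f => sampleLaw n ϖ (μ : Fin p → ℝ))
      = ∑ i, sampleLaw n ϖ (f i) := by
  ext s hs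
  rw [Measure.sum_apply _ hs, Measure.coe_finsetSum, Finset.sum_apply,
    ← (Equiv.ofInjective f hf).tsum_eq, tsum_fintype]
  rfl

/-- Every signal of the class has exactly one placement and one sign vector, so the uniform law on
the class, combined with the labels, is the product prior. -/
lemma altLaw_eq_mixLaw (hϖ : 0 < ϖ) {ρ : ℕ → ℝ} {α β r : ℝ} (hp : 1 ≤ p) (hρ : 0 ≤ ρ 0)
    (hlen : ∀ g, 1 ≤ blockLen ρ α p g) (N : ℕ) :
    altLaw N p ϖ ρ α β r = mixLaw (priorWeight ϖ)
      (priorMean (p := p) (G := gapLen ρ α p) (N := N) ϖ ((p : ℝ) ^ (-r))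
        (len := fun g : Fin (numBlocks α β p) => blockLen ρ α p (g + 1))) := by
  have hp' : (0 : ℝ) < p := by exact_mod_cast hp
  have hδ : (0 : ℝ) < (p : ℝ) ^ (-r) := Real.rpow_pos_of_pos hp' _
  set δ := (p : ℝ) ^ (-r)
  set len : Fin (numBlocks α β p) → ℕ := fun g => blockLen ρ α p (g + 1) with hlendef
  set G := gapLen ρ α p
  set A := arrangements (fun g => len g + G) 0 (p + G) with hA
  set f : A × (Fin (numBlocks α β p) → Bool) → Fin p → ℝ :=
    fun ω => signSignal p δ len ω.1 ω.2 with hf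
  have hinj : Function.Injective f := by
    intro ω ω' h
    have := signSignal_inj (isPlacement_iff_mem_arrangements.2 ω.1.2)
      (isPlacement_iff_mem_arrangements.2 ω'.1.2) (fun g => hlen _) hδ.ne' h
    exact Prod.ext (Subtype.ext this.1) this.2
  have hrange : blockClass ρ α β r p = Set.range f := by
    ext μ
    rw [mem_blockClass_iff hp hρ]
    constructor
    · rintro ⟨s, τ, hs, hτ, rfl⟩
      refine ⟨(⟨s, isPlacement_iff_mem_arrangements.1 hs⟩, fun g => decide (0 < τ g)), ?_⟩
      simp only [hf, signSignal]
      congr 1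
      funext g
      simp only [boolSign, decide_eq_true_eq]
      have hτg : |τ g| = δ := hτ g
      split_ifs with h
      · rw [one_mul, ← hτg, abs_of_pos h]
      · rw [neg_one_mul, ← hτg, abs_of_nonpos (not_lt.1 h), neg_neg]
    · rintro ⟨ω, rfl⟩
      refine ⟨ω.1, fun g => boolSign (ω.2 g) * δ, isPlacement_iff_mem_arrangements.2 ω.1.2,
        fun g => ?_, rfl⟩
      rw [abs_mul, abs_boolSign, one_mul, abs_of_pos hδ]
  have hcard : (Set.range f).ncard = A.card * 2 ^ numBlocks α β p := by
    rw [← Nat.card_coe_set_eq, Nat.card_range_of_injective hinj, Nat.card_eq_fintype_card]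
    simp
  unfold altLaw
  rw [hrange, sum_sampleLaw_range hinj, hcard, mixLaw, Fintype.sum_prod_type]
  simp_rw [Fintype.sum_prod_type]
  rw [Finset.smul_sum]
  refine Finset.sum_congr rfl fun s _ => ?_
  rw [Finset.smul_sum]
  refine Finset.sum_congr rfl fun e _ => ?_
  rw [sampleLaw_eq_sum hϖ, Finset.smul_sum]
  refine Finset.sum_congr rfl fun b _ => ?_
  rw [smul_smul]
  congr 1
  have hApos : 0 < A.card := Finset.card_pos.2 ⟨s.1, s.2⟩
  simp only [priorWeight]
  rw [ENNReal.ofReal_mul (by positivity), ENNReal.ofReal_inv_of_pos (by positivity)]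
  congr 2
  rw [ENNReal.ofReal_mul (by positivity), ENNReal.ofReal_natCast, ENNReal.ofReal_pow (by norm_num)]
  simp
  rfl

end LowDegree
/-! ### The low-degree likelihood ratio of weak block signals -/

lemma tendsto_natCast_rpow_neg {η : ℝ} (hη : 0 < η) :
    Tendsto (fun p : ℕ => (p : ℝ) ^ (-η)) atTop (𝓝 0) :=
  (tendsto_rpow_neg_atTop hη).comp tendsto_natCast_atTop_atTop

lemma floor_log_rpow_le {p : ℕ} (hp : 1 ≤ Real.log p) :
    (⌊Real.log p ^ (1.01 : ℝ)⌋₊ : ℝ) ≤ (1 + Real.log p) ^ 2 := by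
  refine (Nat.floor_le (by positivity)).trans ?_
  calc Real.log p ^ (1.01 : ℝ) ≤ Real.log p ^ (2 : ℝ) :=
        Real.rpow_le_rpow_of_exponent_le hp (by norm_num)
    _ = Real.log p ^ 2 := by norm_cast
    _ ≤ _ := pow_le_pow_left₀ (by linarith) (by linarith) 2

/-- Only bookkeeping of powers: with `l = 1 + log p`, the exponent `k + 8` collects `k` from the
sample size, `2` from `1 + d` and `6` from `d³`. The product `e * e` supplies one factor to absorb
these logarithms and one to remain as the bound. -/
lemma error_le {d l E B n A z K b' x lam B' e u : ℝ} {k : ℕ} (hd0 : 0 ≤ d)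
    (hd1 : 1 + d ≤ 2 * l ^ 2) (hdl : d ≤ l ^ 2) (hl0 : 0 ≤ l) (hE : 0 ≤ E) (hB : 0 ≤ B)
    (hn : 0 ≤ n) (hnl : n ≤ A * l ^ k * z) (hK : 0 ≤ K) (hκ : K ≤ b' * x) (hlam : 0 ≤ lam)
    (hA : 0 ≤ A) (hb' : 0 ≤ b') (hexp : z * (x * lam) ≤ B' * (e * e))
    (hcl : 2 * (2 * E * (B * A * (2 * b' * B'))) * l ^ (k + 8) ≤ u) (hue : u * e = 1)
    (he : 0 ≤ e) :
    (1 + d) * (2 * E * (d ^ 3 * (B * n * (2 * K * lam)))) ≤ e := by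
  have h1 : (1 + d) * (2 * E * (d ^ 3 * (B * n * (2 * K * lam))))
      ≤ (2 * l ^ 2) * (2 * E * ((l ^ 2) ^ 3 * (B * (A * l ^ k * z) * (2 * (b' * x) * lam)))) := by
    have hz := mul_nonneg hB (hn.trans hnl)
    gcongr
  have h2 : (2 * l ^ 2) * (2 * E * ((l ^ 2) ^ 3 * (B * (A * l ^ k * z) * (2 * (b' * x) * lam))))
      = (2 * (2 * E * (B * A * (2 * b'))) * l ^ (k + 8)) * (z * (x * lam)) := by ring
  have h3 : (2 * (2 * E * (B * A * (2 * b'))) * l ^ (k + 8)) * (z * (x * lam))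
      ≤ (2 * (2 * E * (B * A * (2 * b'))) * l ^ (k + 8)) * (B' * (e * e)) := by gcongr
  have h4 : (2 * (2 * E * (B * A * (2 * b'))) * l ^ (k + 8)) * (B' * (e * e))
      = (2 * (2 * E * (B * A * (2 * b' * B'))) * l ^ (k + 8)) * (e * e) := by ring
  have h5 : (2 * (2 * E * (B * A * (2 * b' * B'))) * l ^ (k + 8)) * (e * e) ≤ u * (e * e) := by
    gcongr
  have h6 : u * (e * e) = e := by rw [← mul_assoc, hue, one_mul]
  linarith

set_option maxHeartbeats 1000000 in
/-- If the signal is weak, the sample size close to `p ^ θ`, the low-degree likelihood ratio tends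
to one. -/
theorem exists_isLowDegreeProj_tendsto {θ α β r ϖ a b : ℝ} (hα : 0 < α) (hβ : 0 < β)
    (hβ' : β < 1 - α) (hϖ : 0 < ϖ) {ρ : ℕ → ℝ} (ha : 0 < a) (hρ : ∀ g, a ≤ ρ g ∧ ρ g ≤ b)
    (h1 : θ + 2 * α < 4 * r) (h2 : θ + α + 1 - 2 * β < 4 * r) {N : ℕ → ℕ}
    (hN1 : ∀ᶠ p in atTop, 1 ≤ N p) {C : ℝ} {k : ℕ}
    (hN : ∀ᶠ p : ℕ in atTop, (N p : ℝ) ≤ C * (1 + Real.log p) ^ k * (p : ℝ) ^ θ) :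
    ∃ q : ∀ p, MvPolynomial (Fin (N p) × Fin p) ℝ,
      (∀ᶠ p in atTop, IsLowDegreeProj (noiseLaw (N p) p) (altLaw (N p) p ϖ ρ α β r)
        (Real.log p ^ (1.01 : ℝ)) (q p)) ∧
      Tendsto (fun p => ∫ x, polyVal (q p) x ^ 2 ∂(noiseLaw (N p) p)) atTop (𝓝 1) := by
  have hb : 0 < b := ha.trans_le ((hρ 0).1.trans (hρ 0).2)
  have hsizes := eventually_blockSizes hα hβ hβ' ha hρ
  have hlog : ∀ᶠ p : ℕ in atTop, 1 ≤ Real.log p :=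
    (Real.tendsto_log_atTop.comp tendsto_natCast_atTop_atTop).eventually_ge_atTop 1
  refine ⟨fun p => lowDegPoly (priorWeight ϖ)
      (priorMean (p := p) (G := gapLen ρ α p) (N := N p) ϖ ((p : ℝ) ^ (-r))
        (len := fun g : Fin (numBlocks α β p) => blockLen ρ α p (g + 1)))
        ⌊Real.log p ^ (1.01 : ℝ)⌋₊, ?_, ?_⟩
  · filter_upwards [hsizes, hlog] with p hB hl
    rw [altLaw_eq_mixLaw hϖ hB.one_le (ha.le.trans (hρ 0).1) hB.one_le_len]
    exact isLowDegreeProj_lowDegPoly (fun ω => priorWeight_nonneg hϖ ω) _ (by positivity)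
  -- Half of the smaller margin in the two exponent conditions. The error decays like `p^(-2η)`
  -- times a power of the logarithm, so a rate `p^(-η)` is left.
  · set η := min ((4 * r - (θ + 2 * α)) / 2) ((4 * r - (θ + α + 1 - 2 * β)) / 2) with hη
    have hη0 : 0 < η := lt_min (by linarith) (by linarith)
    have hη1 : θ + 2 * α - 4 * r ≤ -η - η := by
      have := min_le_left ((4 * r - (θ + 2 * α)) / 2) ((4 * r - (θ + α + 1 - 2 * β)) / 2)
      rw [← hη] at this; linarith
    have hη2 : θ + α + 1 - 2 * β - 4 * r ≤ -η - η := by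
      have := min_le_right ((4 * r - (θ + 2 * α)) / 2) ((4 * r - (θ + α + 1 - 2 * β)) / 2)
      rw [← hη] at this; linarith
    set c : ℝ := 2 * (2 * Real.exp (5 / 2) * ((1 + ϖ) ^ 4 * |C| * (2 * b ^ 2 * (1 + 4 * b))))
    have key : ∀ᶠ p : ℕ in atTop,
        1 ≤ ∫ x, polyVal (lowDegPoly (priorWeight ϖ)
          (priorMean (p := p) (G := gapLen ρ α p) (N := N p) ϖ ((p : ℝ) ^ (-r))
          (len := fun g : Fin (numBlocks α β p) => blockLen ρ α p (g + 1)))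
          ⌊Real.log p ^ (1.01 : ℝ)⌋₊) x ^ 2 ∂(noiseLaw (N p) p) ∧
        ∫ x, polyVal (lowDegPoly (priorWeight ϖ)
          (priorMean (p := p) (G := gapLen ρ α p) (N := N p) ϖ ((p : ℝ) ^ (-r))
          (len := fun g : Fin (numBlocks α β p) => blockLen ρ α p (g + 1)))
          ⌊Real.log p ^ (1.01 : ℝ)⌋₊) x ^ 2 ∂(noiseLaw (N p) p) ≤ 1 + (p : ℝ) ^ (-η) := by
      filter_upwards [hsizes, hlog, hN1, hN, eventually_log_pow_le c (k + 8) hη0]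
        with p hB hl hN1 hN hcl
      have hp : (0 : ℝ) < p := by exact_mod_cast hB.one_le
      have hp1 : (1 : ℝ) ≤ p := by exact_mod_cast hB.one_le
      have hδ : (0 : ℝ) < (p : ℝ) ^ (-r) := Real.rpow_pos_of_pos hp _
      set m := numBlocks α β p with hm
      set G := gapLen ρ α p with hG
      set len : Fin m → ℕ := fun g => blockLen ρ α p (g + 1) with hlen
      set d := ⌊Real.log p ^ (1.01 : ℝ)⌋₊ with hd
      set w := ⌊b * (p : ℝ) ^ α⌋₊ with hw
      have hww : (w : ℝ) ≤ b * (p : ℝ) ^ α := Nat.floor_le (by positivity)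
      have hsum : 8 * ∑ g, (len g + G) ≤ p := by
        rw [Finset.mul_sum]
        have h3 : ∀ g ∈ (Finset.univ : Finset (Fin m)), 8 * (len g + G) ≤ p / m :=
          fun g _ => hB.room (g + 1)
        refine (Finset.sum_le_sum h3).trans ?_
        rw [Finset.sum_const, Finset.card_univ, Fintype.card_fin, smul_eq_mul]
        exact Nat.mul_div_le p m
      set P := p + G - ∑ g, (len g + G) with hP
      have hPG : p + G = ∑ g, (len g + G) + P := by omega
      have hPhalf : (p : ℝ) / 2 ≤ P + m := by
        have : p ≤ 2 * P := by omega
        have h3 : (p : ℝ) ≤ 2 * P := by exact_mod_cast this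
        have h4 : (0 : ℝ) ≤ m := Nat.cast_nonneg m
        linarith
      -- The expected number of colliding blocks is at most `m · 2 w m / (P + m)`, which is of order
      -- `p^(1-α-2β)` because at least half of the line is free. The summand one covers the regime
      -- where collisions are rare.
      set lam := 1 + 4 * b * (p : ℝ) ^ (1 - α - 2 * β) with hlam
      have hpow : 0 < (p : ℝ) ^ (1 - α - 2 * β) := Real.rpow_pos_of_pos hp _
      have hlam1 : 1 ≤ lam := by
        have : 0 ≤ 4 * b * (p : ℝ) ^ (1 - α - 2 * β) := by positivity
        linarith
      have hlam' : (m : ℝ) / (P + m) * (m * (2 * w)) ≤ lam := by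
        have h3 : (m : ℝ) / (P + m) ≤ m / (p / 2) := by gcongr
        have h4 : (m : ℝ) / (p / 2) * (m * (2 * w))
            ≤ (p : ℝ) ^ (1 - α - β) / (p / 2) *
              ((p : ℝ) ^ (1 - α - β) * (2 * (b * (p : ℝ) ^ α))) := by
          have := hB.num_le
          gcongr
        have h5 : (p : ℝ) ^ (1 - α - β) / (p / 2) *
              ((p : ℝ) ^ (1 - α - β) * (2 * (b * (p : ℝ) ^ α)))
            = 4 * b * (p : ℝ) ^ (1 - α - 2 * β) := by
          have h6 : (p : ℝ) ^ (1 - α - 2 * β)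
              = (p : ℝ) ^ (1 - α - β) * (p : ℝ) ^ (1 - α - β) * (p : ℝ) ^ α / p := by
            rw [← Real.rpow_add hp, ← Real.rpow_add hp, ← Real.rpow_sub_one hp.ne']
            congr 1; ring
          rw [h6]; field_simp; norm_num
        have h7 : (m : ℝ) / (P + m) * (m * (2 * w)) ≤ (m : ℝ) / (p / 2) * (m * (2 * w)) := by
          gcongr
        linarith
      set y := (d : ℝ) ^ 3 * ((1 + ϖ) ^ 4 * N p * (2 * (((p : ℝ) ^ (-r)) ^ 2 * w) ^ 2 * lam)) with hy
      have hy0 : 0 ≤ y := by positivity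
      have hpneg : 0 < (p : ℝ) ^ (-η) := Real.rpow_pos_of_pos hp _
      have hbound : ((1 : ℝ) + d) * (2 * Real.exp (5 / 2) * y) ≤ (p : ℝ) ^ (-η) := by
        have hdl : (d : ℝ) ≤ (1 + Real.log p) ^ 2 := floor_log_rpow_le hl
        have hd1 : (1 : ℝ) + d ≤ 2 * (1 + Real.log p) ^ 2 := by nlinarith
        have hκ : (((p : ℝ) ^ (-r)) ^ 2 * w) ^ 2 ≤ b ^ 2 * (p : ℝ) ^ (2 * α - 4 * r) := by
          calc (((p : ℝ) ^ (-r)) ^ 2 * w) ^ 2 ≤ (((p : ℝ) ^ (-r)) ^ 2 * (b * (p : ℝ) ^ α)) ^ 2 := by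
                gcongr
            _ = b ^ 2 * (((p : ℝ) ^ (-r)) ^ (4 : ℕ) * ((p : ℝ) ^ α) ^ (2 : ℕ)) := by ring
            _ = _ := by
                rw [← Real.rpow_mul_natCast hp.le, ← Real.rpow_mul_natCast hp.le, ← Real.rpow_add hp]
                congr 2; push_cast; ring
        have hNl : (N p : ℝ) ≤ |C| * (1 + Real.log p) ^ k * (p : ℝ) ^ θ := by
          refine hN.trans ?_
          have := le_abs_self C
          have : 0 ≤ 1 + Real.log p := by linarith
          gcongr
        have hl0 : 0 ≤ 1 + Real.log p := by linarith
        have hexp : (p : ℝ) ^ θ * ((p : ℝ) ^ (2 * α - 4 * r) * lam)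
            ≤ (1 + 4 * b) * ((p : ℝ) ^ (-η) * (p : ℝ) ^ (-η)) := by
          have e1 : (p : ℝ) ^ θ * (p : ℝ) ^ (2 * α - 4 * r) ≤ (p : ℝ) ^ (-η) * (p : ℝ) ^ (-η) := by
            rw [← Real.rpow_add hp, ← Real.rpow_add hp]
            exact Real.rpow_le_rpow_of_exponent_le hp1 (by linarith)
          have e2 : (p : ℝ) ^ θ * (p : ℝ) ^ (2 * α - 4 * r) * (p : ℝ) ^ (1 - α - 2 * β)
              ≤ (p : ℝ) ^ (-η) * (p : ℝ) ^ (-η) := by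
            rw [← Real.rpow_add hp, ← Real.rpow_add hp, ← Real.rpow_add hp]
            exact Real.rpow_le_rpow_of_exponent_le hp1 (by linarith)
          have e3 : (p : ℝ) ^ θ * ((p : ℝ) ^ (2 * α - 4 * r) * lam)
              = (p : ℝ) ^ θ * (p : ℝ) ^ (2 * α - 4 * r) + 4 * b *
                ((p : ℝ) ^ θ * (p : ℝ) ^ (2 * α - 4 * r) * (p : ℝ) ^ (1 - α - 2 * β)) := by
            rw [hlam]; ring
          rw [e3]
          have e4 := mul_le_mul_of_nonneg_left e2 (by positivity : 0 ≤ 4 * b)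
          linarith
        refine error_le (Nat.cast_nonneg d) hd1 hdl hl0 (Real.exp_pos _).le (by positivity)
          (Nat.cast_nonneg _) hNl (by positivity) hκ (by positivity) (by positivity) (by positivity)
          hexp hcl ?_ hpneg.le
        rw [← Real.rpow_add hp, add_neg_cancel, Real.rpow_zero]
      have hd0 : (0 : ℝ) ≤ d := Nat.cast_nonneg d
      have hY : 0 ≤ 2 * Real.exp (5 / 2) * y := by positivity
      have hy1 : y ≤ 1 := by
        have e1 : (p : ℝ) ^ (-η) ≤ 1 := Real.rpow_le_one_of_one_le_of_nonpos hp1 (by linarith)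
        have e2 : (1 : ℝ) ≤ Real.exp (5 / 2) := Real.one_le_exp (by norm_num)
        have e3 : y ≤ 2 * Real.exp (5 / 2) * y := by nlinarith
        nlinarith [mul_nonneg hd0 hY]
      have := integral_lowDegPoly_prior_sq (G := G) (len := len) hϖ hN1
        (fun g => Nat.le_floor (hB.len_le (g + 1)))
        (fun g => hB.one_le_len (g + 1)) hB.one_le_num hδ hPG hlam1 hlam' d hy1
      refine ⟨this.1, this.2.trans ?_⟩
      rw [add_mul, one_mul] at hbound
      linarith
    refine tendsto_of_tendsto_of_tendsto_of_le_of_le' tendsto_const_nhds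
      (h := fun p : ℕ => 1 + (p : ℝ) ^ (-η)) ?_ (key.mono fun _ h => h.1) (key.mono fun _ h => h.2)
    simpa using (tendsto_natCast_rpow_neg hη0).const_add 1
/-! ### Programs -/

section Programs

lemma Mem.write_same (s : Mem) (a : ℕ) (i v : ℤ) :
    s.write a i v a = Function.update (s a) i v := by simp [Mem.write]

lemma Mem.write_of_ne (s : Mem) {a b : ℕ} (h : b ≠ a) (i v : ℤ) : s.write a i v b = s b := by
  simp [Mem.write, h]

/-- The result and the running time of a program are determined by the initial memory. -/
lemma Exec.unique {c : Prog} {s s₁ s₂ : Mem} {t₁ t₂ : ℕ} (h₁ : Exec c s t₁ s₁)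
    (h₂ : Exec c s t₂ s₂) : s₁ = s₂ := by
  induction h₁ generalizing s₂ t₂ with
  | skip s => cases h₂; rfl
  | store s a i v => cases h₂; rfl
  | seq _ _ ih1 ih2 =>
    cases h₂ with
    | seq h3 h4 =>
      obtain rfl := ih1 h3
      exact ih2 h4
  | ifTrue he _ ih =>
    cases h₂ with
    | ifTrue _ h => exact ih h
    | ifFalse he' _ => exact absurd he he'
  | ifFalse he _ ih =>
    cases h₂ with
    | ifTrue he' _ => exact absurd he' he
    | ifFalse _ h => exact ih h
  | whileTrue he _ _ ih1 ih2 =>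
    cases h₂ with
    | whileTrue _ h3 h4 =>
      obtain rfl := ih1 h3
      exact ih2 h4
    | whileFalse he' => exact absurd he he'
  | whileFalse he =>
    cases h₂ with
    | whileTrue he' _ _ => exact absurd he' he
    | whileFalse _ => rfl

/-- A strict upper bound for the arrays that occur in an expression. -/
def Expr.bound : Expr → ℕ
  | .const _ => 0
  | .get a i => max (a + 1) i.bound
  | .add e f => max e.bound f.bound
  | .sub e f => max e.bound f.bound

/-- A strict upper bound for the arrays that occur in a program. -/
def Prog.bound : Prog → ℕ
  | .skip => 0
  | .store a i v => max (a + 1) (max i.bound v.bound)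
  | .seq c d => max c.bound d.bound
  | .ifPos e c d => max e.bound (max c.bound d.bound)
  | .whilePos e c => max e.bound c.bound

/-- The arrays below `f` of one memory together with the arrays from `f` on of another. -/
def Mem.glue (f : ℕ) (s u : Mem) : Mem := fun a => if a < f then s a else u a

lemma Mem.glue_of_lt {f a : ℕ} (h : a < f) (s u : Mem) : Mem.glue f s u a = s a := if_pos h

lemma Mem.glue_of_le {f a : ℕ} (h : f ≤ a) (s u : Mem) : Mem.glue f s u a = u a :=
  if_neg (not_lt.2 h)

lemma Expr.eval_glue {f : ℕ} {e : Expr} (h : e.bound ≤ f) (s u : Mem) :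
    e.eval (Mem.glue f s u) = e.eval s := by
  induction e with
  | const z => rfl
  | get a i ih =>
    simp only [Expr.bound, max_le_iff] at h
    simp only [Expr.eval, ih h.2, Mem.glue_of_lt (Nat.lt_of_succ_le h.1)]
  | add e f ih1 ih2 =>
    simp only [Expr.bound, max_le_iff] at h
    simp only [Expr.eval, ih1 h.1, ih2 h.2]
  | sub e f ih1 ih2 =>
    simp only [Expr.bound, max_le_iff] at h
    simp only [Expr.eval, ih1 h.1, ih2 h.2]

lemma Mem.write_glue {f a : ℕ} (h : a < f) (s u : Mem) (i v : ℤ) :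
    (Mem.glue f s u).write a i v = Mem.glue f (s.write a i v) u := by
  funext b
  by_cases hb : b = a
  · subst hb
    rw [Mem.write_same, Mem.glue_of_lt h, Mem.glue_of_lt h, Mem.write_same]
  · rw [Mem.write_of_ne _ hb]
    unfold Mem.glue
    split_ifs
    · rw [Mem.write_of_ne _ hb]
    · rfl

/-- A program does not see the arrays that do not occur in it. -/
lemma Exec.glue {c : Prog} {s s' : Mem} {t f : ℕ} (h : Exec c s t s') (hc : c.bound ≤ f) (u : Mem) :
    Exec c (Mem.glue f s u) t (Mem.glue f s' u) := by
  induction h with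
  | skip s => exact .skip _
  | store s a i v =>
    simp only [Prog.bound, max_le_iff] at hc
    have := Exec.store (Mem.glue f s u) a i v
    rwa [Expr.eval_glue hc.2.1, Expr.eval_glue hc.2.2, Mem.write_glue (Nat.lt_of_succ_le hc.1)]
      at this
  | seq _ _ ih1 ih2 =>
    simp only [Prog.bound, max_le_iff] at hc
    exact .seq (ih1 hc.1) (ih2 hc.2)
  | ifTrue he _ ih =>
    simp only [Prog.bound, max_le_iff] at hc
    exact .ifTrue (by rwa [Expr.eval_glue hc.1]) (ih hc.2.1)
  | ifFalse he _ ih =>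
    simp only [Prog.bound, max_le_iff] at hc
    exact .ifFalse (by rwa [Expr.eval_glue hc.1]) (ih hc.2.2)
  | whileTrue he _ _ ih1 ih2 =>
    have hc' := hc
    simp only [Prog.bound, max_le_iff] at hc
    exact .whileTrue (by rwa [Expr.eval_glue hc.1]) (ih1 hc.2) (ih2 hc')
  | whileFalse he =>
    simp only [Prog.bound, max_le_iff] at hc
    exact .whileFalse (by rwa [Expr.eval_glue hc.1])

/-- From every memory with property `A`, the program halts within `t` steps in a memory with
property `B`. -/
def HaltsIn (A : Mem → Prop) (c : Prog) (t : ℕ) (B : Mem → Prop) : Prop :=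
  ∀ s, A s → ∃ t' s', t' ≤ t ∧ Exec c s t' s' ∧ B s'

lemma HaltsIn.mono {A A' B B' : Mem → Prop} {c : Prog} {t t' : ℕ} (h : HaltsIn A c t B)
    (hA : ∀ s, A' s → A s) (ht : t ≤ t') (hB : ∀ s, B s → B' s) : HaltsIn A' c t' B' := by
  intro s hs
  obtain ⟨t₁, s', h1, h2, h3⟩ := h s (hA s hs)
  exact ⟨t₁, s', h1.trans ht, h2, hB s' h3⟩

lemma HaltsIn.seq {A B C : Mem → Prop} {c d : Prog} {t u : ℕ} (h₁ : HaltsIn A c t B)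
    (h₂ : HaltsIn B d u C) : HaltsIn A (.seq c d) (t + u) C := by
  intro s hs
  obtain ⟨t₁, s₁, h1, h2, h3⟩ := h₁ s hs
  obtain ⟨t₂, s₂, h4, h5, h6⟩ := h₂ s₁ h3
  exact ⟨t₁ + t₂, s₂, Nat.add_le_add h1 h4, .seq h2 h5, h6⟩

lemma HaltsIn.store {A B : Mem → Prop} {a : ℕ} {i v : Expr}
    (h : ∀ s, A s → B (s.write a (i.eval s) (v.eval s))) : HaltsIn A (.store a i v) 1 B :=
  fun s hs => ⟨1, _, le_rfl, .store s a i v, h s hs⟩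

lemma HaltsIn.skip {A B : Mem → Prop} (h : ∀ s, A s → B s) : HaltsIn A .skip 1 B :=
  fun s hs => ⟨1, s, le_rfl, .skip s, h s hs⟩

lemma HaltsIn.ifPos {A B : Mem → Prop} {e : Expr} {c d : Prog} {t : ℕ}
    (h₁ : HaltsIn (fun s => A s ∧ 0 < e.eval s) c t B)
    (h₂ : HaltsIn (fun s => A s ∧ ¬ 0 < e.eval s) d t B) : HaltsIn A (.ifPos e c d) (t + 1) B := by
  intro s hs
  by_cases he : 0 < e.eval s
  · obtain ⟨t', s', h1, h2, h3⟩ := h₁ s ⟨hs, he⟩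
    exact ⟨t' + 1, s', Nat.succ_le_succ h1, .ifTrue he h2, h3⟩
  · obtain ⟨t', s', h1, h2, h3⟩ := h₂ s ⟨hs, he⟩
    exact ⟨t' + 1, s', Nat.succ_le_succ h1, .ifFalse he h2, h3⟩

/-- A loop whose invariant `I k` says that `k` rounds remain. -/
lemma HaltsIn.whilePos {e : Expr} {c : Prog} {t : ℕ} (I : ℕ → Mem → Prop)
    (h0 : ∀ s, I 0 s → ¬ 0 < e.eval s) (hpos : ∀ k s, I (k + 1) s → 0 < e.eval s)
    (hstep : ∀ k, HaltsIn (I (k + 1)) c t (I k)) (k : ℕ) :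
    HaltsIn (I k) (.whilePos e c) (k * (t + 1) + 1) (I 0) := by
  induction k with
  | zero => exact fun s hs => ⟨1, s, by omega, .whileFalse (h0 s hs), hs⟩
  | succ k ih =>
    intro s hs
    obtain ⟨t₁, s₁, h1, h2, h3⟩ := hstep k s hs
    obtain ⟨t₂, s₂, h4, h5, h6⟩ := ih s₁ h3
    refine ⟨t₁ + t₂ + 1, s₂, ?_, .whileTrue (hpos k s hs) h2 h5, h6⟩
    rw [Nat.succ_mul]
    omega

end Programs
/-! ### The preprocessing of the sample -/

section Preprocessing

/-- The `k`-th register: a cell of the array `f`. -/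
def reg (f k : ℕ) : Expr := .get f (.const k)

lemma eval_reg (f k : ℕ) (s : Mem) : (reg f k).eval s = s f k := rfl

/-- The memory agrees with `s₀` except in the array `f`, which has the property `Φ`. -/
def RegInv (f : ℕ) (s₀ : Mem) (Φ : (ℤ → ℤ) → Prop) (s : Mem) : Prop :=
  (∀ a, a ≠ f → s a = s₀ a) ∧ Φ (s f)

variable {f : ℕ} {s₀ : Mem}

lemma RegInv.write {Φ Ψ : (ℤ → ℤ) → Prop} {s : Mem} (h : RegInv f s₀ Φ s) (i v : ℤ)
    (hΨ : Ψ (Function.update (s f) i v)) : RegInv f s₀ Ψ (s.write f i v) :=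
  ⟨fun a ha => by rw [Mem.write_of_ne _ ha]; exact h.1 a ha, by rwa [Mem.write_same]⟩

lemma HaltsIn.setReg {Φ Ψ : (ℤ → ℤ) → Prop} {k : ℕ} {v : Expr}
    (h : ∀ s, RegInv f s₀ Φ s → Ψ (Function.update (s f) k (v.eval s))) :
    HaltsIn (RegInv f s₀ Φ) (.store f (.const k) v) 1 (RegInv f s₀ Ψ) :=
  HaltsIn.store fun s hs => hs.write _ _ (h s hs)

/-- A program for the number of binary digits of the dimension, plus one (register `0`). -/
def sizeProg (f : ℕ) : Prog :=
  .seq (.store f (.const (0 : ℕ)) (.const 1)) <| .seq (.store f (.const (1 : ℕ)) (.const 1)) <|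
    .whilePos (.sub (.add (.get 0 (.const 1)) (.const 1)) (reg f 1)) <|
      .seq (.store f (.const (0 : ℕ)) (.add (reg f 0) (.const 1)))
        (.store f (.const (1 : ℕ)) (.add (reg f 1) (reg f 1)))

/-- Register `1` runs through the powers of two as long as they do not exceed `p`; the number of
rounds is the number of binary digits. -/
lemma haltsIn_sizeProg (hf : 0 < f) {p : ℕ} (hp : s₀ 0 1 = p) :
    HaltsIn (RegInv f s₀ fun _ => True) (sizeProg f) (1 + (1 + (p.size * (1 + 1 + 1) + 1)))
      (RegInv f s₀ fun g => g 0 = (p.size + 1 : ℕ)) := by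
  have hp' : ∀ {Φ s}, RegInv f s₀ Φ s → s 0 1 = p := fun h => by rw [h.1 0 hf.ne, hp]
  refine HaltsIn.seq (B := RegInv f s₀ fun g => g 0 = 1) (HaltsIn.setReg fun s hs => ?_)
    (HaltsIn.seq (B := RegInv f s₀ fun g => ∃ i : ℕ, i + p.size = p.size ∧ g 0 = i + 1 ∧ g 1 = 2 ^ i)
    (HaltsIn.setReg fun s hs => ⟨0, ?_⟩) (HaltsIn.mono (HaltsIn.whilePos (fun k => RegInv f s₀
      fun g => ∃ i : ℕ, i + k = p.size ∧ g 0 = i + 1 ∧ g 1 = 2 ^ i) ?_ ?_ (fun k => ?_) p.size)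
      (fun _ h => h) le_rfl ?_))
  · simp [Expr.eval]
  · have := hs.2
    simp [Expr.eval, this]
  · rintro s ⟨hs, i, hi, h0, h1⟩
    have h2 := Nat.lt_size_self p
    rw [show p.size = i by omega] at h2
    have h3 : (p : ℤ) < 2 ^ i := by exact_mod_cast h2
    simp only [Expr.eval, eval_reg]
    rw [hs 0 hf.ne, hp]
    push_cast
    rw [h1]
    omega
  · rintro k s ⟨hs, i, hi, h0, h1⟩
    have h2 : 2 ^ i ≤ p := Nat.lt_size.1 (by omega)
    have h3 : (2 : ℤ) ^ i ≤ p := by exact_mod_cast h2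
    simp only [Expr.eval, eval_reg]
    rw [hs 0 hf.ne, hp]
    push_cast
    rw [h1]
    omega
  · refine HaltsIn.seq (B := RegInv f s₀
      fun g => ∃ i : ℕ, i + (k + 1) = p.size ∧ g 0 = i + 2 ∧ g 1 = 2 ^ i)
      (HaltsIn.setReg ?_) (HaltsIn.setReg ?_)
    · rintro s ⟨hs, i, hi, h0, h1⟩
      refine ⟨i, hi, ?_, ?_⟩
      · simp [Expr.eval, eval_reg, h0]; ring
      · simpa [Expr.eval] using h1
    · rintro s ⟨hs, i, hi, h0, h1⟩
      refine ⟨i + 1, by omega, ?_, ?_⟩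
      · simp [Expr.eval, h0]; ring
      · simp [Expr.eval, eval_reg, h1]; ring
  · rintro s ⟨hs, i, hi, h0, h1⟩
    refine ⟨hs, ?_⟩
    simp only [h0, ← hi]; simp

/-- A program for the division of the sample size by register `0`: the quotient is put into
register `2` and the remainder into register `3`. -/
def divProg (f : ℕ) : Prog :=
  .seq (.store f (.const (2 : ℕ)) (.const 0)) <|
    .seq (.store f (.const (3 : ℕ)) (.get 0 (.const 0))) <|
    .whilePos (.sub (.add (reg f 3) (.const 1)) (reg f 0)) <|
      .seq (.store f (.const (2 : ℕ)) (.add (reg f 2) (.const 1)))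
        (.store f (.const (3 : ℕ)) (.sub (reg f 3) (reg f 0)))

/-- Division by repeated subtraction. The number of rounds is the quotient, which in the application
is the sample size of the estimator. -/
lemma haltsIn_divProg (hf : 0 < f) {N L : ℕ} (hN : s₀ 0 0 = N) (hL : 0 < L) :
    HaltsIn (RegInv f s₀ fun g => g 0 = L) (divProg f) (1 + (1 + (N / L * (1 + 1 + 1) + 1)))
      (RegInv f s₀ fun g => g 2 = (N / L : ℕ) ∧ g 3 = (N % L : ℕ)) := by
  refine HaltsIn.seq (B := RegInv f s₀ fun g => g 0 = L ∧ g 2 = 0) (HaltsIn.setReg fun s hs => ?_)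
    (HaltsIn.seq (B := RegInv f s₀ fun g => g 0 = L ∧ g 2 + (N / L : ℕ) = (N / L : ℕ) ∧
        g 3 = (N / L : ℕ) * L + (N % L : ℕ))
    (HaltsIn.setReg fun s hs => ?_) (HaltsIn.mono (HaltsIn.whilePos (fun k => RegInv f s₀
      fun g => g 0 = L ∧ g 2 + k = (N / L : ℕ) ∧ g 3 = k * L + (N % L : ℕ)) ?_ ?_
      (fun k => ?_) (N / L)) (fun _ h => h) le_rfl ?_))
  · have := hs.2
    simp [Expr.eval, this]
  · have := hs.2
    refine ⟨by simp [Expr.eval, this], by simp [Expr.eval, this], ?_⟩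
    have h1 : s 0 0 = N := by rw [hs.1 0 hf.ne, hN]
    have h2 : (N : ℤ) = (N / L : ℕ) * L + (N % L : ℕ) := by
      exact_mod_cast (Nat.div_add_mod' N L).symm
    simp only [Expr.eval, h1, Nat.cast_ofNat, Function.update_self]
    exact h2
  · rintro s ⟨hs, h0, h2, h3⟩
    have h4 : ((N % L : ℕ) : ℤ) < L := by exact_mod_cast Nat.mod_lt N hL
    simp only [Expr.eval, eval_reg, Nat.cast_ofNat, Nat.cast_zero, h0, h3]
    omega
  · rintro k s ⟨hs, h0, h2, h3⟩
    have h4 : (0 : ℤ) ≤ (N % L : ℕ) := Nat.cast_nonneg _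
    have h5 : (0 : ℤ) ≤ k * L := by positivity
    simp only [Expr.eval, eval_reg, Nat.cast_ofNat, Nat.cast_zero, h0, h3]
    push_cast at h4 ⊢
    linarith
  · refine HaltsIn.seq (B := RegInv f s₀
      fun g => g 0 = L ∧ g 2 + k = (N / L : ℕ) ∧ g 3 = (k + 1 : ℕ) * L + (N % L : ℕ))
      (HaltsIn.setReg ?_) (HaltsIn.setReg ?_)
    · rintro s ⟨hs, h0, h2, h3⟩
      refine ⟨by simpa [Expr.eval] using h0, ?_, by simpa [Expr.eval] using h3⟩
      simp only [Expr.eval, eval_reg, Nat.cast_ofNat, Function.update_self]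
      rw [← h2]; push_cast; ring
    · rintro s ⟨hs, h0, h2, h3⟩
      refine ⟨by simpa [Expr.eval] using h0, by simpa [Expr.eval] using h2, ?_⟩
      simp only [Expr.eval, eval_reg, Nat.cast_ofNat, Nat.cast_zero, Function.update_self, h0, h3]
      push_cast; ring
  · rintro s ⟨hs, h0, h2, h3⟩
    refine ⟨hs, ?_, ?_⟩
    · simpa using h2
    · simpa using h3

/-- A program for the power of two with exponent in register `3` (register `4`). -/
def powProg (f : ℕ) : Prog :=
  .seq (.store f (.const (4 : ℕ)) (.const 1)) <|
    .whilePos (reg f 3) <|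
      .seq (.store f (.const (4 : ℕ)) (.add (reg f 4) (reg f 4)))
        (.store f (.const (3 : ℕ)) (.sub (reg f 3) (.const 1)))

lemma haltsIn_powProg {n k : ℕ} :
    HaltsIn (RegInv f s₀ fun g => g 2 = n ∧ g 3 = k) (powProg f) (1 + (k * (1 + 1 + 1) + 1))
      (RegInv f s₀ fun g => g 2 = n ∧ g 4 = (2 ^ k : ℕ)) := by
  refine HaltsIn.seq (B := RegInv f s₀ fun g => g 2 = n ∧ g 3 = k ∧ g 4 * 2 ^ k = 2 ^ k)
    (HaltsIn.setReg fun s hs => ?_) (HaltsIn.mono (HaltsIn.whilePos (fun i => RegInv f s₀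
      fun g => g 2 = n ∧ g 3 = i ∧ g 4 * 2 ^ i = 2 ^ k) ?_ ?_
      (fun i => ?_) k) (fun _ h => h) le_rfl ?_)
  · obtain ⟨-, h2, h3⟩ := hs
    simp [Expr.eval, h2, h3]
  · rintro s ⟨hs, h2, h3, h4⟩
    simp [eval_reg, h3]
  · rintro i s ⟨hs, h2, h3, h4⟩
    simp only [eval_reg, Nat.cast_ofNat, h3]
    positivity
  · refine HaltsIn.seq (B := RegInv f s₀ fun g => g 2 = n ∧ g 3 = (i + 1 : ℕ) ∧
      g 4 * 2 ^ i = 2 ^ k) (HaltsIn.setReg ?_) (HaltsIn.setReg ?_)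
    · rintro s ⟨hs, h2, h3, h4⟩
      refine ⟨by simpa [Expr.eval] using h2, by simpa [Expr.eval] using h3, ?_⟩
      simp only [Expr.eval, eval_reg, Nat.cast_ofNat, Function.update_self]
      rw [← h4]; ring
    · rintro s ⟨hs, h2, h3, h4⟩
      refine ⟨by simpa [Expr.eval] using h2, ?_, by simpa [Expr.eval] using h4⟩
      simp only [Expr.eval, eval_reg, Nat.cast_ofNat, Function.update_self, h3]
      push_cast; ring
  · rintro s ⟨hs, h2, h3, h4⟩
    refine ⟨hs, h2, ?_⟩
    simpa using h4

/-- A program for the product of the dimension and the value of the expression `e` (register `k`);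
the register `6` is the counter. -/
def mulProg (f k : ℕ) (e : Expr) : Prog :=
  .seq (.store f (.const k) (.const 0)) <| .seq (.store f (.const (6 : ℕ)) e) <|
    .whilePos (reg f 6) <|
      .seq (.store f (.const k) (.add (reg f k) (.get 0 (.const 1))))
        (.store f (.const (6 : ℕ)) (.sub (reg f 6) (.const 1)))

/-- Repeated addition. The assertion `Φ` carries the registers computed before, and it only has to
be stable under writing to the result and to the counter. -/
lemma haltsIn_mulProg (hf : 0 < f) {p n k : ℕ} (hp : s₀ 0 1 = p) (hk : k ≠ 6) {e : Expr}
    {Φ : (ℤ → ℤ) → Prop} (hΦk : ∀ g v, Φ g → Φ (Function.update g k v))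
    (hΦ6 : ∀ g v, Φ g → Φ (Function.update g 6 v)) (he : ∀ s, RegInv f s₀ Φ s → e.eval s = n) :
    HaltsIn (RegInv f s₀ Φ) (mulProg f k e) (1 + (1 + (n * (1 + 1 + 1) + 1)))
      (RegInv f s₀ fun g => Φ g ∧ g k = (n * p : ℕ)) := by
  have hk' : (k : ℤ) ≠ 6 := by exact_mod_cast hk
  refine HaltsIn.seq (B := RegInv f s₀ fun g => Φ g ∧ g k = 0) (HaltsIn.setReg fun s hs => ?_)
    (HaltsIn.seq (B := RegInv f s₀ fun g => Φ g ∧ g k + n * p = n * p ∧ g 6 = n)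
    (HaltsIn.setReg fun s hs => ?_) (HaltsIn.mono (HaltsIn.whilePos (fun i => RegInv f s₀
      fun g => Φ g ∧ g k + i * p = n * p ∧ g 6 = i) ?_ ?_
      (fun i => ?_) n) (fun _ h => h) le_rfl ?_))
  · exact ⟨hΦk _ _ hs.2, by simp [Expr.eval]⟩
  · refine ⟨hΦ6 _ _ hs.2.1, ?_, ?_⟩
    · have := hs.2.2
      simp [hk', this]
    · simpa using he s ⟨hs.1, hs.2.1⟩
  · rintro s ⟨hs, h1, h2, h3⟩
    simp [eval_reg, h3]
  · rintro i s ⟨hs, h1, h2, h3⟩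
    simp only [eval_reg, Nat.cast_ofNat, h3]
    positivity
  · refine HaltsIn.seq (B := RegInv f s₀ fun g => Φ g ∧ g k + i * p = n * p ∧
      g 6 = (i + 1 : ℕ)) (HaltsIn.setReg ?_) (HaltsIn.setReg ?_)
    · rintro s ⟨hs, h1, h2, h3⟩
      have h4 : s 0 1 = p := by rw [hs 0 hf.ne, hp]
      refine ⟨hΦk _ _ h1, ?_, by rw [Function.update_of_ne hk'.symm]; exact h3⟩
      simp only [Expr.eval, eval_reg, Function.update_self, h4]
      rw [← h2]; push_cast; ring
    · rintro s ⟨hs, h1, h2, h3⟩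
      refine ⟨hΦ6 _ _ h1, by simpa [hk'] using h2, ?_⟩
      simp only [Expr.eval, eval_reg, Nat.cast_ofNat, Function.update_self, h3]
      push_cast; ring
  · rintro s ⟨hs, h1, h2, h3⟩
    refine ⟨hs, h1, ?_⟩
    push_cast
    simpa using h2

end Preprocessing
/-! ### The test statistic as a program -/

section Scan

variable {f : ℕ} {s₀ : Mem}

/-- The sign of an integer, where zero counts as positive. -/
def signZ (v : ℤ) : ℤ := if 0 < v + 1 then 1 else -1

/-- The agreement of the signs of the entries `q + j` and `q + j + d` of the data `D`, if `j` and
`j + d` belong to the set with indicator `A`. -/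
def scanTerm (A D : ℤ → ℤ) (p q j d : ℤ) : ℤ :=
  if 0 < A j ∧ 0 < p - (j + d) ∧ 0 < A (j + d) then signZ (D (q + j)) * signZ (D (q + j + d)) else 0

/-- A program that adds the value of `scanTerm` to register `9`. -/
def termProg (f : ℕ) : Prog :=
  .ifPos (.get 3 (reg f 10))
    (.ifPos (.sub (reg f 13) (.add (reg f 10) (reg f 11)))
      (.ifPos (.get 3 (.add (reg f 10) (reg f 11)))
        (.ifPos (.add (.get (f + 1) (.add (reg f 8) (reg f 10))) (.const 1))
          (.ifPos (.add (.get (f + 1) (.add (.add (reg f 8) (reg f 10)) (reg f 11))) (.const 1))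
            (.store f (.const (9 : ℕ)) (.add (reg f 9) (.const 1)))
            (.store f (.const (9 : ℕ)) (.sub (reg f 9) (.const 1))))
          (.ifPos (.add (.get (f + 1) (.add (.add (reg f 8) (reg f 10)) (reg f 11))) (.const 1))
            (.store f (.const (9 : ℕ)) (.sub (reg f 9) (.const 1)))
            (.store f (.const (9 : ℕ)) (.add (reg f 9) (.const 1)))))
        .skip)
      .skip)
    .skip

/-- The bound `6` counts five nested tests and one assignment. The product of two signs is computed
by case distinction since the machine has no multiplication. -/
lemma haltsIn_termProg (hf : 3 < f) (g₀ : ℤ → ℤ) :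
    HaltsIn (RegInv f s₀ fun g => g = g₀) (termProg f) 6 (RegInv f s₀ fun g => g =
      Function.update g₀ 9 (g₀ 9 + scanTerm (s₀ 3) (s₀ (f + 1)) (g₀ 13) (g₀ 8) (g₀ 10) (g₀ 11))) := by
  have h3 : ∀ {s}, RegInv f s₀ (fun g => g = g₀) s → s 3 = s₀ 3 := fun h => h.1 3 hf.ne
  have h1 : ∀ {s}, RegInv f s₀ (fun g => g = g₀) s → s (f + 1) = s₀ (f + 1) := fun h =>
    h.1 (f + 1) (by omega)
  have hstore : ∀ (A : Mem → Prop) (v : Expr) (z : ℤ), (∀ s, A s → RegInv f s₀ (fun g => g = g₀) s) →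
      (∀ s, A s → v.eval s = z) →
      HaltsIn A (.store f (.const (9 : ℕ)) v) 1 (RegInv f s₀ fun g => g = Function.update g₀ 9 z) :=
    fun A v z hA hv => HaltsIn.store fun s hs => (hA s hs).write _ _ (by
      rw [hv s hs, (hA s hs).2]; rfl)
  have hskip : ∀ A : Mem → Prop, (∀ s, A s → RegInv f s₀ (fun g => g = g₀) s) →
      HaltsIn A .skip 1 (RegInv f s₀ fun g => g = Function.update g₀ 9 (g₀ 9 + 0)) :=
    fun A hA => HaltsIn.skip fun s hs => ⟨(hA s hs).1, by rw [(hA s hs).2]; simp⟩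
  set A := s₀ 3
  set D := s₀ (f + 1)
  unfold scanTerm
  by_cases c1 : 0 < A (g₀ 10)
  swap
  · rw [if_neg (by tauto)]
    refine (HaltsIn.ifPos (t := 5) (fun s hs => ?_) ((hskip _ fun s hs => hs.1).mono (fun _ h => h)
      (by norm_num) fun _ h => h))
    have h := hs.2
    simp only [Expr.eval, eval_reg, h3 hs.1, hs.1.2] at h
    exact absurd h c1
  refine HaltsIn.ifPos (t := 5) ?_ (fun s hs => ?_)
  swap
  · have h := hs.2
    simp only [Expr.eval, eval_reg, h3 hs.1, hs.1.2] at h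
    exact absurd c1 h
  by_cases c2 : 0 < g₀ 13 - (g₀ 10 + g₀ 11)
  swap
  · rw [if_neg (by tauto)]
    refine (HaltsIn.ifPos (t := 4) (fun s hs => ?_) ((hskip _ fun s hs => hs.1.1).mono
      (fun _ h => h) (by norm_num) fun _ h => h))
    have h := hs.2
    simp only [Expr.eval, eval_reg, hs.1.1.2] at h
    exact absurd h c2
  refine HaltsIn.ifPos (t := 4) ?_ (fun s hs => ?_)
  swap
  · have h := hs.2
    simp only [Expr.eval, eval_reg, hs.1.1.2] at h
    exact absurd c2 h
  by_cases c3 : 0 < A (g₀ 10 + g₀ 11)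
  swap
  · rw [if_neg (by tauto)]
    refine (HaltsIn.ifPos (t := 3) (fun s hs => ?_) ((hskip _ fun s hs => hs.1.1.1).mono
      (fun _ h => h) (by norm_num) fun _ h => h))
    have h := hs.2
    simp only [Expr.eval, eval_reg, h3 hs.1.1.1, hs.1.1.1.2] at h
    exact absurd h c3
  refine HaltsIn.ifPos (t := 3) ?_ (fun s hs => ?_)
  swap
  · have h := hs.2
    simp only [Expr.eval, eval_reg, h3 hs.1.1.1, hs.1.1.1.2] at h
    exact absurd c3 h
  rw [if_pos ⟨c1, c2, c3⟩]
  refine HaltsIn.ifPos (t := 2) (HaltsIn.ifPos (t := 1) ?_ ?_) (HaltsIn.ifPos (t := 1) ?_ ?_) <;>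
  refine hstore _ _ _ (fun s hs => hs.1.1.1.1.1) (fun s hs => ?_) <;>
  · have e1 := hs.1.2
    have e2 := hs.2
    have e3 := hs.1.1.1.1.1
    simp only [Expr.eval, eval_reg, h1 e3, e3.2, Nat.cast_ofNat] at e1 e2 ⊢
    simp only [signZ, D, e1, e2, if_true, if_false]
    ring

/-- A program that adds the values of `scanTerm` for all odd distances. -/
def pairProg (f : ℕ) : Prog :=
  .seq (.store f (.const (11 : ℕ)) (.const 1)) <| .seq (.store f (.const (12 : ℕ)) (reg f 4)) <|
    .whilePos (reg f 12) <| .seq (termProg f) <|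
      .seq (.store f (.const (11 : ℕ)) (.add (reg f 11) (.const 2)))
        (.store f (.const (12 : ℕ)) (.sub (reg f 12) (.const 1)))

lemma haltsIn_pairProg (hf : 3 < f) (g₀ : ℤ → ℤ) {W : ℕ} (hW : g₀ 4 = W) :
    HaltsIn (RegInv f s₀ fun g => g = g₀) (pairProg f) (1 + (1 + (W * (6 + (1 + 1) + 1) + 1)))
      (RegInv f s₀ fun g => (∀ i, i ≠ 9 → i ≠ 11 → i ≠ 12 → g i = g₀ i) ∧ g 9 = g₀ 9 +
        ∑ e ∈ Finset.range W,
          scanTerm (s₀ 3) (s₀ (f + 1)) (g₀ 13) (g₀ 8) (g₀ 10) ((2 * e + 1 : ℕ) : ℤ)) := by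
  set F : ℕ → ℤ := fun e =>
    scanTerm (s₀ 3) (s₀ (f + 1)) (g₀ 13) (g₀ 8) (g₀ 10) ((2 * e + 1 : ℕ) : ℤ) with hF
  refine HaltsIn.seq (B := RegInv f s₀ fun g => g = Function.update g₀ 11 1)
    (HaltsIn.setReg fun s hs => ?_) (HaltsIn.seq (B := RegInv f s₀ fun g =>
      (∀ i, i ≠ 9 → i ≠ 11 → i ≠ 12 → g i = g₀ i) ∧ ∃ i : ℕ, i + W = W ∧ g 11 = (2 * i + 1 : ℕ) ∧
        g 12 = W ∧ g 9 = g₀ 9 + ∑ e ∈ Finset.range i, F e)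
    (HaltsIn.setReg fun s hs => ?_) (HaltsIn.mono (HaltsIn.whilePos (fun k => RegInv f s₀ fun g =>
      (∀ i, i ≠ 9 → i ≠ 11 → i ≠ 12 → g i = g₀ i) ∧ ∃ i : ℕ, i + k = W ∧ g 11 = (2 * i + 1 : ℕ) ∧
        g 12 = k ∧ g 9 = g₀ 9 + ∑ e ∈ Finset.range i, F e) ?_ ?_
      (fun k => ?_) W) (fun _ h => h) le_rfl ?_))
  · have := hs.2
    simp [Expr.eval, this]
  · have := hs.2
    refine ⟨fun i h9 h11 h12 => ?_, 0, by simp, ?_, ?_, ?_⟩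
    · simp [this, h11, h12]
    · simp [this]
    · simp [eval_reg, this, hW]
    · simp [this]
  · rintro s ⟨hs, hg, i, hi, h11, h12, h9⟩
    simp [eval_reg, h12]
  · rintro k s ⟨hs, hg, i, hi, h11, h12, h9⟩
    simp only [eval_reg, Nat.cast_ofNat, h12]
    positivity
  · intro s hs
    -- The inner program is specified for fixed contents of the registers, so it is instantiated at
    -- the contents in the current round.
    have hterm := haltsIn_termProg (s₀ := s₀) hf (s f)
    obtain ⟨hs1, hg, i, hi, h11, h12, h9⟩ := hs
    refine HaltsIn.seq (A := RegInv f s₀ fun g => g = s f) hterm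
      (HaltsIn.seq (B := RegInv f s₀ fun g =>
        (∀ i, i ≠ 9 → i ≠ 11 → i ≠ 12 → g i = g₀ i) ∧ g 11 = (2 * (i + 1) + 1 : ℕ) ∧
        g 12 = (k + 1 : ℕ) ∧ g 9 = g₀ 9 + ∑ e ∈ Finset.range (i + 1), F e)
        (HaltsIn.setReg fun s' hs' => ?_) (HaltsIn.setReg fun s' hs' => ?_)) s ⟨hs1, rfl⟩
    · have h := hs'.2
      have e1 : s' f 11 = (2 * i + 1 : ℕ) := by rw [h]; simpa using h11
      refine ⟨fun l l9 l11 l12 => ?_, ?_, ?_, ?_⟩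
      · rw [h]; simp [l9, l11]; exact hg l l9 l11 l12
      · simp [Expr.eval, eval_reg, e1]; ring
      · rw [h]; simpa using h12
      · rw [h]
        rw [Function.update_of_ne (by norm_num), Function.update_self]
        rw [h9, Finset.sum_range_succ, hg 13 (by decide) (by decide) (by decide),
          hg 8 (by decide) (by decide) (by decide), hg 10 (by decide) (by decide) (by decide), h11]
        simp only [hF]
        ring
    · obtain ⟨hs1', hg', h11', h12', h9'⟩ := hs'
      refine ⟨fun l l9 l11 l12 => ?_, i + 1, by omega, ?_, ?_, ?_⟩
      · simp [l12]; exact hg' l l9 l11 l12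
      · simpa using h11'
      · simp [Expr.eval, eval_reg, h12']
      · simpa using h9'
  · rintro s ⟨hs, hg, i, hi, h11, h12, h9⟩
    refine ⟨hs, hg, ?_⟩
    rw [h9]; congr 2; rw [show i = W by omega]

/-- A program that scans one row of the data. -/
def rowProg (f : ℕ) : Prog :=
  .seq (.store f (.const (10 : ℕ)) (.const 0)) <|
    .whilePos (.sub (reg f 13) (reg f 10)) <| .seq (pairProg f) <|
      (.store f (.const (10 : ℕ)) (.add (reg f 10) (.const 1)))

lemma haltsIn_rowProg (hf : 3 < f) (g₀ : ℤ → ℤ) {p W : ℕ} (hW : g₀ 4 = W) (hp : g₀ 13 = p) :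
    HaltsIn (RegInv f s₀ fun g => g = g₀) (rowProg f)
      (1 + (p * ((1 + (1 + (W * (6 + (1 + 1) + 1) + 1))) + 1 + 1) + 1))
      (RegInv f s₀ fun g => (∀ i, i ≠ 9 → i ≠ 10 → i ≠ 11 → i ≠ 12 → g i = g₀ i) ∧ g 9 = g₀ 9 +
        ∑ j ∈ Finset.range p, ∑ e ∈ Finset.range W,
          scanTerm (s₀ 3) (s₀ (f + 1)) p (g₀ 8) j ((2 * e + 1 : ℕ) : ℤ)) := by
  set F : ℕ → ℤ := fun j => ∑ e ∈ Finset.range W,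
    scanTerm (s₀ 3) (s₀ (f + 1)) p (g₀ 8) j ((2 * e + 1 : ℕ) : ℤ) with hF
  refine HaltsIn.seq (B := RegInv f s₀ fun g =>
      (∀ i, i ≠ 9 → i ≠ 10 → i ≠ 11 → i ≠ 12 → g i = g₀ i) ∧ ∃ i : ℕ, i + p = p ∧ g 10 = i ∧
        g 9 = g₀ 9 + ∑ e ∈ Finset.range i, F e)
    (HaltsIn.setReg fun s hs => ?_) (HaltsIn.mono (HaltsIn.whilePos (fun k => RegInv f s₀ fun g =>
      (∀ i, i ≠ 9 → i ≠ 10 → i ≠ 11 → i ≠ 12 → g i = g₀ i) ∧ ∃ i : ℕ, i + k = p ∧ g 10 = i ∧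
        g 9 = g₀ 9 + ∑ e ∈ Finset.range i, F e) ?_ ?_
      (fun k => ?_) p) (fun _ h => h) le_rfl ?_)
  · have := hs.2
    refine ⟨fun i h9 h10 h11 h12 => ?_, 0, by simp, ?_, ?_⟩
    · simp [this, h10]
    · simp [Expr.eval]
    · simp [this]
  · rintro s ⟨hs, hg, i, hi, h10, h9⟩
    have h13 := hg 13 (by decide) (by decide) (by decide) (by decide)
    simp only [Expr.eval, eval_reg, Nat.cast_ofNat, h10, h13, hp]
    omega
  · rintro k s ⟨hs, hg, i, hi, h10, h9⟩
    have h13 := hg 13 (by decide) (by decide) (by decide) (by decide)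
    simp only [Expr.eval, eval_reg, Nat.cast_ofNat, h10, h13, hp]
    omega
  · intro s hs
    obtain ⟨hs1, hg, i, hi, h10, h9⟩ := hs
    have hpair := haltsIn_pairProg (s₀ := s₀) hf (s f) (W := W)
      (by rw [hg 4 (by decide) (by decide) (by decide) (by decide), hW])
    refine HaltsIn.seq (A := RegInv f s₀ fun g => g = s f) hpair
      (HaltsIn.setReg fun s' hs' => ?_) s ⟨hs1, rfl⟩
    obtain ⟨-, hg', h9'⟩ := hs'
    refine ⟨fun l l9 l10 l11 l12 => ?_, i + 1, by omega, ?_, ?_⟩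
    · simp [l10]; rw [hg' l l9 l11 l12, hg l l9 l10 l11 l12]
    · have := hg' 10 (by decide) (by decide) (by decide)
      simp [Expr.eval, eval_reg, this, h10]
    · rw [Function.update_of_ne (by norm_num)]
      rw [h9', h9, Finset.sum_range_succ, h10, hg 13 (by decide) (by decide) (by decide) (by decide),
        hg 8 (by decide) (by decide) (by decide) (by decide), hp]
      simp only [hF]
      ring
  · rintro s ⟨hs, hg, i, hi, h10, h9⟩
    refine ⟨hs, hg, ?_⟩
    rw [h9]; congr 2; rw [show i = p by omega]

/-- A program that computes the test statistic (register `9`). -/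
def scanProg (f : ℕ) : Prog :=
  .seq (.store f (.const (8 : ℕ)) (reg f 5)) <| .seq (.store f (.const (9 : ℕ)) (.const 0)) <|
    .whilePos (reg f 14) <| .seq (rowProg f) <|
      .seq (.store f (.const (8 : ℕ)) (.add (reg f 8) (reg f 13)))
        (.store f (.const (14 : ℕ)) (.sub (reg f 14) (.const 1)))

/-- The test statistic. -/
def scanStat (A D : ℤ → ℤ) (p q M W : ℕ) : ℤ :=
  ∑ i ∈ Finset.range M, ∑ j ∈ Finset.range p, ∑ e ∈ Finset.range W,
    scanTerm A D p ((q + i * p : ℕ) : ℤ) j ((2 * e + 1 : ℕ) : ℤ)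

lemma haltsIn_scanProg (hf : 3 < f) {p W M q : ℕ} :
    HaltsIn (RegInv f s₀ fun g => g 4 = W ∧ g 5 = q ∧ g 13 = p ∧ g 14 = M) (scanProg f)
      (1 + (1 + (M * ((1 + (p * ((1 + (1 + (W * (6 + (1 + 1) + 1) + 1))) + 1 + 1) + 1)) +
        (1 + 1) + 1) + 1)))
      (RegInv f s₀ fun g => g 9 = scanStat (s₀ 3) (s₀ (f + 1)) p q M W) := by
  set F : ℕ → ℤ := fun i => ∑ j ∈ Finset.range p, ∑ e ∈ Finset.range W,
    scanTerm (s₀ 3) (s₀ (f + 1)) p ((q + i * p : ℕ) : ℤ) j ((2 * e + 1 : ℕ) : ℤ) with hF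
  refine HaltsIn.seq (B := RegInv f s₀ fun g => g 4 = W ∧ g 13 = p ∧ g 14 = M ∧ g 8 = q)
    (HaltsIn.setReg fun s hs => ?_) (HaltsIn.seq (B := RegInv f s₀ fun g => g 4 = W ∧ g 13 = p ∧
      ∃ i : ℕ, i + M = M ∧ g 14 = M ∧ g 8 = (q + i * p : ℕ) ∧ g 9 = ∑ i ∈ Finset.range i, F i)
    (HaltsIn.setReg fun s hs => ?_) (HaltsIn.mono (HaltsIn.whilePos (fun k => RegInv f s₀ fun g =>
      g 4 = W ∧ g 13 = p ∧ ∃ i : ℕ, i + k = M ∧ g 14 = k ∧ g 8 = (q + i * p : ℕ) ∧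
        g 9 = ∑ i ∈ Finset.range i, F i) ?_ ?_ (fun k => ?_) M) (fun _ h => h) le_rfl ?_))
  · obtain ⟨-, h4, h5, h13, h14⟩ := hs
    refine ⟨by simpa using h4, by simpa using h13, by simpa using h14, ?_⟩
    simp [eval_reg, h5]
  · obtain ⟨-, h4, h13, h14, h8⟩ := hs
    refine ⟨by simpa using h4, by simpa using h13, 0, by simp, by simpa using h14,
      by simpa using h8, by simp [Expr.eval]⟩
  · rintro s ⟨hs, h4, h13, i, hi, h14, h8, h9⟩
    simp [eval_reg, h14]
  · rintro k s ⟨hs, h4, h13, i, hi, h14, h8, h9⟩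
    simp only [eval_reg, Nat.cast_ofNat, h14]
    positivity
  · intro s hs
    obtain ⟨hs1, h4, h13, i, hi, h14, h8, h9⟩ := hs
    refine HaltsIn.seq (A := RegInv f s₀ fun g => g = s f)
      (haltsIn_rowProg (s₀ := s₀) hf (s f) h4 h13)
      (HaltsIn.seq (B := RegInv f s₀ fun g => g 4 = W ∧ g 13 = p ∧ g 14 = (k + 1 : ℕ) ∧
        g 8 = (q + (i + 1) * p : ℕ) ∧ g 9 = ∑ i ∈ Finset.range (i + 1), F i)
        (HaltsIn.setReg fun s' hs' => ?_) (HaltsIn.setReg fun s' hs' => ?_)) s ⟨hs1, rfl⟩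
    · obtain ⟨-, hg', h9'⟩ := hs'
      have e4 := hg' 4 (by decide) (by decide) (by decide) (by decide)
      have e13 := hg' 13 (by decide) (by decide) (by decide) (by decide)
      have e14 := hg' 14 (by decide) (by decide) (by decide) (by decide)
      have e8 := hg' 8 (by decide) (by decide) (by decide) (by decide)
      refine ⟨by simp [e4, h4], by simp [e13, h13], by simp [e14, h14], ?_, ?_⟩
      · simp [Expr.eval, eval_reg, e8, e13, h8, h13]; ring
      · rw [Function.update_of_ne (by norm_num)]
        rw [h9', h9, h8, Finset.sum_range_succ]
    · obtain ⟨-, h4', h13', h14', h8', h9'⟩ := hs'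
      refine ⟨by simpa using h4', by simpa using h13', i + 1, by omega, ?_, by simpa using h8',
        by simpa using h9'⟩
      simp [Expr.eval, eval_reg, h14']
  · rintro s ⟨hs, h4, h13, i, hi, h14, h8, h9⟩
    refine ⟨hs, ?_⟩
    show s f 9 = _
    rw [h9, scanStat, show i = M by omega]

end Scan
/-! ### The test built from a signal recovery program -/

section TestProgram

lemma initMem_one_apply {n p K R : ℕ} (x : Sample n p) (w : Fin R → Bool) (i : Fin n) (j : Fin p) :
    initMem K R x w 1 ((i * p + j : ℕ) : ℤ) = quantize K (x i j) := by
  have h1 : ((i * p + j : ℕ) : ℤ).toNat = i * p + j := Int.toNat_natCast _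
  have h2 : (i : ℕ) * p + j < n * p := by
    have := finProdFinEquiv (i, j)
    have h := (finProdFinEquiv (i, j)).2
    simp only [finProdFinEquiv_apply_val] at h
    rw [mul_comm p] at h
    omega
  have h3 : finProdFinEquiv.symm ⟨((i * p + j : ℕ) : ℤ).toNat, by rw [h1]; exact h2⟩ = (i, j) := by
    rw [Equiv.symm_apply_eq]
    refine Fin.ext ?_
    simp only [finProdFinEquiv_apply_val, h1]
    rw [mul_comm p]
    omega
  simp only [initMem]
  rw [dif_pos ⟨Int.natCast_nonneg _, by rw [h1]; exact h2⟩]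
  rw [h3]

lemma initMem_one_of_not {n p K R : ℕ} (x : Sample n p) (w : Fin R → Bool) {z : ℤ}
    (hz : ¬ (0 ≤ z ∧ z < (n * p : ℕ))) : initMem K R x w 1 z = 0 := by
  simp only [initMem]
  rw [dif_neg]
  rintro ⟨h1, h2⟩
  exact hz ⟨h1, by omega⟩

lemma exists_eq_mul_add {n p : ℕ} {z : ℤ} (h0 : 0 ≤ z) (h1 : z < (n * p : ℕ)) :
    ∃ (i : Fin n) (j : Fin p), z = ((i * p + j : ℕ) : ℤ) := by
  lift z to ℕ using h0
  have h1' : z < n * p := by exact_mod_cast h1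
  have hp : 0 < p := Nat.pos_of_ne_zero fun h => by simp [h] at h1'
  refine ⟨⟨z / p, ?_⟩, ⟨z % p, Nat.mod_lt _ hp⟩, ?_⟩
  · exact Nat.div_lt_of_lt_mul (by rwa [mul_comm] at h1')
  · have := Nat.div_add_mod' z p
    exact_mod_cast this.symm

/-- The first `n` rows of a sample. -/
def firstRows {n N p : ℕ} (h : n ≤ N) (x : Sample N p) : Sample n p := fun i => x (Fin.castLE h i)

lemma initMem_firstRows {n N p K R : ℕ} (h : n ≤ N) (x : Sample N p) (w : Fin R → Bool) (z : ℤ) :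
    initMem K R (firstRows h x) w 1 z = if 0 ≤ z ∧ z < (n * p : ℕ) then initMem K R x w 1 z else 0 := by
  split_ifs with hz
  · obtain ⟨i, j, rfl⟩ := exists_eq_mul_add hz.1 hz.2
    rw [initMem_one_apply]
    exact (initMem_one_apply x w (Fin.castLE h i) j).symm
  · exact initMem_one_of_not _ _ hz

variable {f : ℕ} {s₀ : Mem}

/-- A program that moves the cells of the data with numbers between register `5` and the sum of the
registers `5` and `7` to the array `f + 1`. -/
def saveProg (f : ℕ) : Prog :=
  .seq (.store f (.const (6 : ℕ)) (reg f 7)) <| .whilePos (reg f 6) <|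
    .seq (.store (f + 1) (.sub (.add (reg f 5) (reg f 6)) (.const 1))
        (.get 1 (.sub (.add (reg f 5) (reg f 6)) (.const 1)))) <|
      .seq (.store 1 (.sub (.add (reg f 5) (reg f 6)) (.const 1)) (.const 0))
        (.store f (.const (6 : ℕ)) (.sub (reg f 6) (.const 1)))

/-- The cells with numbers between `u` and `v` have been moved from the array `1` to `f + 1`. -/
def SavedInv (f : ℕ) (s₀ : Mem) (u v : ℕ) (Φ : (ℤ → ℤ) → Prop) (s : Mem) : Prop :=
  (∀ a, a ≠ f → a ≠ f + 1 → a ≠ 1 → s a = s₀ a) ∧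
    (s 1 = fun z => if (u : ℤ) ≤ z ∧ z < v then 0 else s₀ 1 z) ∧
    (s (f + 1) = fun z => if (u : ℤ) ≤ z ∧ z < v then s₀ 1 z else 0) ∧ Φ (s f)

/-- The cells are moved from the top down, so with `k` rounds left exactly the cells from `q + k` to
`q + c` have been moved. Erasing them in array `1` is essential: the recovery program must find the
memory that belongs to the shorter sample. -/
lemma haltsIn_saveProg (hf : 3 < f) {q c : ℕ} (h0 : ∀ z, s₀ (f + 1) z = 0)
    {Φ : (ℤ → ℤ) → Prop} (hΦ6 : ∀ g v, Φ g → Φ (Function.update g 6 v)) (h5 : ∀ g, Φ g → g 5 = q)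
    (h7 : ∀ g, Φ g → g 7 = c) :
    HaltsIn (RegInv f s₀ Φ) (saveProg f) (1 + (c * (1 + (1 + 1) + 1) + 1))
      (SavedInv f s₀ q (q + c) Φ) := by
  refine HaltsIn.seq (B := SavedInv f s₀ (q + c) (q + c) fun g => Φ g ∧ g 6 = c ∧ c ≤ c)
    (HaltsIn.store fun s hs => ?_) (HaltsIn.mono (HaltsIn.whilePos
      (fun k => SavedInv f s₀ (q + k) (q + c) fun g => Φ g ∧ g 6 = k ∧ k ≤ c) ?_ ?_ (fun k => ?_) c)
      (fun _ h => h) le_rfl ?_)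
  · have hs1 := hs.1
    refine ⟨fun a ha _ _ => ?_, ?_, ?_, ?_, ?_⟩
    · rw [Mem.write_of_ne _ ha]; exact hs1 a ha
    · rw [Mem.write_of_ne _ (by omega), hs1 1 (by omega)]
      funext z
      rw [if_neg (by omega)]
    · rw [Mem.write_of_ne _ (by omega), hs1 (f + 1) (by omega)]
      funext z
      rw [if_neg (by omega), h0]
    · rw [Mem.write_same]; exact hΦ6 _ _ hs.2
    · rw [Mem.write_same]
      have := h7 _ hs.2
      exact ⟨by simp [Expr.eval, eval_reg, this], le_rfl⟩
  · rintro s ⟨-, -, -, -, h6, -⟩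
    simp [eval_reg, h6]
  · rintro k s ⟨-, -, -, -, h6, -⟩
    simp only [eval_reg, Nat.cast_ofNat, h6]
    positivity
  · intro s hs
    obtain ⟨hs1, hd, he, hΦ, h6, hkc⟩ := hs
    have hidx : ∀ s' : Mem, s' f = s f →
        (Expr.sub (.add (reg f 5) (reg f 6)) (.const 1)).eval s' = (q + k : ℕ) := by
      intro s' hs'
      simp only [Expr.eval, eval_reg, hs', Nat.cast_ofNat, h5 _ hΦ, h6]
      push_cast; ring
    refine HaltsIn.seq (A := fun s' => s' = s) (B := fun s' => s' f = s f ∧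
        (∀ a, a ≠ f → a ≠ f + 1 → a ≠ 1 → s' a = s₀ a) ∧ s' 1 = s 1 ∧
        (s' (f + 1) = fun z => if ((q + k : ℕ) : ℤ) ≤ z ∧ z < (q + c : ℕ) then s₀ 1 z else 0))
      (HaltsIn.store fun s' hs' => ?_) (HaltsIn.seq (B := SavedInv f s₀ (q + k) (q + c)
        fun g => Φ g ∧ g 6 = (k + 1 : ℕ)) (HaltsIn.store fun s' hs' => ?_)
        (HaltsIn.store fun s' hs' => ?_)) s rfl
    · subst hs'
      rw [hidx s' rfl]
      have hq : s' 1 (q + k : ℕ) = s₀ 1 (q + k : ℕ) := by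
        rw [hd]; exact if_neg (by push_cast; omega)
      refine ⟨Mem.write_of_ne _ (by omega) _ _, fun a ha1 ha2 ha3 => ?_,
        Mem.write_of_ne _ (by omega) _ _, ?_⟩
      · rw [Mem.write_of_ne _ ha2]; exact hs1 a ha1 ha2 ha3
      · rw [Mem.write_same]
        simp only [Expr.eval] at hidx ⊢
        rw [hidx s' rfl, hq, he]
        funext z
        by_cases hz : z = (q + k : ℕ)
        · subst hz
          rw [Function.update_self]
          rw [if_pos (by push_cast; omega)]
        · rw [Function.update_of_ne hz]
          by_cases h : ((q + k : ℕ) : ℤ) ≤ z ∧ z < (q + c : ℕ)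
          · rw [if_pos h, if_pos (by push_cast at *; omega)]
          · rw [if_neg h, if_neg (by push_cast at *; omega)]
    · obtain ⟨hsf, hs1', hd', he'⟩ := hs'
      rw [hidx s' hsf]
      refine ⟨fun a ha1 ha2 ha3 => ?_, ?_, ?_, ?_, ?_⟩
      · rw [Mem.write_of_ne _ ha3]; exact hs1' a ha1 ha2 ha3
      · rw [Mem.write_same, hd', hd]
        funext z
        simp only [Expr.eval]
        by_cases hz : z = (q + k : ℕ)
        · subst hz
          rw [Function.update_self]
          rw [if_pos (by push_cast; omega)]
        · rw [Function.update_of_ne hz]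
          by_cases h : ((q + k : ℕ) : ℤ) ≤ z ∧ z < (q + c : ℕ)
          · rw [if_pos h, if_pos (by push_cast at *; omega)]
          · rw [if_neg h, if_neg (by push_cast at *; omega)]
      · rw [Mem.write_of_ne _ (by omega)]; exact he'
      · rw [Mem.write_of_ne _ (by omega), hsf]; exact hΦ
      · rw [Mem.write_of_ne _ (by omega), hsf]; exact h6
    · obtain ⟨hs1', hd', he', hΦ', h6'⟩ := hs'
      refine ⟨fun a ha1 ha2 ha3 => ?_, ?_, ?_, ?_, ?_⟩
      · rw [Mem.write_of_ne _ ha1]; exact hs1' a ha1 ha2 ha3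
      · rw [Mem.write_of_ne _ (by omega)]; exact hd'
      · rw [Mem.write_of_ne _ (by omega)]; exact he'
      · rw [Mem.write_same]; exact hΦ6 _ _ hΦ'
      · rw [Mem.write_same]
        exact ⟨by simp [Expr.eval, eval_reg, h6'], by omega⟩
  · rintro s ⟨hs1, hd, he, hΦ, -⟩
    exact ⟨hs1, hd, he, hΦ⟩

end TestProgram
/-! ### The test program and its running time -/

section TestProgram

/-- The test program built from the signal recovery program `P`, which uses arrays below `f`. -/
def testProg (P : Prog) (f : ℕ) : Prog :=
  .seq (sizeProg f) <| .seq (divProg f) <| .seq (powProg f) <| .seq (mulProg f 5 (reg f 2)) <|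
    .seq (mulProg f 7 (.sub (.get 0 (.const 0)) (reg f 2))) <|
    .seq (.store f (.const (13 : ℕ)) (.get 0 (.const 1))) <|
    .seq (.store f (.const (14 : ℕ)) (.sub (.get 0 (.const 0)) (reg f 2))) <|
    .seq (saveProg f) <| .seq (.store 0 (.const 0) (reg f 2)) <| .seq P <| .seq (scanProg f) <|
    .store 3 (.const 0) (reg f 9)

/-- The data that are not used by the signal recovery program. -/
def heldOut {N p K R : ℕ} (x : Sample N p) (w : Fin R → Bool) (n : ℕ) (z : ℤ) : ℤ :=
  if ((n * p : ℕ) : ℤ) ≤ z ∧ z < ((n * p + (N - n) * p : ℕ) : ℤ) then initMem K R x w 1 z else 0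

/-- The recovery program is run as a subroutine on memory that it cannot distinguish from its own
initial memory. Precision and number of coins depend on the dimension only, so they need not be
changed. -/
lemma exists_exec_testProg {P : Prog} {f N n L k p K R t τ : ℕ} (hf : 3 < f) (hP : P.bound ≤ f)
    (x : Sample N p) (w : Fin R → Bool) (hL : L = p.size + 1) (hn : n = N / L) (hk : k = N % L)
    (hnN : n ≤ N) {s' : Mem} (hS : Exec P (initMem K R (firstRows hnN x) w) t s') (ht : t ≤ τ) :
    ∃ t' s'', t' ≤ (1 + (1 + (p.size * (1 + 1 + 1) + 1))) + ((1 + (1 + (N / L * (1 + 1 + 1) + 1))) +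
      ((1 + (k * (1 + 1 + 1) + 1)) + ((1 + (1 + (n * (1 + 1 + 1) + 1))) +
      ((1 + (1 + ((N - n) * (1 + 1 + 1) + 1))) + (1 + (1 + ((1 + ((N - n) * p * (1 + (1 + 1) + 1) + 1))
      + (1 + (τ + ((1 + (1 + ((N - n) * ((1 + (p * ((1 + (1 + (2 ^ k * (6 + (1 + 1) + 1) + 1))) + 1 + 1)
      + 1)) + (1 + 1) + 1) + 1))) + 1)))))))))) ∧
      Exec (testProg P f) (initMem K R x w) t' s'' ∧
      s'' 3 0 = scanStat (s' 3) (heldOut (K := K) x w n) p (n * p) (N - n) (2 ^ k) := by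
  set s₀ := initMem K R x w with hs₀
  have hN0 : s₀ 0 0 = N := by simp [hs₀, initMem]
  have hp1 : s₀ 0 1 = p := by simp [hs₀, initMem]
  have hzero : ∀ a, 3 ≤ a → ∀ z, s₀ a z = 0 := by
    intro a ha z
    rw [hs₀]
    match a, ha with
    | a + 3, _ => rfl
  have hf0 : 0 < f := by omega
  have hsub : ((N - n : ℕ) : ℤ) = (N : ℤ) - n := Nat.cast_sub hnN
  set Φ : (ℤ → ℤ) → Prop := fun g => g 2 = n ∧ g 4 = (2 ^ k : ℕ) with hΦ
  set Φ' : (ℤ → ℤ) → Prop := fun g => Φ g ∧ g 5 = (n * p : ℕ) with hΦ'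
  set Ψ : (ℤ → ℤ) → Prop := fun g => (g 2 = n ∧ g 4 = (2 ^ k : ℕ) ∧ g 5 = (n * p : ℕ) ∧ g 13 = p ∧
    g 14 = (N - n : ℕ)) ∧ g 7 = ((N - n) * p : ℕ) with hΨ
  set q := n * p with hq
  set c := (N - n) * p with hc
  have main : HaltsIn (RegInv f s₀ fun _ => True) (testProg P f)
      ((1 + (1 + (p.size * (1 + 1 + 1) + 1))) + ((1 + (1 + (N / L * (1 + 1 + 1) + 1))) +
      ((1 + (k * (1 + 1 + 1) + 1)) + ((1 + (1 + (n * (1 + 1 + 1) + 1))) +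
      ((1 + (1 + ((N - n) * (1 + 1 + 1) + 1))) + (1 + (1 + ((1 + ((N - n) * p * (1 + (1 + 1) + 1) + 1))
      + (1 + (τ + ((1 + (1 + ((N - n) * ((1 + (p * ((1 + (1 + (2 ^ k * (6 + (1 + 1) + 1) + 1))) + 1 + 1)
      + 1)) + (1 + 1) + 1) + 1))) + 1)))))))))))
      (fun s => s 3 0 = scanStat (s' 3) (heldOut (K := K) x w n) p (n * p) (N - n) (2 ^ k)) := by
    refine HaltsIn.seq (haltsIn_sizeProg hf0 hp1) ?_
    rw [← hL]
    refine HaltsIn.seq (haltsIn_divProg hf0 hN0 (by omega)) ?_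
    rw [← hk, ← hn]
    refine HaltsIn.seq haltsIn_powProg ?_
    refine HaltsIn.seq (haltsIn_mulProg (Φ := Φ) (n := n) hf0 hp1 (by norm_num) ?_ ?_ ?_) ?_
    · rintro g v ⟨h2, h4⟩; exact ⟨by simpa using h2, by simpa using h4⟩
    · rintro g v ⟨h2, h4⟩; exact ⟨by simpa using h2, by simpa using h4⟩
    · rintro s ⟨-, h2, h4⟩; simpa [eval_reg] using h2
    refine HaltsIn.seq (haltsIn_mulProg (Φ := Φ') (n := N - n) hf0 hp1 (by norm_num) ?_ ?_ ?_) ?_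
    · rintro g v ⟨⟨h2, h4⟩, h5⟩
      exact ⟨⟨by simpa using h2, by simpa using h4⟩, by simpa using h5⟩
    · rintro g v ⟨⟨h2, h4⟩, h5⟩
      exact ⟨⟨by simpa using h2, by simpa using h4⟩, by simpa using h5⟩
    · rintro s ⟨hs, ⟨h2, h4⟩, h5⟩
      simp only [Expr.eval, eval_reg, hs 0 hf0.ne, hN0, Nat.cast_ofNat, h2, hsub]
    refine HaltsIn.seq (B := RegInv f s₀ fun g => Φ' g ∧ g 7 = c ∧ g 13 = p)
      (HaltsIn.setReg ?_) (HaltsIn.seq (B := RegInv f s₀ Ψ) (HaltsIn.setReg ?_) ?_)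
    · rintro s ⟨hs, ⟨⟨h2, h4⟩, h5⟩, h7⟩
      refine ⟨⟨⟨by simpa using h2, by simpa using h4⟩, by simpa using h5⟩, ?_, ?_⟩
      · rw [Function.update_of_ne (by norm_num)]; exact h7
      simp [Expr.eval, hs 0 hf0.ne, hp1]
    · rintro s ⟨hs, ⟨⟨h2, h4⟩, h5⟩, h7, h13⟩
      refine ⟨⟨by simpa using h2, by simpa using h4, by simpa using h5, by simpa using h13, ?_⟩, ?_⟩
      swap
      · rw [Function.update_of_ne (by norm_num)]; exact h7
      simp [Expr.eval, eval_reg, hs 0 hf0.ne, hN0, h2, hsub]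
    refine HaltsIn.seq (haltsIn_saveProg hf (q := q) (c := c) (hzero _ (by omega)) ?_ ?_ ?_) ?_
    · rintro g v ⟨⟨h2, h4, h5, h13, h14⟩, h7⟩
      exact ⟨⟨by simpa using h2, by simpa using h4, by simpa using h5, by simpa using h13,
        by simpa using h14⟩, by simpa using h7⟩
    · rintro g ⟨⟨h2, h4, h5, h13, h14⟩, h7⟩; exact h5
    · rintro g ⟨⟨h2, h4, h5, h13, h14⟩, h7⟩; exact h7
    set Γ : (ℤ → ℤ) → Prop := fun g => g 4 = (2 ^ k : ℕ) ∧ g 5 = (q : ℕ) ∧ g 13 = p ∧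
      g 14 = (N - n : ℕ)
    set D := heldOut (K := K) x w n with hD
    -- After the stored sample size has been overwritten by `n`, all arrays below `f` coincide with
    -- the initial memory for the first `n` rows.
    refine HaltsIn.seq (B := fun s => (∀ a < f, s a = initMem K R (firstRows hnN x) w a) ∧
      s (f + 1) = D ∧ Γ (s f)) (HaltsIn.store ?_)
      (HaltsIn.seq (B := fun s => (∀ a < f, s a = s' a) ∧ s (f + 1) = D ∧ Γ (s f)) ?_ ?_)
    · rintro s ⟨hs, hs1, hsf, ⟨h2, h4, h5, h13, h14⟩, h7⟩
      refine ⟨fun a ha => ?_, ?_, ?_⟩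
      · by_cases ha0 : a = 0
        · subst ha0
          rw [Mem.write_same, hs 0 (by omega) (by omega) (by omega)]
          simp only [eval_reg, Nat.cast_ofNat, h2]
          funext z
          by_cases hz : z = 0
          · subst hz; simp [Expr.eval, initMem]
          · simp only [Expr.eval, Function.update_of_ne hz, hs₀, initMem, if_neg hz]
        rw [Mem.write_of_ne _ ha0]
        by_cases ha1 : a = 1
        · subst ha1
          rw [hs1]
          funext z
          rw [initMem_firstRows hnN x w z]
          by_cases hz : 0 ≤ z ∧ z < (N * p : ℕ)
          · have hNp : n * p + (N - n) * p = N * p := by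
              rw [← add_mul]; congr 1; omega
            rw [← hNp] at hz
            by_cases hz' : z < (n * p : ℕ)
            · rw [if_neg (by omega), if_pos ⟨hz.1, hz'⟩]
            · rw [if_pos (by omega), if_neg (by omega)]
          · have := initMem_one_of_not (K := K) x w hz
            rw [hs₀, this]; simp
        rw [hs a (by omega) (by omega) ha1]
        by_cases ha2 : a = 2
        · subst ha2; rfl
        funext z
        rw [hzero a (by omega)]
        obtain ⟨a', rfl⟩ : ∃ a', a = a' + 3 := ⟨a - 3, by omega⟩
        rfl
      · rw [Mem.write_of_ne _ (by omega), hsf]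
        rfl
      · rw [Mem.write_of_ne _ (by omega)]
        exact ⟨h4, h5, h13, h14⟩
    · rintro s ⟨hs, hsf, hg⟩
      -- The subroutine uses only arrays below `f`, so its run lifts to the larger memory and leaves
      -- the registers and the held-out data in place.
      have hglue : s = Mem.glue f (initMem K R (firstRows hnN x) w) s := by
        funext a
        by_cases ha : a < f
        · rw [Mem.glue_of_lt ha, hs a ha]
        · rw [Mem.glue_of_le (not_lt.1 ha)]
      refine ⟨t, Mem.glue f s' s, ht, ?_, fun a ha => Mem.glue_of_lt ha _ _, ?_, ?_⟩
      · have := hS.glue hP s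
        rwa [← hglue] at this
      · rw [Mem.glue_of_le (by omega), hsf]
      · rw [Mem.glue_of_le le_rfl]; exact hg
    · intro s hs
      obtain ⟨hs1, hs2, hs3⟩ := hs
      refine HaltsIn.seq (A := RegInv f s Γ) (haltsIn_scanProg hf) (HaltsIn.store ?_) s
        ⟨fun _ _ => rfl, hs3⟩
      rintro u ⟨-, hu⟩
      rw [Mem.write_same]
      have h9 : u f 9 = scanStat (s 3) (s (f + 1)) p q (N - n) (2 ^ k) := hu
      simp only [Expr.eval, eval_reg, Nat.cast_ofNat, Function.update_self, h9, hs2,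
        hs1 3 (by omega), hq]
  exact main s₀ ⟨fun _ _ => rfl, trivial⟩

/-- The longest loop visits `N - n` rows, `p` columns and `2 ^ k` distances. The first number is at
most `(p + 2)²` and each of the others at most `p + 1`, whence the fourth power. -/
lemma testProg_time_le {N n L k p τ : ℕ} (hL : L = p.size + 1) (hn : n = N / L) (hk : k = N % L)
    (hnp : n ≤ p) (hW : 2 ^ k ≤ p + 1) :
    (1 + (1 + (p.size * (1 + 1 + 1) + 1))) + ((1 + (1 + (N / L * (1 + 1 + 1) + 1))) +
      ((1 + (k * (1 + 1 + 1) + 1)) + ((1 + (1 + (n * (1 + 1 + 1) + 1))) +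
      ((1 + (1 + ((N - n) * (1 + 1 + 1) + 1))) + (1 + (1 + ((1 + ((N - n) * p * (1 + (1 + 1) + 1) + 1))
      + (1 + (τ + ((1 + (1 + ((N - n) * ((1 + (p * ((1 + (1 + (2 ^ k * (6 + (1 + 1) + 1) + 1))) + 1 + 1)
      + 1)) + (1 + 1) + 1) + 1))) + 1)))))))))) ≤ 100 * (p + 2) ^ 4 + τ := by
  have h1 : p.size ≤ p := Nat.size_le.2 Nat.lt_two_pow_self
  have h2 : L ≤ p + 1 := by omega
  have h3 : k ≤ p := by
    have : N % L < L := Nat.mod_lt N (by omega)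
    omega
  rw [← hn]
  have h4 : N - n ≤ (p + 2) ^ 2 := by
    have e1 : N = N / L * L + N % L := (Nat.div_add_mod' N L).symm
    rw [← hn, ← hk] at e1
    have e2 : n * L ≤ p * (p + 1) := Nat.mul_le_mul hnp h2
    have e3 : (p + 2) ^ 2 = p * (p + 1) + 3 * p + 4 := by ring
    omega
  set M := N - n
  set W := 2 ^ k
  have hu : 2 ≤ p + 2 := by omega
  set u := p + 2 with hudef
  have h5 : M * p ≤ u ^ 2 * u := Nat.mul_le_mul h4 (by omega)
  have h6 : p * (9 * W + 5) ≤ u * (9 * u + 5) := Nat.mul_le_mul (by omega) (by omega)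
  have h7 : M * (p * (9 * W + 5) + 5) ≤ u ^ 2 * (u * (9 * u + 5) + 5) :=
    Nat.mul_le_mul h4 (by omega)
  have e1 : M * ((1 + (p * ((1 + (1 + (W * (6 + (1 + 1) + 1) + 1))) + 1 + 1) + 1)) + (1 + 1) + 1)
      = M * (p * (9 * W + 5) + 5) := by ring
  have h8 : u ≤ u ^ 4 := Nat.le_self_pow (by norm_num) u
  have h9 : u ^ 2 ≤ u ^ 4 := Nat.pow_le_pow_right (by omega) (by norm_num)
  have h10 : u ^ 3 ≤ u ^ 4 := Nat.pow_le_pow_right (by omega) (by norm_num)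
  have e2 : u ^ 2 * (u * (9 * u + 5) + 5) = 9 * u ^ 4 + 5 * u ^ 3 + 5 * u ^ 2 := by ring
  have e3 : u ^ 2 * u = u ^ 3 := by ring
  have e4 : M * p * (1 + (1 + 1) + 1) = 4 * (M * p) := by ring
  rw [e1, e4]
  omega

lemma exists_time_le_pow_add (c : ℕ) :
    ∃ c', ∀ p : ℕ, 100 * (p + 2) ^ 4 + (p ^ c + c) ≤ p ^ c' + c' := by
  refine ⟨10000 + c + 16, fun p => ?_⟩
  rcases Nat.lt_or_ge p 2 with hp | hp
  · have : p ^ c ≤ 1 := pow_le_one' (by omega) c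
    have h4 : (p + 2) ^ 4 ≤ 3 ^ 4 := Nat.pow_le_pow_left (by omega) 4
    omega
  · have h1 : (p + 2) ^ 4 ≤ (p ^ 2) ^ 4 := Nat.pow_le_pow_left (by nlinarith) 4
    have h2 : 100 ≤ p ^ 7 := le_trans (by norm_num) (Nat.pow_le_pow_left hp 7)
    have h3 : 100 * (p + 2) ^ 4 ≤ p ^ 15 := by
      calc 100 * (p + 2) ^ 4 ≤ p ^ 7 * (p ^ 2) ^ 4 := Nat.mul_le_mul h2 h1
        _ = p ^ 15 := by ring
    have h4 : p ^ 15 + p ^ c ≤ p ^ (10000 + c + 16) := by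
      have e1 : p ^ 15 ≤ p ^ (c + 15) := Nat.pow_le_pow_right (by omega) (by omega)
      have e2 : p ^ c ≤ p ^ (c + 15) := Nat.pow_le_pow_right (by omega) (by omega)
      have e3 : p ^ (c + 15) * 2 ≤ p ^ (c + 15) * p := Nat.mul_le_mul_left _ hp
      have e4 : p ^ (c + 15) * p = p ^ (c + 16) := by ring
      have e5 : p ^ (c + 16) ≤ p ^ (10000 + c + 16) := Nat.pow_le_pow_right (by omega) (by omega)
      omega
    omega

end TestProgram
/-! ### The test as a kernel -/

section TestKernel

lemma toMeasure_map_uniform_apply {R : ℕ} {O : Type*} [MeasurableSpace O]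
    (g : (Fin R → Bool) → O) {s : Set O} (hs : MeasurableSet s) :
    ((PMF.uniformOfFintype (Fin R → Bool)).map g).toMeasure s
      = ∑ w, ((Fintype.card (Fin R → Bool) : ℝ≥0∞))⁻¹ * s.indicator 1 (g w) := by
  rw [PMF.toMeasure_map_apply g _ s (measurable_of_countable g) hs, PMF.toMeasure_apply_fintype]
  refine Finset.sum_congr rfl fun w _ => ?_
  by_cases h : g w ∈ s
  · rw [Set.indicator_of_mem (Set.mem_preimage.2 h), Set.indicator_of_mem h,
      PMF.uniformOfFintype_apply]
    simp
  · have h' : w ∉ g ⁻¹' s := h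
    rw [Set.indicator_of_notMem h', Set.indicator_of_notMem h, mul_zero]

lemma measurable_quantize (K : ℕ) : Measurable (quantize K) :=
  Int.measurable_floor.comp (measurable_const.mul
    (measurable_const.max (measurable_const.min measurable_id)))

/-- A function of the quantized data is measurable. -/
lemma measurable_of_quantize {n p K : ℕ} {O : Type*} [MeasurableSpace O] {F : Sample n p → O}
    (hF : ∀ x x', (∀ i j, quantize K (x i j) = quantize K (x' i j)) → F x = F x') :
    Measurable F := by
  -- The function factors through the quantized data, which take countably many values, and every
  -- function on a countable discrete space is measurable.
  set Q : Sample n p → Fin n → Fin p → ℤ := fun x i j => quantize K (x i j) with hQ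
  have hQm : Measurable Q := by
    refine measurable_pi_lambda _ fun i => measurable_pi_lambda _ fun j => ?_
    exact (measurable_quantize K).comp ((measurable_pi_apply j).comp (measurable_pi_apply i))
  have hfac : Function.FactorsThrough F Q := fun x x' h => hF x x' fun i j =>
    congrFun (congrFun h i) j
  have : F = Function.extend Q F (fun _ => F 0) ∘ Q := by
    funext x
    exact (hfac.extend_apply _ x).symm
  rw [this]
  exact (measurable_of_countable _).comp hQm

lemma initMem_congr {n p K R : ℕ} {x x' : Sample n p}
    (h : ∀ i j, quantize K (x i j) = quantize K (x' i j)) (w : Fin R → Bool) :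
    initMem K R x w = initMem K R x' w := by
  funext a z
  match a with
  | 0 => rfl
  | 1 =>
    simp only [initMem]
    split_ifs
    · exact h _ _
    · rfl
  | 2 => rfl
  | a + 3 => rfl

/-- The functions computed by a randomized program are measurable in the data. -/
lemma measurable_of_exec {n p K R : ℕ} {O : Type*} [MeasurableSpace O] {P : Prog}
    {decode : Mem → O} {F : Sample n p → (Fin R → Bool) → O}
    (h : ∀ x w, ∃ t s, Exec P (initMem K R x w) t s ∧ decode s = F x w) (w : Fin R → Bool) :
    Measurable fun x => F x w := by
  refine measurable_of_quantize (K := K) fun x x' hx => ?_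
  obtain ⟨t, s, h1, h2⟩ := h x w
  obtain ⟨t', s', h1', h2'⟩ := h x' w
  rw [initMem_congr hx] at h1
  rw [← h2, ← h2', h1.unique h1']

/-- A kernel given by fair coins and a function of the data. -/
def coinKernel {n p R : ℕ} {O : Type*} [MeasurableSpace O] (F : Sample n p → (Fin R → Bool) → O)
    (hF : ∀ w, Measurable fun x => F x w) : Kernel (Sample n p) O where
  toFun x := ((PMF.uniformOfFintype (Fin R → Bool)).map (F x)).toMeasure
  measurable' := by
    refine Measure.measurable_of_measurable_coe _ fun s hs => ?_
    simp only [toMeasure_map_uniform_apply _ hs]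
    refine Finset.measurable_fun_sum _ fun w _ => measurable_const.mul ?_
    exact (measurable_one.indicator hs).comp (hF w)

/-- The rows of a sample after the first `n`. -/
def lastRows (n : ℕ) {N p : ℕ} (x : Sample N p) : Sample (N - n) p :=
  fun i => x ⟨n + i, by omega⟩

/-- The sign of a real number, where zero counts as positive. -/
def realSign (v : ℝ) : ℝ := if 0 ≤ v then 1 else -1

open Classical in
/-- The pairs of elements of a set at odd distances less than `2 * W`. -/
def oddPairs {p : ℕ} (A : Set (Fin p)) (W : ℕ) : Finset (Fin p × Fin p) :=
  Finset.univ.filter fun e => e.1 ∈ A ∧ e.2 ∈ A ∧ ∃ d < W, (e.2 : ℕ) = e.1 + (2 * d + 1)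

lemma mem_oddPairs {p : ℕ} {A : Set (Fin p)} {W : ℕ} {e : Fin p × Fin p} :
    e ∈ oddPairs A W ↔ e.1 ∈ A ∧ e.2 ∈ A ∧ ∃ d < W, (e.2 : ℕ) = e.1 + (2 * d + 1) := by
  simp [oddPairs]

/-- The sum of the products of the signs over given pairs of columns. -/
def pairStat {M p : ℕ} (E : Finset (Fin p × Fin p)) (y : Sample M p) : ℝ :=
  ∑ i, ∑ e ∈ E, realSign (y i e.1) * realSign (y i e.2)

/-- Clipping preserves the sign, and the floor of a number is nonnegative exactly if the number is.
So the sign is exact at every precision, including the convention at zero. -/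
lemma signZ_quantize (K : ℕ) (v : ℝ) : (signZ (quantize K v) : ℝ) = realSign v := by
  have h : 0 < quantize K v + 1 ↔ 0 ≤ v := by
    rw [Int.lt_add_one_iff, quantize, Int.floor_nonneg,
      mul_nonneg_iff_of_pos_left (by positivity)]
    have h2 : (0 : ℝ) < 2 ^ K := by positivity
    constructor
    · intro h
      by_contra! hv
      rcases le_max_iff.1 h with h3 | h3
      · linarith
      · exact absurd (le_min_iff.1 h3).2 (not_le.2 hv)
    · intro h
      exact le_max_of_le_right (le_min h2.le h)
  unfold signZ realSign
  simp only [h]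
  split_ifs <;> simp

lemma heldOut_apply {N p K R n : ℕ} (x : Sample N p) (w : Fin R → Bool) (i : Fin (N - n))
    (j : Fin p) {z : ℤ} (hz : z = ((n * p + i * p + j : ℕ) : ℤ)) :
    heldOut (K := K) x w n z = quantize K (lastRows n x i j) := by
  have h1 : n * p + i * p + j = ((⟨n + i, by omega⟩ : Fin N) : ℕ) * p + j := by
    simp only []; ring
  have h2 : (i : ℕ) * p + j < (N - n) * p := by
    have := (finProdFinEquiv (i, j)).2
    simp only [finProdFinEquiv_apply_val] at this
    rw [mul_comm p] at this
    omega
  unfold heldOut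
  rw [if_pos (by rw [hz]; push_cast at *; omega), hz, h1, initMem_one_apply]
  rfl

/-- The program enumerates columns and half distances, the statistic enumerates pairs. Integer
positions outside the matrix or the set contribute zero. -/
lemma scanStat_eq_pairStat {N p K R n W : ℕ} (x : Sample N p) (w : Fin R → Bool) (s : Mem) :
    (scanStat (s 3) (heldOut (K := K) x w n) p (n * p) (N - n) W : ℝ)
      = pairStat (oddPairs (decodeSet p s) W) (lastRows n x) := by
  classical
  unfold scanStat pairStat
  rw [Finset.sum_range]
  push_cast
  refine Finset.sum_congr rfl fun i _ => ?_
  rw [Finset.sum_range]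
  rw [← Finset.sum_product']
  set D := heldOut (K := K) x w n with hD
  have hterm : ∀ (j : Fin p) (e : ℕ), ((scanTerm (s 3) D p
      (((n * p + i * p : ℕ)) : ℤ) (j : ℕ) ((2 * e + 1 : ℕ) : ℤ) : ℤ) : ℝ)
      = if h : (j : ℕ) + (2 * e + 1) < p then (if j ∈ decodeSet p s ∧
        (⟨(j : ℕ) + (2 * e + 1), h⟩ : Fin p) ∈ decodeSet p s then
          realSign (lastRows n x i j) * realSign (lastRows n x i ⟨(j : ℕ) + (2 * e + 1), h⟩)
          else 0) else 0 := by
    intro j e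
    unfold scanTerm
    by_cases h : (j : ℕ) + (2 * e + 1) < p
    · rw [dif_pos h]
      have hc : ((j : ℕ) : ℤ) + ((2 * e + 1 : ℕ) : ℤ) = (((j : ℕ) + (2 * e + 1) : ℕ) : ℤ) := by
        push_cast; ring
      have hpos : (0 : ℤ) < p - (((j : ℕ) : ℤ) + ((2 * e + 1 : ℕ) : ℤ)) := by
        rw [hc]; omega
      by_cases h2 : j ∈ decodeSet p s ∧ (⟨(j : ℕ) + (2 * e + 1), h⟩ : Fin p) ∈ decodeSet p s
      · rw [if_pos h2, if_pos ⟨h2.1, hpos, by rw [hc]; exact h2.2⟩]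
        rw [hD, heldOut_apply x w i j (by push_cast; ring),
          heldOut_apply x w i ⟨(j : ℕ) + (2 * e + 1), h⟩ (by push_cast; ring)]
        push_cast
        rw [signZ_quantize, signZ_quantize]
      · rw [if_neg h2, if_neg, Int.cast_zero]
        rintro ⟨h3, -, h4⟩
        rw [hc] at h4
        exact h2 ⟨h3, h4⟩
    · rw [dif_neg h, if_neg, Int.cast_zero]
      rintro ⟨-, h3, -⟩
      push_cast at h3
      omega
  push_cast at hterm
  rw [Finset.sum_congr rfl fun x _ => hterm x.1 x.2]
  symm
  -- A pair at distance `2 d + 1` corresponds to its first column and `d`, which integer halving of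
  -- the distance recovers.
  refine Finset.sum_bij_ne_zero (fun e he _ => (e.1, ((e.2 : ℕ) - e.1) / 2)) ?_ ?_ ?_ ?_
  · intro e he _
    obtain ⟨h1, h2, d, hd, h3⟩ := mem_oddPairs.1 he
    rw [Finset.mem_product, Finset.mem_range]
    exact ⟨Finset.mem_univ _, by simp only []; omega⟩
  · intro e he _ e' he' _ h
    obtain ⟨-, -, d, hd, h3⟩ := mem_oddPairs.1 he
    obtain ⟨-, -, d', hd', h3'⟩ := mem_oddPairs.1 he'
    rw [Prod.mk.injEq] at h
    have h1 := congrArg Fin.val h.1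
    refine Prod.ext h.1 (Fin.ext ?_)
    have := h.2
    omega
  · rintro ⟨j, d⟩ hjd hne
    rw [Finset.mem_product, Finset.mem_range] at hjd
    simp only [] at hne hjd
    by_cases h : (j : ℕ) + (2 * d + 1) < p
    swap
    · rw [dif_neg h] at hne; exact absurd rfl hne
    rw [dif_pos h] at hne
    by_cases h2 : j ∈ decodeSet p s ∧ (⟨(j : ℕ) + (2 * d + 1), h⟩ : Fin p) ∈ decodeSet p s
    swap
    · rw [if_neg h2] at hne; exact absurd rfl hne
    rw [if_pos h2] at hne
    refine ⟨(j, ⟨(j : ℕ) + (2 * d + 1), h⟩), mem_oddPairs.2 ⟨h2.1, h2.2, d, hjd.2, rfl⟩, hne, ?_⟩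
    rw [Prod.mk.injEq]
    exact ⟨rfl, by simp only []; omega⟩
  · intro e he _
    obtain ⟨h1, h2, d, hd, h3⟩ := mem_oddPairs.1 he
    have h4 : ((e.2 : ℕ) - e.1) / 2 = d := by omega
    have h5 : (e.1 : ℕ) + (2 * (((e.2 : ℕ) - e.1) / 2) + 1) < p := by
      rw [h4, ← h3]; exact e.2.2
    have h6 : (⟨(e.1 : ℕ) + (2 * (((e.2 : ℕ) - e.1) / 2) + 1), h5⟩ : Fin p) = e.2 :=
      Fin.ext (by simp only [h4]; exact h3.symm)
    rw [dif_pos h5, h6, if_pos ⟨h1, h2⟩]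

/-- From a polynomial-time signal recovery procedure one gets a polynomial-time test, which compares
signs of the remaining observations at pairs of estimated signal coordinates. -/
theorem exists_polyTime_test {n N L k : ℕ → ℕ} {S : Procedure n fun p => Set (Fin p)}
    (hS : IsPolyTime n decodeSet S) (hL : ∀ p, L p = p.size + 1) (hn : ∀ p, n p = N p / L p)
    (hk : ∀ p, k p = N p % L p) (hnN : ∀ p, n p ≤ N p) (hnp : ∀ p, n p ≤ p)
    (hW : ∀ p, 2 ^ k p ≤ p + 1) :
    ∃ (R : ℕ → ℕ) (F : ∀ p, Sample (n p) p → (Fin (R p) → Bool) → Set (Fin p))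
      (φ : Procedure N fun _ => Bool), IsPolyTime N decodeTest φ ∧
      (∀ p w, Measurable fun y => F p y w) ∧
      (∀ p y, S p y = ((PMF.uniformOfFintype (Fin (R p) → Bool)).map (F p y)).toMeasure) ∧
      ∀ p x, φ p x {true} = ∑ w, ((Fintype.card (Fin (R p) → Bool) : ℝ≥0∞))⁻¹ *
        {x | 0 < pairStat (oddPairs (F p (firstRows (hnN p) x) w) (2 ^ k p))
          (lastRows (n p) x)}.indicator 1 x := by
  obtain ⟨P, a, b, c, hP⟩ := hS
  choose F hF hSF using hP
  obtain ⟨c', hc'⟩ := exists_time_le_pow_add c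
  -- The arrays `0` to `3` hold input and output, so the registers have to lie beyond them as well
  -- as beyond all arrays of the given program.
  set f := max P.bound 4 with hf
  set G : ∀ p, Sample (N p) p → (Fin (p ^ b + b) → Bool) → Bool := fun p x w =>
    decide (0 < pairStat (oddPairs (F p (firstRows (hnN p) x) w) (2 ^ k p)) (lastRows (n p) x))
    with hG
  have hexec : ∀ p (x : Sample (N p) p) w, ∃ t s, Exec (testProg P f)
      (initMem (p ^ a + a) (p ^ b + b) x w) t s ∧ t ≤ p ^ c' + c' ∧ decodeTest p s = G p x w := by
    intro p x w
    obtain ⟨t, s', h1, h2, h3⟩ := hF p (firstRows (hnN p) x) w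
    obtain ⟨t', s'', h4, h5, h6⟩ := exists_exec_testProg (f := f) (by omega) (le_max_left _ _) x w
      (hL p) (hn p) (hk p) (hnN p) h1 h2
    refine ⟨t', s'', h5, h4.trans ((testProg_time_le (hL p) (hn p) (hk p) (hnp p) (hW p)).trans
      (hc' p)), ?_⟩
    simp only [decodeTest, hG, h6]
    rw [← h3, ← scanStat_eq_pairStat (K := p ^ a + a) x w s', decide_eq_decide, Int.cast_pos]
  have hGm : ∀ p w, Measurable fun x => G p x w := fun p w =>
    measurable_of_exec (P := testProg P f) (decode := decodeTest p) (K := p ^ a + a)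
      (fun x w => by
        obtain ⟨t, s, h1, -, h2⟩ := hexec p x w
        exact ⟨t, s, h1, h2⟩) w
  refine ⟨fun p => p ^ b + b, F, fun p => coinKernel (G p) (hGm p),
    ⟨testProg P f, a, b, c', fun p => ⟨G p, hexec p, fun x => rfl⟩⟩, fun p w => ?_, hSF, ?_⟩
  · exact measurable_of_exec (P := P) (decode := decodeSet p) (K := p ^ a + a)
      (fun x w => by
        obtain ⟨t, s, h1, -, h2⟩ := hF p x w
        exact ⟨t, s, h1, h2⟩) w
  · intro p x
    refine (toMeasure_map_uniform_apply (G p x) (MeasurableSet.singleton true)).trans ?_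
    refine Finset.sum_congr rfl fun w _ => ?_
    congr 1
    simp [Set.indicator, hG]

end TestKernel
/-! ### Sums of products of independent signs -/

section Signs

lemma realSign_sq (v : ℝ) : realSign v ^ 2 = 1 := by unfold realSign; split_ifs <;> norm_num

lemma abs_realSign (v : ℝ) : |realSign v| = 1 := by unfold realSign; split_ifs <;> norm_num

lemma realSign_neg {v : ℝ} (hv : v ≠ 0) : realSign (-v) = -realSign v := by
  unfold realSign
  rcases lt_or_gt_of_ne hv with h | h
  · rw [if_pos (by linarith), if_neg (by linarith), neg_neg]
  · rw [if_neg (by linarith), if_pos (by linarith)]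

lemma measurable_realSign : Measurable realSign :=
  Measurable.ite measurableSet_Ici measurable_const measurable_const

/-- The mean of the sign of a normal variable with mean `t` and variance one. -/
def meanSign (t : ℝ) : ℝ := ∫ v, realSign v ∂gaussianReal t 1

lemma meanSign_eq (t : ℝ) : meanSign t = ∫ z, realSign (z + t) ∂gaussianReal 0 1 := by
  unfold meanSign
  have h := gaussianReal_map_add_const (μ := 0) (v := 1) t
  rw [zero_add] at h
  rw [← h, integral_map (by fun_prop) measurable_realSign.aestronglyMeasurable]

lemma integrable_realSign_comp {Ω : Type*} [MeasurableSpace Ω] {P : Measure Ω} [IsFiniteMeasure P]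
    {X : Ω → ℝ} (hX : Measurable X) : Integrable (fun ω => realSign (X ω)) P :=
  Integrable.of_bound (measurable_realSign.comp hX).aestronglyMeasurable 1
    (ae_of_all _ fun ω => (abs_realSign _).le)

lemma meanSign_neg (t : ℝ) : meanSign (-t) = -meanSign t := by
  rw [meanSign_eq, meanSign_eq, ← integral_neg]
  have h := gaussianReal_map_neg (μ := 0) (v := 1)
  rw [neg_zero] at h
  conv_lhs => rw [← h]
  have hm : Measurable fun z : ℝ => realSign (z + -t) := measurable_realSign.comp (by fun_prop)
  rw [integral_map (by fun_prop) hm.aestronglyMeasurable]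
  refine integral_congr_ae ?_
  have hne : ∀ᵐ z ∂gaussianReal 0 1, z ≠ -t := by
    have := nullSingletonClass_gaussianReal (μ := 0) (v := 1) one_ne_zero
    exact (Set.countable_singleton (-t)).ae_notMem _
  filter_upwards [hne] with z hz
  rw [← realSign_neg (fun h => hz (by linarith))]
  congr 1; ring

lemma meanSign_zero : meanSign 0 = 0 := by
  have := meanSign_neg 0
  rw [neg_zero] at this
  linarith

/-- Symmetry of the normal law doubles the mean into the integral of `sign (z + t) - sign (z - t)`,
which is twice the indicator of the interval `[-t, t)`. Bounds for the density then make the mean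
comparable to `t`. -/
lemma meanSign_eq_measure {t : ℝ} (ht : 0 ≤ t) :
    meanSign t = (gaussianReal 0 1).real (Set.Ico (-t) t) := by
  have h1 : 2 * meanSign t = ∫ z, (realSign (z + t) - realSign (z + -t)) ∂gaussianReal 0 1 := by
    rw [integral_sub (integrable_realSign_comp (by fun_prop)) (integrable_realSign_comp (by fun_prop)),
      ← meanSign_eq, ← meanSign_eq, meanSign_neg]
    ring
  have h2 : ∀ z, realSign (z + t) - realSign (z + -t)
      = 2 * (Set.Ico (-t) t).indicator 1 z := by
    intro z
    unfold realSign Set.indicator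
    simp only [Set.mem_Ico, Pi.one_apply]
    by_cases c1 : 0 ≤ z + t <;> by_cases c2 : 0 ≤ z + -t
    · rw [if_pos c1, if_pos c2, if_neg (by rintro ⟨-, h⟩; linarith)]; norm_num
    · rw [if_pos c1, if_neg c2, if_pos ⟨by linarith, by linarith⟩]; norm_num
    · exact absurd (by linarith) c1
    · rw [if_neg c1, if_neg c2, if_neg (by rintro ⟨h, -⟩; exact c1 (by linarith))]; norm_num
  simp only [h2] at h1
  rw [integral_const_mul, integral_indicator_one measurableSet_Ico] at h1
  linarith

lemma gaussianPDFReal_std_le (z : ℝ) : gaussianPDFReal 0 1 z ≤ 1 / 2 := by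
  rw [gaussianPDFReal]
  have h1 : (2 : ℝ) ≤ √(2 * Real.pi * (1 : ℝ≥0)) := by
    refine Real.le_sqrt_of_sq_le ?_
    have := Real.pi_gt_three
    simp only [NNReal.coe_one]
    linarith
  have h2 : Real.exp (-(z - 0) ^ 2 / (2 * (1 : ℝ≥0))) ≤ 1 := by
    refine Real.exp_le_one_iff.2 ?_
    simp only [NNReal.coe_one]
    nlinarith [sq_nonneg (z - 0)]
  calc _ ≤ (2 : ℝ)⁻¹ * 1 := by gcongr
    _ = 1 / 2 := by norm_num

lemma le_gaussianPDFReal_std {z : ℝ} (hz : |z| ≤ 1) : 1 / 8 ≤ gaussianPDFReal 0 1 z := by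
  rw [gaussianPDFReal]
  have h1 : √(2 * Real.pi * (1 : ℝ≥0)) ≤ 4 := by
    refine Real.sqrt_le_iff.2 ⟨by norm_num, ?_⟩
    have := Real.pi_le_four
    simp only [NNReal.coe_one]
    linarith
  have h0 : 0 < √(2 * Real.pi * (1 : ℝ≥0)) := Real.sqrt_pos.2 (by
    have := Real.pi_pos; simp only [NNReal.coe_one]; linarith)
  have h2 : 1 / 2 ≤ Real.exp (-(z - 0) ^ 2 / (2 * (1 : ℝ≥0))) := by
    have h3 := Real.add_one_le_exp (-(z - 0) ^ 2 / (2 * (1 : ℝ≥0)))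
    have h4 : z ^ 2 ≤ 1 := (sq_le_one_iff_abs_le_one z).2 hz
    simp only [NNReal.coe_one, sub_zero] at h3 ⊢
    linarith
  calc (1 / 8 : ℝ) = (4 : ℝ)⁻¹ * (1 / 2) := by norm_num
    _ ≤ _ := by gcongr

lemma meanSign_le {t : ℝ} (ht : 0 ≤ t) : meanSign t ≤ t := by
  rw [meanSign_eq_measure ht, measureReal_def]
  refine ENNReal.toReal_le_of_le_ofReal ht ?_
  rw [gaussianReal_apply 0 one_ne_zero]
  calc ∫⁻ z in Set.Ico (-t) t, gaussianPDF 0 1 z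
      ≤ ∫⁻ _ in Set.Ico (-t) t, ENNReal.ofReal (1 / 2) := by
        refine lintegral_mono fun z => ?_
        exact ENNReal.ofReal_le_ofReal (gaussianPDFReal_std_le z)
    _ = ENNReal.ofReal t := by
        rw [setLIntegral_const, Real.volume_Ico, ← ENNReal.ofReal_mul (by norm_num)]
        congr 1; ring

/-- An interval of length `2 t` inside `[-1, 1]`, where the density is at least `1 / 8`. -/
lemma le_meanSign {t : ℝ} (ht : 0 ≤ t) (ht1 : t ≤ 1) : t / 4 ≤ meanSign t := by
  rw [meanSign_eq_measure ht, measureReal_def]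
  refine (ENNReal.ofReal_le_iff_le_toReal (measure_ne_top _ _)).1 ?_
  rw [gaussianReal_apply 0 one_ne_zero]
  calc ENNReal.ofReal (t / 4) = ∫⁻ _ in Set.Ico (-t) t, ENNReal.ofReal (1 / 8) := by
        rw [setLIntegral_const, Real.volume_Ico, ← ENNReal.ofReal_mul (by norm_num)]
        congr 1; ring
    _ ≤ ∫⁻ z in Set.Ico (-t) t, gaussianPDF 0 1 z := by
        refine setLIntegral_mono (measurable_gaussianPDF 0 1) fun z hz => ?_
        refine ENNReal.ofReal_le_ofReal (le_gaussianPDFReal_std ?_)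
        rw [Set.mem_Ico] at hz
        exact abs_le.2 ⟨by linarith, by linarith⟩

lemma abs_meanSign (t : ℝ) : |meanSign t| = meanSign |t| := by
  have h0 : ∀ s, 0 ≤ s → 0 ≤ meanSign s := fun s hs => by
    rw [meanSign_eq_measure hs]; exact measureReal_nonneg
  rcases le_total 0 t with h | h
  · rw [abs_of_nonneg h, abs_of_nonneg (h0 t h)]
  · rw [abs_of_nonpos h, meanSign_neg, abs_of_nonpos]
    have := h0 (-t) (by linarith)
    rw [meanSign_neg] at this
    linarith

/-- The second moment of a centred sum of products of two independent signs. -/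
lemma integral_sq_sum_pairs_le {Ω V ι : Type*} [DecidableEq V] [DecidableEq ι] [MeasurableSpace Ω]
    {P : Measure Ω} [IsProbabilityMeasure P] {s : V → Ω → ℝ} (hs : ∀ v, Measurable (s v))
    (hs2 : ∀ v ω, s v ω ^ 2 = 1) {x : V → ℝ}
    (hprod : ∀ T : Finset V, ∫ ω, ∏ v ∈ T, s v ω ∂P = ∏ v ∈ T, x v) {X : ℝ} (hX : 0 ≤ X)
    (hxX : ∀ v, |x v| ≤ X) (hx1 : ∀ v, |x v| ≤ 1) (E : Finset ι) (T : ι → Finset V)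
    (hT : ∀ e ∈ E, (T e).card = 2) (hinj : Set.InjOn T E) {D : ℕ}
    (hD : ∀ e ∈ E, (E.filter fun e' => ¬ Disjoint (T e) (T e')).card ≤ D) :
    ∫ ω, (∑ e ∈ E, ∏ v ∈ T e, s v ω - ∑ e ∈ E, ∏ v ∈ T e, x v) ^ 2 ∂P
      ≤ E.card * (1 + D * X ^ 2) := by
  have hsb : ∀ v ω, |s v ω| = 1 := fun v ω => by
    have := hs2 v ω
    rw [← sq_abs] at this
    nlinarith [abs_nonneg (s v ω)]
  have hint : ∀ T : Finset V, Integrable (fun ω => ∏ v ∈ T, s v ω) P := fun T =>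
    Integrable.of_bound (Finset.measurable_fun_prod T fun v _ => hs v).aestronglyMeasurable 1
      (ae_of_all _ fun ω => by
        rw [Real.norm_eq_abs, Finset.abs_prod, Finset.prod_congr rfl fun v _ => hsb v ω,
          Finset.prod_const_one])
  have hmul : ∀ T T' : Finset V, ∀ y : V → ℝ, (∏ v ∈ T, y v) * ∏ v ∈ T', y v
      = (∏ v ∈ symmDiff T T', y v) * ∏ v ∈ T ∩ T', y v ^ 2 := by
    intro T T' y
    have h1 : ∏ v ∈ T, y v = (∏ v ∈ T \ T', y v) * ∏ v ∈ T ∩ T', y v := by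
      rw [mul_comm, Finset.prod_inter_mul_prod_sdiff]
    have h2 : ∏ v ∈ T', y v = (∏ v ∈ T' \ T, y v) * ∏ v ∈ T ∩ T', y v := by
      rw [mul_comm, Finset.inter_comm, Finset.prod_inter_mul_prod_sdiff]
    have h3 : ∏ v ∈ symmDiff T T', y v = (∏ v ∈ T \ T', y v) * ∏ v ∈ T' \ T, y v := by
      rw [symmDiff_def, Finset.sup_eq_union, Finset.prod_union]
      exact Finset.disjoint_left.2 fun v h h' =>
        (Finset.mem_sdiff.1 h').2 (Finset.mem_sdiff.1 h).1
    rw [h1, h2, h3, Finset.prod_pow]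
    ring
  have hcov : ∀ e ∈ E, ∀ e' ∈ E,
      ∫ ω, (∏ v ∈ T e, s v ω - ∏ v ∈ T e, x v) * (∏ v ∈ T e', s v ω - ∏ v ∈ T e', x v) ∂P
        ≤ (if e = e' then 1 else 0) + if ¬ Disjoint (T e) (T e') then X ^ 2 else 0 := by
    intro e he e' he'
    -- A sign that occurs in both products squares to one, so only the symmetric difference remains.
    -- Hence disjoint pairs are uncorrelated, and two distinct overlapping pairs have covariance at
    -- most `X²`.
    have h1 : ∫ ω, (∏ v ∈ T e, s v ω - ∏ v ∈ T e, x v) * (∏ v ∈ T e', s v ω - ∏ v ∈ T e', x v) ∂P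
        = (∏ v ∈ symmDiff (T e) (T e'), x v) - (∏ v ∈ T e, x v) * ∏ v ∈ T e', x v := by
      have h2 : ∀ ω, (∏ v ∈ T e, s v ω - ∏ v ∈ T e, x v) * (∏ v ∈ T e', s v ω - ∏ v ∈ T e', x v)
          = (∏ v ∈ symmDiff (T e) (T e'), s v ω - (∏ v ∈ T e', x v) * ∏ v ∈ T e, s v ω)
            - ((∏ v ∈ T e, x v) * ∏ v ∈ T e', s v ω - (∏ v ∈ T e, x v) * ∏ v ∈ T e', x v) := by
        intro ω
        have := hmul (T e) (T e') fun v => s v ω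
        rw [Finset.prod_congr rfl fun v (_ : v ∈ T e ∩ T e') => hs2 v ω, Finset.prod_const_one,
          mul_one] at this
        rw [← this]; ring
      simp only [h2]
      have i1 : Integrable (fun ω => ∏ v ∈ symmDiff (T e) (T e'), s v ω -
          (∏ v ∈ T e', x v) * ∏ v ∈ T e, s v ω) P := (hint _).sub ((hint _).const_mul _)
      have i2 : Integrable (fun ω => (∏ v ∈ T e, x v) * ∏ v ∈ T e', s v ω -
          (∏ v ∈ T e, x v) * ∏ v ∈ T e', x v) P := ((hint _).const_mul _).sub (integrable_const _)
      rw [integral_sub i1 i2,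
        integral_sub (hint _) ((hint _).const_mul _),
        integral_sub ((hint _).const_mul _) (integrable_const _), integral_const_mul,
        integral_const_mul, hprod, hprod, hprod, integral_const]
      simp only [probReal_univ, smul_eq_mul, one_mul]
      ring
    rw [h1, hmul]
    have hxT : ∀ T : Finset V, |∏ v ∈ T, x v| ≤ X ^ T.card := fun T => by
      rw [Finset.abs_prod]
      exact (Finset.prod_le_prod (fun v _ => abs_nonneg _) fun v _ => hxX v).trans_eq
        (Finset.prod_const X)
    have hx2 : ∀ T : Finset V, 0 ≤ ∏ v ∈ T, x v ^ 2 ∧ ∏ v ∈ T, x v ^ 2 ≤ 1 := fun T =>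
      ⟨Finset.prod_nonneg fun v _ => sq_nonneg _, Finset.prod_le_one (fun v _ => sq_nonneg _)
        fun v _ => (sq_le_one_iff_abs_le_one _).2 (hx1 v)⟩
    obtain ⟨hq0, hq1⟩ := hx2 (T e ∩ T e')
    set q := ∏ v ∈ T e ∩ T e', x v ^ 2
    by_cases hee : e = e'
    · subst hee
      rw [if_pos rfl, symmDiff_self, Finset.bot_eq_empty, Finset.prod_empty]
      have : 0 ≤ if ¬ Disjoint (T e) (T e) then X ^ 2 else 0 := by split_ifs <;> positivity
      linarith
    rw [if_neg hee, zero_add]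
    by_cases hdis : Disjoint (T e) (T e')
    · have : q = 1 := by
        simp only [q]
        rw [Finset.disjoint_iff_inter_eq_empty.1 hdis, Finset.prod_empty]
      rw [this, if_neg (not_not.2 hdis)]
      linarith
    · rw [if_pos hdis]
      have hTne : T e ≠ T e' := fun h => hee (hinj he he' h)
      have hcard : (symmDiff (T e) (T e')).card = 2 := by
        have h3 : 0 < (T e ∩ T e').card := Finset.card_pos.2
          (Finset.nonempty_iff_ne_empty.2 fun h => hdis (Finset.disjoint_iff_inter_eq_empty.2 h))
        have h4 : (T e ∩ T e').card ≠ 2 := by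
          intro h4
          have h5 : T e ∩ T e' = T e := Finset.eq_of_subset_of_card_le Finset.inter_subset_left
            (by rw [h4, hT e he])
          have h6 : T e ∩ T e' = T e' := Finset.eq_of_subset_of_card_le Finset.inter_subset_right
            (by rw [h4, hT e' he'])
          exact hTne (h5.symm.trans h6)
        have h7 := Finset.card_inter_add_card_sdiff (T e) (T e')
        have h8 := Finset.card_inter_add_card_sdiff (T e') (T e)
        rw [hT e he] at h7
        rw [hT e' he', Finset.inter_comm] at h8
        rw [symmDiff_def, Finset.sup_eq_union, Finset.card_union_of_disjoint]
        · omega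
        · exact Finset.disjoint_left.2 fun v h h' =>
            (Finset.mem_sdiff.1 h').2 (Finset.mem_sdiff.1 h).1
      have h9 := hxT (symmDiff (T e) (T e'))
      rw [hcard] at h9
      have h10 := le_abs_self (∏ v ∈ symmDiff (T e) (T e'), x v)
      have h11 := neg_abs_le (∏ v ∈ symmDiff (T e) (T e'), x v)
      nlinarith
  have hexp : ∀ ω, (∑ e ∈ E, ∏ v ∈ T e, s v ω - ∑ e ∈ E, ∏ v ∈ T e, x v) ^ 2
      = ∑ e ∈ E, ∑ e' ∈ E, (∏ v ∈ T e, s v ω - ∏ v ∈ T e, x v) *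
        (∏ v ∈ T e', s v ω - ∏ v ∈ T e', x v) := by
    intro ω
    rw [← Finset.sum_sub_distrib, pow_two, Finset.sum_mul_sum]
  have hintm : ∀ e e', Integrable (fun ω => (∏ v ∈ T e, s v ω - ∏ v ∈ T e, x v) *
        (∏ v ∈ T e', s v ω - ∏ v ∈ T e', x v)) P := fun e e' =>
    Integrable.bdd_mul (c := 1 + |∏ v ∈ T e, x v|) ((hint _).sub (integrable_const _))
      ((hint _).sub (integrable_const _)).aestronglyMeasurable (ae_of_all _ fun ω => by
        refine (norm_sub_le _ _).trans ?_
        rw [Real.norm_eq_abs, Real.norm_eq_abs, Finset.abs_prod,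
          Finset.prod_congr rfl fun v _ => hsb v ω, Finset.prod_const_one])
  simp only [hexp]
  rw [integral_finsetSum _ fun e _ => integrable_finsetSum _ fun e' _ => hintm e e']
  simp only [integral_finsetSum _ fun e' _ => hintm _ e']
  refine (Finset.sum_le_sum fun e he => (Finset.sum_le_sum fun e' he' => hcov e he e' he').trans
    (show _ ≤ 1 + (D : ℝ) * X ^ 2 from ?_)).trans ?_
  · rw [Finset.sum_add_distrib, Finset.sum_ite_eq, if_pos he, ← Finset.sum_filter,
      Finset.sum_const, nsmul_eq_mul]
    have : ((E.filter fun e' => ¬ Disjoint (T e) (T e')).card : ℝ) ≤ D := Nat.cast_le.2 (hD e he)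
    gcongr
  · rw [Finset.sum_const, nsmul_eq_mul]

end Signs
/-! ### Errors of the test for a given set of pairs -/

section TestErrors

variable {M p : ℕ}

lemma measurable_pairStat (E : Finset (Fin p × Fin p)) :
    Measurable (pairStat E : Sample M p → ℝ) := by
  have h : ∀ i j, Measurable fun y : Sample M p => realSign (y i j) := fun i j =>
    measurable_realSign.comp ((measurable_pi_apply j).comp (measurable_pi_apply i))
  exact Finset.measurable_fun_sum _ fun i _ => Finset.measurable_fun_sum _ fun e _ =>
    (h i e.1).mul (h i e.2)

/-- The signs of the entries in the even columns are changed. -/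
def flipEven (y : Sample M p) : Sample M p := fun i j => if Even (j : ℕ) then -y i j else y i j

lemma measurePreserving_flipEven :
    MeasurePreserving (flipEven : Sample M p → Sample M p) (noiseLaw M p) (noiseLaw M p) := by
  have h : ∀ j : Fin p, MeasurePreserving (fun v : ℝ => if Even (j : ℕ) then -v else v)
      (gaussianReal 0 1) (gaussianReal 0 1) := by
    intro j
    split_ifs
    · refine ⟨measurable_neg, ?_⟩
      have := gaussianReal_map_neg (μ := 0) (v := 1)
      rwa [neg_zero] at this
    · exact MeasurePreserving.id _
  exact measurePreserving_pi _ _ fun _ : Fin M => measurePreserving_pi _ _ h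

/-- Columns at odd distance have opposite parity, so exactly one sign of every product changes. -/
lemma pairStat_flipEven {E : Finset (Fin p × Fin p)} (hE : ∀ e ∈ E, Odd ((e.1 : ℕ) + e.2))
    {y : Sample M p} (hy : ∀ i j, y i j ≠ 0) : pairStat E (flipEven y) = -pairStat E y := by
  unfold pairStat
  rw [← Finset.sum_neg_distrib]
  refine Finset.sum_congr rfl fun i _ => ?_
  rw [← Finset.sum_neg_distrib]
  refine Finset.sum_congr rfl fun e he => ?_
  have h := Nat.odd_add.1 (hE e he)
  unfold flipEven
  by_cases h1 : Even (e.1 : ℕ)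
  · have h2 : ¬ Even (e.2 : ℕ) := fun h2 => (Nat.not_odd_iff_even.2 h1) (h.2 h2)
    rw [if_pos h1, if_neg h2, realSign_neg (hy _ _)]; ring
  · have h2 : Even (e.2 : ℕ) := h.1 (Nat.not_even_iff_odd.1 h1)
    rw [if_neg h1, if_pos h2, realSign_neg (hy _ _)]; ring

/-- Under pure noise the test statistic is positive with probability at most one half. -/
lemma noiseLaw_pairStat_pos_le {E : Finset (Fin p × Fin p)}
    (hE : ∀ e ∈ E, Odd ((e.1 : ℕ) + e.2)) :
    noiseLaw M p {y | 0 < pairStat E y} ≤ 1 / 2 := by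
  have hm := measurable_pairStat (M := M) E
  have hpos : MeasurableSet {y : Sample M p | 0 < pairStat E y} := measurableSet_lt measurable_const hm
  have hneg : MeasurableSet {y : Sample M p | pairStat E y < 0} := measurableSet_lt hm measurable_const
  -- Zero counts as positive, so the sign is odd only away from zero; entries equal to zero form a
  -- null set.
  have hne : ∀ᵐ y ∂noiseLaw M p, ∀ i j, y i j ≠ 0 := by
    refine ae_all_iff.2 fun i => ae_all_iff.2 fun j => ?_
    have h0 : ∀ᵐ z ∂gaussianReal 0 1, z ≠ 0 := by
      have := nullSingletonClass_gaussianReal (μ := 0) (v := 1) one_ne_zero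
      exact (Set.countable_singleton (0 : ℝ)).ae_notMem _
    have h1 : MeasurePreserving (fun y : Sample M p => y i j) (noiseLaw M p) (gaussianReal 0 1) :=
      (measurePreserving_eval (fun _ : Fin p => gaussianReal 0 1) j).comp
        (measurePreserving_eval (fun _ : Fin M => Measure.pi fun _ : Fin p => gaussianReal 0 1) i)
    exact h1.quasiMeasurePreserving.ae h0
  have h1 : noiseLaw M p {y | 0 < pairStat E y} = noiseLaw M p {y | pairStat E y < 0} := by
    rw [← measurePreserving_flipEven.measure_preimage hpos.nullMeasurableSet]
    refine measure_congr ?_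
    filter_upwards [hne] with y hy
    refine propext ?_
    show 0 < pairStat E (flipEven y) ↔ pairStat E y < 0
    rw [pairStat_flipEven hE hy, neg_pos]
  have h2 : noiseLaw M p {y | 0 < pairStat E y} + noiseLaw M p {y | pairStat E y < 0} ≤ 1 := by
    have hdis : Disjoint {y : Sample M p | 0 < pairStat E y} {y | pairStat E y < 0} :=
      Set.disjoint_left.2 fun y hy hy' => lt_asymm (Set.mem_ofPred.1 hy) (Set.mem_ofPred.1 hy')
    rw [← measure_union hdis hneg]
    exact prob_le_one
  rw [← h1, ← two_mul] at h2
  rw [ENNReal.le_div_iff_mul_le (Or.inl two_ne_zero) (Or.inl ENNReal.ofNat_ne_top), mul_comm]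
  exact h2

lemma odd_of_mem_oddPairs {A : Set (Fin p)} {W : ℕ} {e : Fin p × Fin p} (he : e ∈ oddPairs A W) :
    Odd ((e.1 : ℕ) + e.2) := by
  obtain ⟨-, -, d, -, h⟩ := mem_oddPairs.1 he
  exact ⟨e.1 + d, by omega⟩

lemma card_oddPairs_fst_le (A : Set (Fin p)) (W : ℕ) (j : Fin p) :
    ((oddPairs A W).filter fun e => e.1 = j).card ≤ W := by
  refine (Finset.card_le_card_of_injOn (t := Finset.range W)
    (fun e => ((e.2 : ℕ) - e.1) / 2) (fun e he => ?_) ?_).trans_eq (Finset.card_range W)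
  · obtain ⟨he, -⟩ := Finset.mem_filter.1 he
    obtain ⟨-, -, d, hd, h⟩ := mem_oddPairs.1 he
    simp only [Finset.coe_range, Set.mem_Iio]; omega
  · intro e he e' he' h
    obtain ⟨he, h1⟩ := Finset.mem_filter.1 he
    obtain ⟨he', h1'⟩ := Finset.mem_filter.1 he'
    obtain ⟨-, -, d, hd, h2⟩ := mem_oddPairs.1 he
    obtain ⟨-, -, d', hd', h2'⟩ := mem_oddPairs.1 he'
    refine Prod.ext (h1.trans h1'.symm) (Fin.ext ?_)
    have := congrArg Fin.val (h1.trans h1'.symm)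
    simp only [] at h
    omega

lemma card_oddPairs_snd_le (A : Set (Fin p)) (W : ℕ) (j : Fin p) :
    ((oddPairs A W).filter fun e => e.2 = j).card ≤ W := by
  refine (Finset.card_le_card_of_injOn (t := Finset.range W)
    (fun e => ((e.2 : ℕ) - e.1) / 2) (fun e he => ?_) ?_).trans_eq (Finset.card_range W)
  · obtain ⟨he, -⟩ := Finset.mem_filter.1 he
    obtain ⟨-, -, d, hd, h⟩ := mem_oddPairs.1 he
    simp only [Finset.coe_range, Set.mem_Iio]; omega
  · intro e he e' he' h
    obtain ⟨he, h1⟩ := Finset.mem_filter.1 he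
    obtain ⟨he', h1'⟩ := Finset.mem_filter.1 he'
    obtain ⟨-, -, d, hd, h2⟩ := mem_oddPairs.1 he
    obtain ⟨-, -, d', hd', h2'⟩ := mem_oddPairs.1 he'
    refine Prod.ext (Fin.ext ?_) (h1.trans h1'.symm)
    have := congrArg Fin.val (h1.trans h1'.symm)
    simp only [] at h
    omega

open Classical in
lemma card_oddPairs_le (A : Set (Fin p)) (W : ℕ) : (oddPairs A W).card ≤ W * A.ncard := by
  rw [Set.ncard_eq_toFinset_card' A]
  exact Finset.card_le_mul_card_image_of_maps_to (f := Prod.fst)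
    (fun e he => Set.mem_toFinset.2 (mem_oddPairs.1 he).1) W
    fun j _ => card_oddPairs_fst_le A W j

open Classical in
/-- A set that misses few points of `S` contains most pairs of points of `S`. -/
lemma card_oddPairs_le_add (A S : Set (Fin p)) (W : ℕ) : (oddPairs S W).card ≤
    ((oddPairs A W).filter fun e => e.1 ∈ S ∧ e.2 ∈ S).card + 2 * W * (S \ A).ncard := by
  have hsub : oddPairs S W ⊆ ((oddPairs A W).filter fun e => e.1 ∈ S ∧ e.2 ∈ S) ∪
      (((oddPairs S W).filter fun e => e.1 ∈ S \ A) ∪ ((oddPairs S W).filter fun e => e.2 ∈ S \ A)) := by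
    intro e he
    obtain ⟨h1, h2, h3⟩ := mem_oddPairs.1 he
    simp only [Finset.mem_union, Finset.mem_filter, mem_oddPairs, Set.mem_sdiff]
    by_cases a1 : e.1 ∈ A <;> by_cases a2 : e.2 ∈ A <;>
      simp only [a1, a2, h1, h2, h3, and_true, not_true_eq_false, not_false_eq_true, or_true,
        and_false, or_false]
  have hfst : ((oddPairs S W).filter fun e => e.1 ∈ S \ A).card ≤ W * (S \ A).ncard := by
    rw [Set.ncard_eq_toFinset_card' (S \ A)]
    refine Finset.card_le_mul_card_image_of_maps_to (f := Prod.fst)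
      (fun e he => Set.mem_toFinset.2 (Finset.mem_filter.1 he).2) W fun j _ => ?_
    refine (Finset.card_le_card ?_).trans (card_oddPairs_fst_le S W j)
    exact Finset.filter_subset_filter _ (Finset.filter_subset _ _)
  have hsnd : ((oddPairs S W).filter fun e => e.2 ∈ S \ A).card ≤ W * (S \ A).ncard := by
    rw [Set.ncard_eq_toFinset_card' (S \ A)]
    refine Finset.card_le_mul_card_image_of_maps_to (f := Prod.snd)
      (fun e he => Set.mem_toFinset.2 (Finset.mem_filter.1 he).2) W fun j _ => ?_
    refine (Finset.card_le_card ?_).trans (card_oddPairs_snd_le S W j)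
    exact Finset.filter_subset_filter _ (Finset.filter_subset _ _)
  refine (Finset.card_le_card hsub).trans ((Finset.card_union_le _ _).trans ?_)
  have := Finset.card_union_le ((oddPairs S W).filter fun e => e.1 ∈ S \ A)
    ((oddPairs S W).filter fun e => e.2 ∈ S \ A)
  have h2 : 2 * W * (S \ A).ncard = W * (S \ A).ncard + W * (S \ A).ncard := by ring
  omega

/-- Long blocks contain many pairs. -/
lemma IsPlacement.le_card_oddPairs {G m W : ℕ} {len s : Fin m → ℕ} (h : IsPlacement p G len s)
    (hW : ∀ g, 4 * W ≤ len g) :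
    W * ∑ g, len g ≤ 2 * (oddPairs (blkUnion p len s : Set (Fin p)) W).card := by
  -- Each block is shortened by `2 W` at its right end; from the points that are left all `W` odd
  -- distances stay in the block. Because of `4 W ≤ len g` at least half of each block is left.
  have h' : IsPlacement p G (fun g => len g - 2 * W) s :=
    ⟨fun g => by have := h.1 g; dsimp only; omega,
      fun g k hgk => by have := h.2 g k hgk; dsimp only; omega⟩
  set S₀ := blkUnion p (fun g => len g - 2 * W) s with hS₀
  have hmem : ∀ j ∈ S₀, ∀ d < W, ∃ hlt : (j : ℕ) + (2 * d + 1) < p,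
      j ∈ blkUnion p len s ∧ (⟨(j : ℕ) + (2 * d + 1), hlt⟩ : Fin p) ∈ blkUnion p len s := by
    intro j hj d hd
    obtain ⟨g, -, hg⟩ := Finset.mem_biUnion.1 hj
    rw [mem_blk] at hg
    dsimp only at hg
    have h1 := h.1 g
    have h3 := hW g
    refine ⟨by omega, Finset.mem_biUnion.2 ⟨g, Finset.mem_univ g, mem_blk.2 ⟨hg.1, by omega⟩⟩,
      Finset.mem_biUnion.2 ⟨g, Finset.mem_univ g, mem_blk.2 ⟨?_, ?_⟩⟩⟩ <;>
    · dsimp only; omega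
  have h1 : (S₀ ×ˢ Finset.range W).card ≤ (oddPairs (blkUnion p len s : Set (Fin p)) W).card := by
    refine Finset.card_le_card_of_injOn
      (fun jd => if hlt : (jd.1 : ℕ) + (2 * jd.2 + 1) < p then (jd.1, ⟨_, hlt⟩) else (jd.1, jd.1))
      (fun jd hjd => ?_) ?_
    · obtain ⟨hj, hd⟩ := Finset.mem_product.1 hjd
      obtain ⟨hlt, h2, h3⟩ := hmem jd.1 hj jd.2 (Finset.mem_range.1 hd)
      simp only [dif_pos hlt]
      exact mem_oddPairs.2 ⟨h2, h3, jd.2, Finset.mem_range.1 hd, rfl⟩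
    · intro jd hjd jd' hjd' heq
      obtain ⟨hj, hd⟩ := Finset.mem_product.1 hjd
      obtain ⟨hj', hd'⟩ := Finset.mem_product.1 hjd'
      obtain ⟨hlt, -⟩ := hmem jd.1 hj jd.2 (Finset.mem_range.1 hd)
      obtain ⟨hlt', -⟩ := hmem jd'.1 hj' jd'.2 (Finset.mem_range.1 hd')
      simp only [dif_pos hlt, dif_pos hlt', Prod.mk.injEq, Fin.mk.injEq] at heq
      refine Prod.ext heq.1 ?_
      have := congrArg Fin.val heq.1
      omega
  rw [Finset.card_product, Finset.card_range, h'.card_blkUnion] at h1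
  have h2 : ∑ g, len g ≤ 2 * ∑ g, (len g - 2 * W) := by
    rw [Finset.mul_sum]
    exact Finset.sum_le_sum fun g _ => by have := hW g; omega
  calc W * ∑ g, len g ≤ W * (2 * ∑ g, (len g - 2 * W)) := Nat.mul_le_mul_left _ h2
    _ = 2 * ((∑ g, (len g - 2 * W)) * W) := by ring
    _ ≤ _ := Nat.mul_le_mul_left _ h1

lemma integral_prod_realSign (B : Fin M → Fin p → ℝ) (T : Finset (Fin M × Fin p)) :
    ∫ y, ∏ v ∈ T, realSign (y v.1 v.2) ∂shiftLaw B = ∏ v ∈ T, meanSign (B v.1 v.2) := by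
  have h : ∀ g : Fin M × Fin p → ℝ, ∏ v ∈ T, g v
      = ∏ i, ∏ j, if (i, j) ∈ T then g (i, j) else 1 := by
    intro g
    rw [← Fintype.prod_prod_type', Fintype.prod_ite_mem]
  simp only [h]
  have h2 := integral_shiftLaw_prod B fun i j v => if (i, j) ∈ T then realSign v else 1
  refine h2.trans (Finset.prod_congr rfl fun i _ => Finset.prod_congr rfl fun j _ => ?_)
  split_ifs
  · rfl
  · simp

/-- If the means are aligned, the test statistic is positive with high probability. -/
lemma shiftLaw_pairStat_nonpos_le (B : Fin M → Fin p → ℝ) (A : Set (Fin p)) (W : ℕ) {X : ℝ}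
    (hX : 0 ≤ X) (hBX : ∀ i j, |B i j| ≤ X) (hX1 : X ≤ 1) {q : ℝ} (hq : 0 < q)
    (hmean : q ≤ ∑ i, ∑ e ∈ oddPairs A W, meanSign (B i e.1) * meanSign (B i e.2)) :
    shiftLaw B {y | ¬ 0 < pairStat (oddPairs A W) y}
      ≤ ENNReal.ofReal (M * (oddPairs A W).card * (1 + (4 * W : ℕ) * X ^ 2) / q ^ 2) := by
  classical
  set E := oddPairs A W with hE
  have hlt : ∀ e ∈ E, (e.1 : ℕ) < e.2 := by
    intro e he
    obtain ⟨-, -, d, -, h⟩ := mem_oddPairs.1 he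
    omega
  have hne : ∀ e ∈ E, ∀ i : Fin M, (i, e.1) ≠ (i, e.2) := fun e he i h => by
    have := hlt e he
    rw [(Prod.mk.injEq _ _ _ _).mp h |>.2] at this
    exact lt_irrefl _ this
  set T : Fin M × (Fin p × Fin p) → Finset (Fin M × Fin p) :=
    fun ie => {(ie.1, ie.2.1), (ie.1, ie.2.2)} with hT
  set E' : Finset (Fin M × (Fin p × Fin p)) := Finset.univ ×ˢ E with hE'
  have hmemE' : ∀ ie ∈ E', ie.2 ∈ E := fun ie h => (Finset.mem_product.1 h).2
  have hsum : ∀ z : Fin M × Fin p → ℝ, ∑ ie ∈ E', ∏ v ∈ T ie, z v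
      = ∑ i, ∑ e ∈ E, z (i, e.1) * z (i, e.2) := by
    intro z
    rw [hE', Finset.sum_product]
    refine Finset.sum_congr rfl fun i _ => Finset.sum_congr rfl fun e he => ?_
    exact Finset.prod_pair (hne e he i)
  have hxle : ∀ t : ℝ, |meanSign t| ≤ |t| := fun t => by
    rw [abs_meanSign]; exact meanSign_le (abs_nonneg t)
  have hvar := integral_sq_sum_pairs_le (P := shiftLaw B)
    (s := fun v y => realSign (y v.1 v.2)) (x := fun v : Fin M × Fin p => meanSign (B v.1 v.2))
    (fun v => measurable_realSign.comp ((measurable_pi_apply v.2).comp (measurable_pi_apply v.1)))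
    (fun v y => realSign_sq _) (integral_prod_realSign B) hX
    (fun v => (hxle _).trans (hBX _ _)) (fun v => ((hxle _).trans (hBX _ _)).trans hX1) E' T
    (fun ie h => Finset.card_pair (hne _ (hmemE' ie h) _)) ?_ (D := 4 * W) ?_
  rotate_left
  · rintro ⟨i, e⟩ he ⟨i', e'⟩ he' h
    have h1 := hlt _ (hmemE' _ he)
    have h2 := hlt _ (hmemE' _ he')
    simp only [hT] at h h1 h2
    have m1 : (i, e.1) ∈ ({(i', e'.1), (i', e'.2)} : Finset (Fin M × Fin p)) := by
      rw [← h]; simp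
    have m2 : (i, e.2) ∈ ({(i', e'.1), (i', e'.2)} : Finset (Fin M × Fin p)) := by
      rw [← h]; simp
    simp only [Finset.mem_insert, Finset.mem_singleton, Prod.mk.injEq] at m1 m2
    rcases m1 with ⟨hi, m1⟩ | ⟨hi, m1⟩ <;> rcases m2 with ⟨-, m2⟩ | ⟨-, m2⟩
    · rw [m1, m2] at h1; exact absurd h1 (lt_irrefl _)
    · rw [hi, Prod.ext m1 m2]
    · rw [m1, m2] at h1; exact absurd h1 (lt_asymm h2)
    · rw [m1, m2] at h1; exact absurd h1 (lt_irrefl _)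
  · rintro ⟨i, e⟩ he
    -- Overlapping pairs lie in the same row and share a first or second column in one of four ways,
    -- each with at most `W` possibilities. This is the source of `4 * W`.
    have hsub : (E'.filter fun ie' => ¬ Disjoint (T (i, e)) (T ie')) ⊆
        (((E.filter fun e' => e'.1 = e.1) ∪ (E.filter fun e' => e'.2 = e.1)) ∪
        ((E.filter fun e' => e'.1 = e.2) ∪ (E.filter fun e' => e'.2 = e.2))).map
          ⟨fun e' => (i, e'), fun _ _ h => (Prod.mk.injEq _ _ _ _).mp h |>.2⟩ := by
      rintro ⟨i', e'⟩ h
      obtain ⟨h1, h2⟩ := Finset.mem_filter.1 h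
      have h3 := hmemE' _ h1
      rw [Finset.not_disjoint_iff] at h2
      obtain ⟨v, hv, hv'⟩ := h2
      simp only [hT, Finset.mem_insert, Finset.mem_singleton] at hv hv' h3
      simp only [Finset.mem_map, Finset.mem_union, Finset.mem_filter]
      rcases hv with rfl | rfl <;> rcases hv' with hv' | hv' <;>
      · rw [Prod.mk.injEq] at hv'
        refine ⟨e', ?_, by simp_all⟩
        have := hv'.2.symm
        tauto
    refine (Finset.card_le_card hsub).trans ?_
    rw [Finset.card_map]
    refine (Finset.card_union_le _ _).trans ?_
    have c1 := Finset.card_union_le (E.filter fun e' => e'.1 = e.1) (E.filter fun e' => e'.2 = e.1)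
    have c2 := Finset.card_union_le (E.filter fun e' => e'.1 = e.2) (E.filter fun e' => e'.2 = e.2)
    have d1 := card_oddPairs_fst_le A W e.1
    have d2 := card_oddPairs_snd_le A W e.1
    have d3 := card_oddPairs_fst_le A W e.2
    have d4 := card_oddPairs_snd_le A W e.2
    rw [← hE] at d1 d2 d3 d4
    omega
  simp only [hsum] at hvar
  set mean := ∑ i, ∑ e ∈ E, meanSign (B i e.1) * meanSign (B i e.2) with hmeandef
  have hcard : (E'.card : ℝ) = M * E.card := by
    rw [hE', Finset.card_product, Finset.card_univ, Fintype.card_fin]; push_cast; ring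
  rw [hcard] at hvar
  have hmeas : Measurable fun y : Sample M p => (pairStat E y - mean) ^ 2 :=
    ((measurable_pairStat E).sub measurable_const).pow_const 2
  have hbd : ∀ y : Sample M p, |pairStat E y| ≤ M * E.card := by
    intro y
    unfold pairStat
    refine (Finset.abs_sum_le_sum_abs _ _).trans ?_
    refine (Finset.sum_le_sum fun i _ => (Finset.abs_sum_le_sum_abs _ _)).trans ?_
    simp only [abs_mul, abs_realSign, mul_one, Finset.sum_const, Finset.card_univ, Fintype.card_fin,
      nsmul_eq_mul, le_refl]
  have hint : Integrable (fun y : Sample M p => (pairStat E y - mean) ^ 2) (shiftLaw B) :=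
    Integrable.of_bound hmeas.aestronglyMeasurable ((M * E.card + |mean|) ^ 2)
      (ae_of_all _ fun y => by
        rw [Real.norm_eq_abs, abs_pow]
        refine pow_le_pow_left₀ (abs_nonneg _) ?_ 2
        exact (abs_sub _ _).trans (add_le_add (hbd y) le_rfl))
  have hcheb := mul_meas_ge_le_integral_of_nonneg (μ := shiftLaw B)
    (f := fun y : Sample M p => (pairStat E y - mean) ^ 2) (ae_of_all _ fun y => sq_nonneg _) hint
    (q ^ 2)
  -- A statistic that is not positive deviates from its mean by at least `q`.
  have hsub : {y : Sample M p | ¬ 0 < pairStat E y} ⊆ {y | q ^ 2 ≤ (pairStat E y - mean) ^ 2} := by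
    intro y hy
    have hy' : pairStat E y ≤ 0 := not_lt.1 hy
    show q ^ 2 ≤ (pairStat E y - mean) ^ 2
    nlinarith
  refine (measure_mono hsub).trans ?_
  rw [← ofReal_measureReal (μ := shiftLaw B)]
  refine ENNReal.ofReal_le_ofReal ?_
  rw [le_div_iff₀ (by positivity), mul_comm]
  exact hcheb.trans hvar

end TestErrors
/-! ### The test based on an estimate of the support -/

section Split

variable {n N p : ℕ}

/-- Independent observations are split into the first `n` and the remaining ones. -/
lemma measurePreserving_finSplit (h : n ≤ N) {X : Type*} [MeasurableSpace X]
    (μ : Fin N → Measure X) [∀ i, IsProbabilityMeasure (μ i)] :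
    MeasurePreserving
      (fun x : Fin N → X =>
        (fun i : Fin n => x (Fin.castLE h i), fun i : Fin (N - n) => x ⟨n + i, by omega⟩))
      (Measure.pi μ)
      ((Measure.pi fun i => μ (Fin.castLE h i)).prod (Measure.pi fun i => μ ⟨n + i, by omega⟩)) := by
  set e : Fin n ⊕ Fin (N - n) ≃ Fin N := finSumFinEquiv.trans (finCongr (by omega)) with he
  exact (measurePreserving_sumPiEquivProdPi fun s => μ (e s)).comp
    (measurePreserving_piCongrLeft μ e).symm

lemma measurePreserving_finRestrict (h : n ≤ N) {X : Type*} [MeasurableSpace X]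
    (μ : Fin N → Measure X) [∀ i, IsProbabilityMeasure (μ i)] :
    MeasurePreserving (fun (x : Fin N → X) (i : Fin n) => x (Fin.castLE h i))
      (Measure.pi μ) (Measure.pi fun i => μ (Fin.castLE h i)) :=
  measurePreserving_fst.comp (measurePreserving_finSplit h μ)

lemma measurePreserving_rowSplit (h : n ≤ N) (B : Fin N → Fin p → ℝ) :
    MeasurePreserving (fun x : Sample N p => (firstRows h x, lastRows n x)) (shiftLaw B)
      ((shiftLaw (firstRows h B)).prod (shiftLaw (lastRows n B))) :=
  measurePreserving_finSplit h fun i => Measure.pi fun j => gaussianReal (B i j) 1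

/-- Inside the larger sample the estimator sees data of its own law, so its risk is unchanged. -/
lemma measurePreserving_firstRows_sampleLaw (h : n ≤ N) {ϖ : ℝ} (hϖ : 0 < ϖ) (μ : Fin p → ℝ) :
    MeasurePreserving (firstRows h) (sampleLaw N ϖ μ) (sampleLaw n ϖ μ) := by
  have := isProbabilityMeasure_labelLaw hϖ
  have hm : ∀ k : ℕ, Measurable fun (y : (Fin k → ℝ) × Sample k p) i j => y.1 i * μ j + y.2 i j :=
    fun k => by fun_prop
  have hf : Measurable (firstRows h : Sample N p → Sample n p) :=
    measurable_pi_lambda _ fun i => measurable_pi_apply _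
  refine ⟨hf, ?_⟩
  have h1 := ((measurePreserving_finRestrict h fun _ => labelLaw ϖ).prod
    (measurePreserving_finRestrict h fun _ => Measure.pi fun _ : Fin p => gaussianReal 0 1)).map_eq
  unfold sampleLaw noiseLaw
  rw [Measure.map_map hf (hm N), ← h1, Measure.map_map (hm n) ?_]
  · rfl
  · exact (measurable_pi_lambda _ fun i => measurable_pi_apply _).prodMap
      (measurable_pi_lambda _ fun i => measurable_pi_apply _)

lemma measurableSet_pairStat_pos {n M : ℕ} {F : Sample n p → Set (Fin p)} (hF : Measurable F)
    (W : ℕ) : MeasurableSet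
      {y : Sample n p × Sample M p | 0 < pairStat (oddPairs (F y.1) W) y.2} := by
  have h : {y : Sample n p × Sample M p | 0 < pairStat (oddPairs (F y.1) W) y.2}
      = ⋃ A : Set (Fin p), (F ⁻¹' {A}) ×ˢ {z | 0 < pairStat (oddPairs A W) z} := by
    ext y
    simp only [Set.mem_ofPred_eq, Set.mem_iUnion, Set.mem_prod, Set.mem_preimage,
      Set.mem_singleton_iff]
    exact ⟨fun h => ⟨_, rfl, h⟩, fun ⟨A, h1, h2⟩ => h1 ▸ h2⟩
  rw [h]
  exact MeasurableSet.iUnion fun A => (hF (MeasurableSet.singleton A)).prod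
    (measurableSet_lt measurable_const (measurable_pairStat _))

/-- Given the labels, the held-out rows are independent of the estimated set, so the set may be
regarded as fixed when the statistic is analysed. -/
lemma shiftLaw_split_apply (h : n ≤ N) (B : Fin N → Fin p → ℝ) {F : Sample n p → Set (Fin p)}
    (hF : Measurable F) (W : ℕ) :
    shiftLaw B {x | 0 < pairStat (oddPairs (F (firstRows h x)) W) (lastRows n x)}
      = ∫⁻ y, shiftLaw (lastRows n B) {z | 0 < pairStat (oddPairs (F y) W) z}
          ∂shiftLaw (firstRows h B) := by
  have hm := measurableSet_pairStat_pos (M := N - n) hF W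
  exact ((measurePreserving_rowSplit h B).measure_preimage hm.nullMeasurableSet).symm ▸
    Measure.prod_apply hm

/-- Under pure noise the test rejects with probability at most one half. -/
lemma noiseLaw_split_le (h : n ≤ N) {F : Sample n p → Set (Fin p)} (hF : Measurable F) (W : ℕ) :
    noiseLaw N p {x | 0 < pairStat (oddPairs (F (firstRows h x)) W) (lastRows n x)} ≤ 1 / 2 := by
  rw [noiseLaw_eq_shiftLaw, shiftLaw_split_apply h _ hF W]
  refine (lintegral_mono fun y => ?_).trans_eq (by rw [lintegral_const, measure_univ, mul_one])
  exact noiseLaw_pairStat_pos_le fun e he => odd_of_mem_oddPairs he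

end Split

/-! ### Power of the pair statistic for a good estimate of the support -/

section Power

variable {n N p G m W : ℕ} {len s : Fin m → ℕ} {τ : Fin m → ℝ} {ϖ δ : ℝ}

lemma IsPlacement.blockSignal_eq (h : IsPlacement p G len s) {i j : Fin p}
    (hi : i ∈ blkUnion p len s) (hj : j ∈ blkUnion p len s) (hij : i ≤ j) (hjG : (j : ℕ) ≤ i + G) :
    blockSignal p len s τ i = blockSignal p len s τ j := by
  obtain ⟨g, -, hg⟩ := Finset.mem_biUnion.1 hi
  obtain ⟨k, -, hk⟩ := Finset.mem_biUnion.1 hj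
  rcases lt_trichotomy g k with hgk | rfl | hgk
  · have := h.add_le hgk
    rw [mem_blk] at hg hk
    omega
  · rw [h.apply_of_mem hg, h.apply_of_mem hk]
  · have := h.add_le hgk
    rw [mem_blk] at hg hk
    have := Fin.le_def.1 hij
    omega

lemma IsPlacement.abs_blockSignal (h : IsPlacement p G len s) (hτ : ∀ g, |τ g| = δ) {j : Fin p}
    (hj : j ∈ blkUnion p len s) : |blockSignal p len s τ j| = δ := by
  obtain ⟨g, -, hg⟩ := Finset.mem_biUnion.1 hj
  rw [h.apply_of_mem hg, hτ]

lemma blockSignal_eq_zero {j : Fin p} (hj : j ∉ blkUnion p len s) :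
    blockSignal p len s τ j = 0 :=
  blockSignal_of_notMem fun g hg => hj (Finset.mem_biUnion.2 ⟨g, Finset.mem_univ g, hg⟩)

/-- The mean of the test statistic for a good estimate of the support. -/
lemma IsPlacement.le_mean_pairStat (h : IsPlacement p G len s) (hτ : ∀ g, |τ g| = δ)
    (hδ : 0 ≤ δ) (hϖ : 0 < ϖ) (hX : (1 + ϖ) * δ ≤ 1) (hW : ∀ g, 4 * W ≤ len g) (hWG : 2 * W ≤ G)
    {M : ℕ} (b : Fin M → Bool) {A : Set (Fin p)}
    (hA : 16 * (A ∆ (blkUnion p len s : Set (Fin p))).ncard ≤ ∑ g, len g) :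
    (M : ℝ) * (3 / 8 * (W * ∑ g, len g : ℕ)) * (min 1 ϖ * δ / 4) ^ 2
      ≤ ∑ i, ∑ e ∈ oddPairs A W, meanSign (meanMat ϖ b (blockSignal p len s τ) i e.1)
          * meanSign (meanMat ϖ b (blockSignal p len s τ) i e.2) := by
  classical
  set S : Set (Fin p) := ↑(blkUnion p len s) with hS
  set μ := blockSignal p len s τ with hμ
  set κ := min 1 ϖ * δ / 4 with hκ
  have hκ0 : 0 ≤ κ := by
    have : 0 ≤ min 1 ϖ := le_min zero_le_one hϖ.le
    positivity
  set E := (oddPairs A W).filter fun e => e.1 ∈ S ∧ e.2 ∈ S with hE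
  -- Of at least `W L / 2` pairs inside the support, with `L` its size, those touching a missed
  -- point number at most `2 W · L / 16 = W L / 8`.
  have hcard : (3 / 8 * (W * ∑ g, len g : ℕ) : ℝ) ≤ E.card := by
    have h1 := h.le_card_oddPairs hW
    have h2 : (oddPairs S W).card ≤ E.card + 2 * W * (S \ A).ncard := by
      convert card_oddPairs_le_add A S W
    have h3 : (S \ A).ncard ≤ (A ∆ S).ncard :=
      Set.ncard_le_ncard (fun j hj => Or.inr hj) (Set.toFinite _)
    have h4 : 16 * (W * (S \ A).ncard) ≤ W * ∑ g, len g := by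
      calc 16 * (W * (S \ A).ncard) = W * (16 * (S \ A).ncard) := by ring
        _ ≤ _ := Nat.mul_le_mul_left _ (le_trans (by omega) hA)
    have h5 : 3 * (W * ∑ g, len g) ≤ 8 * E.card := by
      rw [mul_assoc] at h2
      rw [← hS] at h1
      omega
    have h6 : (3 * (W * ∑ g, len g : ℕ) : ℝ) ≤ 8 * E.card := by exact_mod_cast h5
    linarith
  have hterm : ∀ i, (3 / 8 * (W * ∑ g, len g : ℕ) : ℝ) * κ ^ 2
      ≤ ∑ e ∈ oddPairs A W, meanSign (meanMat ϖ b μ i e.1) * meanSign (meanMat ϖ b μ i e.2) := by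
    intro i
    have hle : ∀ e ∈ oddPairs A W, (if e.1 ∈ S ∧ e.2 ∈ S then κ ^ 2 else 0)
        ≤ meanSign (meanMat ϖ b μ i e.1) * meanSign (meanMat ϖ b μ i e.2) := by
      intro e he
      obtain ⟨-, -, d, hd, h1⟩ := mem_oddPairs.1 he
      unfold meanMat
      split_ifs with h2
      · have h3 : μ e.1 = μ e.2 := h.blockSignal_eq h2.1 h2.2 (Fin.le_def.2 (by omega)) (by omega)
        -- Both entries of the pair have the same mean, label included, so the product is a square
        -- and the sign of the label does not matter.
        rw [← h3, ← abs_mul_abs_self, abs_meanSign, ← pow_two]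
        refine pow_le_pow_left₀ hκ0 ?_ 2
        have h4 : |lab ϖ (b i) * μ e.1| = |lab ϖ (b i)| * δ := by
          rw [abs_mul, h.abs_blockSignal hτ h2.1]
        rw [h4]
        refine le_trans ?_ (le_meanSign (by positivity)
          ((mul_le_mul_of_nonneg_right (abs_lab_le hϖ _) hδ).trans hX))
        have := mul_le_mul_of_nonneg_right (le_abs_lab hϖ (b i)) hδ
        rw [hκ]; linarith
      -- Wrongly selected columns add noise but no bias: an entry of mean zero has a sign of mean
      -- zero.
      · have h3 : μ e.1 = 0 ∨ μ e.2 = 0 := by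
          by_contra! h3
          refine h2 ⟨?_, ?_⟩
          · by_contra h4; exact h3.1 (blockSignal_eq_zero h4)
          · by_contra h4; exact h3.2 (blockSignal_eq_zero h4)
        rcases h3 with h3 | h3 <;> simp [h3, meanSign_zero]
    refine le_trans ?_ (Finset.sum_le_sum hle)
    rw [← Finset.sum_filter, Finset.sum_const, nsmul_eq_mul]
    exact mul_le_mul_of_nonneg_right hcard (sq_nonneg _)
  refine le_trans (le_of_eq ?_) (Finset.sum_le_sum fun i _ => hterm i)
  rw [Finset.sum_const, Finset.card_univ, Fintype.card_fin, nsmul_eq_mul, mul_assoc]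

/-- The bound for the probability that the test misses the signal. -/
def missBound (ϖ δ : ℝ) (M W L : ℕ) : ℝ :=
  16 * (1 + (4 * W : ℕ) * ((1 + ϖ) * δ) ^ 2) / (M * (W * L : ℕ) * (min 1 ϖ * δ / 4) ^ 4)

/-- Given a good estimate of the support, the test detects the signal. -/
lemma IsPlacement.shiftLaw_pairStat_nonpos_le (h : IsPlacement p G len s) (hτ : ∀ g, |τ g| = δ)
    (hδ : 0 < δ) (hϖ : 0 < ϖ) (hX : (1 + ϖ) * δ ≤ 1) (hW : ∀ g, 4 * W ≤ len g) (hWG : 2 * W ≤ G)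
    (hW0 : 0 < W) (hL : 0 < ∑ g, len g)
    {M : ℕ} (hM : 0 < M) (b : Fin M → Bool) {A : Set (Fin p)}
    (hA : 16 * (A ∆ (blkUnion p len s : Set (Fin p))).ncard ≤ ∑ g, len g) :
    shiftLaw (meanMat ϖ b (blockSignal p len s τ)) {y | ¬ 0 < pairStat (oddPairs A W) y}
      ≤ ENNReal.ofReal (missBound ϖ δ M W (∑ g, len g)) := by
  classical
  set S : Set (Fin p) := ↑(blkUnion p len s) with hS
  set L := ∑ g, len g with hLdef
  have hκ : 0 < min 1 ϖ * δ / 4 := by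
    have : 0 < min 1 ϖ := lt_min zero_lt_one hϖ
    positivity
  set κ := min 1 ϖ * δ / 4 with hκdef
  have hWL : (0 : ℝ) < (W * L : ℕ) := by exact_mod_cast Nat.mul_pos hW0 hL
  have hM' : (0 : ℝ) < M := by exact_mod_cast hM
  have hq : 0 < (M : ℝ) * (3 / 8 * (W * L : ℕ)) * κ ^ 2 := by positivity
  have hbd : ∀ (i : Fin M) (j : Fin p), |meanMat ϖ b (blockSignal p len s τ) i j| ≤ (1 + ϖ) * δ := by
    intro i j
    unfold meanMat
    rw [abs_mul]
    refine mul_le_mul (abs_lab_le hϖ _) ?_ (abs_nonneg _) (by positivity)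
    by_cases hj : j ∈ blkUnion p len s
    · exact (h.abs_blockSignal hτ hj).le
    · rw [blockSignal_eq_zero hj, abs_zero]; exact hδ.le
  refine (BlockSignal.shiftLaw_pairStat_nonpos_le _ A W (by positivity) hbd hX hq
    (h.le_mean_pairStat hτ hδ.le hϖ hX hW hWG b hA)).trans (ENNReal.ofReal_le_ofReal ?_)
  have hcard : ((oddPairs A W).card : ℝ) ≤ 2 * (W * L : ℕ) := by
    -- The estimate has at most `2 L` points, those of the support and the errors, so the number of
    -- pairs is at most `2 W L`.
    have h1 := card_oddPairs_le A W
    have h2 : A.ncard ≤ 2 * L := by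
      have h3 : A ⊆ S ∪ A ∆ S := fun j hj => by
        by_cases hjS : j ∈ S
        · exact Or.inl hjS
        · exact Or.inr (Or.inl ⟨hj, hjS⟩)
      have h4 := (Set.ncard_le_ncard h3 (Set.toFinite _)).trans (Set.ncard_union_le _ _)
      have h5 : S.ncard = L := by rw [hS, Set.ncard_coe_finset, h.card_blkUnion]
      omega
    have h3 : (oddPairs A W).card ≤ 2 * (W * L) := by
      refine h1.trans ((Nat.mul_le_mul_left W h2).trans_eq (by ring))
    exact_mod_cast h3
  set V : ℝ := 1 + (4 * W : ℕ) * ((1 + ϖ) * δ) ^ 2 with hV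
  have hV0 : 0 ≤ V := by positivity
  unfold missBound
  rw [div_le_div_iff₀ (by positivity) (by positivity)]
  calc (M : ℝ) * (oddPairs A W).card * V * (M * (W * L : ℕ) * κ ^ 4)
      ≤ M * (2 * (W * L : ℕ)) * V * (M * (W * L : ℕ) * κ ^ 4) := by gcongr
    _ = 2 * (V * (M * (W * L : ℕ) * κ ^ 2) ^ 2) := by ring
    -- Chebyshev's bound has the constant `2 · 64 / 9`, which is rounded up to `16`.
    _ ≤ 16 * (9 / 64) * (V * (M * (W * L : ℕ) * κ ^ 2) ^ 2) := by
        refine mul_le_mul_of_nonneg_right (by norm_num) (by positivity)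
    _ = 16 * V * (M * (3 / 8 * (W * L : ℕ)) * κ ^ 2) ^ 2 := by ring

end Power
/-! ### From the risk of an estimator to the power of the test -/

section Combine

variable {n N p G m W : ℕ} {len s : Fin m → ℕ} {τ : Fin m → ℝ} {ϖ δ : ℝ}

/-- The conditions on the block signal under which the test detects it. -/
structure IsDetectable (G W : ℕ) (ϖ δ : ℝ) {m : ℕ} (len : Fin m → ℕ) : Prop where
  pos : 0 < δ
  label_pos : 0 < ϖ
  le_one : (1 + ϖ) * δ ≤ 1
  le_len : ∀ g, 4 * W ≤ len g
  le_gap : 2 * W ≤ G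
  width_pos : 0 < W
  sum_pos : 0 < ∑ g, len g

/-- A union bound for fixed labels: for each value of the first rows either the estimate is bad, or
the held-out rows lead to rejection except with probability `missBound`. -/
lemma IsPlacement.one_le_shiftLaw_split (h : IsPlacement p G len s) (hτ : ∀ g, |τ g| = δ)
    (hd : IsDetectable G W ϖ δ len) (hnN : n < N) (b : Fin N → Bool)
    {F : Sample n p → Set (Fin p)} (hF : Measurable F) :
    1 ≤ shiftLaw (meanMat ϖ b (blockSignal p len s τ))
          {x | 0 < pairStat (oddPairs (F (firstRows hnN.le x)) W) (lastRows n x)}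
        + shiftLaw (meanMat ϖ b (blockSignal p len s τ)) (firstRows hnN.le ⁻¹' (F ⁻¹'
          {A | ∑ g, len g < 16 * (A ∆ (blkUnion p len s : Set (Fin p))).ncard}))
        + ENNReal.ofReal (missBound ϖ δ (N - n) W (∑ g, len g)) := by
  set B := meanMat ϖ b (blockSignal p len s τ) with hB
  set bad : Set (Set (Fin p)) :=
    {A | ∑ g, len g < 16 * (A ∆ (blkUnion p len s : Set (Fin p))).ncard} with hbad
  have hbm : MeasurableSet (F ⁻¹' bad) := hF (Set.toFinite bad).measurableSet
  have hfirst : MeasurePreserving (firstRows hnN.le) (shiftLaw B) (shiftLaw (firstRows hnN.le B)) :=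
    measurePreserving_fst.comp (measurePreserving_rowSplit hnN.le B)
  rw [shiftLaw_split_apply hnN.le B hF, hfirst.measure_preimage hbm.nullMeasurableSet,
    ← lintegral_indicator_one hbm, ← lintegral_add_right _ (measurable_one.indicator hbm)]
  set η := ENNReal.ofReal (missBound ϖ δ (N - n) W (∑ g, len g)) with hη
  have hconst : η = ∫⁻ _, η ∂shiftLaw (firstRows hnN.le B) := by
    rw [lintegral_const, measure_univ, mul_one]
  rw [hconst, ← lintegral_add_right _ measurable_const]
  have hone : (1 : ℝ≥0∞) = ∫⁻ _, 1 ∂shiftLaw (firstRows hnN.le B) := by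
    rw [lintegral_const, measure_univ, mul_one]
  rw [hone]
  refine lintegral_mono fun y => ?_
  by_cases hy : F y ∈ bad
  · have : (F ⁻¹' bad).indicator (1 : Sample n p → ℝ≥0∞) y = 1 :=
      Set.indicator_of_mem (Set.mem_preimage.2 hy) _
    simp only [this]
    exact le_add_right le_add_self
  · have hmiss := h.shiftLaw_pairStat_nonpos_le hτ hd.pos hd.label_pos hd.le_one hd.le_len hd.le_gap
      hd.width_pos hd.sum_pos (M := N - n) (by omega) (fun i => b ⟨n + i, by omega⟩) (A := F y)
      (not_lt.1 hy)
    have hset : MeasurableSet {z : Sample (N - n) p | 0 < pairStat (oddPairs (F y) W) z} :=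
      measurableSet_lt measurable_const (measurable_pairStat _)
    have hcompl := measure_add_measure_compl (μ := shiftLaw (lastRows n B)) hset
    rw [measure_univ] at hcompl
    rw [← hcompl]
    refine add_le_add le_self_add ?_
    exact hmiss

/-- The bound for fixed labels holds uniformly, so it can be averaged over the label vectors. -/
lemma IsPlacement.one_le_sampleLaw_split (h : IsPlacement p G len s) (hτ : ∀ g, |τ g| = δ)
    (hd : IsDetectable G W ϖ δ len) (hnN : n < N)
    {F : Sample n p → Set (Fin p)} (hF : Measurable F) :
    1 ≤ sampleLaw N ϖ (blockSignal p len s τ)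
          {x | 0 < pairStat (oddPairs (F (firstRows hnN.le x)) W) (lastRows n x)}
        + sampleLaw n ϖ (blockSignal p len s τ) (F ⁻¹'
          {A | ∑ g, len g < 16 * (A ∆ (blkUnion p len s : Set (Fin p))).ncard})
        + ENNReal.ofReal (missBound ϖ δ (N - n) W (∑ g, len g)) := by
  set bad : Set (Set (Fin p)) :=
    {A | ∑ g, len g < 16 * (A ∆ (blkUnion p len s : Set (Fin p))).ncard} with hbad
  have hbm : MeasurableSet (F ⁻¹' bad) := hF (Set.toFinite bad).measurableSet
  rw [← (measurePreserving_firstRows_sampleLaw hnN.le hd.label_pos _).measure_preimage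
    hbm.nullMeasurableSet, sampleLaw_eq_sum hd.label_pos]
  simp only [Measure.coe_finsetSum, Finset.sum_apply, Measure.smul_apply, smul_eq_mul]
  set η := ENNReal.ofReal (missBound ϖ δ (N - n) W (∑ g, len g)) with hη
  have hone : ∑ b : Fin N → Bool, ENNReal.ofReal (labProd ϖ b) = 1 := by
    rw [← ENNReal.ofReal_sum_of_nonneg fun b _ => labProd_nonneg hd.label_pos b,
      sum_labProd hd.label_pos, ENNReal.ofReal_one]
  have hη' : η = ∑ b : Fin N → Bool, ENNReal.ofReal (labProd ϖ b) * η := by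
    rw [← Finset.sum_mul, hone, one_mul]
  rw [hη', ← Finset.sum_add_distrib, ← Finset.sum_add_distrib]
  refine hone.symm.le.trans (Finset.sum_le_sum fun b _ => ?_)
  rw [← mul_add, ← mul_add]
  exact le_mul_of_one_le_right zero_le (h.one_le_shiftLaw_split hτ hd hnN b hF)

lemma lintegral_test_eq (hnN : n ≤ N) {R : ℕ}
    {F : Sample n p → (Fin R → Bool) → Set (Fin p)} (hF : ∀ w, Measurable fun y => F y w)
    {φ : Kernel (Sample N p) Bool}
    (hφ : ∀ x, φ x {true} = ∑ w, ((Fintype.card (Fin R → Bool) : ℝ≥0∞))⁻¹ *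
        {x | 0 < pairStat (oddPairs (F (firstRows hnN x) w) W) (lastRows n x)}.indicator 1 x)
    (P : Measure (Sample N p)) :
    ∫⁻ x, φ x {true} ∂P = ∑ w, (Fintype.card (Fin R → Bool) : ℝ≥0∞)⁻¹ *
      P {x | 0 < pairStat (oddPairs (F (firstRows hnN x) w) W) (lastRows n x)} := by
  have hm : ∀ w, MeasurableSet
      {x : Sample N p | 0 < pairStat (oddPairs (F (firstRows hnN x) w) W) (lastRows n x)} :=
    fun w => (measurePreserving_rowSplit hnN 0).measurable
      (measurableSet_pairStat_pos (M := N - n) (hF w) W)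
  simp_rw [hφ]
  rw [lintegral_finsetSum _ fun w _ => (measurable_one.indicator (hm w)).const_mul _]
  refine Finset.sum_congr rfl fun w _ => ?_
  rw [lintegral_const_mul _ (measurable_one.indicator (hm w)), lintegral_indicator_one (hm w)]

/-- Markov's inequality for the number of errors of an estimator. -/
lemma sum_sampleLaw_bad_le {R : ℕ}
    {F : Sample n p → (Fin R → Bool) → Set (Fin p)} (hF : ∀ w, Measurable fun y => F y w)
    {κ : Kernel (Sample n p) (Set (Fin p))}
    (hκ : ∀ y, κ y = ((PMF.uniformOfFintype (Fin R → Bool)).map (F y)).toMeasure)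
    {μ : Fin p → ℝ} {S : Set (Fin p)} {L : ℕ} (hS : Function.support μ = S) (hL : S.ncard = L)
    (hL0 : 0 < L) :
    ∑ w, (Fintype.card (Fin R → Bool) : ℝ≥0∞)⁻¹ *
      sampleLaw n ϖ μ ((fun y => F y w) ⁻¹' {A | L < 16 * (A ∆ S).ncard})
        ≤ 16 * hammSig κ ϖ μ := by
  set bad : Set (Set (Fin p)) := {A | L < 16 * (A ∆ S).ncard} with hbad
  have hbm : MeasurableSet bad := (Set.toFinite bad).measurableSet
  have h1 : ∑ w, (Fintype.card (Fin R → Bool) : ℝ≥0∞)⁻¹ *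
      sampleLaw n ϖ μ ((fun y => F y w) ⁻¹' bad) = ∫⁻ y, κ y bad ∂sampleLaw n ϖ μ := by
    simp_rw [hκ, toMeasure_map_uniform_apply _ hbm]
    have hi : ∀ w, Measurable fun y => bad.indicator (1 : Set (Fin p) → ℝ≥0∞) (F y w) :=
      fun w => (measurable_one.indicator hbm).comp (hF w)
    rw [lintegral_finsetSum _ fun w _ => (hi w).const_mul _]
    refine Finset.sum_congr rfl fun w _ => ?_
    rw [lintegral_const_mul _ (hi w), ← lintegral_indicator_one (hF w hbm)]
    rfl
  have hL1 : (L : ℝ≥0∞) ≠ 0 := by exact_mod_cast hL0.ne'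
  have hLt : (L : ℝ≥0∞) ≠ ∞ := ENNReal.natCast_ne_top L
  have h2 : ∀ y, κ y bad ≤ 16 * (L : ℝ≥0∞)⁻¹ * ∫⁻ A, ((A ∆ S).ncard : ℝ≥0∞) ∂κ y := by
    intro y
    rw [← lintegral_const_mul _ (measurable_of_countable _), ← lintegral_indicator_one hbm]
    refine lintegral_mono fun A => ?_
    by_cases hA : A ∈ bad
    · rw [Set.indicator_of_mem hA, Pi.one_apply]
      have h3 : (L : ℝ≥0∞) ≤ 16 * ((A ∆ S).ncard : ℝ≥0∞) := by
        exact_mod_cast (show L < 16 * (A ∆ S).ncard from hA).le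
      calc (1 : ℝ≥0∞) = (L : ℝ≥0∞)⁻¹ * L := (ENNReal.inv_mul_cancel hL1 hLt).symm
        _ ≤ (L : ℝ≥0∞)⁻¹ * (16 * ((A ∆ S).ncard : ℝ≥0∞)) := by gcongr
        _ = _ := by ring
    · rw [Set.indicator_of_notMem hA]; exact zero_le
  rw [h1]
  refine (lintegral_mono h2).trans ?_
  rw [lintegral_const_mul' _ _ (ENNReal.mul_ne_top (by simp) (ENNReal.inv_ne_top.2 hL1)), hammSig,
    hS, hL, ENNReal.div_eq_inv_mul, mul_assoc]

/-- If the estimator has small risk then the test is powerful. -/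
lemma IsPlacement.one_le_lintegral_test (h : IsPlacement p G len s) (hτ : ∀ g, |τ g| = δ)
    (hd : IsDetectable G W ϖ δ len) (hnN : n < N) {R : ℕ}
    {F : Sample n p → (Fin R → Bool) → Set (Fin p)} (hF : ∀ w, Measurable fun y => F y w)
    {κ : Kernel (Sample n p) (Set (Fin p))}
    (hκ : ∀ y, κ y = ((PMF.uniformOfFintype (Fin R → Bool)).map (F y)).toMeasure)
    {φ : Kernel (Sample N p) Bool}
    (hφ : ∀ x, φ x {true} = ∑ w, ((Fintype.card (Fin R → Bool) : ℝ≥0∞))⁻¹ *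
        {x | 0 < pairStat (oddPairs (F (firstRows hnN.le x) w) W) (lastRows n x)}.indicator 1 x) :
    1 ≤ ∫⁻ x, φ x {true} ∂sampleLaw N ϖ (blockSignal p len s τ)
        + 16 * hammSig κ ϖ (blockSignal p len s τ)
        + ENNReal.ofReal (missBound ϖ δ (N - n) W (∑ g, len g)) := by
  have hmiss := sum_sampleLaw_bad_le (ϖ := ϖ) hF hκ
    (h.support_blockSignal fun g => abs_pos.1 ((hτ g).symm ▸ hd.pos))
    (by rw [Set.ncard_coe_finset, h.card_blkUnion]) hd.sum_pos
  have hone : ∑ _w : Fin R → Bool, (Fintype.card (Fin R → Bool) : ℝ≥0∞)⁻¹ = 1 := by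
    rw [Finset.sum_const, Finset.card_univ, nsmul_eq_mul]
    exact ENNReal.mul_inv_cancel (by simp) (ENNReal.natCast_ne_top _)
  rw [lintegral_test_eq hnN.le hF hφ]
  generalize (Fintype.card (Fin R → Bool) : ℝ≥0∞)⁻¹ = c at hone hmiss
  have hw := fun w => h.one_le_sampleLaw_split hτ hd hnN (hF w)
  generalize ENNReal.ofReal (missBound ϖ δ (N - n) W (∑ g, len g)) = η at hw ⊢
  refine le_trans ?_ (add_le_add_left (add_le_add_right hmiss _) _)
  have hη : η = ∑ _w : Fin R → Bool, c * η := by rw [← Finset.sum_mul, hone, one_mul]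
  rw [hη, ← Finset.sum_add_distrib, ← Finset.sum_add_distrib]
  refine hone.symm.le.trans (Finset.sum_le_sum fun w _ => ?_)
  rw [← mul_add, ← mul_add]
  exact le_mul_of_one_le_right zero_le (hw w)

end Combine

/-! ### Averages over the uniform law on the class of signals -/

section AltLaw

variable {N p : ℕ} {ϖ α β r : ℝ} {ρ : ℕ → ℝ}

lemma finite_blockClass : (blockClass ρ α β r p).Finite := by
  refine (Set.Finite.pi' fun _ : Fin p =>
    Set.toFinite ({0, (p : ℝ) ^ (-r), -(p : ℝ) ^ (-r)} : Set ℝ)).subset ?_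
  rintro μ ⟨s, τ, -, h2, -, h4, h5⟩ j
  by_cases hj : ∀ g, ¬ (s g ≤ j ∧ (j : ℕ) < s g + blockLen ρ α p (g + 1))
  · exact Or.inl (h5 j hj)
  · push Not at hj
    obtain ⟨g, hg1, hg2⟩ := hj
    rw [h4 g j hg1 hg2]
    rcases abs_choice (τ g) with h | h
    · exact Or.inr (Or.inl (by rw [← h2 g, h]))
    · exact Or.inr (Or.inr (by rw [Set.mem_singleton_iff, ← h2 g, h, neg_neg]))

lemma lintegral_altLaw (f : Sample N p → ℝ≥0∞) : ∫⁻ x, f x ∂altLaw N p ϖ ρ α β r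
    = ((blockClass ρ α β r p).ncard : ℝ≥0∞)⁻¹ *
      ∑ μ ∈ (finite_blockClass (ρ := ρ) (α := α) (β := β) (r := r) (p := p)).toFinset,
        ∫⁻ x, f x ∂sampleLaw N ϖ μ := by
  have := (finite_blockClass (ρ := ρ) (α := α) (β := β) (r := r) (p := p)).fintype
  unfold altLaw
  rw [lintegral_smul_measure, lintegral_sum_measure, tsum_fintype, smul_eq_mul]
  congr 1
  refine (Finset.sum_subtype _ (fun μ => ?_) fun μ => ∫⁻ x, f x ∂sampleLaw N ϖ μ).symm
  simp

/-- A power bound that is uniform over the class passes to the average. Nonemptiness matters, since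
the average over an empty class would be the zero measure. -/
lemma one_le_lintegral_altLaw_add (hne : (blockClass ρ α β r p).Nonempty) {f : Sample N p → ℝ≥0∞}
    {c : ℝ≥0∞} (h : ∀ μ ∈ blockClass ρ α β r p, 1 ≤ ∫⁻ x, f x ∂sampleLaw N ϖ μ + c) :
    1 ≤ ∫⁻ x, f x ∂altLaw N p ϖ ρ α β r + c := by
  rw [lintegral_altLaw]
  set T := (finite_blockClass (ρ := ρ) (α := α) (β := β) (r := r) (p := p)).toFinset with hT
  have hcard : (blockClass ρ α β r p).ncard = T.card := Set.ncard_eq_toFinset_card _ _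
  have hT0 : (T.card : ℝ≥0∞) ≠ 0 := by
    have : T.Nonempty := by simpa [hT] using hne
    exact_mod_cast this.card_pos.ne'
  have hinv := ENNReal.inv_mul_cancel hT0 (ENNReal.natCast_ne_top T.card)
  rw [hcard]
  have h1 : (T.card : ℝ≥0∞) ≤ ∑ μ ∈ T, ∫⁻ x, f x ∂sampleLaw N ϖ μ + T.card * c := by
    rw [← nsmul_eq_mul, ← Finset.sum_const, ← Finset.sum_add_distrib]
    refine le_trans (le_of_eq ?_) (Finset.sum_le_sum fun μ hμ => h μ (by simpa [hT] using hμ))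
    simp
  calc (1 : ℝ≥0∞) = (T.card : ℝ≥0∞)⁻¹ * T.card := hinv.symm
    _ ≤ (T.card : ℝ≥0∞)⁻¹ * (∑ μ ∈ T, ∫⁻ x, f x ∂sampleLaw N ϖ μ + T.card * c) := by gcongr
    _ = _ := by rw [mul_add, ← mul_assoc, hinv, one_mul]

lemma lintegral_altLaw_le_one (hϖ : 0 < ϖ) {f : Sample N p → ℝ≥0∞} (hf : ∀ x, f x ≤ 1) :
    ∫⁻ x, f x ∂altLaw N p ϖ ρ α β r ≤ 1 := by
  rw [lintegral_altLaw, Set.ncard_eq_toFinset_card _ finite_blockClass]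
  refine le_trans (mul_le_mul_right (Finset.sum_le_card_nsmul _ _ 1 fun μ _ => ?_) _) ?_
  · have := isProbabilityMeasure_sampleLaw hϖ N μ
    exact (lintegral_mono hf).trans_eq (by rw [lintegral_const, measure_univ, mul_one])
  · rw [nsmul_eq_mul, mul_one]
    exact ENNReal.inv_mul_le_one _

end AltLaw
-- Advantage of the test and its sample size
section Boundary

lemma le_two_pow_log {x : ℕ} : x ≤ 2 * 2 ^ Nat.log 2 x := by
  have := Nat.lt_pow_succ_log_self (b := 2) (by norm_num) x
  rw [pow_succ] at this
  omega

/-- With `δ = p^(-r)` the bound is a constant times `1 / (M W L δ⁴) + 1 / (M L δ²)`. The two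
hypotheses on `r` say that the powers of `p` in both denominators have nonnegative exponents, and
then the factor `K` is all that is left. Equality is allowed. -/
lemma missBound_le {ϖ r θ α β K w l : ℝ} {p M W L : ℕ} (hϖ : 0 < ϖ) (hp : 1 ≤ p) (hK : 0 < K)
    (hw : 0 < w) (hl : 0 < l) (hM : K * (p : ℝ) ^ θ ≤ M) (hW : w * (p : ℝ) ^ α ≤ W)
    (hL : l * (p : ℝ) ^ (1 - β) ≤ L) (h1 : 4 * r ≤ 1 + θ + α - β) (h2 : 2 * r ≤ 1 + θ - β) :
    missBound ϖ ((p : ℝ) ^ (-r)) M W L ≤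
      (16 / (w * l * (min 1 ϖ / 4) ^ 4) + 64 * (1 + ϖ) ^ 2 / (l * (min 1 ϖ / 4) ^ 4)) / K := by
  have hp1 : (1 : ℝ) ≤ p := by exact_mod_cast hp
  have hp0 : (0 : ℝ) < p := by linarith
  set y := (p : ℝ) ^ (-r) with hy
  have hy0 : 0 < y := Real.rpow_pos_of_pos hp0 _
  have hθ := Real.rpow_pos_of_pos hp0 θ
  have hα := Real.rpow_pos_of_pos hp0 α
  have hβ := Real.rpow_pos_of_pos hp0 (1 - β)
  have hM0 : (0 : ℝ) < M := (mul_pos hK hθ).trans_le hM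
  have hW0 : (0 : ℝ) < W := (mul_pos hw hα).trans_le hW
  have hL0 : (0 : ℝ) < L := (mul_pos hl hβ).trans_le hL
  set u := min 1 ϖ / 4 with hu
  have hu0 : 0 < u := div_pos (lt_min one_pos hϖ) (by norm_num)
  have hy2 : y ^ 2 = (p : ℝ) ^ (-(2 * r)) := by
    rw [hy, ← Real.rpow_natCast, ← Real.rpow_mul hp0.le]; congr 1; push_cast; ring
  have hy4 : y ^ 4 = (p : ℝ) ^ (-(4 * r)) := by
    rw [hy, ← Real.rpow_natCast, ← Real.rpow_mul hp0.le]; congr 1; push_cast; ring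
  have tM : (p : ℝ) ^ θ ≤ M / K := by rwa [le_div_iff₀' hK]
  have tW : (p : ℝ) ^ α ≤ W / w := by rwa [le_div_iff₀' hw]
  have tL : (p : ℝ) ^ (1 - β) ≤ L / l := by rwa [le_div_iff₀' hl]
  have e1 : 1 ≤ M / K * (W / w) * (L / l) * y ^ 4 := by
    calc (1 : ℝ) ≤ (p : ℝ) ^ (θ + α + (1 - β) + -(4 * r)) :=
          Real.one_le_rpow hp1 (by linarith)
      _ = (p : ℝ) ^ θ * (p : ℝ) ^ α * (p : ℝ) ^ (1 - β) * y ^ 4 := by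
          rw [hy4, ← Real.rpow_add hp0, ← Real.rpow_add hp0, ← Real.rpow_add hp0]
      _ ≤ _ := by gcongr
  have e2 : y ^ 2 ≤ M / K * (L / l) * y ^ 4 := by
    calc y ^ 2 ≤ (p : ℝ) ^ (θ + (1 - β) + -(4 * r)) := by
          rw [hy2]; exact Real.rpow_le_rpow_of_exponent_le hp1 (by linarith)
      _ = (p : ℝ) ^ θ * (p : ℝ) ^ (1 - β) * y ^ 4 := by
          rw [hy4, ← Real.rpow_add hp0, ← Real.rpow_add hp0]
      _ ≤ _ := by gcongr
  unfold missBound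
  rw [show min 1 ϖ * y / 4 = u * y by rw [hu]; ring]
  push_cast
  rw [div_le_iff₀ (by positivity)]
  calc 16 * (1 + 4 * (W : ℝ) * ((1 + ϖ) * y) ^ 2)
      = 16 * 1 + 64 * (1 + ϖ) ^ 2 * W * y ^ 2 := by ring
    _ ≤ 16 * (M / K * (W / w) * (L / l) * y ^ 4)
        + 64 * (1 + ϖ) ^ 2 * W * (M / K * (L / l) * y ^ 4) := by gcongr
    _ = _ := by field_simp

/-- A procedure with small worst-case risk gives a test that distinguishes the two laws. -/
lemma eighth_le_rejectProb_sub {ϖ α β r a b : ℝ} {ρ : ℕ → ℝ} {p n N W : ℕ}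
    (hρ : 0 ≤ ρ 0) (hB : BlockSizes ρ α β a b p)
    (hd : IsDetectable (gapLen ρ α p) W ϖ ((p : ℝ) ^ (-r))
      fun g : Fin (numBlocks α β p) => blockLen ρ α p (g + 1))
    (hmiss : missBound ϖ ((p : ℝ) ^ (-r)) (N - n) W
      (∑ g : Fin (numBlocks α β p), blockLen ρ α p (g + 1)) ≤ 1 / 8)
    (hnN : n < N) {R : ℕ}
    {F : Sample n p → (Fin R → Bool) → Set (Fin p)} (hF : ∀ w, Measurable fun y => F y w)
    {κ : Kernel (Sample n p) (Set (Fin p))}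
    (hκ : ∀ y, κ y = ((PMF.uniformOfFintype (Fin R → Bool)).map (F y)).toMeasure)
    {φ : Kernel (Sample N p) Bool}
    (hφ : ∀ x, φ x {true} = ∑ w, ((Fintype.card (Fin R → Bool) : ℝ≥0∞))⁻¹ *
        {x | 0 < pairStat (oddPairs (F (firstRows hnN.le x) w) W) (lastRows n x)}.indicator 1 x)
    (hworst : worstHammSig κ ϖ ρ α β r ≤ ENNReal.ofReal (1 / 64)) :
    1 / 8 ≤ rejectProb (altLaw N p ϖ ρ α β r) φ - rejectProb (noiseLaw N p) φ := by
  have hp : (0 : ℝ) < p := by exact_mod_cast hB.one_le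
  set len : Fin (numBlocks α β p) → ℕ := fun g => blockLen ρ α p (g + 1) with hlen
  have hone : ∑ _w : Fin R → Bool, (Fintype.card (Fin R → Bool) : ℝ≥0∞)⁻¹ = 1 := by
    rw [Finset.sum_const, Finset.card_univ, nsmul_eq_mul]
    exact ENNReal.mul_inv_cancel (by simp) (ENNReal.natCast_ne_top _)
  have hle : ∀ x, φ x {true} ≤ 1 := by
    intro x
    rw [hφ, ← hone]
    refine Finset.sum_le_sum fun w _ => mul_le_of_le_one_right zero_le ?_
    exact Set.indicator_apply_le fun _ => le_rfl
  have h0 : ∫⁻ x, φ x {true} ∂noiseLaw N p ≤ ENNReal.ofReal (1 / 2) := by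
    rw [lintegral_test_eq hnN.le hF hφ]
    refine (Finset.sum_le_sum fun w _ =>
      mul_le_mul_right (noiseLaw_split_le hnN.le (hF w) W) _).trans_eq ?_
    rw [← Finset.sum_mul, hone, one_mul, ENNReal.ofReal_div_of_pos two_pos]
    simp
  have hcell : ∀ g, 2 * len g + gapLen ρ α p ≤ p / numBlocks α β p := fun g => by
    have := hB.room (g + 1); simp only [hlen]; omega
  have hne : (blockClass ρ α β r p).Nonempty :=
    ⟨cubeSignal p ((p : ℝ) ^ (-r)) (p / numBlocks α β p) len fun _ => false,
      (mem_blockClass_iff hB.one_le hρ _).2 ⟨_, _,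
        isPlacement_cubeStart hcell (Nat.mul_div_le _ _) _,
        fun g => abs_of_pos (Real.rpow_pos_of_pos hp _), rfl⟩⟩
  have h1 := one_le_lintegral_altLaw_add (N := N) (ϖ := ϖ) hne (f := fun x => φ x {true})
    (c := ENNReal.ofReal (3 / 8)) fun μ hμ => by
      obtain ⟨s, τ, hs, hτ, rfl⟩ := (mem_blockClass_iff hB.one_le hρ _).1 hμ
      have h2 := hs.one_le_lintegral_test hτ hd hnN hF hκ hφ
      refine h2.trans ?_
      rw [add_assoc]
      refine add_le_add le_rfl ?_
      have h3 : hammSig κ ϖ (blockSignal p len s τ) ≤ ENNReal.ofReal (1 / 64) :=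
        (le_iSup₂_of_le (f := fun μ (_ : μ ∈ blockClass ρ α β r p) => hammSig κ ϖ μ)
          _ hμ le_rfl).trans hworst
      -- The probability of missing the signal is at most `16 / 64 + 1 / 8 = 3 / 8`: Markov's
      -- inequality for a bad estimate, and Chebyshev's for the statistic. Rejection under noise has
      -- probability at most `1 / 2`, so an advantage of `1 / 8` remains.
      calc 16 * hammSig κ ϖ (blockSignal p len s τ) + _
          ≤ ENNReal.ofReal 16 * ENNReal.ofReal (1 / 64) + ENNReal.ofReal (1 / 8) := by
            rw [ENNReal.ofReal_ofNat]
            gcongr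
        _ = ENNReal.ofReal (3 / 8) := by
            rw [← ENNReal.ofReal_mul (by norm_num), ← ENNReal.ofReal_add (by norm_num)
              (by norm_num)]
            norm_num
  have hfin : ∫⁻ x, φ x {true} ∂altLaw N p ϖ ρ α β r ≠ ∞ :=
    ne_top_of_le_ne_top ENNReal.one_ne_top (lintegral_altLaw_le_one hd.label_pos hle)
  unfold rejectProb
  have h2 : (∫⁻ x, φ x {true} ∂noiseLaw N p).toReal ≤ 1 / 2 :=
    ENNReal.toReal_le_of_le_ofReal (by norm_num) h0
  have h3 : 1 ≤ (∫⁻ x, φ x {true} ∂altLaw N p ϖ ρ α β r).toReal + 3 / 8 := by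
    have := ENNReal.toReal_mono (ENNReal.add_ne_top.2 ⟨hfin, ENNReal.ofReal_ne_top⟩) h1
    rwa [ENNReal.toReal_add hfin ENNReal.ofReal_ne_top, ENNReal.toReal_ofReal (by norm_num),
      ENNReal.toReal_one] at this
  linarith

/-- The sample size of the test, from which the size of the estimator's sample and the width of the
window can be computed. -/
def testSize (θ α a : ℝ) (p : ℕ) : ℕ :=
  sampleSize θ p * (p.size + 1) + Nat.log 2 ⌊a * (p : ℝ) ^ α⌋₊

lemma floor_rpow_le {x c : ℝ} (hx0 : 0 < x) (hx : x ≤ 1) (hc0 : 0 ≤ c) (hc : c ≤ 1) (p : ℕ) :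
    ⌊c * (p : ℝ) ^ x⌋₊ ≤ p := by
  rcases Nat.eq_zero_or_pos p with rfl | hp
  · simp [Real.zero_rpow hx0.ne']
  · have hp1 : (1 : ℝ) ≤ p := by exact_mod_cast hp
    refine Nat.floor_le_of_le ?_
    calc c * (p : ℝ) ^ x ≤ 1 * (p : ℝ) ^ (1 : ℝ) := by gcongr
      _ = p := by rw [one_mul, Real.rpow_one]

lemma two_pow_log_le {x p : ℕ} (h : x ≤ p) : 2 ^ Nat.log 2 x ≤ p + 1 := by
  rcases Nat.eq_zero_or_pos x with rfl | hx
  · simp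
  · exact (Nat.pow_log_le_self 2 hx.ne').trans (by omega)

/-- The encoded logarithm has to be smaller than the divisor in order to be read off as the
remainder. -/
lemma log_lt_size_add_one {x p : ℕ} (h : x ≤ p) : Nat.log 2 x < p.size + 1 := by
  rcases Nat.eq_zero_or_pos x with rfl | hx
  · simp
  · exact Nat.lt_succ_of_lt (Nat.lt_size.2 ((Nat.pow_log_le_self 2 hx.ne').trans h))

lemma size_le_log {p : ℕ} (hp : 1 ≤ p) : (p.size : ℝ) ≤ 1 + 2 * Real.log p := by
  have hp0 : (0 : ℝ) < p := by exact_mod_cast hp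
  have h1 : 0 < p.size := Nat.size_pos.2 hp
  have h2 : 2 ^ (p.size - 1) ≤ p := Nat.lt_size.1 (by omega)
  have h3 : ((2 : ℝ) ^ (p.size - 1)) ≤ p := by exact_mod_cast h2
  have h4 := Real.log_le_log (by positivity) h3
  rw [Real.log_pow, Nat.cast_sub h1] at h4
  have h5 := Real.log_two_gt_d9
  have h6 : (1 : ℝ) ≤ p.size := by exact_mod_cast h1
  push_cast at h4
  nlinarith

end Boundary
-- Recovery below the statistical boundary contradicts the conjecture
section Recovery

variable {θ α β r ϖ a b a' : ℝ} {ρ : ℕ → ℝ}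

lemma sampleSize_le (hθ0 : 0 < θ) (hθ : θ ≤ 1) (p : ℕ) : sampleSize θ p ≤ p := by
  have := floor_rpow_le hθ0 hθ zero_le_one le_rfl p
  rwa [one_mul] at this

lemma log_window_lt (hα0 : 0 < α) (hα : α ≤ 1) (ha0 : 0 < a') (ha1 : a' ≤ 1) (p : ℕ) :
    Nat.log 2 ⌊a' * (p : ℝ) ^ α⌋₊ < p.size + 1 :=
  log_lt_size_add_one (floor_rpow_le hα0 hα ha0.le ha1 p)

lemma testSize_div (hα0 : 0 < α) (hα : α ≤ 1) (ha0 : 0 < a') (ha1 : a' ≤ 1) (p : ℕ) :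
    testSize θ α a' p / (p.size + 1) = sampleSize θ p := by
  unfold testSize
  rw [mul_comm, Nat.mul_add_div (Nat.succ_pos _),
    Nat.div_eq_of_lt (log_window_lt hα0 hα ha0 ha1 p), add_zero]

lemma testSize_mod (hα0 : 0 < α) (hα : α ≤ 1) (ha0 : 0 < a') (ha1 : a' ≤ 1) (p : ℕ) :
    testSize θ α a' p % (p.size + 1) = Nat.log 2 ⌊a' * (p : ℝ) ^ α⌋₊ := by
  unfold testSize
  rw [mul_comm, Nat.mul_add_mod, Nat.mod_eq_of_lt (log_window_lt hα0 hα ha0 ha1 p)]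

lemma sampleSize_le_testSize (p : ℕ) : sampleSize θ p ≤ testSize θ α a' p :=
  Nat.le_add_right_of_le (Nat.le_mul_of_pos_right _ (Nat.succ_pos _))

lemma eventually_one_le_rpow {c x : ℝ} (hc : 0 < c) (hx : 0 < x) :
    ∀ᶠ p : ℕ in atTop, 1 ≤ c * (p : ℝ) ^ x := by
  filter_upwards [eventually_log_pow_le (1 / c) 0 hx] with p h
  rwa [pow_zero, mul_one, div_le_iff₀' hc] at h

lemma eventually_half_le_sampleSize (hθ0 : 0 < θ) :
    ∀ᶠ p : ℕ in atTop, (p : ℝ) ^ θ / 2 ≤ sampleSize θ p := by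
  filter_upwards [eventually_one_le_rpow one_pos hθ0] with p h
  rw [one_mul] at h
  exact half_le_floor h

lemma eventually_testSize_le (hθ0 : 0 < θ) (hα0 : 0 < α) (hα : α ≤ 1) (ha0 : 0 < a')
    (ha1 : a' ≤ 1) : ∀ᶠ p : ℕ in atTop,
      (testSize θ α a' p : ℝ) ≤ 4 * (1 + Real.log p) ^ 1 * (p : ℝ) ^ θ := by
  filter_upwards [eventually_one_le_rpow one_pos hθ0, eventually_ge_atTop 1] with p h1 hp
  rw [one_mul] at h1
  have h2 : (sampleSize θ p : ℝ) ≤ (p : ℝ) ^ θ := Nat.floor_le (by positivity)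
  have h3 : ((Nat.log 2 ⌊a' * (p : ℝ) ^ α⌋₊ : ℕ) : ℝ) ≤ (p.size : ℝ) + 1 := by
    exact_mod_cast (log_window_lt hα0 hα ha0 ha1 p).le
  have h4 := size_le_log hp
  have h5 := Real.log_natCast_nonneg p
  unfold testSize
  push_cast
  calc (sampleSize θ p : ℝ) * (p.size + 1) + (Nat.log 2 ⌊a' * (p : ℝ) ^ α⌋₊ : ℕ)
      ≤ (p : ℝ) ^ θ * (p.size + 1) + 1 * (p.size + 1) := by rw [one_mul]; gcongr
    _ ≤ (p : ℝ) ^ θ * (p.size + 1) + (p : ℝ) ^ θ * (p.size + 1) := by gcongr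
    _ = 2 * (p : ℝ) ^ θ * (p.size + 1) := by ring
    _ ≤ 2 * (p : ℝ) ^ θ * (1 + 2 * Real.log p + 1) := by gcongr
    _ = _ := by ring

lemma testSize_le_pow (hθ0 : 0 < θ) (hθ : θ ≤ 1) (hα0 : 0 < α) (hα : α ≤ 1) (ha0 : 0 < a')
    (ha1 : a' ≤ 1) {p : ℕ} (hp : 3 ≤ p) : testSize θ α a' p ≤ p ^ 3 := by
  have h1 := sampleSize_le hθ0 hθ p
  have h2 := log_window_lt hα0 hα ha0 ha1 p
  have h3 : p.size ≤ p := Nat.size_le.2 Nat.lt_two_pow_self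
  unfold testSize
  calc sampleSize θ p * (p.size + 1) + Nat.log 2 ⌊a' * (p : ℝ) ^ α⌋₊
      ≤ p * (p + 1) + p := by gcongr; omega
    _ ≤ p ^ 3 := by nlinarith [Nat.mul_le_mul_left p hp, Nat.mul_le_mul_left (p * p) hp]

/-- There are at least `n · p.size` held-out rows, and the logarithmic factor `p.size` exceeds every
constant. Thus any prescribed multiple of `p ^ θ` is available. -/
lemma eventually_le_testSize_sub (hθ0 : 0 < θ) {K : ℝ} (hK : 0 < K) :
    ∀ᶠ p : ℕ in atTop, sampleSize θ p < testSize θ α a' p ∧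
      K * (p : ℝ) ^ θ ≤ (testSize θ α a' p - sampleSize θ p : ℕ) := by
  filter_upwards [eventually_half_le_sampleSize hθ0, eventually_ge_atTop (2 ^ ⌈2 * K⌉₊),
    eventually_one_le_rpow one_pos hθ0] with p h1 h2 h3
  have h4 : ⌈2 * K⌉₊ ≤ p.size := (Nat.lt_size.2 h2).le
  have h5 : 2 * K ≤ p.size := Nat.ceil_le.1 h4
  have h6 : sampleSize θ p * p.size ≤ testSize θ α a' p - sampleSize θ p := by
    unfold testSize
    rw [mul_add, mul_one]
    omega
  have h7 : K * (p : ℝ) ^ θ ≤ (testSize θ α a' p - sampleSize θ p : ℕ) := by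
    calc K * (p : ℝ) ^ θ = (p : ℝ) ^ θ / 2 * (2 * K) := by ring
      _ ≤ sampleSize θ p * p.size := by gcongr
      _ ≤ _ := by exact_mod_cast h6
  have h8 : (0 : ℝ) < (testSize θ α a' p - sampleSize θ p : ℕ) :=
    lt_of_lt_of_le (by rw [one_mul] at h3; positivity) h7
  exact ⟨by have := Nat.cast_pos.1 h8; omega, h7⟩

/-- The window is at most `a' p ^ α ≤ a p ^ α / 8` wide while each block has length at least `a p ^
α / 2`; this yields `4 W ≤ len`, and the gap is at least as long as a block. Rounding to a power of
two loses only a constant. -/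
lemma eventually_isDetectable (hα0 : 0 < α) (hβ : 0 < β) (hβ' : β < 1 - α) (hr : 0 < r)
    (hϖ : 0 < ϖ) (ha : 0 < a) (hρ : ∀ g, a ≤ ρ g ∧ ρ g ≤ b) (ha0 : 0 < a') (ha8 : a' ≤ a / 8) :
    ∀ᶠ p : ℕ in atTop, BlockSizes ρ α β a b p ∧
      IsDetectable (gapLen ρ α p) (2 ^ Nat.log 2 ⌊a' * (p : ℝ) ^ α⌋₊) ϖ ((p : ℝ) ^ (-r))
        (fun g : Fin (numBlocks α β p) => blockLen ρ α p (g + 1)) ∧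
      a' / 4 * (p : ℝ) ^ α ≤ (2 ^ Nat.log 2 ⌊a' * (p : ℝ) ^ α⌋₊ : ℕ) ∧
      a / 4 * (p : ℝ) ^ (1 - β)
        ≤ (∑ g : Fin (numBlocks α β p), blockLen ρ α p (g + 1) : ℕ) := by
  filter_upwards [eventually_blockSizes hα0 hβ hβ' ha hρ, eventually_one_le_rpow ha0 hα0,
    eventually_mul_rpow_neg_le (1 + ϖ) one_pos (neg_lt_zero.2 hr)] with p hB h1 h2
  have hp : (0 : ℝ) < p := by exact_mod_cast hB.one_le
  have hpα := Real.rpow_pos_of_pos hp α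
  have hfl : ⌊a' * (p : ℝ) ^ α⌋₊ ≠ 0 := (Nat.floor_pos.2 h1).ne'
  have hWle : ((2 ^ Nat.log 2 ⌊a' * (p : ℝ) ^ α⌋₊ : ℕ) : ℝ) ≤ a' * (p : ℝ) ^ α :=
    (Nat.cast_le.2 (Nat.pow_log_le_self 2 hfl)).trans (Nat.floor_le (by positivity))
  have hlen : ∀ g, 4 * 2 ^ Nat.log 2 ⌊a' * (p : ℝ) ^ α⌋₊ ≤ blockLen ρ α p g := by
    intro g
    have h3 : ((4 * 2 ^ Nat.log 2 ⌊a' * (p : ℝ) ^ α⌋₊ : ℕ) : ℝ) ≤ blockLen ρ α p g := by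
      rw [Nat.cast_mul]
      refine le_trans ?_ (hB.le_len g)
      have := mul_le_mul_of_nonneg_right ha8 hpα.le
      push_cast at hWle ⊢
      linarith
    exact_mod_cast h3
  have hsum : a / 4 * (p : ℝ) ^ (1 - β)
      ≤ (∑ g : Fin (numBlocks α β p), blockLen ρ α p (g + 1) : ℕ) := by
    push_cast
    calc a / 4 * (p : ℝ) ^ (1 - β)
        = (p : ℝ) ^ (1 - α - β) / 2 * (a / 2 * (p : ℝ) ^ α) := by
          rw [show 1 - β = (1 - α - β) + α by ring, Real.rpow_add hp]; ring
      _ ≤ numBlocks α β p * (a / 2 * (p : ℝ) ^ α) := by gcongr; exact hB.le_num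
      _ = ∑ _g : Fin (numBlocks α β p), a / 2 * (p : ℝ) ^ α := by simp
      _ ≤ _ := Finset.sum_le_sum fun g _ => hB.le_len _
  have hsum0 : (0 : ℝ) < (∑ g : Fin (numBlocks α β p), blockLen ρ α p (g + 1) : ℕ) :=
    lt_of_lt_of_le (by positivity) hsum
  refine ⟨hB, ⟨Real.rpow_pos_of_pos hp _, hϖ, h2, fun g => hlen _, ?_, by positivity,
    by exact_mod_cast hsum0⟩, ?_, hsum⟩
  · have := (hlen 0).trans (hB.len_le_gap 0)
    omega
  · have h3 := half_le_floor h1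
    have h4 : ((⌊a' * (p : ℝ) ^ α⌋₊ : ℕ) : ℝ)
        ≤ 2 * (2 ^ Nat.log 2 ⌊a' * (p : ℝ) ^ α⌋₊ : ℕ) := by
      exact_mod_cast le_two_pow_log
    linarith

/-- Between the computational and the statistical boundary, the low-degree conjecture excludes
polynomial-time procedures with small risk. -/
theorem eventually_le_worstHammSig_of_isPolyTime (hθ : θ ∈ Set.Ioo (0 : ℝ) 1)
    (hα : α ∈ Set.Ioo (0 : ℝ) 1) (hβ : 0 < β) (hβ' : β < 1 - α) (hr : 0 < r) (hϖ : 0 < ϖ)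
    (ha : 0 < a) (hρ : ∀ g, a ≤ ρ g ∧ ρ g ≤ b)
    (hconj : LowDegreeConjecture ϖ ρ α β r) (h1 : θ + 2 * α < 4 * r)
    (h2 : θ + α + 1 - 2 * β < 4 * r) (h3 : 4 * r ≤ 1 + θ + α - β) (h4 : 2 * r ≤ θ + α)
    {S : Procedure (sampleSize θ) fun p => Set (Fin p)}
    (hS : IsPolyTime (sampleSize θ) decodeSet S) :
    ∀ᶠ p in atTop, ENNReal.ofReal (1 / 64) ≤ worstHammSig (S p) ϖ ρ α β r := by
  -- The bound `a / 8` fits the window into the blocks, and the bound `1` keeps the window at most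
  -- `p`, so that its logarithm can be encoded.
  set a' := min (a / 8) 1 with ha'
  have ha0 : 0 < a' := lt_min (by positivity) one_pos
  have ha1 : a' ≤ 1 := min_le_right _ _
  set N := testSize θ α a' with hN
  obtain ⟨R, F, φ, hφP, hF, hκ, hφ⟩ := exists_polyTime_test (N := N) (L := fun p => p.size + 1)
    (k := fun p => Nat.log 2 ⌊a' * (p : ℝ) ^ α⌋₊) hS (fun p => rfl)
    (fun p => (testSize_div hα.1 hα.2.le ha0 ha1 p).symm)
    (fun p => (testSize_mod hα.1 hα.2.le ha0 ha1 p).symm)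
    (fun p => sampleSize_le_testSize p) (fun p => sampleSize_le hθ.1 hθ.2.le p)
    (fun p => two_pow_log_le (floor_rpow_le hα.1 hα.2.le ha0.le ha1 p))
  -- The constant of `missBound_le` for the windows and blocks at hand; `8 Q p ^ θ` held-out rows
  -- bring the probability of a miss down to `1 / 8`.
  set Q := 16 / (a' / 4 * (a / 4) * (min 1 ϖ / 4) ^ 4)
    + 64 * (1 + ϖ) ^ 2 / (a / 4 * (min 1 ϖ / 4) ^ 4) with hQ
  have hQ0 : 0 < Q := by
    have : 0 < min 1 ϖ := lt_min one_pos hϖ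
    positivity
  have hsub := eventually_le_testSize_sub (α := α) (a' := a') hθ.1 (K := 8 * Q) (by positivity)
  obtain ⟨q, hq1, hq2⟩ := exists_isLowDegreeProj_tendsto (N := N) hα.1 hβ hβ' hϖ ha hρ h1 h2
    (hsub.mono fun p hp => by have := hp.1; simp only [hN]; omega)
    (eventually_testSize_le hθ.1 hα.1 hα.2.le ha0 ha1)
  have hlim := hconj N ⟨3, (eventually_ge_atTop 3).mono fun p hp =>
    testSize_le_pow hθ.1 hθ.2.le hα.1 hα.2.le ha0 ha1 hp⟩ q hq1 hq2 φ hφP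
  -- A risk below `1 / 64` at a large `p` would force an advantage of at least `1 / 8` at that `p`,
  -- while the advantage tends to zero. So the bound holds for all large `p`, as the lower limit
  -- requires.
  filter_upwards [hlim.eventually (gt_mem_nhds (show (0 : ℝ) < 1 / 8 by norm_num)), hsub,
    eventually_isDetectable hα.1 hβ hβ' hr hϖ ha hρ ha0 (min_le_left _ _)] with p hp hsub hdet
  obtain ⟨hB, hd, hW, hL⟩ := hdet
  by_contra! hworst
  have hmiss := (missBound_le hϖ hB.one_le (by positivity) (by positivity) (by positivity) hsub.2
    hW hL h3 (by linarith)).trans_eq (show Q / (8 * Q) = 1 / 8 by field_simp)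
  exact absurd (eighth_le_rejectProb_sub (ha.le.trans (hρ 0).1) hB hd hmiss hsub.1 (hF p) (hκ p)
    (hφ p) hworst.le) (not_le.2 hp)

lemma IsPolyTime.isMarkovKernel {n : ℕ → ℕ} {S : Procedure n fun p => Set (Fin p)}
    (hS : IsPolyTime n decodeSet S) (p : ℕ) : IsMarkovKernel (S p) := by
  obtain ⟨P, a, b, c, h⟩ := hS
  obtain ⟨f, -, hf⟩ := h p
  exact ⟨fun x => by rw [hf]; infer_instance⟩

end Recovery
end BlockSignal

end

theorem theorem6 (θ α β r ϖ : ℝ) (hθ : θ ∈ Set.Ioo (0 : ℝ) 1) (hα : α ∈ Set.Ioo (0 : ℝ) 1)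
    (hθα : θ < 1 - α) (hβ : β ∈ Set.Ioo (0 : ℝ) (1 - α)) (hr : r ∈ Set.Ioo (0 : ℝ) 1)
    (hϖ : 0 < ϖ)
    (ρ : ℕ → ℝ) (hρ : ∃ a b : ℝ, 0 < a ∧ ∀ g, a ≤ ρ g ∧ ρ g ≤ b) :
    (BlockSignal.etaSig θ α β < r →
      ∃ C : ℝ, 0 < C ∧
        ∀ S : BlockSignal.Procedure (BlockSignal.sampleSize θ) (fun p => Set (Fin p)),
          (∀ p, ProbabilityTheory.IsMarkovKernel (S p)) →
          ENNReal.ofReal C ≤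
            Filter.liminf (fun p => BlockSignal.worstHammSig (S p) ϖ ρ α β r) Filter.atTop) ∧
    (BlockSignal.LowDegreeConjecture ϖ ρ α β r → BlockSignal.etaSigComp θ α β < r →
      ∃ C : ℝ, 0 < C ∧
        ∀ S : BlockSignal.Procedure (BlockSignal.sampleSize θ) (fun p => Set (Fin p)),
          BlockSignal.IsPolyTime (BlockSignal.sampleSize θ) BlockSignal.decodeSet S →
          ENNReal.ofReal C ≤
            Filter.liminf (fun p => BlockSignal.worstHammSig (S p) ϖ ρ α β r) Filter.atTop) := by
  obtain ⟨a, b, ha, hρ⟩ := hρ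
  have stat : BlockSignal.etaSig θ α β < r →
      ∀ S : BlockSignal.Procedure (BlockSignal.sampleSize θ) (fun p => Set (Fin p)),
        (∀ p, ProbabilityTheory.IsMarkovKernel (S p)) → ENNReal.ofReal (1 / 2) ≤
          Filter.liminf (fun p => BlockSignal.worstHammSig (S p) ϖ ρ α β r) Filter.atTop := by
    intro h S hS
    refine Filter.le_liminf_of_le (by isBoundedDefault) ?_
    filter_upwards [BlockSignal.eventually_half_le_worstHammSig hα.1 hβ.1 hβ.2 hϖ ha hρ h]
      with p hp
    refine le_trans (le_of_eq ?_) (hp (S p) (hS p))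
    rw [ENNReal.ofReal_div_of_pos two_pos]
    simp
  refine ⟨fun h => ⟨1 / 2, by norm_num, stat h⟩, fun hconj h => ?_⟩
  -- Polynomial-time procedures are Markov kernels, so above the statistical boundary the first part
  -- covers them.
  by_cases hs : BlockSignal.etaSig θ α β < r
  · exact ⟨1 / 2, by norm_num, fun S hS => stat hs S hS.isMarkovKernel⟩
  · rw [BlockSignal.etaSig_eq_min, not_lt, le_min_iff] at hs
    -- Below the statistical boundary `r ≤ (θ + α) / 2`, which excludes the first branch. In the
    -- other two branches the computational boundary is the larger of `(θ + 2α) / 4` and `(θ + α + 1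
    -- - 2β) / 4`, with the change at `β = (1 - α) / 2`.
    have hexp : θ + 2 * α < 4 * r ∧ θ + α + 1 - 2 * β < 4 * r := by
      unfold BlockSignal.etaSigComp BlockSignal.c₁ at h
      split_ifs at h with h1 h2
      · exact absurd hs.1 (not_le.2 h)
      · constructor <;> linarith
      · constructor <;> linarith
    refine ⟨1 / 64, by norm_num, fun S hS => Filter.le_liminf_of_le (by isBoundedDefault) ?_⟩
    exact BlockSignal.eventually_le_worstHammSig_of_isPolyTime hθ hα hβ.1 hβ.2 hr.1 hϖ ha hρ hconj
      hexp.1 hexp.2 (by linarith [hs.2]) (by linarith [hs.1]) hS
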